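/- **Proposition 6.2.** Let $M=\mathbb Z^2$ with $\langle a,b\rangle=\det(a,b)$, let $q=e^{i\hbar}$, $q^{1/2}=e^{i\hbar/2}\in\mathbb C((\hbar))$, and let $\hat T$ be the quantum torus algebra over $\mathbb C((\hbar))$ with basis $\hat z^{a}$, $a\in M$, and product $\hat z^{a}\hat z^{b}=q^{\frac12\langle a,b\rangle}\hat z^{a+b}$. Let $\mathfrak m=(m_1,\dots,m_n)$ be an $n$-tuple of primitive vectors of $M$ and $R=\mathbb C[[t_1,\dots,t_n]]$, with maximal ideal $\mathfrak m_R$. *Scattering.* A ray is a half-line $\mathfrak d=x+\mathbb R_{\ge 0}m_{\mathfrak d}$ in $\mathbb R^2$, $m_{\mathfrak d}\in M$ primitive, with a Hamiltonian $\hat H_{\mathfrak d}\in\varprojlim_l (R/\mathfrak m_R^l\otimes\hat T)$, zero modulo $\mathfrak m_R$, which is a series in the powers of $\hat z^{m(\hat H_{\mathfrak d})}$, where $m(\hat H_{\mathfrak d})=m_{\mathfrak d}$ (outgoing) or $-m_{\mathfrak d}$ (ingoing). A scattering diagram is a family of rays of which only finitely many are non-zero modulo $\mathfrak m_R^l$,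 for every $l$. It is consistent if for every closed smooth path $\gamma$ that avoids the initial points of the rays and the points where non-parallel rays meet, whose endpoints are on no ray, and which is transverse to all rays, the composition (first crossing innermost) of the automorphisms $\mathrm{Ad}_{\exp(\hat H_{\mathfrak d})}^{\epsilon}$ over the successive crossings of $\gamma$ with rays, $\epsilon$ being the sign of $\langle m(\hat H_{\mathfrak d}),\gamma'\rangle$, is the identity (computed modulo $\mathfrak m_R^l$ for every $l$). Rays with zero Hamiltonian are disregarded. Let $\hat{\mathfrak D}_{\mathfrak m}$ be the diagram made of the ingoing rays $-\mathbb R_{\ge0}m_j$ with Hamiltonians $$\hat H_{\mathfrak d_j}=\sum_{l\ge1}\frac1l\frac{(-1)^{l-1}}{q^{l/2}-q^{-l/2}}\,t_j^l\,\hat z^{l m_j},\qquad 1\le j\le n .$$ Its consistent completion $S(\hat{\mathfrak D}_{\mathfrak m})$ is the consistent diagram obtained by adding, for every primitive $m\in M$, one outgoing ray $(\mathbb R_{\ge0}m,\hat H_m)$, where $\hat H_m$ is a series in the $\hat z^{lm}$ with $l\ge1$. *Tropical counts.* Let $w=(w_1,\dots,w_s)$ be non-zero vectors of $M$ with non-zero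 sum, and let $x\in(\mathbb R^2)^s$. Let $T_{w,x}$ be the set of isomorphism classes of parametrized rational tropical curves $h\colon\Gamma\to\mathbb R^2$, without contracted edges and bivalent vertices, with $s+1$ labelled legs $E_0,\dots,E_s$, where $E_0$ has direction $\sum_r w_r$ and, for $r\ge1$, $E_r$ has direction $-w_r$ and asymptotically coincides with $x_r-\mathbb R_{\ge0}w_r$. (For $s=1$ the only such curve is the line, with no vertices.) For $x$ in some open dense subset of $(\mathbb R^2)^s$, $T_{w,x}$ is finite, all its elements are trivalent, and $$N_w^{\mathrm{trop}}(q^{1/2})=\sum_{h\in T_{w,x}}\ \prod_{V}\frac{q^{m(V)/2}-q^{-m(V)/2}}{q^{1/2}-q^{-1/2}}\in\mathbb N[q^{\pm1/2}]$$ does not depend on $x$. Here the product is over the vertices, and $m(V)=|\det(v_{V,E},v_{V,E'})|$ for the outward integral directions of two of the three edges $E,E'$ at $V$. *Partitions.* For $m\in M$ primitive, let $P_m$ be the set of $p=(p_1,\dots,p_n)\in\mathbb N^n$ such that $\sum_j p_jm_j=l_p m$ for some integer $l_p\ge1$. Write $k\vdash p$ if $k=(k_1,\dots,k_n)$ with $k_j$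 a partition of $p_j$, let $k_{lj}$ be the number of parts of $k_j$ equal to $l$, and let $w(k)$ be the tuple that contains $k_{lj}$ copies of $l m_j$ for all $j$ and all $l\ge1$. *Claim.* The counts $N^{\mathrm{trop}}_{w(k)}$ are well defined in the above sense for every $p$ with $\sum_j p_jm_j\ne0$ and every $k\vdash p$, the consistent completion $S(\hat{\mathfrak D}_{\mathfrak m})$ exists, and its outgoing Hamiltonians (which are therefore unique) are, for every primitive $m\in M$, $$\hat H_m=\sum_{p\in P_m}\sum_{k\vdash p}N^{\mathrm{trop}}_{w(k)}(q^{1/2})\left(\prod_{j=1}^n\prod_{l\ge1}\frac1{k_{lj}!}\left(\frac{(-1)^{l-1}}l\,\frac{q^{1/2}-q^{-1/2}}{q^{l/2}-q^{-l/2}}\right)^{k_{lj}}\right)\left(\prod_{j=1}^n t_j^{p_j}\right)\frac{\hat z^{l_pm}}{q^{1/2}-q^{-1/2}} .$$ -/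

import Mathlib

open Finset
open scoped ContDiff LaurentPolynomial

noncomputable section

namespace TropVertex

/-! ### The lattice `M = ℤ²` -/

/-- The lattice of characters `M = ℤ²`. -/
abbrev ZLat : Type := ℤ × ℤ

/-- The plane `M ⊗ ℝ = ℝ²`. -/
abbrev Plane : Type := ℝ × ℝ

/-- The unimodular skew-symmetric form `⟨a, b⟩ = det (a, b)` on `M`. -/
def skew (a b : ZLat) : ℤ := a.1 * b.2 - a.2 * b.1

/-- The extension of `skew` to the plane. -/
def skewR (a b : Plane) : ℝ := a.1 * b.2 - a.2 * b.1

/-- The inclusion of `M` in the plane. -/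
def toPlane (a : ZLat) : Plane := ((a.1 : ℝ), (a.2 : ℝ))

/-- Primitive vectors of `M` (in particular non-zero). -/
def IsPrimitive (a : ZLat) : Prop := IsCoprime a.1 a.2

/-- The type of primitive vectors of `M`. -/
abbrev PrimVec : Type := {v : ZLat // IsPrimitive v}

/-! ### The field `ℂ((ħ))` and `q = exp (iħ)` -/

/-- The field `ℂ((ħ))`. -/
abbrev LaurentField : Type := LaurentSeries ℂ

/-- The power series `exp (iħ/2)`. -/
def expHalf : PowerSeries ℂ := PowerSeries.rescale (Complex.I / 2) (PowerSeries.exp ℂ)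

theorem expHalf_ne_zero : ((expHalf : PowerSeries ℂ) : LaurentField) ≠ 0 := by
  intro h
  have h0 : expHalf = 0 := HahnSeries.ofPowerSeries_injective (Γ := ℤ) (by simpa using h)
  have h1 : PowerSeries.coeff 0 expHalf = 1 := by
    simp [expHalf, PowerSeries.coeff_rescale, PowerSeries.coeff_exp]
  rw [h0] at h1
  simp at h1

/-- `q^{1/2} = exp (iħ/2)`, an invertible element of `ℂ((ħ))`. -/
def qHalf : LaurentFieldˣ := Units.mk0 ((expHalf : PowerSeries ℂ) : LaurentField) expHalf_ne_zero

/-- `q^{a/2}` for an integer `a`. -/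
def qPow (a : ℤ) : LaurentField := ((qHalf ^ a : LaurentFieldˣ) : LaurentField)

theorem qPow_zero : qPow 0 = 1 := by simp [qPow]

theorem qPow_add (a b : ℤ) : qPow (a + b) = qPow a * qPow b := by simp [qPow, zpow_add]

/-- `q^{l/2} - q^{-l/2}`. -/
def qDiff (l : ℕ) : LaurentField := qPow l - qPow (-l)

/-! ### The quantum torus -/

/-- The algebra of functions on the quantum torus over `ℂ((ħ))`: the vector space with basis
`ẑ^a`, `a ∈ M`, and product `ẑ^a ẑ^b = q^{⟨a, b⟩/2} ẑ^{a + b}`. -/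
def QTorus : Type := ZLat →₀ LaurentField

namespace QTorus

instance : AddCommGroup QTorus := inferInstanceAs (AddCommGroup (ZLat →₀ LaurentField))

instance : Module LaurentField QTorus := inferInstanceAs (Module LaurentField (ZLat →₀ LaurentField))

/-- The basis element `ẑ^a`. -/
def zhat (a : ZLat) : QTorus := Finsupp.single a (1 : LaurentField)

/-- The coefficient of `ẑ^a`. -/
def coeff (a : ZLat) (f : QTorus) : LaurentField := (show ZLat →₀ LaurentField from f) a

/-- The product of the quantum torus, as a bilinear map. -/
def mulMap : QTorus →ₗ[LaurentField] QTorus →ₗ[LaurentField] QTorus :=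
  Finsupp.linearCombination LaurentField (M := QTorus →ₗ[LaurentField] QTorus) fun a =>
    Finsupp.linearCombination LaurentField (M := QTorus) fun b => qPow (skew a b) • zhat (a + b)

instance : Mul QTorus := ⟨fun f g => mulMap f g⟩

instance : One QTorus := ⟨zhat 0⟩

theorem mul_def (f g : QTorus) : f * g = mulMap f g := rfl

theorem one_def : (1 : QTorus) = zhat 0 := rfl

theorem zhat_mul_zhat (a b : ZLat) : zhat a * zhat b = qPow (skew a b) • zhat (a + b) := by
  have h1 : mulMap (zhat a) =
      Finsupp.linearCombination LaurentField (M := QTorus) fun b =>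
        qPow (skew a b) • zhat (a + b) := by
    refine (Finsupp.linearCombination_single (M := QTorus →ₗ[LaurentField] QTorus)
      LaurentField (1 : LaurentField) a).trans ?_
    exact one_smul LaurentField _
  rw [mul_def, h1]
  refine (Finsupp.linearCombination_single (M := QTorus)
    LaurentField (1 : LaurentField) b).trans ?_
  exact one_smul LaurentField _

theorem smul_mul (c : LaurentField) (f g : QTorus) : (c • f) * g = c • (f * g) := by
  simp [mul_def]

theorem mul_smul' (c : LaurentField) (f g : QTorus) : f * (c • g) = c • (f * g) := by
  simp [mul_def]

theorem induction_on {P : QTorus → Prop} (f : QTorus) (h0 : P 0)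
    (hadd : ∀ f g, P f → P g → P (f + g)) (hz : ∀ (c : LaurentField) a, P (c • zhat a)) : P f := by
  refine Finsupp.induction_linear (motive := P) f h0 hadd fun a c => ?_
  have h := hz c a
  unfold zhat at h
  have h2 : (c • (Finsupp.single a (1 : LaurentField)) : ZLat →₀ LaurentField) =
      Finsupp.single a c := by
    rw [Finsupp.smul_single, smul_eq_mul, mul_one]
  exact h2 ▸ h

private theorem left_distrib' (f g h : QTorus) : f * (g + h) = f * g + f * h := by simp [mul_def]

private theorem right_distrib' (f g h : QTorus) : (f + g) * h = f * h + g * h := by simp [mul_def]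

private theorem zero_mul' (f : QTorus) : 0 * f = 0 := by simp [mul_def]

private theorem mul_zero' (f : QTorus) : f * 0 = 0 := by simp [mul_def]

private theorem assoc' (f g h : QTorus) : f * g * h = f * (g * h) := by
  induction f using induction_on with
  | h0 => simp only [zero_mul']
  | hadd f f' e e' => simp only [right_distrib', e, e']
  | hz c a =>
  induction g using induction_on with
  | h0 => simp only [zero_mul', mul_zero']
  | hadd f f' e e' => simp only [right_distrib', left_distrib', e, e']
  | hz d b =>
  induction h using induction_on with
  | h0 => simp only [mul_zero']
  | hadd f f' e e' => simp only [left_distrib', e, e']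
  | hz e c' =>
  simp only [smul_mul, mul_smul', zhat_mul_zhat, smul_smul]
  rw [add_assoc]
  congr 1
  have h1 : skew (a + b) c' = skew a c' + skew b c' := by
    simp only [skew, Prod.fst_add, Prod.snd_add]; ring
  have h2 : skew a (b + c') = skew a b + skew a c' := by
    simp only [skew, Prod.fst_add, Prod.snd_add]; ring
  rw [h1, h2, qPow_add, qPow_add]
  ring

private theorem one_mul' (f : QTorus) : 1 * f = f := by
  induction f using induction_on with
  | h0 => exact mul_zero' _
  | hadd f f' e e' => rw [left_distrib', e, e']
  | hz c a =>
  rw [mul_smul', one_def, zhat_mul_zhat]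
  simp [skew, qPow_zero]

private theorem mul_one' (f : QTorus) : f * 1 = f := by
  induction f using induction_on with
  | h0 => exact zero_mul' _
  | hadd f f' e e' => rw [right_distrib', e, e']
  | hz c a =>
  rw [smul_mul, one_def, zhat_mul_zhat]
  simp [skew, qPow_zero]

instance : Ring QTorus :=
  { (inferInstance : AddCommGroup QTorus) with
    left_distrib := left_distrib'
    right_distrib := right_distrib'
    zero_mul := zero_mul'
    mul_zero := mul_zero'
    mul_assoc := assoc'
    one_mul := one_mul'
    mul_one := mul_one' }

end QTorus

/-! ### Functions on the formal family of quantum tori over `R = ℂ[[t₁, …, tₙ]]` -/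

/-- The completed algebra `lim_l (R / 𝔪_R^l ⊗ Γ(𝒪_{T̂^ħ}))` for `R = ℂ[[t₁, …, tₙ]]`: power series in
the central variables `t_j` with coefficients in the quantum torus algebra. -/
abbrev QFun (n : ℕ) : Type := MvPowerSeries (Fin n) QTorus

/-- The coefficient, in the quantum torus algebra, of `t^d`. -/
def tcoeff {n : ℕ} (d : Fin n →₀ ℕ) (f : QFun n) : QTorus := MvPowerSeries.coeff d f

/-- `f = g` modulo `𝔪_R^l`. -/
def EqMod {n : ℕ} (l : ℕ) (f g : QFun n) : Prop :=
  ∀ d : Fin n →₀ ℕ, d.degree < l → tcoeff d f = tcoeff d g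

/-- The exponential `∑ H^k / k!` of a function `H` with `H = 0` modulo `𝔪_R`. As `H^k` vanishes
modulo `𝔪_R^k`, only the terms with `k ≤ |d|` contribute to the coefficient of `t^d`. -/
def qexp {n : ℕ} (H : QFun n) : QFun n := fun d =>
  ∑ k ∈ range (d.degree + 1), ((k.factorial : LaurentField)⁻¹) • tcoeff d (H ^ k)

/-- The automorphism `Φ_H = Ad (exp H)`. Its inverse is `Φ_{-H}`. -/
def autPhi {n : ℕ} (H : QFun n) : QFun n → QFun n := fun a => qexp H * a * qexp (-H)

/-! ### Quantum scattering diagrams -/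

/-- A ray `base + ℝ_{≥0} dir` with its Hamiltonian, outgoing if the Hamiltonian is a series in
`ẑ^{dir}`, ingoing if it is a series in `ẑ^{-dir}`. -/
structure QRay (n : ℕ) where
  base : Plane
  dir : ZLat
  dir_primitive : IsPrimitive dir
  outgoing : Bool
  ham : QFun n
  ham_const : tcoeff 0 ham = 0
  ham_supp : ∀ d a, QTorus.coeff a (tcoeff d ham) ≠ 0 →
    ∃ l : ℕ, a = l • (if outgoing then dir else -dir)

namespace QRay

/-- The direction `m(H)`: `dir` for outgoing rays and `-dir` for ingoing ones. -/
def hamDir {n : ℕ} (r : QRay n) : ZLat := if r.outgoing then r.dir else -r.dir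

/-- The half-line underlying a ray. -/
def support {n : ℕ} (r : QRay n) : Set Plane :=
  {x | ∃ t : ℝ, 0 ≤ t ∧ x = r.base + t • toPlane r.dir}

end QRay

/-- A quantum scattering diagram over `ℂ[[t₁, …, tₙ]]`: a family of rays such that, for every `l`,
only finitely many Hamiltonians are non-zero modulo `𝔪_R^l`. -/
structure QDiagram (n : ℕ) where
  Index : Type
  ray : Index → QRay n
  finite_mod : ∀ l : ℕ, {i | ¬ EqMod l (ray i).ham 0}.Finite

namespace QDiagram

variable {n : ℕ}

/-- The union of the initial points of the rays and of the points where two non-parallel rays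
meet. Rays with zero Hamiltonian are trivial and are disregarded. -/
def singularLocus (D : QDiagram n) : Set Plane :=
  {x | (∃ i, (D.ray i).ham ≠ 0 ∧ x = (D.ray i).base) ∨
    ∃ i j, (D.ray i).ham ≠ 0 ∧ (D.ray j).ham ≠ 0 ∧ skew (D.ray i).dir (D.ray j).dir ≠ 0 ∧
      x ∈ (D.ray i).support ∧ x ∈ (D.ray j).support}

/-- Admissible smooth paths `[0, 1] → M_ℝ`. -/
structure IsAdmissible (D : QDiagram n) (γ : ℝ → Plane) : Prop where
  smooth : ContDiffOn ℝ ∞ γ (Set.Icc 0 1)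
  avoids : ∀ t ∈ Set.Icc (0 : ℝ) 1, γ t ∉ D.singularLocus
  endpoints : ∀ i, (D.ray i).ham ≠ 0 → γ 0 ∉ (D.ray i).support ∧ γ 1 ∉ (D.ray i).support
  transverse : ∀ i, (D.ray i).ham ≠ 0 → ∀ t ∈ Set.Icc (0 : ℝ) 1, γ t ∈ (D.ray i).support →
    skewR (toPlane (D.ray i).dir) (deriv γ t) ≠ 0

/-- `L` lists the (finitely many) pairs `(t, i)` such that `γ` meets the `i`-th ray at time `t` and
the Hamiltonian of this ray is non-zero modulo `𝔪_R^l`, in the order of increasing times. -/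
structure IsCrossingList (D : QDiagram n) (γ : ℝ → Plane) (l : ℕ) (L : List (ℝ × D.Index)) :
    Prop where
  nodup : L.Nodup
  mem_iff : ∀ t i, (t, i) ∈ L ↔
    t ∈ Set.Icc (0 : ℝ) 1 ∧ γ t ∈ (D.ray i).support ∧ ¬ EqMod l (D.ray i).ham 0
  sorted : L.Pairwise fun c c' => c.1 ≤ c'.1

/-- The sign `ε` of `⟨m(H), γ'(t)⟩` at a crossing. -/
def crossingSign (D : QDiagram n) (γ : ℝ → Plane) (c : ℝ × D.Index) : ℤ :=
  (SignType.sign (skewR (toPlane (D.ray c.2).hamDir) (deriv γ c.1)) : ℤ)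

/-- The path ordered product `Φ_{H_s}^{ε_s} ∘ ⋯ ∘ Φ_{H_1}^{ε_1}` over the list of crossings. -/
def pathProduct (D : QDiagram n) (γ : ℝ → Plane) : List (ℝ × D.Index) → QFun n → QFun n
  | [], a => a
  | c :: L, a => D.pathProduct γ L (autPhi (D.crossingSign γ c • (D.ray c.2).ham) a)

/-- Consistency: the path ordered product along every closed admissible path is the identity,
i.e. it is the identity modulo `𝔪_R^l` for every `l`. Rays crossed at the same time are parallel, so
their automorphisms commute and the choice of the list of crossings does not matter. -/
def IsConsistent (D : QDiagram n) : Prop :=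
  ∀ γ : ℝ → Plane, D.IsAdmissible γ → γ 0 = γ 1 →
    ∀ (l : ℕ) (L : List (ℝ × D.Index)), D.IsCrossingList γ l L →
      ∀ a : QFun n, EqMod l (D.pathProduct γ L a) a

end QDiagram

/-- The coefficient `(1/l) (-1)^{l-1} / (q^{l/2} - q^{-l/2})`. -/
def dilogCoeff (l : ℕ) : LaurentField := (l : LaurentField)⁻¹ * ((-1) ^ (l - 1) / qDiff l)

open Classical in
/-- The Hamiltonian `∑_{l ≥ 1} (1/l) (-1)^{l-1} / (q^{l/2} - q^{-l/2}) t_j^l ẑ^{l m_j}`. -/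
def initialHam {n : ℕ} (m : Fin n → ZLat) (j : Fin n) : QFun n := fun d =>
  if d j ≠ 0 ∧ d = Finsupp.single j (d j) then dilogCoeff (d j) • QTorus.zhat (d j • m j) else 0

theorem IsPrimitive.neg {a : ZLat} (h : IsPrimitive a) : IsPrimitive (-a) :=
  IsCoprime.neg_neg h

theorem QTorus.eq_of_coeff_smul_zhat_ne {c : LaurentField} {a b : ZLat}
    (h : QTorus.coeff b (c • QTorus.zhat a) ≠ 0) : b = a := by
  by_contra hne
  apply h
  change (c • (Finsupp.single a (1 : LaurentField)) : ZLat →₀ LaurentField) b = 0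
  rw [Finsupp.smul_apply, Finsupp.single_eq_of_ne hne, smul_zero]

/-- The ingoing ray `-ℝ_{≥0} m_j` with its Hamiltonian. -/
def initialRay {n : ℕ} (m : Fin n → ZLat) (hm : ∀ j, IsPrimitive (m j)) (j : Fin n) : QRay n where
  base := 0
  dir := -(m j)
  dir_primitive := (hm j).neg
  outgoing := false
  ham := initialHam m j
  ham_const := by
    change initialHam m j 0 = 0
    exact if_neg fun h => h.1 rfl
  ham_supp := by
    intro d a h
    change QTorus.coeff a (initialHam m j d) ≠ 0 at h
    unfold initialHam at h
    split_ifs at h with h1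
    · exact ⟨d j, by simpa using QTorus.eq_of_coeff_smul_zhat_ne h⟩
    · exact absurd rfl h

/-- The quantum scattering diagram `D̂_𝔪` made of the ingoing rays `-ℝ_{≥0} m_j`. -/
def initialDiagram {n : ℕ} (m : Fin n → ZLat) (hm : ∀ j, IsPrimitive (m j)) : QDiagram n where
  Index := Fin n
  ray := initialRay m hm
  finite_mod := fun _ => Set.toFinite _

/-- A family of Hamiltonians `Ĥ_v`, one for each outgoing ray `ℝ_{≥0} v`, `v` primitive, which are
series in the `ẑ^{l v}`, `l ≥ 1`. (A multiple of `ẑ^0` would be central, hence would have no effect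
on the automorphism.) -/
structure OutgoingFamily (n : ℕ) where
  ham : PrimVec → QFun n
  ham_const : ∀ v, tcoeff 0 (ham v) = 0
  ham_supp : ∀ (v : PrimVec) d a, QTorus.coeff a (tcoeff d (ham v)) ≠ 0 →
    ∃ l : ℕ, 1 ≤ l ∧ a = l • v.1
  finite_mod : ∀ l : ℕ, {v | ¬ EqMod l (ham v) 0}.Finite

/-- The diagram obtained from `D` by adding the outgoing rays `(ℝ_{≥0} v, Ĥ_v)`. -/
def QDiagram.addOutgoing {n : ℕ} (D : QDiagram n) (S : OutgoingFamily n) : QDiagram n where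
  Index := D.Index ⊕ PrimVec
  ray := Sum.elim D.ray fun v =>
    { base := 0
      dir := v.1
      dir_primitive := v.2
      outgoing := true
      ham := S.ham v
      ham_const := S.ham_const v
      ham_supp := fun d a h => by
        obtain ⟨l, -, hl⟩ := S.ham_supp v d a h
        exact ⟨l, by simpa using hl⟩ }
  finite_mod := fun l => by
    refine (((D.finite_mod l).image Sum.inl).union ((S.finite_mod l).image Sum.inr)).subset ?_
    rintro (i | v) h
    · exact Or.inl ⟨i, h, rfl⟩
    · exact Or.inr ⟨v, h, rfl⟩

/-- The rays `(ℝ_{≥0} v, Ĥ_v)` are the outgoing rays of the consistent completion of `D̂_𝔪`. -/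
def IsConsistentCompletion {n : ℕ} (m : Fin n → ZLat) (hm : ∀ j, IsPrimitive (m j))
    (S : OutgoingFamily n) : Prop :=
  ((initialDiagram m hm).addOutgoing S).IsConsistent

/-! ### Refined counts of rational tropical curves -/

open Classical in
/-- Parametrized rational tropical curves in the plane, without contracted edges, whose legs are
labelled by `0` (here `none`) and by the elements of a finite set `ι`. The graph is described by the
tree whose nodes are its vertices (`Sum.inl V`) and the ends at infinity of its legs (`Sum.inr e`),
which are univalent. As usual bivalent vertices are not allowed: a curve with just two legs is a
line and has no vertices. -/
structure TropCurve (ι : Type) [Fintype ι] where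
  numVertices : ℕ
  graph : SimpleGraph (Fin numVertices ⊕ Option ι)
  isTree : graph.IsTree
  leg_univalent : ∀ e, (graph.neighborSet (Sum.inr e)).ncard = 1
  valence : ∀ V, 3 ≤ (graph.neighborSet (Sum.inl V)).ncard
  /-- The images of the vertices. -/
  pos : Fin numVertices → Plane
  /-- The vectors `v_{V,E}`, for `E` the edge that joins `V` to a given adjacent node. -/
  dir : Fin numVertices → Fin numVertices ⊕ Option ι → ZLat
  dir_ne_zero : ∀ V u, graph.Adj (Sum.inl V) u → dir V u ≠ 0
  dir_symm : ∀ V V', graph.Adj (Sum.inl V) (Sum.inl V') → dir V' (Sum.inl V) = -dir V (Sum.inl V')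
  /-- A bounded edge has a positive length `len`. -/
  edge : ∀ V V', graph.Adj (Sum.inl V) (Sum.inl V') →
    ∃ len : ℝ, 0 < len ∧ pos V' - pos V = len • toPlane (dir V (Sum.inl V'))
  balancing : ∀ V, ∑ u with graph.Adj (Sum.inl V) u, dir V u = 0

namespace TropCurve

variable {ι : Type} [Fintype ι]

/-- All vertices are trivalent. -/
def IsTrivalent (C : TropCurve ι) : Prop :=
  ∀ V, (C.graph.neighborSet (Sum.inl V)).ncard = 3

/-- The curve is of type `(w, x)`: the leg `E_0` has direction `∑ w_r`, and `E_r` has direction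
`-w_r` and asymptotically coincides with the half-line `-ℝ_{≥0} w_r + x_r`, i.e. it lies on the line
`x_r + ℝ w_r`. -/
def IsOfType (w : ι → ZLat) (x : ι → Plane) (C : TropCurve ι) : Prop :=
  (∀ V, C.graph.Adj (Sum.inl V) (Sum.inr none) → C.dir V (Sum.inr none) = ∑ r, w r) ∧
  ∀ V r, C.graph.Adj (Sum.inl V) (Sum.inr (some r)) →
    C.dir V (Sum.inr (some r)) = -w r ∧ ∃ c : ℝ, C.pos V = x r + c • toPlane (w r)

/-- Isomorphism of parametrized tropical curves (with labelled legs). -/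
def Iso (C C' : TropCurve ι) : Prop :=
  ∃ σ : Fin C.numVertices ≃ Fin C'.numVertices,
    (∀ a b, C'.graph.Adj (σ.sumCongr (Equiv.refl _) a) (σ.sumCongr (Equiv.refl _) b) ↔
      C.graph.Adj a b) ∧
    (∀ V, C'.pos (σ V) = C.pos V) ∧
    ∀ V u, C.graph.Adj (Sum.inl V) u → C'.dir (σ V) (σ.sumCongr (Equiv.refl _) u) = C.dir V u

theorem Iso.refl (C : TropCurve ι) : C.Iso C :=
  ⟨Equiv.refl _, by simp, by simp, by simp⟩

theorem Iso.symm {C C' : TropCurve ι} (h : C.Iso C') : C'.Iso C := by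
  obtain ⟨σ, h1, h2, h3⟩ := h
  have key : ∀ a, σ.sumCongr (Equiv.refl (Option ι)) (σ.symm.sumCongr (Equiv.refl _) a) = a := by
    rintro (a | a) <;> simp
  refine ⟨σ.symm, fun a b => ?_, fun V => ?_, fun V u hu => ?_⟩
  · rw [← h1, key, key]
  · rw [← h2, Equiv.apply_symm_apply]
  · rw [← h3, key, Equiv.apply_symm_apply]
    rw [← h1, key]
    simpa using hu

theorem Iso.trans {C C' C'' : TropCurve ι} (h : C.Iso C') (h' : C'.Iso C'') : C.Iso C'' := by
  obtain ⟨σ, h1, h2, h3⟩ := h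
  obtain ⟨τ, k1, k2, k3⟩ := h'
  have key : ∀ a, (σ.trans τ).sumCongr (Equiv.refl (Option ι)) a =
      τ.sumCongr (Equiv.refl _) (σ.sumCongr (Equiv.refl _) a) := by
    rintro (a | a) <;> simp
  refine ⟨σ.trans τ, fun a b => ?_, fun V => ?_, fun V u hu => ?_⟩
  · rw [key, key, k1, h1]
  · rw [Equiv.trans_apply, k2, h2]
  · rw [key, Equiv.trans_apply, k3, h3 _ _ hu]
    have := (h1 (Sum.inl V) u).2 hu
    simpa using this

open Classical in
/-- The multiplicity `m(V)`: the common value `|det (v_{V,E}, v_{V,E'})|` for pairs of distinct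
adjacent edges of a trivalent vertex, written symmetrically as a maximum over all pairs of adjacent
edges. -/
def vertexMult (C : TropCurve ι) (V : Fin C.numVertices) : ℕ :=
  (univ.filter fun e : (Fin C.numVertices ⊕ Option ι) × (Fin C.numVertices ⊕ Option ι) =>
    C.graph.Adj (Sum.inl V) e.1 ∧ C.graph.Adj (Sum.inl V) e.2).sup
      fun e => (skew (C.dir V e.1) (C.dir V e.2)).natAbs

theorem vertexMult_eq {C C' : TropCurve ι} (σ : Fin C.numVertices ≃ Fin C'.numVertices)
    (h1 : ∀ a b, C'.graph.Adj (σ.sumCongr (Equiv.refl _) a) (σ.sumCongr (Equiv.refl _) b) ↔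
      C.graph.Adj a b)
    (h3 : ∀ V u, C.graph.Adj (Sum.inl V) u →
      C'.dir (σ V) (σ.sumCongr (Equiv.refl _) u) = C.dir V u) (V : Fin C.numVertices) :
    C'.vertexMult (σ V) = C.vertexMult V := by
  classical
  apply le_antisymm
  · refine Finset.sup_le fun e he => ?_
    obtain ⟨e1, e2⟩ := e
    obtain ⟨a, rfl⟩ := (σ.sumCongr (Equiv.refl (Option ι))).surjective e1
    obtain ⟨b, rfl⟩ := (σ.sumCongr (Equiv.refl (Option ι))).surjective e2
    obtain ⟨ha, hb⟩ := (Finset.mem_filter.1 he).2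
    have ha' := (h1 (Sum.inl V) a).1 (by simpa using ha)
    have hb' := (h1 (Sum.inl V) b).1 (by simpa using hb)
    simp only [h3 V a ha', h3 V b hb']
    exact Finset.le_sup (f := fun e : (Fin C.numVertices ⊕ Option ι) × _ =>
      (skew (C.dir V e.1) (C.dir V e.2)).natAbs) (b := (a, b))
      (Finset.mem_filter.2 ⟨mem_univ _, ha', hb'⟩)
  · refine Finset.sup_le fun e he => ?_
    obtain ⟨a, b⟩ := e
    obtain ⟨ha, hb⟩ := (Finset.mem_filter.1 he).2
    simp only [← h3 V a ha, ← h3 V b hb]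
    have ha' := (h1 (Sum.inl V) a).2 ha
    have hb' := (h1 (Sum.inl V) b).2 hb
    exact Finset.le_sup (f := fun e : (Fin C'.numVertices ⊕ Option ι) × _ =>
      (skew (C'.dir (σ V) e.1) (C'.dir (σ V) e.2)).natAbs)
      (b := (σ.sumCongr (Equiv.refl _) a, σ.sumCongr (Equiv.refl _) b))
      (Finset.mem_filter.2 ⟨mem_univ _, by simpa using ha', by simpa using hb'⟩)

end TropCurve

/-- The quantum integer `[k]_q = (q^{k/2} - q^{-k/2}) / (q^{1/2} - q^{-1/2}) =
q^{-(k-1)/2} (1 + q + ⋯ + q^{k-1})`, a Laurent polynomial in the variable `T = q^{1/2}`. -/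
def quantumInt (k : ℕ) : ℕ[T;T⁻¹] := ∑ i ∈ range k, LaurentPolynomial.T (2 * (i : ℤ) - ((k : ℤ) - 1))

namespace TropCurve

variable {ι : Type} [Fintype ι]

/-- The Block-Göttsche refined multiplicity `∏_V [m(V)]_q`. -/
def refinedMult (C : TropCurve ι) : ℕ[T;T⁻¹] := ∏ V, quantumInt (C.vertexMult V)

theorem Iso.refinedMult_eq {C C' : TropCurve ι} (h : C.Iso C') :
    C.refinedMult = C'.refinedMult := by
  obtain ⟨σ, h1, -, h3⟩ := h
  exact Fintype.prod_equiv σ _ _ fun V => by rw [vertexMult_eq σ h1 h3]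

/-- Isomorphism as an equivalence relation on the curves of type `(w, x)`. -/
def isoSetoid (w : ι → ZLat) (x : ι → Plane) : Setoid {C : TropCurve ι // C.IsOfType w x} where
  r := fun C C' => C.1.Iso C'.1
  iseqv := ⟨fun C => Iso.refl C.1, Iso.symm, Iso.trans⟩

end TropCurve

section Count

variable {ι : Type} [Fintype ι]

/-- The set `T_{w,x}` of isomorphism classes of rational tropical curves of type `(w, x)` without
contracted edges. -/
def TropClasses (w : ι → ZLat) (x : ι → Plane) : Type := Quotient (TropCurve.isoSetoid w x)

/-- The refined multiplicity of an isomorphism class. -/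
def TropClasses.refinedMult {w : ι → ZLat} {x : ι → Plane} : TropClasses w x → ℕ[T;T⁻¹] :=
  Quotient.lift (fun C => C.1.refinedMult) fun _ _ h => TropCurve.Iso.refinedMult_eq h

/-- `N` is the refined count `N_{w,x}` for general `x`: for `x` in some open dense set, there are
finitely many curves of type `(w, x)`, all of them are trivalent, and the sum of their refined
multiplicities is `N`. -/
def IsRefinedCount (w : ι → ZLat) (N : ℕ[T;T⁻¹]) : Prop :=
  ∃ U : Set (ι → Plane), IsOpen U ∧ Dense U ∧ ∀ x ∈ U,
    Finite (TropClasses w x) ∧ (∀ C : TropCurve ι, C.IsOfType w x → C.IsTrivalent) ∧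
      ∑ᶠ c : TropClasses w x, c.refinedMult = N

/-- There is at most one refined count. -/
theorem IsRefinedCount.unique {w : ι → ZLat} {N N' : ℕ[T;T⁻¹]} (h : IsRefinedCount w N)
    (h' : IsRefinedCount w N') : N = N' := by
  obtain ⟨U, hU, hd, hN⟩ := h
  obtain ⟨U', -, hd', hN'⟩ := h'
  obtain ⟨x, hx, hx'⟩ := hd'.inter_open_nonempty U hU hd.nonempty
  rw [← (hN x hx).2.2, (hN' x hx').2.2]

open Classical in
/-- The refined tropical count `N_w^{trop}`. -/
def refinedCount (w : ι → ZLat) : ℕ[T;T⁻¹] :=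
  if h : ∃ N, IsRefinedCount w N then h.choose else 0

end Count

/-- The value of a Laurent polynomial in `q^{1/2}` at `q^{1/2} = exp (iħ/2)`. -/
def atQ (N : ℕ[T;T⁻¹]) : LaurentField :=
  LaurentPolynomial.eval₂ (Nat.castRingHom LaurentField) qHalf N

/-! ### Partitions -/

/-- The set of the parts (with repetitions) of a tuple `k` of partitions `k_j ⊢ p_j`. It has
`s(k) = ∑_j ∑_l k_{lj}` elements, where `k_{lj}` is the number of parts of `k_j` equal to `l`. -/
abbrev PartIndex {n : ℕ} {p : Fin n →₀ ℕ} (k : ∀ j, Nat.Partition (p j)) : Type :=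
  (j : Fin n) × ((k j).parts : Type)

/-- The tuple `w(k)`, which contains `k_{lj}` copies of the vector `l m_j`. -/
def partVec {n : ℕ} (m : Fin n → ZLat) {p : Fin n →₀ ℕ} (k : ∀ j, Nat.Partition (p j)) :
    PartIndex k → ZLat :=
  fun r => (r.2 : ℕ) • m r.1

/-- The factor `∏_j ∏_l (1/k_{lj}!) (((-1)^{l-1}/l) (q^{1/2}-q^{-1/2})/(q^{l/2}-q^{-l/2}))^{k_{lj}}`
of a tuple `k` of partitions `k_j ⊢ p_j`. All parts of `k_j` are between `1` and `p_j`. -/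
def partFactor {n : ℕ} {p : Fin n →₀ ℕ} (k : ∀ j, Nat.Partition (p j)) : LaurentField :=
  ∏ j, ∏ l ∈ Finset.Icc 1 (p j),
    (((k j).parts.count l).factorial : LaurentField)⁻¹ *
      ((-1) ^ (l - 1) / (l : LaurentField) * (qDiff 1 / qDiff l)) ^ ((k j).parts.count l)

end TropVertex

end

/-!
Everything takes place in power series over the quantum torus whose coefficient at an exponent `d` is
a multiple of `ẑ^{wt d}`, where `wt d = ∑ d_i w_i` is the weight (`homGrading`). A point `y` of the
plane, or more generally an additive function of the exponents, splits the exponents by sign, and a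
series `g` with constant coefficient `1` factors uniquely as `g = g₋ g₀ g₊` accordingly (`facPart`). For
the function `d ↦ ⟨wt d, y⟩` the exponents in `g₀` have parallel weights, so that `g₀` is the
exponential of a series with commuting parts; its logarithm `wallLog w g y` is the wall at `y`. It
depends only on the ray of `y`, and has an outgoing part (weights in the direction of `y`) and an
incoming part (weights in the direction of `-y`).

*Consistency.* The factor `g₊` is a potential for this arrangement of walls: when `y` crosses a wall,
`g₊` is multiplied by the exponential of the positive part of the wall on one side and by that of the
negative part on the other (`facPart_lexSign_slope`), so that it jumps exactly by the crossing
automorphism. Hence the path-ordered product along a closed path is trivial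
(`IsWallDiagram.isConsistent`).

*Existence.* The coefficient at `d` of the incoming wall in the direction of `wt d` is the coefficient
of `g` at `d` up to terms in lower coefficients. By this triangularity there is a `g` with any prescribed
incoming walls (`exists_incoming`); for the initial diagram its outgoing walls form the consistent
completion (`isConsistentCompletion_outgoingFamily`).

*Uniqueness.* On a circle around the origin all crossings with outgoing rays have the same sign. The
path-ordered product of a loop commutes with the quantum torus, so that its coefficients are central,
that is, constants (`QTorus.coeff_eq_zero_of_central`). By induction on the degree, two completions
that agree below `d` differ at `d` by a sum over the rays that has to vanish, and the rays are told
apart by their exponents `ẑ^b` (`IsConsistentCompletion.ham_eq`).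

*Tropical counts.* Take one variable `u_i` for each leg, with incoming walls `u_i ẑ^{w_i}/(q^{1/2} -
q^{-1/2})`, and look at the coefficients of the squarefree monomials `u_I`. Displacing the lines makes
the function that splits the exponents affine in `y`. While `y` runs along the line of `I`, the
coefficient of the middle factor at `u_I` changes only where the lines of `J` and `I \ J` meet on it,
and there by the commutator of the coefficients at `u_J` and `u_{I \ J}`. For lines in general position
(`GenericLines`) this is the recursion for the sum, over the binary trees with leaves `I` drawn in the
plane, of the products of the multiplicities of the vertices (`wallCoeff_eq_treeSum`). Far away on the
line of `I` the affine function has the signs of the linear one, so that the outgoing wall at `u_I`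
counts all the trees (`coeff_wallLog_eq_sum`). The trees are the isomorphism classes of tropical curves
through the given lines: a curve is cut open at its root `E_0` (`exists_model`, `exists_tree`,
`count_of_generic`). As the wall does not know the displacement, the count does not depend on it
(`exists_refinedCount`).

*Multiple parts.* Take next one variable `s_{l,j}` for every multiple `l m_j`. Homogeneous
substitutions of the variables are compatible with factorizations and logarithms. The substitution of
`∑ u_i`, over the legs `i` of weight `l m_j`, for `s_{l,j}` expresses the coefficients of the outgoing
walls through the counts above, with a factor `∏ k_{lj}!` (`colourSubst`,
`HasIncoming.coeff_colourType`). The substitution of multiples of `t_j^l`, with the coefficients of the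
quantum dilogarithm, for `s_{l,j}` turns the incoming walls into the initial Hamiltonians
(`dilogSubst`, `exists_hasIncoming_initialHam`); the coefficient at `t^p` then collects the monomials in
the `s_{l,j}`, which are the tuples of partitions of the `p_j`.
-/


set_option linter.unusedSectionVars false

noncomputable section

namespace TropVertex

/-! ### The field `ℂ((ħ))` and the powers of `q^{1/2}` -/

/-- The exponential `exp (iaħ/2)` as a power series. -/
def expPS (a : ℤ) : PowerSeries ℂ := PowerSeries.rescale (a * (Complex.I / 2)) (PowerSeries.exp ℂ)

theorem expPS_add (a b : ℤ) : expPS a * expPS b = expPS (a + b) := by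
  unfold expPS
  rw [PowerSeries.exp_mul_exp_eq_exp_add]
  push_cast
  rw [add_mul]

theorem qPow_ne_zero (a : ℤ) : qPow a ≠ 0 := Units.ne_zero _

theorem qPow_eq_expPS (a : ℤ) : qPow a = ((expPS a : PowerSeries ℂ) : LaurentField) := by
  have h0 : expPS 0 = 1 := by
    ext n
    rw [expPS, PowerSeries.coeff_rescale, PowerSeries.coeff_exp, PowerSeries.coeff_one]
    rcases n with - | n <;> simp
  have h1 : expPS 1 = expHalf := by simp [expPS, expHalf]
  induction a using Int.induction_on with
  | zero => rw [qPow_zero, h0]; simp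
  | succ n ih =>
    rw [qPow_add, ih, ← expPS_add, h1]
    simp [qPow, qHalf]
  | pred n ih =>
    have h2 : qPow (-(n : ℤ) - 1) * qPow 1 = ((expPS (-(n : ℤ) - 1) : PowerSeries ℂ) : LaurentField) * qPow 1 := by
      have h3 : qPow 1 = ((expPS 1 : PowerSeries ℂ) : LaurentField) := by
        rw [h1]; simp [qPow, qHalf]
      rw [← qPow_add, sub_add_cancel, ih, h3, ← PowerSeries.coe_mul, expPS_add, sub_add_cancel]
    exact mul_right_cancel₀ (qPow_ne_zero 1) h2

instance : CharZero LaurentField :=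
  charZero_of_injective_algebraMap (R := ℂ) (algebraMap ℂ LaurentField).injective

/-- The powers of `q^{1/2}` are linearly independent over `ℂ`. Comparing the coefficients of `ħ^k`
shows that `∑ c_a f(a) = 0` for every polynomial `f`; take for `f` the product of the `X - b`
with `b ≠ a`. -/
theorem qPow_linearIndependent (s : Finset ℤ) (c : ℤ → ℤ)
    (h : ∑ a ∈ s, (c a : LaurentField) * qPow a = 0) : ∀ a ∈ s, c a = 0 := by
  have h1 : ∑ a ∈ s, (c a : PowerSeries ℂ) * expPS a = 0 := by
    apply HahnSeries.ofPowerSeries_injective (Γ := ℤ)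
    rw [map_sum, map_zero, ← h]
    refine sum_congr rfl fun a _ => ?_
    rw [map_mul, map_intCast, qPow_eq_expPS]
  have h2 : ∀ k : ℕ, ∑ a ∈ s, (c a : ℂ) * (a : ℂ) ^ k = 0 := by
    intro k
    have h3 := congrArg (PowerSeries.coeff k) h1
    rw [map_sum, map_zero] at h3
    have h4 : ∀ a ∈ s, PowerSeries.coeff k ((c a : PowerSeries ℂ) * expPS a) =
        ((c a : ℂ) * (a : ℂ) ^ k) * ((Complex.I / 2) ^ k * ((k.factorial : ℂ))⁻¹) := by
      intro a _
      have h5 : (c a : PowerSeries ℂ) = PowerSeries.C (c a : ℂ) := by simp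
      rw [h5, PowerSeries.coeff_C_mul, expPS, PowerSeries.coeff_rescale, PowerSeries.coeff_exp, mul_pow]
      simp only [one_div, map_inv₀, map_natCast]
      ring
    rw [sum_congr rfl h4, ← sum_mul] at h3
    refine (mul_eq_zero.1 h3).resolve_right ?_
    refine mul_ne_zero (pow_ne_zero _ (by simp)) (inv_ne_zero ?_)
    exact_mod_cast Nat.factorial_ne_zero k
  have h3 : ∀ f : Polynomial ℂ, ∑ a ∈ s, (c a : ℂ) * f.eval (a : ℂ) = 0 := by
    intro f
    simp_rw [Polynomial.eval_eq_sum_range, mul_sum]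
    rw [sum_comm]
    refine sum_eq_zero fun k _ => ?_
    have : ∀ a ∈ s, (c a : ℂ) * (f.coeff k * (a : ℂ) ^ k) = f.coeff k * ((c a : ℂ) * (a : ℂ) ^ k) :=
      fun a _ => by ring
    rw [sum_congr rfl this, ← mul_sum, h2, mul_zero]
  intro a ha
  have h4 := h3 (∏ b ∈ s.erase a, (Polynomial.X - Polynomial.C (b : ℂ)))
  rw [Finset.sum_eq_single_of_mem a ha] at h4
  · rw [Polynomial.eval_prod] at h4
    have h5 := (mul_eq_zero.1 h4).resolve_right (by
      refine prod_ne_zero_iff.2 ?_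
      intro b hb
      simp only [Polynomial.eval_sub, Polynomial.eval_X, Polynomial.eval_C]
      rw [sub_ne_zero]
      exact_mod_cast (ne_of_mem_erase hb).symm)
    exact_mod_cast h5
  · intro b hb hba
    rw [Polynomial.eval_prod, prod_eq_zero (mem_erase.2 ⟨hba, hb⟩), mul_zero]
    simp

theorem qPow_sub_ne_zero {a b : ℤ} (h : a ≠ b) : qPow a - qPow b ≠ 0 := by
  intro h0
  have := qPow_linearIndependent {a, b} (fun x => if x = a then 1 else -1) (by
    rw [sum_pair h]
    simp only [if_true, if_neg h.symm]
    push_cast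
    linear_combination h0) a (by simp)
  simp at this

theorem qDiff_ne_zero {l : ℕ} (hl : l ≠ 0) : qDiff l ≠ 0 :=
  qPow_sub_ne_zero (by omega)

theorem atQ_eq_sum (N : ℕ[T;T⁻¹]) (s : Finset ℤ) (hs : N.coeff.support ⊆ s) :
    atQ N = ∑ a ∈ s, ((N.coeff a : ℕ) : LaurentField) * qPow a := by
  have h1 : N = ∑ a ∈ s, LaurentPolynomial.C (N.coeff a) * LaurentPolynomial.T a := by
    refine AddMonoidAlgebra.ext (Finsupp.ext fun b => ?_)
    simp_rw [← LaurentPolynomial.single_eq_C_mul_T]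
    rw [AddMonoidAlgebra.coeff_sum, Finsupp.finsetSum_apply]
    by_cases hb : b ∈ s
    · rw [Finset.sum_eq_single_of_mem b hb]
      · rw [AddMonoidAlgebra.coeff_single, Finsupp.single_eq_same]
      · intro a _ hab
        rw [AddMonoidAlgebra.coeff_single, Finsupp.single_eq_of_ne hab.symm]
    · rw [Finsupp.notMem_support_iff.1 fun h => hb (hs h)]
      refine (sum_eq_zero fun a ha => ?_).symm
      rw [AddMonoidAlgebra.coeff_single, Finsupp.single_eq_of_ne]
      rintro rfl
      exact hb ha
  conv_lhs => rw [h1]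
  unfold atQ
  rw [map_sum]
  refine sum_congr rfl fun a _ => ?_
  rw [LaurentPolynomial.eval₂_C_mul_T]
  rfl

/-- As `q^{1/2} = exp (iħ/2)` is transcendental, a Laurent polynomial is determined by its value. -/
theorem atQ_injective : Function.Injective atQ := by
  intro N N' h
  have h1 := atQ_eq_sum N (N.coeff.support ∪ N'.coeff.support) subset_union_left
  have h2 := atQ_eq_sum N' (N.coeff.support ∪ N'.coeff.support) subset_union_right
  have h3 := qPow_linearIndependent (N.coeff.support ∪ N'.coeff.support) (fun a => (N.coeff a : ℤ) - (N'.coeff a : ℤ)) (by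
    have h4 : atQ N - atQ N' = 0 := sub_eq_zero.2 h
    rw [h1, h2, ← sum_sub_distrib] at h4
    rw [← h4]
    refine sum_congr rfl fun a _ => ?_
    push_cast
    ring)
  refine AddMonoidAlgebra.ext (Finsupp.ext fun a => ?_)
  by_cases ha : a ∈ N.coeff.support ∪ N'.coeff.support
  · have := h3 a ha
    omega
  · rw [mem_union, not_or] at ha
    rw [Finsupp.notMem_support_iff.1 ha.1, Finsupp.notMem_support_iff.1 ha.2]

theorem atQ_quantumInt (k : ℕ) : atQ (quantumInt k) * qDiff 1 = qPow k - qPow (-k) := by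
  have h1 : atQ (quantumInt k) = ∑ i ∈ range k, qPow (2 * (i : ℤ) - ((k : ℤ) - 1)) := by
    unfold quantumInt atQ
    rw [map_sum]
    refine sum_congr rfl fun i _ => ?_
    rw [LaurentPolynomial.eval₂_T]
    rfl
  rw [h1, sum_mul]
  have h2 : ∀ i ∈ range k, qPow (2 * (i : ℤ) - ((k : ℤ) - 1)) * qDiff 1 =
      qPow (2 * ((i + 1 : ℕ) : ℤ) - k) - qPow (2 * (i : ℤ) - k) := by
    intro i _
    rw [qDiff, mul_sub, ← qPow_add, ← qPow_add]
    congr 2 <;> push_cast <;> ring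
  rw [sum_congr rfl h2, sum_range_sub (fun i : ℕ => qPow (2 * (i : ℤ) - k))]
  congr 2
  · ring
  · push_cast; ring

/-! ### The quantum torus -/

scoped instance : Algebra LaurentField QTorus :=
  Algebra.ofModule QTorus.smul_mul fun c f g => QTorus.mul_smul' c f g

namespace QTorus

theorem ext_coeff {f g : QTorus} (h : ∀ a, coeff a f = coeff a g) : f = g :=
  Finsupp.ext h

theorem coeff_add (a : ZLat) (f g : QTorus) : coeff a (f + g) = coeff a f + coeff a g := rfl

theorem coeff_zero (a : ZLat) : coeff a (0 : QTorus) = 0 := rfl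

theorem coeff_smul (a : ZLat) (c : LaurentField) (f : QTorus) : coeff a (c • f) = c * coeff a f :=
  rfl

theorem coeff_sub (a : ZLat) (f g : QTorus) : coeff a (f - g) = coeff a f - coeff a g := rfl

theorem coeff_zhat_self (a : ZLat) : coeff a (zhat a) = 1 := Finsupp.single_eq_same

theorem coeff_zhat_of_ne {a b : ZLat} (h : a ≠ b) : coeff a (zhat b) = 0 :=
  Finsupp.single_eq_of_ne h

theorem coeff_mul_zhat (f : QTorus) (a b : ZLat) :
    coeff (a + b) (f * zhat b) = qPow (skew a b) * coeff a f := by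
  induction f using induction_on with
  | h0 => rw [zero_mul, coeff_zero, coeff_zero, mul_zero]
  | hadd f g hf hg => rw [add_mul, coeff_add, coeff_add, hf, hg, mul_add]
  | hz c e =>
    rw [smul_mul, coeff_smul, coeff_smul, zhat_mul_zhat, coeff_smul]
    by_cases h : a = e
    · subst h
      rw [coeff_zhat_self, coeff_zhat_self]; ring
    · rw [coeff_zhat_of_ne h, coeff_zhat_of_ne (fun h' => h (add_right_cancel h'))]; ring

theorem coeff_zhat_mul (f : QTorus) (a b : ZLat) :
    coeff (a + b) (zhat b * f) = qPow (skew b a) * coeff a f := by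
  induction f using induction_on with
  | h0 => rw [mul_zero, coeff_zero, coeff_zero, mul_zero]
  | hadd f g hf hg => rw [mul_add, coeff_add, coeff_add, hf, hg, mul_add]
  | hz c e =>
    rw [mul_smul', coeff_smul, coeff_smul, zhat_mul_zhat, coeff_smul, add_comm b e]
    by_cases h : a = e
    · subst h
      rw [coeff_zhat_self, coeff_zhat_self]; ring
    · rw [coeff_zhat_of_ne h, coeff_zhat_of_ne (fun h' => h (add_right_cancel h'))]; ring

theorem skew_neg_swap (a b : ZLat) : skew b a = -skew a b := by
  simp only [skew]; ring

/-- As `q` is not a root of unity, the centre of the quantum torus is spanned by `1 = ẑ^0`. -/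
theorem coeff_eq_zero_of_central {f : QTorus} (h : ∀ a, f * zhat a = zhat a * f) {b : ZLat}
    (hb : b ≠ 0) : coeff b f = 0 := by
  obtain ⟨a, ha⟩ : ∃ a, skew b a ≠ 0 := by
    by_contra hc
    push Not at hc
    apply hb
    have h1 := hc (0, 1)
    have h2 := hc (1, 0)
    simp only [skew] at h1 h2
    ext
    · simpa using h1
    · simpa using h2
  have h1 := congrArg (coeff (b + a)) (h a)
  rw [coeff_mul_zhat, coeff_zhat_mul, skew_neg_swap b a] at h1
  have h2 : (qPow (skew b a) - qPow (-skew b a)) * coeff b f = 0 := by rw [sub_mul, h1, sub_self]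
  exact (mul_eq_zero.1 h2).resolve_left (qPow_sub_ne_zero (by omega))

theorem zhat_commute {a b : ZLat} (h : skew a b = 0) : Commute (zhat a) (zhat b) := by
  change zhat a * zhat b = zhat b * zhat a
  rw [zhat_mul_zhat, zhat_mul_zhat, skew_neg_swap a b, h, neg_zero, add_comm]

end QTorus

/-! ### Triangular maps on power series -/

section Triangular

variable {σ : Type*} {k : Type*} {A : Type*} [Field k] [Ring A] [Algebra k A]

open MvPowerSeries (coeff)

theorem lt_of_add_eq_left {a b d : σ →₀ ℕ} (h : a + b = d) (hb : b ≠ 0) : a < d := by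
  rw [← h]
  exact lt_add_of_pos_right a (pos_iff_ne_zero.2 hb)

theorem lt_of_add_eq_right {a b d : σ →₀ ℕ} (h : a + b = d) (ha : a ≠ 0) : b < d := by
  rw [← h]
  exact lt_add_of_pos_left b (pos_iff_ne_zero.2 ha)

/-- `F` is triangular with identity diagonal: the coefficient of `F f - f` at an exponent `d`
depends only on the coefficients of `f` at exponents smaller than `d`. -/
def Triangular (F : MvPowerSeries σ A → MvPowerSeries σ A) : Prop :=
  ∀ d f f', (∀ d' < d, coeff d' f = coeff d' f') →
    coeff d (F f) - coeff d f = coeff d (F f') - coeff d f'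

/-- The part of `f` with exponents in `s`. -/
def restrict (s : Set (σ →₀ ℕ)) (f : MvPowerSeries σ A) : MvPowerSeries σ A := by
  classical exact fun d => if d ∈ s then coeff d f else 0

theorem coeff_restrict_of_mem {s : Set (σ →₀ ℕ)} {d : σ →₀ ℕ} (h : d ∈ s)
    (f : MvPowerSeries σ A) : coeff d (restrict s f) = coeff d f := by
  classical exact if_pos h

theorem coeff_restrict_of_notMem {s : Set (σ →₀ ℕ)} {d : σ →₀ ℕ} (h : d ∉ s)
    (f : MvPowerSeries σ A) : coeff d (restrict s f) = 0 := by
  classical exact if_neg h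

theorem coeff_restrict_congr {s t : Set (σ →₀ ℕ)} {f f' : MvPowerSeries σ A} {d : σ →₀ ℕ}
    (hs : d ∈ s ↔ d ∈ t) (h : coeff d f = coeff d f') :
    coeff d (restrict s f) = coeff d (restrict t f') := by
  by_cases hd : d ∈ s
  · rw [coeff_restrict_of_mem hd, coeff_restrict_of_mem (hs.1 hd), h]
  · rw [coeff_restrict_of_notMem hd, coeff_restrict_of_notMem fun h' => hd (hs.2 h')]

theorem Triangular.injective {F : MvPowerSeries σ A → MvPowerSeries σ A} (hF : Triangular F) :
    Function.Injective F := by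
  intro f f' h
  ext d
  induction d using WellFoundedLT.induction with
  | ind d ih =>
    have := hF d f f' ih
    rw [h] at this
    simpa using this

theorem Triangular.surjective {F : MvPowerSeries σ A → MvPowerSeries σ A} (hF : Triangular F) :
    Function.Surjective F := by
  classical
  intro g
  let step : ∀ d : σ →₀ ℕ, (∀ d' : σ →₀ ℕ, d' < d → A) → A := fun d rec =>
    coeff d g - coeff d (F (fun d' => if h : d' < d then rec d' h else 0))
  let f : MvPowerSeries σ A := wellFounded_lt.fix step
  have hf : ∀ d, coeff d f =
      coeff d g - coeff d (F (fun d' => if d' < d then coeff d' f else 0)) := by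
    intro d
    have h1 : coeff d f = step d fun d' _ => coeff d' f := wellFounded_lt.fix_eq step d
    rw [h1]
    simp only [step, dite_eq_ite]
  refine ⟨f, ?_⟩
  ext d
  have h2 := hF d f (fun d' => if d' < d then coeff d' f else 0) fun d' h => (if_pos h).symm
  have h3 : coeff d (fun d' => if d' < d then coeff d' f else 0 : MvPowerSeries σ A) = 0 :=
    if_neg (lt_irrefl d)
  rw [h3, sub_zero, sub_eq_iff_eq_add] at h2
  rw [h2, hf d]
  abel

theorem coeff_mul_congr {x x' y y' : MvPowerSeries σ A} {d : σ →₀ ℕ}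
    (hx : ∀ d' ≤ d, coeff d' x = coeff d' x') (hy : ∀ d' ≤ d, coeff d' y = coeff d' y') :
    coeff d (x * y) = coeff d (x' * y') := by
  classical
  rw [MvPowerSeries.coeff_mul, MvPowerSeries.coeff_mul]
  refine sum_congr rfl fun p hp => ?_
  rw [HasAntidiagonal.mem_antidiagonal] at hp
  rw [hx p.1 (hp ▸ le_self_add), hy p.2 (hp ▸ le_add_self)]

/-- If the constant coefficients vanish, the coefficient of a product at `d` only depends on the
coefficients of the factors below `d`. -/
theorem coeff_mul_congr_of_lt {x x' y y' : MvPowerSeries σ A} {d : σ →₀ ℕ}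
    (hx0 : coeff 0 x = 0) (hx0' : coeff 0 x' = 0) (hy0 : coeff 0 y = 0) (hy0' : coeff 0 y' = 0)
    (hx : ∀ d' < d, coeff d' x = coeff d' x') (hy : ∀ d' < d, coeff d' y = coeff d' y') :
    coeff d (x * y) = coeff d (x' * y') := by
  classical
  rw [MvPowerSeries.coeff_mul, MvPowerSeries.coeff_mul]
  refine sum_congr rfl fun p hp => ?_
  rw [HasAntidiagonal.mem_antidiagonal] at hp
  by_cases h1 : p.1 = 0
  · rw [h1, hx0, hx0', zero_mul, zero_mul]
  by_cases h2 : p.2 = 0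
  · rw [h2, hy0, hy0', mul_zero, mul_zero]
  rw [hx p.1 (lt_of_add_eq_left hp h2), hy p.2 (lt_of_add_eq_right hp h1)]

theorem coeff_zero_mul' (x y : MvPowerSeries σ A) : coeff 0 (x * y) = coeff 0 x * coeff 0 y := by
  classical
  rw [MvPowerSeries.coeff_mul, HasAntidiagonal.antidiagonal_zero, sum_singleton]

theorem coeff_one_zero : coeff (0 : σ →₀ ℕ) (1 : MvPowerSeries σ A) = 1 := by
  classical
  rw [MvPowerSeries.coeff_one, if_pos rfl]

theorem coeff_one_ne {d : σ →₀ ℕ} (h : d ≠ 0) : coeff d (1 : MvPowerSeries σ A) = 0 := by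
  classical
  rw [MvPowerSeries.coeff_one, if_neg h]

/-! ### Graded subalgebras -/

variable (σ k A) in
/-- A family of subspaces, one for each exponent, compatible with products: the power series whose
coefficients belong to these subspaces form a subalgebra. -/
structure Grading where
  carrier : (σ →₀ ℕ) → Submodule k A
  one_mem : (1 : A) ∈ carrier 0
  mul_mem : ∀ a b x y, x ∈ carrier a → y ∈ carrier b → x * y ∈ carrier (a + b)

namespace Grading

/-- The subalgebra of the power series with coefficients in the given subspaces. -/
def sub (𝒜 : Grading σ k A) : Subalgebra k (MvPowerSeries σ A) where
  carrier := {f | ∀ d, coeff d f ∈ 𝒜.carrier d}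
  mul_mem' := by
    classical
    intro f g hf hg d
    rw [MvPowerSeries.coeff_mul]
    refine Submodule.sum_mem _ fun p hp => ?_
    rw [HasAntidiagonal.mem_antidiagonal] at hp
    rw [← hp]
    exact 𝒜.mul_mem _ _ _ _ (hf _) (hg _)
  add_mem' := fun {f g} hf hg d => by
    rw [map_add]
    exact Submodule.add_mem _ (hf d) (hg d)
  algebraMap_mem' := fun r d => by
    rw [Algebra.algebraMap_eq_smul_one]
    change r • coeff d (1 : MvPowerSeries σ A) ∈ _
    refine Submodule.smul_mem _ _ ?_
    by_cases h : d = 0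
    · rw [h, coeff_one_zero]; exact 𝒜.one_mem
    · rw [coeff_one_ne h]; exact Submodule.zero_mem _

theorem restrict_mem {𝒜 : Grading σ k A} {f : MvPowerSeries σ A} (hf : f ∈ 𝒜.sub)
    (s : Set (σ →₀ ℕ)) : restrict s f ∈ 𝒜.sub := by
  intro d
  by_cases h : d ∈ s
  · rw [coeff_restrict_of_mem h]; exact hf d
  · rw [coeff_restrict_of_notMem h]; exact Submodule.zero_mem _

variable (k A) in
/-- The power series supported in an additive submonoid of exponents. -/
def supported (S : AddSubmonoid (σ →₀ ℕ)) : Grading σ k A where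
  carrier d := {
    carrier := {x | d ∉ S → x = 0}
    add_mem' := fun {x y} hx hy h => by rw [hx h, hy h, add_zero]
    zero_mem' := fun _ => rfl
    smul_mem' := fun c x hx h => by rw [hx h, smul_zero] }
  one_mem h := absurd S.zero_mem h
  mul_mem a b x y hx hy h := by
    by_cases ha : a ∈ S
    · by_cases hb : b ∈ S
      · exact absurd (S.add_mem ha hb) h
      · rw [hy hb, mul_zero]
    · rw [hx ha, zero_mul]

theorem mem_supported {S : AddSubmonoid (σ →₀ ℕ)} {f : MvPowerSeries σ A} :
    f ∈ (supported k A S).sub ↔ ∀ d, d ∉ S → coeff d f = 0 := Iff.rfl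

end Grading

/-- If a triangular map preserves a graded subalgebra, then so does its inverse. -/
theorem Triangular.mem_of_map_mem {F : MvPowerSeries σ A → MvPowerSeries σ A} (hF : Triangular F)
    (𝒜 : Grading σ k A) (hB : ∀ f ∈ 𝒜.sub, F f ∈ 𝒜.sub) {f : MvPowerSeries σ A}
    (hf : F f ∈ 𝒜.sub) : f ∈ 𝒜.sub := by
  intro d
  induction d using WellFoundedLT.induction with
  | ind d ih =>
    have h1 := hF d f (restrict {d' | d' < d} f) fun d' h => (coeff_restrict_of_mem h f).symm
    rw [coeff_restrict_of_notMem (s := {d' | d' < d}) (lt_irrefl d), sub_zero] at h1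
    have h2 : restrict {d' | d' < d} f ∈ 𝒜.sub := by
      intro d'
      by_cases h : d' < d
      · rw [coeff_restrict_of_mem (s := {d' | d' < d}) h]; exact ih d' h
      · rw [coeff_restrict_of_notMem (s := {d' | d' < d}) h]; exact Submodule.zero_mem _
    have h3 : coeff d f = coeff d (F f) - coeff d (F (restrict {d' | d' < d} f)) := by
      rw [← h1]; abel
    rw [h3]
    exact Submodule.sub_mem _ (hf d) (hB _ h2 d)

/-! ### Factorization according to the sign of the exponents -/

/-- The non-zero exponents of sign `s`. -/
def signClass (sg : (σ →₀ ℕ) → SignType) (s : SignType) : Set (σ →₀ ℕ) := {d | d ≠ 0 ∧ sg d = s}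

/-- The product `(1 + f₋) (1 + f₀) (1 + f₊) - 1` of the parts of `f` of negative, zero and positive
sign; the constant coefficient is kept. -/
def facMap (sg : (σ →₀ ℕ) → SignType) (f : MvPowerSeries σ A) : MvPowerSeries σ A :=
  (1 + restrict (signClass sg (-1)) f) * (1 + restrict (signClass sg 0) f) *
    (1 + restrict (signClass sg 1) f) - 1 + restrict {0} f

theorem coeff_zero_restrict_signClass (sg : (σ →₀ ℕ) → SignType) (s : SignType)
    (f : MvPowerSeries σ A) : coeff 0 (restrict (signClass sg s) f) = 0 :=
  coeff_restrict_of_notMem (fun h => h.1 rfl) f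

theorem restrict_signClass_add (sg : (σ →₀ ℕ) → SignType) (f : MvPowerSeries σ A) :
    restrict (signClass sg (-1)) f + restrict (signClass sg 0) f + restrict (signClass sg 1) f +
      restrict {0} f = f := by
  ext d
  simp only [map_add]
  by_cases h : d = 0
  · subst h
    simp only [coeff_zero_restrict_signClass]
    rw [coeff_restrict_of_mem (Set.mem_singleton 0)]
    simp
  · rw [coeff_restrict_of_notMem (s := {0}) h]
    have htri : ∀ s : SignType, s = 0 ∨ s = -1 ∨ s = 1 := by decide
    rcases htri (sg d) with hs | hs | hs
    · rw [coeff_restrict_of_notMem (s := signClass sg (-1)) (fun h' => by simpa [hs] using h'.2),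
        coeff_restrict_of_mem (s := signClass sg 0) ⟨h, hs⟩,
        coeff_restrict_of_notMem (s := signClass sg 1) (fun h' => by simpa [hs] using h'.2)]
      simp
    · rw [coeff_restrict_of_mem (s := signClass sg (-1)) ⟨h, hs⟩,
        coeff_restrict_of_notMem (s := signClass sg 0) (fun h' => by simpa [hs] using h'.2),
        coeff_restrict_of_notMem (s := signClass sg 1) (fun h' => by simpa [hs] using h'.2)]
      simp
    · rw [coeff_restrict_of_notMem (s := signClass sg (-1)) (fun h' => by simpa [hs] using h'.2),
        coeff_restrict_of_notMem (s := signClass sg 0) (fun h' => by simpa [hs] using h'.2),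
        coeff_restrict_of_mem (s := signClass sg 1) ⟨h, hs⟩]
      simp

theorem facMap_eq (sg : (σ →₀ ℕ) → SignType) (f : MvPowerSeries σ A) :
    facMap sg f = f + (restrict (signClass sg (-1)) f * restrict (signClass sg 0) f +
      (restrict (signClass sg (-1)) f + restrict (signClass sg 0) f +
        restrict (signClass sg (-1)) f * restrict (signClass sg 0) f) *
          restrict (signClass sg 1) f) := by
  conv_rhs => enter [1]; rw [← restrict_signClass_add sg f]
  unfold facMap
  noncomm_ring

theorem facMap_congr {sg sg' : (σ →₀ ℕ) → SignType} {f f' : MvPowerSeries σ A} {d : σ →₀ ℕ}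
    (h : ∀ d' < d, coeff d' f = coeff d' f') (hs : ∀ d' < d, sg d' = sg' d') :
    coeff d (facMap sg f) - coeff d f = coeff d (facMap sg' f') - coeff d f' := by
  have hr : ∀ s, ∀ d' < d, coeff d' (restrict (signClass sg s) f) =
      coeff d' (restrict (signClass sg' s) f') := fun s d' hd =>
    coeff_restrict_congr (by simp only [signClass, Set.mem_ofPred_eq, hs d' hd]) (h d' hd)
  have h0 := fun s => coeff_zero_restrict_signClass sg s f
  have h0' := fun s => coeff_zero_restrict_signClass sg' s f'
  rw [facMap_eq sg f, facMap_eq sg' f', map_add (coeff d) f, map_add (coeff d) f',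
    add_sub_cancel_left, add_sub_cancel_left, map_add, map_add]
  have h1 : ∀ d' < d, coeff d' (restrict (signClass sg (-1)) f * restrict (signClass sg 0) f) =
      coeff d' (restrict (signClass sg' (-1)) f' * restrict (signClass sg' 0) f') :=
    fun d' hd => coeff_mul_congr (fun e he => hr _ e (he.trans_lt hd))
      fun e he => hr _ e (he.trans_lt hd)
  congr 1
  · exact coeff_mul_congr_of_lt (h0 _) (h0' _) (h0 _) (h0' _) (hr _) (hr _)
  · refine coeff_mul_congr_of_lt ?_ ?_ (h0 _) (h0' _) ?_ (hr _)
    · simp only [map_add, coeff_zero_mul', h0]; simp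
    · simp only [map_add, coeff_zero_mul', h0']; simp
    · intro d' hd
      simp only [map_add]
      rw [hr _ d' hd, hr _ d' hd, h1 d' hd]

theorem facMap_triangular (sg : (σ →₀ ℕ) → SignType) :
    Triangular (facMap sg : MvPowerSeries σ A → MvPowerSeries σ A) :=
  fun _ _ _ h => facMap_congr h fun _ _ => rfl

/-- The inverse of `facMap`. -/
def facInv (sg : (σ →₀ ℕ) → SignType) : MvPowerSeries σ A → MvPowerSeries σ A :=
  Function.surjInv (facMap_triangular sg).surjective

theorem facMap_facInv (sg : (σ →₀ ℕ) → SignType) (g : MvPowerSeries σ A) :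
    facMap sg (facInv sg g) = g := Function.surjInv_eq _ g

theorem facInv_facMap (sg : (σ →₀ ℕ) → SignType) (f : MvPowerSeries σ A) :
    facInv sg (facMap sg f) = f :=
  (facMap_triangular sg).injective (facMap_facInv sg _)

theorem coeff_zero_facMap (sg : (σ →₀ ℕ) → SignType) (f : MvPowerSeries σ A) :
    coeff 0 (facMap sg f) = coeff 0 f := by
  rw [facMap_eq]
  simp only [map_add, coeff_zero_mul', coeff_zero_restrict_signClass]
  simp

theorem coeff_zero_facInv (sg : (σ →₀ ℕ) → SignType) (g : MvPowerSeries σ A) :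
    coeff 0 (facInv sg g) = coeff 0 g := by
  rw [← coeff_zero_facMap sg, facMap_facInv]

theorem facInv_congr {sg sg' : (σ →₀ ℕ) → SignType} {g g' : MvPowerSeries σ A} {d : σ →₀ ℕ}
    (h : ∀ d' ≤ d, coeff d' g = coeff d' g') (hs : ∀ d' ≤ d, sg d' = sg' d') :
    ∀ d' ≤ d, coeff d' (facInv sg g) = coeff d' (facInv sg' g') := by
  intro d' hd
  induction d' using WellFoundedLT.induction with
  | ind d' ih =>
    have h1 := facMap_congr (f := facInv sg g) (f' := facInv sg' g') (sg := sg) (sg' := sg') (d := d')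
      (fun e he => ih e he (he.le.trans hd)) fun e he => hs e (he.le.trans hd)
    rw [facMap_facInv, facMap_facInv, h d' hd] at h1
    exact sub_right_injective h1

theorem facInv_sub_congr {sg : (σ →₀ ℕ) → SignType} {g g' : MvPowerSeries σ A} {d : σ →₀ ℕ}
    (h : ∀ d' < d, coeff d' g = coeff d' g') :
    coeff d (facInv sg g) - coeff d g = coeff d (facInv sg g') - coeff d g' := by
  have h1 := facMap_congr (f := facInv sg g) (f' := facInv sg g') (sg := sg) (sg' := sg) (d := d)
    (fun e he => facInv_congr (fun e' he' => h e' (he'.trans_lt he)) (fun _ _ => rfl) e le_rfl)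
    fun _ _ => rfl
  rw [facMap_facInv, facMap_facInv] at h1
  rw [← neg_sub, h1, neg_sub]

theorem facMap_mem {𝒜 : Grading σ k A} {sg : (σ →₀ ℕ) → SignType} {f : MvPowerSeries σ A}
    (hf : f ∈ 𝒜.sub) : facMap sg f ∈ 𝒜.sub := by
  have h := fun s => Subalgebra.add_mem _ (Subalgebra.one_mem 𝒜.sub)
    (Grading.restrict_mem hf (signClass sg s))
  exact Subalgebra.add_mem _ (Subalgebra.sub_mem _ (Subalgebra.mul_mem _ (Subalgebra.mul_mem _
    (h _) (h _)) (h _)) (Subalgebra.one_mem _)) (Grading.restrict_mem hf _)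

theorem facInv_mem {𝒜 : Grading σ k A} {sg : (σ →₀ ℕ) → SignType} {g : MvPowerSeries σ A}
    (hg : g ∈ 𝒜.sub) : facInv sg g ∈ 𝒜.sub :=
  (facMap_triangular sg).mem_of_map_mem 𝒜 (fun _ h => facMap_mem h) (by rwa [facMap_facInv])

/-- The factor of sign `s` in the factorization `g = g₋ g₀ g₊` of a power series with constant
coefficient `1`. -/
def facPart (sg : (σ →₀ ℕ) → SignType) (s : SignType) (g : MvPowerSeries σ A) :
    MvPowerSeries σ A := 1 + restrict (signClass sg s) (facInv sg (g - 1))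

/-- The constant coefficient of `f` is `1` and its other exponents belong to `s`. -/
def OneSupported (s : Set (σ →₀ ℕ)) (f : MvPowerSeries σ A) : Prop :=
  coeff 0 f = 1 ∧ ∀ d, d ≠ 0 → d ∉ s → coeff d f = 0

theorem coeff_zero_facPart (sg : (σ →₀ ℕ) → SignType) (s : SignType) (g : MvPowerSeries σ A) :
    coeff 0 (facPart sg s g) = 1 := by
  rw [facPart, map_add, coeff_zero_restrict_signClass, coeff_one_zero, add_zero]

theorem facPart_oneSupported (sg : (σ →₀ ℕ) → SignType) (s : SignType) (g : MvPowerSeries σ A) :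
    OneSupported {d | sg d = s} (facPart sg s g) := by
  refine ⟨coeff_zero_facPart sg s g, fun d h0 hd => ?_⟩
  rw [facPart, map_add, coeff_one_ne h0, coeff_restrict_of_notMem (fun h => hd h.2), add_zero]

theorem facPart_mul (sg : (σ →₀ ℕ) → SignType) {g : MvPowerSeries σ A} (hg : coeff 0 g = 1) :
    facPart sg (-1) g * facPart sg 0 g * facPart sg 1 g = g := by
  have h1 := facMap_facInv sg (g - 1)
  have h2 : restrict {0} (facInv sg (g - 1)) = 0 := by
    ext d
    by_cases hd : d = 0
    · subst hd
      rw [coeff_restrict_of_mem (Set.mem_singleton 0), coeff_zero_facInv, map_sub, hg, coeff_one_zero, sub_self,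
        map_zero]
    · rw [coeff_restrict_of_notMem (s := {0}) hd, map_zero]
  rw [facMap, h2, add_zero] at h1
  exact sub_left_injective h1

theorem restrict_signClass_of_oneSupported {sg : (σ →₀ ℕ) → SignType} {s : SignType}
    {f : MvPowerSeries σ A} (hf : OneSupported {d | sg d = s} f) :
    restrict (signClass sg s) (f - 1) = f - 1 := by
  ext d
  by_cases hd : d ∈ signClass sg s
  · rw [coeff_restrict_of_mem hd]
  · rw [coeff_restrict_of_notMem hd, map_sub]
    by_cases h0 : d = 0
    · rw [h0, hf.1, coeff_one_zero, sub_self]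
    · rw [hf.2 d h0 (fun h => hd ⟨h0, h⟩), coeff_one_ne h0, sub_self]

theorem restrict_signClass_of_oneSupported_ne {sg : (σ →₀ ℕ) → SignType} {s t : SignType}
    {f : MvPowerSeries σ A} (hf : OneSupported {d | sg d = s} f) (hst : s ≠ t) :
    restrict (signClass sg t) (f - 1) = 0 := by
  ext d
  by_cases hd : d ∈ signClass sg t
  · rw [coeff_restrict_of_mem hd, map_sub, coeff_one_ne hd.1,
      hf.2 d hd.1 (fun h => hst (h.symm.trans hd.2)), sub_zero, map_zero]
  · rw [coeff_restrict_of_notMem hd, map_zero]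

theorem restrict_add (s : Set (σ →₀ ℕ)) (f g : MvPowerSeries σ A) :
    restrict s (f + g) = restrict s f + restrict s g := by
  ext d
  by_cases hd : d ∈ s
  · simp only [map_add, coeff_restrict_of_mem hd]
  · simp only [map_add, coeff_restrict_of_notMem hd, add_zero]

/-- Uniqueness of the factorization `g = g₋ g₀ g₊`. -/
theorem facPart_eq_of_mul {sg : (σ →₀ ℕ) → SignType} {x : SignType → MvPowerSeries σ A}
    (hx : ∀ s, OneSupported {d | sg d = s} (x s)) (s : SignType) :
    facPart sg s (x (-1) * x 0 * x 1) = x s := by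
  have h1 : facMap sg ((x (-1) - 1) + (x 0 - 1) + (x 1 - 1)) = x (-1) * x 0 * x 1 - 1 := by
    have h0 : restrict {0} ((x (-1) - 1) + (x 0 - 1) + (x 1 - 1)) = 0 := by
      ext d
      by_cases hd : d = 0
      · subst hd
        rw [coeff_restrict_of_mem (Set.mem_singleton 0)]
        simp only [map_add, map_sub, (hx _).1, coeff_one_zero]
        simp
      · rw [coeff_restrict_of_notMem (s := {0}) hd, map_zero]
    unfold facMap
    simp only [restrict_add, h0]
    rw [restrict_signClass_of_oneSupported (hx (-1)), restrict_signClass_of_oneSupported (hx 0),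
      restrict_signClass_of_oneSupported (hx 1),
      restrict_signClass_of_oneSupported_ne (hx (-1)) (t := 0) (by decide),
      restrict_signClass_of_oneSupported_ne (hx (-1)) (t := 1) (by decide),
      restrict_signClass_of_oneSupported_ne (hx 0) (t := -1) (by decide),
      restrict_signClass_of_oneSupported_ne (hx 0) (t := 1) (by decide),
      restrict_signClass_of_oneSupported_ne (hx 1) (t := -1) (by decide),
      restrict_signClass_of_oneSupported_ne (hx 1) (t := 0) (by decide)]
    simp
  rw [facPart, ← h1, facInv_facMap]
  simp only [restrict_add]
  rcases s with _ | _ | _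
  · change 1 + (restrict (signClass sg 0) _ + restrict (signClass sg 0) _ +
      restrict (signClass sg 0) _) = x 0
    rw [restrict_signClass_of_oneSupported (hx 0),
      restrict_signClass_of_oneSupported_ne (hx (-1)) (t := 0) (by decide),
      restrict_signClass_of_oneSupported_ne (hx 1) (t := 0) (by decide)]
    simp
  · change 1 + (restrict (signClass sg (-1)) _ + restrict (signClass sg (-1)) _ +
      restrict (signClass sg (-1)) _) = x (-1)
    rw [restrict_signClass_of_oneSupported (hx (-1)),
      restrict_signClass_of_oneSupported_ne (hx 0) (t := -1) (by decide),
      restrict_signClass_of_oneSupported_ne (hx 1) (t := -1) (by decide)]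
    simp
  · change 1 + (restrict (signClass sg 1) _ + restrict (signClass sg 1) _ +
      restrict (signClass sg 1) _) = x 1
    rw [restrict_signClass_of_oneSupported (hx 1),
      restrict_signClass_of_oneSupported_ne (hx (-1)) (t := 1) (by decide),
      restrict_signClass_of_oneSupported_ne (hx 0) (t := 1) (by decide)]
    simp

theorem facPart_mem {𝒜 : Grading σ k A} {sg : (σ →₀ ℕ) → SignType} {s : SignType}
    {g : MvPowerSeries σ A} (hg : g ∈ 𝒜.sub) : facPart sg s g ∈ 𝒜.sub :=
  Subalgebra.add_mem _ (Subalgebra.one_mem _) (Grading.restrict_mem (facInv_mem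
    (Subalgebra.sub_mem _ hg (Subalgebra.one_mem _))) _)

theorem facPart_congr {sg sg' : (σ →₀ ℕ) → SignType} {s : SignType} {g g' : MvPowerSeries σ A}
    {d : σ →₀ ℕ} (h : ∀ d' ≤ d, coeff d' g = coeff d' g') (hs : ∀ d' ≤ d, sg d' = sg' d') :
    coeff d (facPart sg s g) = coeff d (facPart sg' s g') := by
  rw [facPart, facPart, map_add, map_add]
  congr 1
  refine coeff_restrict_congr (by simp only [signClass, Set.mem_ofPred_eq, hs d le_rfl]) ?_
  exact facInv_congr (fun d' hd => by rw [map_sub, map_sub, h d' hd]) hs d le_rfl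

end Triangular

/-! ### Exponential and logarithm of power series -/

section ExpLog

variable {σ : Type*} {k : Type*} {A : Type*} [Field k] [Ring A] [Algebra k A]

open MvPowerSeries (coeff)

theorem degree_lt_degree {a b : σ →₀ ℕ} (h : a < b) : a.degree < b.degree := by
  obtain ⟨c, rfl⟩ := exists_add_of_le h.le
  have hc : c ≠ 0 := by
    rintro rfl
    simp at h
  have h1 : c.degree ≠ 0 := fun h0 => hc ((Finsupp.degree_eq_zero_iff c).1 h0)
  rw [map_add]
  omega

theorem coeff_mul_eq_zero_of_degree_lt {x y : MvPowerSeries σ A} {r s : ℕ}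
    (hx : ∀ d, d.degree < r → coeff d x = 0) (hy : ∀ d, d.degree < s → coeff d y = 0)
    {d : σ →₀ ℕ} (hd : d.degree < r + s) : coeff d (x * y) = 0 := by
  classical
  rw [MvPowerSeries.coeff_mul]
  refine sum_eq_zero fun p hp => ?_
  rw [HasAntidiagonal.mem_antidiagonal] at hp
  rw [← hp, map_add] at hd
  by_cases h : p.1.degree < r
  · rw [hx _ h, zero_mul]
  · rw [hy _ (by omega), mul_zero]

theorem coeff_pow_eq_zero {x : MvPowerSeries σ A} (hx : coeff 0 x = 0) {r : ℕ} :
    ∀ d : σ →₀ ℕ, d.degree < r → coeff d (x ^ r) = 0 := by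
  induction r with
  | zero => intro d h; omega
  | succ r ih =>
    intro d hd
    rw [pow_succ]
    refine coeff_mul_eq_zero_of_degree_lt ih (s := 1) (fun e he => ?_) hd
    rw [Nat.lt_one_iff] at he
    rw [(Finsupp.degree_eq_zero_iff e).1 he, hx]

variable (k) in
/-- The exponential `∑ f^r / r!` of a power series without constant coefficient. Only the terms with
`r ≤ |d|` contribute to the coefficient at `d`. -/
def pexp (f : MvPowerSeries σ A) : MvPowerSeries σ A := fun d =>
  ∑ r ∈ range (d.degree + 1), ((r.factorial : k)⁻¹) • coeff d (f ^ r)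

theorem coeff_pexp (f : MvPowerSeries σ A) (d : σ →₀ ℕ) :
    coeff d (pexp k f) = ∑ r ∈ range (d.degree + 1), ((r.factorial : k)⁻¹) • coeff d (f ^ r) := rfl

theorem coeff_pexp_of_le {f : MvPowerSeries σ A} (hf : coeff 0 f = 0) {d : σ →₀ ℕ} {N : ℕ}
    (hN : d.degree ≤ N) :
    coeff d (pexp k f) = ∑ r ∈ range (N + 1), ((r.factorial : k)⁻¹) • coeff d (f ^ r) := by
  rw [coeff_pexp]
  refine sum_subset (range_mono (by omega)) fun r _ hr => ?_
  rw [mem_range] at hr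
  rw [coeff_pow_eq_zero hf d (by omega), smul_zero]

theorem coeff_zero_pexp (f : MvPowerSeries σ A) : coeff 0 (pexp k f) = 1 := by
  rw [coeff_pexp]
  simp

theorem pexp_zero : pexp k (0 : MvPowerSeries σ A) = 1 := by
  ext d
  rw [coeff_pexp, sum_range_succ', sum_eq_zero fun r _ => by
    rw [pow_succ, mul_zero, map_zero, smul_zero]]
  simp

theorem pexp_add [CharZero k] {x y : MvPowerSeries σ A} (hx : coeff 0 x = 0) (hy : coeff 0 y = 0)
    (hxy : Commute x y) : pexp k (x + y) = pexp k x * pexp k y := by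
  classical
  ext d
  set N := d.degree with hN
  let F : ℕ × ℕ → A := fun p =>
    ((p.1.factorial : k)⁻¹ * (p.2.factorial : k)⁻¹) • coeff d (x ^ p.1 * y ^ p.2)
  have hR : coeff d (pexp k x * pexp k y) = ∑ p ∈ range (N + 1) ×ˢ range (N + 1), F p := by
    rw [MvPowerSeries.coeff_mul]
    have h1 : ∀ p ∈ HasAntidiagonal.antidiagonal d, coeff p.1 (pexp k x) * coeff p.2 (pexp k y) =
        ∑ q ∈ range (N + 1) ×ˢ range (N + 1), ((q.1.factorial : k)⁻¹ * (q.2.factorial : k)⁻¹) •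
          (coeff p.1 (x ^ q.1) * coeff p.2 (y ^ q.2)) := by
      intro p hp
      rw [HasAntidiagonal.mem_antidiagonal] at hp
      have h2 : p.1.degree + p.2.degree = N := by rw [hN, ← hp, map_add]
      rw [coeff_pexp_of_le hx (N := N) (by omega), coeff_pexp_of_le hy (N := N) (by omega),
        sum_mul_sum, sum_product]
      refine sum_congr rfl fun r _ => sum_congr rfl fun s _ => ?_
      rw [smul_mul_smul_comm]
    rw [sum_congr rfl h1, sum_comm]
    refine sum_congr rfl fun q _ => ?_
    simp only [F]
    rw [MvPowerSeries.coeff_mul, smul_sum]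
  have hL : coeff d (pexp k (x + y)) =
      ∑ m ∈ range (N + 1), ∑ p ∈ HasAntidiagonal.antidiagonal m, F p := by
    rw [coeff_pexp]
    refine sum_congr rfl fun m _ => ?_
    rw [hxy.add_pow', map_sum, smul_sum]
    refine sum_congr rfl fun p hp => ?_
    rw [HasAntidiagonal.mem_antidiagonal] at hp
    simp only [F]
    rw [map_nsmul, ← Nat.cast_smul_eq_nsmul k, smul_smul]
    congr 1
    subst hp
    have h3 := Nat.add_choose_mul_factorial_mul_factorial p.1 p.2
    have e1 : (p.1.factorial : k) ≠ 0 := by exact_mod_cast Nat.factorial_ne_zero _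
    have e2 : (p.2.factorial : k) ≠ 0 := by exact_mod_cast Nat.factorial_ne_zero _
    have e3 : ((p.1 + p.2).factorial : k) ≠ 0 := by exact_mod_cast Nat.factorial_ne_zero _
    have h4 : (((p.1 + p.2).choose p.1 : ℕ) : k) * (p.1.factorial : k) * (p.2.factorial : k) =
        ((p.1 + p.2).factorial : k) := by
      rw [Nat.choose_symm_add]; exact_mod_cast h3
    field_simp
    linear_combination h4
  rw [hL, hR]
  have h5 : ∑ p ∈ range (N + 1) ×ˢ range (N + 1), F p =
      ∑ p ∈ (range (N + 1) ×ˢ range (N + 1)).filter (fun p => p.1 + p.2 < N + 1), F p := by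
    rw [sum_filter_of_ne]
    intro p _ hp
    by_contra hlt
    apply hp
    simp only [F]
    rw [coeff_mul_eq_zero_of_degree_lt (coeff_pow_eq_zero hx) (coeff_pow_eq_zero hy) (by omega),
      smul_zero]
  rw [h5, ← sum_fiberwise_of_maps_to (t := range (N + 1)) (g := fun p : ℕ × ℕ => p.1 + p.2)
    (fun p hp => mem_range.2 (mem_filter.1 hp).2)]
  refine sum_congr rfl fun m hm => sum_congr ?_ fun _ _ => rfl
  ext p
  simp only [HasAntidiagonal.mem_antidiagonal, mem_filter, mem_product, mem_range] at hm ⊢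
  omega

theorem pexp_mul_pexp_neg [CharZero k] {x : MvPowerSeries σ A} (hx : coeff 0 x = 0) :
    pexp k x * pexp k (-x) = 1 := by
  rw [← pexp_add hx (by rw [map_neg, hx, neg_zero]) (Commute.neg_right rfl), add_neg_cancel,
    pexp_zero]

theorem pexp_neg_mul_pexp [CharZero k] {x : MvPowerSeries σ A} (hx : coeff 0 x = 0) :
    pexp k (-x) * pexp k x = 1 := by
  rw [← pexp_add (by rw [map_neg, hx, neg_zero]) hx (Commute.neg_left rfl), neg_add_cancel,
    pexp_zero]

/-- The coefficient at `d` of a power of exponent at least two of a series without constant coefficient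
only depends on the coefficients below `d`. -/
theorem coeff_pow_congr_of_lt {x y : MvPowerSeries σ A} {d : σ →₀ ℕ} (hx : coeff 0 x = 0)
    (hy : coeff 0 y = 0) (h : ∀ d' < d, coeff d' x = coeff d' y) (r : ℕ) :
    (∀ d' < d, coeff d' (x ^ r) = coeff d' (y ^ r)) ∧
      coeff d (x ^ (r + 2)) = coeff d (y ^ (r + 2)) := by
  have h1 : ∀ s, ∀ d' < d, coeff d' (x ^ s) = coeff d' (y ^ s) := by
    intro s
    induction s with
    | zero => intro d' _; rw [pow_zero, pow_zero]
    | succ s ih =>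
      intro d' hd
      rw [pow_succ, pow_succ]
      exact coeff_mul_congr (fun e he => ih e (he.trans_lt hd)) fun e he => h e (he.trans_lt hd)
  have h0 : ∀ z : MvPowerSeries σ A, coeff 0 z = 0 → coeff 0 (z ^ (r + 1)) = 0 := fun z hz => by
    rw [pow_succ, coeff_zero_mul', hz, mul_zero]
  refine ⟨h1 r, ?_⟩
  rw [pow_succ, pow_succ y]
  exact coeff_mul_congr_of_lt (h0 x hx) (h0 y hy) hx hy (h1 _) h

theorem pexp_sub_congr {x y : MvPowerSeries σ A} {d : σ →₀ ℕ} (hx : coeff 0 x = 0)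
    (hy : coeff 0 y = 0) (h : ∀ d' < d, coeff d' x = coeff d' y) :
    coeff d (pexp k x) - coeff d x = coeff d (pexp k y) - coeff d y := by
  rcases hm : d.degree with - | m
  · rw [Finsupp.degree_eq_zero_iff] at hm
    subst hm
    rw [coeff_zero_pexp, coeff_zero_pexp, hx, hy]
  · have h1 : ∀ z : MvPowerSeries σ A, coeff d (pexp k z) - coeff d z =
        ∑ r ∈ range m, (((r + 2).factorial : k)⁻¹) • coeff d (z ^ (r + 2)) +
          coeff d (1 : MvPowerSeries σ A) := by
      intro z
      rw [coeff_pexp, hm, sum_range_succ', sum_range_succ']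
      simp
      abel
    rw [h1, h1]
    congr 1
    refine sum_congr rfl fun r _ => ?_
    rw [(coeff_pow_congr_of_lt hx hy h r).2]

theorem pexp_mem {𝒜 : Grading σ k A} {f : MvPowerSeries σ A} (hf : f ∈ 𝒜.sub) :
    pexp k f ∈ 𝒜.sub := fun d => by
  rw [coeff_pexp]
  exact Submodule.sum_mem _ fun r _ => Submodule.smul_mem _ _ (Subalgebra.pow_mem _ hf r d)

theorem coeff_zero_restrict_compl (f : MvPowerSeries σ A) : coeff 0 (restrict {0}ᶜ f) = 0 :=
  coeff_restrict_of_notMem (by simp) f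

variable (k) in
/-- The map `f ↦ exp f - 1` on the series without constant coefficient, extended to all series so
that it keeps the constant coefficient. -/
def expMap (f : MvPowerSeries σ A) : MvPowerSeries σ A :=
  pexp k (restrict {0}ᶜ f) - 1 + restrict {0} f

theorem restrict_compl_add (f : MvPowerSeries σ A) : restrict {0}ᶜ f + restrict {0} f = f := by
  ext d
  rw [map_add]
  by_cases h : d = 0
  · subst h
    rw [coeff_zero_restrict_compl, coeff_restrict_of_mem (Set.mem_singleton 0), zero_add]
  · rw [coeff_restrict_of_mem (s := {0}ᶜ) h, coeff_restrict_of_notMem (s := {0}) h, add_zero]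

theorem restrict_compl_eq {f : MvPowerSeries σ A} (hf : coeff 0 f = 0) :
    restrict {0}ᶜ f = f := by
  ext d
  by_cases h : d = 0
  · subst h
    rw [coeff_zero_restrict_compl, hf]
  · rw [coeff_restrict_of_mem (s := {0}ᶜ) h]

theorem expMap_triangular : Triangular (expMap k : MvPowerSeries σ A → MvPowerSeries σ A) := by
  intro d f f' h
  have h1 : ∀ f : MvPowerSeries σ A, coeff d (expMap k f) - coeff d f =
      coeff d (pexp k (restrict {0}ᶜ f)) - coeff d (restrict {0}ᶜ f) -
        coeff d (1 : MvPowerSeries σ A) := by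
    intro f
    conv_lhs => enter [2]; rw [← restrict_compl_add f]
    rw [expMap, map_add, map_sub, map_add]
    abel
  rw [h1, h1, pexp_sub_congr (coeff_zero_restrict_compl f) (coeff_zero_restrict_compl f')
    fun d' hd => coeff_restrict_congr Iff.rfl (h d' hd)]

variable (k) in
/-- The logarithm of a power series with constant coefficient `1`, i.e. the inverse of `pexp`. -/
def plog (g : MvPowerSeries σ A) : MvPowerSeries σ A :=
  Function.surjInv (expMap_triangular (k := k)).surjective (g - 1)

theorem expMap_plog (g : MvPowerSeries σ A) : expMap k (plog k g) = g - 1 :=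
  Function.surjInv_eq _ _

theorem expMap_of_coeff_zero {f : MvPowerSeries σ A} (hf : coeff 0 f = 0) :
    expMap k f = pexp k f - 1 := by
  have h : restrict {0} f = 0 := by
    have := restrict_compl_add f
    rw [restrict_compl_eq hf] at this
    simpa using this
  rw [expMap, restrict_compl_eq hf, h, add_zero]

theorem coeff_zero_plog {g : MvPowerSeries σ A} (hg : coeff 0 g = 1) : coeff 0 (plog k g) = 0 := by
  have h := congrArg (coeff 0) (expMap_plog (k := k) g)
  rw [expMap, map_add, map_sub, map_sub, coeff_zero_pexp, hg, coeff_one_zero,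
    coeff_restrict_of_mem (Set.mem_singleton 0)] at h
  simpa using h

theorem pexp_plog {g : MvPowerSeries σ A} (hg : coeff 0 g = 1) : pexp k (plog k g) = g := by
  have h := expMap_plog (k := k) g
  rw [expMap_of_coeff_zero (coeff_zero_plog hg)] at h
  exact sub_left_injective h

theorem plog_pexp {f : MvPowerSeries σ A} (hf : coeff 0 f = 0) : plog k (pexp k f) = f := by
  apply (expMap_triangular (k := k)).injective
  rw [expMap_plog, expMap_of_coeff_zero hf]

theorem plog_mem {𝒜 : Grading σ k A} {g : MvPowerSeries σ A} (hg : g ∈ 𝒜.sub) :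
    plog k g ∈ 𝒜.sub := by
  refine (expMap_triangular (k := k)).mem_of_map_mem 𝒜 (fun f hf => ?_) ?_
  · exact Subalgebra.add_mem _ (Subalgebra.sub_mem _ (pexp_mem (Grading.restrict_mem hf _))
      (Subalgebra.one_mem _)) (Grading.restrict_mem hf _)
  · rw [expMap_plog]
    exact Subalgebra.sub_mem _ hg (Subalgebra.one_mem _)

theorem plog_congr {g g' : MvPowerSeries σ A} {d : σ →₀ ℕ}
    (h : ∀ d' ≤ d, coeff d' g = coeff d' g') :
    ∀ d' ≤ d, coeff d' (plog k g) = coeff d' (plog k g') := by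
  intro d' hd
  induction d' using WellFoundedLT.induction with
  | ind d' ih =>
    have h1 := expMap_triangular (k := k) d' (plog k g) (plog k g') fun e he =>
      ih e he (he.le.trans hd)
    rw [expMap_plog, expMap_plog, map_sub, map_sub, h d' hd] at h1
    exact sub_right_injective h1

theorem plog_sub_congr {g g' : MvPowerSeries σ A} {d : σ →₀ ℕ}
    (h : ∀ d' < d, coeff d' g = coeff d' g') :
    coeff d (plog k g) - coeff d g = coeff d (plog k g') - coeff d g' := by
  have h1 := expMap_triangular (k := k) d (plog k g) (plog k g') fun e he =>
    plog_congr (fun e' he' => h e' (he'.trans_lt he)) e le_rfl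
  rw [expMap_plog, expMap_plog, map_sub, map_sub] at h1
  have h2 : coeff d (plog k g) - coeff d g = -(coeff d g - coeff d (1 : MvPowerSeries σ A) -
      coeff d (plog k g)) - coeff d (1 : MvPowerSeries σ A) := by abel
  rw [h2, h1]
  abel

/-! ### Refinement of factorizations -/

/-- The sign of `θ`, refined by the sign of `θ'` where `θ` vanishes. -/
def lexSign (θ θ' : (σ →₀ ℕ) →+ ℝ) (d : σ →₀ ℕ) : SignType :=
  if θ d ≠ 0 then SignType.sign (θ d) else SignType.sign (θ' d)

/-- The sign function of an additive function. -/
def signOf (θ : (σ →₀ ℕ) →+ ℝ) (d : σ →₀ ℕ) : SignType := SignType.sign (θ d)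

theorem SignType.trichotomy' : ∀ s : SignType, s = 0 ∨ s = -1 ∨ s = 1 := by decide

theorem lexSign_eq_zero {θ θ' : (σ →₀ ℕ) →+ ℝ} {d : σ →₀ ℕ} :
    lexSign θ θ' d = 0 ↔ θ d = 0 ∧ θ' d = 0 := by
  unfold lexSign
  split_ifs with h
  · rw [sign_eq_zero_iff]; tauto
  · rw [sign_eq_zero_iff]; tauto

theorem lexSign_eq_one {θ θ' : (σ →₀ ℕ) →+ ℝ} {d : σ →₀ ℕ} :
    lexSign θ θ' d = 1 ↔ 0 < θ d ∨ (θ d = 0 ∧ 0 < θ' d) := by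
  unfold lexSign
  split_ifs with h
  · rw [sign_eq_one_iff]; tauto
  · rw [not_not] at h
    rw [sign_eq_one_iff, h]; simp

theorem lexSign_eq_neg_one {θ θ' : (σ →₀ ℕ) →+ ℝ} {d : σ →₀ ℕ} :
    lexSign θ θ' d = -1 ↔ θ d < 0 ∨ (θ d = 0 ∧ θ' d < 0) := by
  unfold lexSign
  split_ifs with h
  · rw [sign_eq_neg_one_iff]; tauto
  · rw [not_not] at h
    rw [sign_eq_neg_one_iff, h]; simp

theorem lexSign_add {θ θ' : (σ →₀ ℕ) →+ ℝ} {s : SignType} {a b : σ →₀ ℕ}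
    (ha : lexSign θ θ' a = s) (hb : lexSign θ θ' b = s) : lexSign θ θ' (a + b) = s := by
  rcases SignType.trichotomy' s with rfl | rfl | rfl
  · rw [lexSign_eq_zero] at *
    rw [map_add, map_add, ha.1, ha.2, hb.1, hb.2]
    simp
  · rw [lexSign_eq_neg_one] at *
    rw [map_add, map_add]
    rcases ha with ha | ⟨ha, ha'⟩ <;> rcases hb with hb | ⟨hb, hb'⟩
    · left; linarith
    · left; linarith
    · left; linarith
    · right; constructor <;> linarith
  · rw [lexSign_eq_one] at *
    rw [map_add, map_add]
    rcases ha with ha | ⟨ha, ha'⟩ <;> rcases hb with hb | ⟨hb, hb'⟩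
    · left; linarith
    · left; linarith
    · left; linarith
    · right; constructor <;> linarith

theorem OneSupported.mul {s : Set (σ →₀ ℕ)} (hs : ∀ a ∈ s, ∀ b ∈ s, a + b ∈ s)
    {x y : MvPowerSeries σ A} (hx : OneSupported s x) (hy : OneSupported s y) :
    OneSupported s (x * y) := by
  classical
  refine ⟨by rw [coeff_zero_mul', hx.1, hy.1, mul_one], fun d h0 hd => ?_⟩
  rw [MvPowerSeries.coeff_mul]
  refine sum_eq_zero fun p hp => ?_
  rw [HasAntidiagonal.mem_antidiagonal] at hp
  by_cases h1 : p.1 = 0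
  · rw [h1, zero_add] at hp
    rw [hp, hy.2 d h0 hd, mul_zero]
  by_cases h2 : p.2 = 0
  · rw [h2, add_zero] at hp
    rw [hp, hx.2 d h0 hd, zero_mul]
  by_cases h3 : p.1 ∈ s
  · rw [hy.2 p.2 h2 fun h4 => hd (hp ▸ hs _ h3 _ h4), mul_zero]
  · rw [hx.2 _ h1 h3, zero_mul]

theorem OneSupported.mono {s t : Set (σ →₀ ℕ)} (hst : ∀ d ∈ s, d ∈ t)
    {x : MvPowerSeries σ A} (hx : OneSupported s x) : OneSupported t x :=
  ⟨hx.1, fun d h0 hd => hx.2 d h0 fun h => hd (hst d h)⟩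

theorem oneSupported_iff_mem (S : AddSubmonoid (σ →₀ ℕ)) {x : MvPowerSeries σ A}
    (hx : coeff 0 x = 1) : OneSupported {d | d ∈ S} x ↔ x ∈ (Grading.supported k A S).sub :=
  ⟨fun h => Grading.mem_supported.2 fun d hd => h.2 d (fun h0 => hd (h0 ▸ S.zero_mem)) hd,
    fun h => ⟨hx, fun d _ hd => Grading.mem_supported.1 h d hd⟩⟩

theorem signOf_add {θ : (σ →₀ ℕ) →+ ℝ} {s : SignType} {a b : σ →₀ ℕ}
    (ha : signOf θ a = s) (hb : signOf θ b = s) : signOf θ (a + b) = s := by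
  unfold signOf at *
  rw [map_add]
  rcases SignType.trichotomy' s with rfl | rfl | rfl
  · rw [sign_eq_zero_iff] at *; rw [ha, hb, add_zero]
  · rw [sign_eq_neg_one_iff] at *; linarith
  · rw [sign_eq_one_iff] at *; linarith

theorem signOf_eq_zero {θ : (σ →₀ ℕ) →+ ℝ} {d : σ →₀ ℕ} : signOf θ d = 0 ↔ θ d = 0 :=
  sign_eq_zero_iff

variable (k) in
theorem facPart_zero_mem (θ : (σ →₀ ℕ) →+ ℝ) (g : MvPowerSeries σ A) :
    facPart (signOf θ) 0 g ∈ (Grading.supported k A (AddMonoidHom.mker θ)).sub := by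
  rw [← oneSupported_iff_mem _ (coeff_zero_facPart _ _ _)]
  exact (facPart_oneSupported _ _ _).mono fun d hd => signOf_eq_zero.1 hd

/-- Factorizing the middle factor again with respect to `θ'` gives the factorization with respect to
the lexicographic sign. -/
theorem facPart_lexSign (𝕜 : Type*) [Field 𝕜] [Algebra 𝕜 A]
    (θ θ' : (σ →₀ ℕ) →+ ℝ) {g : MvPowerSeries σ A} (hg : coeff 0 g = 1) :
    facPart (lexSign θ θ') 0 g = facPart (signOf θ') 0 (facPart (signOf θ) 0 g) ∧
    facPart (lexSign θ θ') 1 g =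
      facPart (signOf θ') 1 (facPart (signOf θ) 0 g) * facPart (signOf θ) 1 g := by
  set z := facPart (signOf θ) 0 g with hz
  have hz1 : coeff 0 z = 1 := coeff_zero_facPart _ _ _
  have h1 : ∀ s, OneSupported {d | lexSign θ θ' d = s} (facPart (signOf θ') s z) := by
    intro s
    refine ⟨coeff_zero_facPart _ _ _, fun d h0 hd => ?_⟩
    by_cases h2 : θ d = 0
    · refine (facPart_oneSupported (signOf θ') s z).2 d h0 fun h3 => hd ?_
      change lexSign θ θ' d = s
      rw [lexSign, if_neg (not_not.2 h2)]
      exact h3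
    · exact Grading.mem_supported.1 (facPart_mem (facPart_zero_mem 𝕜 θ g)) d h2
  have h2 : ∀ s, s ≠ 0 → OneSupported {d | lexSign θ θ' d = s} (facPart (signOf θ) s g) := by
    intro s hs
    refine (facPart_oneSupported _ _ _).mono fun d hd => ?_
    change lexSign θ θ' d = s
    change SignType.sign (θ d) = s at hd
    rw [lexSign, if_pos, hd]
    intro h
    rw [h, sign_zero] at hd
    exact hs hd.symm
  have hcl : ∀ s, ∀ a ∈ {d | lexSign θ θ' d = s}, ∀ b ∈ {d | lexSign θ θ' d = s},
      a + b ∈ {d | lexSign θ θ' d = s} := fun s a ha b hb =>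
    lexSign_add (θ := θ) (θ' := θ') (s := s) (a := a) (b := b) ha hb
  let x : SignType → MvPowerSeries σ A := fun s =>
    if s = -1 then facPart (signOf θ) (-1) g * facPart (signOf θ') (-1) z
    else if s = 0 then facPart (signOf θ') 0 z
    else facPart (signOf θ') 1 z * facPart (signOf θ) 1 g
  have hx : ∀ s, OneSupported {d | lexSign θ θ' d = s} (x s) := by
    intro s
    rcases SignType.trichotomy' s with rfl | rfl | rfl
    · exact h1 0
    · exact (h2 _ (by decide)).mul (hcl _) (h1 (-1))
    · exact (h1 1).mul (hcl _) (h2 _ (by decide))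
  have hprod : x (-1) * x 0 * x 1 = g := by
    have e1 := facPart_mul (signOf θ') hz1
    have e2 := facPart_mul (signOf θ) hg
    change facPart (signOf θ) (-1) g * facPart (signOf θ') (-1) z * facPart (signOf θ') 0 z *
      (facPart (signOf θ') 1 z * facPart (signOf θ) 1 g) = g
    calc _ = facPart (signOf θ) (-1) g * (facPart (signOf θ') (-1) z * facPart (signOf θ') 0 z *
      facPart (signOf θ') 1 z) * facPart (signOf θ) 1 g := by noncomm_ring
      _ = g := by rw [e1, hz, e2]
  have h3 := facPart_eq_of_mul hx
  rw [hprod] at h3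
  exact ⟨h3 0, h3 1⟩

theorem oneSupported_pexp_restrict (θ : (σ →₀ ℕ) →+ ℝ) (L : MvPowerSeries σ A)
    (s : SignType) :
    OneSupported {d | signOf θ d = s} (pexp k (restrict (signClass (signOf θ) s) L)) := by
  refine ⟨coeff_zero_pexp _, fun d h0 hd => ?_⟩
  let S : AddSubmonoid (σ →₀ ℕ) := {
    carrier := {d | d = 0 ∨ signOf θ d = s}
    zero_mem' := Or.inl rfl
    add_mem' := by
      rintro a b (rfl | ha) (rfl | hb)
      · left; simp
      · right; simpa using hb
      · right; simpa using ha
      · right; exact signOf_add ha hb }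
  have h1 : restrict (signClass (signOf θ) s) L ∈ (Grading.supported k A S).sub := by
    rw [Grading.mem_supported]
    intro e he
    exact coeff_restrict_of_notMem (fun h2 => he (Or.inr h2.2)) L
  exact Grading.mem_supported.1 (pexp_mem h1) d fun h => h.elim h0 hd

/-- The factorization of the exponential of a series whose homogeneous parts commute. -/
theorem facPart_pexp [CharZero k] (θ : (σ →₀ ℕ) →+ ℝ) {L : MvPowerSeries σ A}
    (hL : coeff 0 L = 0) (hc : ∀ s t : Set (σ →₀ ℕ), Commute (restrict s L) (restrict t L))
    (s : SignType) :
    facPart (signOf θ) s (pexp k L) = pexp k (restrict (signClass (signOf θ) s) L) := by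
  have h0 := fun s => coeff_zero_restrict_signClass (signOf θ) s L
  have h1 := facPart_eq_of_mul (sg := signOf θ)
    (x := fun s => pexp k (restrict (signClass (signOf θ) s) L))
    (oneSupported_pexp_restrict θ L)
  have h2 : pexp k (restrict (signClass (signOf θ) (-1)) L) *
      pexp k (restrict (signClass (signOf θ) 0) L) *
      pexp k (restrict (signClass (signOf θ) 1) L) = pexp k L := by
    rw [← pexp_add (h0 _) (h0 _) (hc _ _), ← pexp_add (by rw [map_add, h0, h0, add_zero]) (h0 _)
      ((hc _ _).add_left (hc _ _))]
    congr 1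
    conv_rhs => rw [← restrict_signClass_add (signOf θ) L]
    have h3 : restrict {0} L = 0 := by
      have h4 := restrict_compl_add L
      rw [restrict_compl_eq hL] at h4
      simpa using h4
    rw [h3, add_zero]
  rw [h2] at h1
  exact h1 s

theorem facMap_zero (sg : (σ →₀ ℕ) → SignType) : facMap sg (0 : MvPowerSeries σ A) = 0 := by
  have h : ∀ s : Set (σ →₀ ℕ), restrict s (0 : MvPowerSeries σ A) = 0 := by
    intro s
    ext d
    by_cases hd : d ∈ s
    · rw [coeff_restrict_of_mem hd]
    · rw [coeff_restrict_of_notMem hd, map_zero]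
  rw [facMap]
  simp only [h]
  simp

/-- Let `e = a + b`, and suppose that `θ` vanishes, among the parts of `e`, only at `0`, `a`, `b` and
`e`. When `θ` is perturbed so that `a` becomes positive and `b` negative, the coefficient of the
middle factor at `e` decreases by the product of its coefficients at `b` and at `a`. -/
theorem coeff_facPart_lexSign (𝕜 : Type*) [Field 𝕜] [Algebra 𝕜 A]
    (θ θ' : (σ →₀ ℕ) →+ ℝ) {g : MvPowerSeries σ A} (hg : coeff 0 g = 1)
    {a b e : σ →₀ ℕ} (hab : a + b = e) (hle : ¬ a ≤ b) (hle' : ¬ b ≤ a)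
    (h : ∀ d ≤ e, θ d = 0 → d = 0 ∨ d = a ∨ d = b ∨ d = e)
    (ha : 0 < θ' a) (hb : θ' b < 0) (he : θ' e = 0) :
    coeff e (facPart (lexSign θ θ') 0 g) = coeff e (facPart (signOf θ) 0 g) -
      coeff b (facPart (signOf θ) 0 g) * coeff a (facPart (signOf θ) 0 g) := by
  classical
  rw [(facPart_lexSign 𝕜 θ θ' hg).1]
  set z := facPart (signOf θ) 0 g with hz
  set f := facInv (signOf θ') (z - 1) with hf
  have ha0 : a ≠ 0 := by rintro rfl; simp at ha
  have hb0 : b ≠ 0 := by rintro rfl; simp at hb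
  have hae : a ≠ e := by rintro rfl; simp [hb0] at hab
  have hbe : b ≠ e := by rintro rfl; simp [ha0] at hab
  have hla : a ≤ e := hab ▸ le_self_add
  have hlb : b ≤ e := hab ▸ le_add_self
  have he0 : e ≠ 0 := by rintro rfl; exact ha0 (le_antisymm hla (zero_le))
  have hf0 : coeff 0 f = 0 := by
    rw [hf, coeff_zero_facInv, map_sub, coeff_zero_facPart, coeff_one_zero, sub_self]
  have hfS : ∀ d, θ d ≠ 0 → coeff d f = 0 := fun d hd =>
    Grading.mem_supported.1 (facInv_mem (Subalgebra.sub_mem _ (facPart_zero_mem 𝕜 θ g)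
      (Subalgebra.one_mem _))) d hd
  have hfz : ∀ d ≤ e, d ≠ a → d ≠ b → d ≠ e → coeff d f = 0 := by
    intro d hd h1 h2 h3
    by_cases h4 : θ d = 0
    · rcases h d hd h4 with rfl | h5 | h5 | h5
      · exact hf0
      · exact absurd h5 h1
      · exact absurd h5 h2
      · exact absurd h5 h3
    · exact hfS d h4
  have hF : facMap (signOf θ') f = z - 1 := facMap_facInv _ _
  have hsmall : ∀ c ≤ e, c ≠ 0 → c ≠ e → (∀ d < c, coeff d f = 0) → coeff c f = coeff c z := by
    intro c hc hc0 _ hlt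
    have h1 := facMap_congr (f := f) (f' := 0) (sg := signOf θ') (sg' := signOf θ') (d := c)
      (fun d hd => by rw [hlt d hd, map_zero]) fun _ _ => rfl
    rw [facMap_zero, map_zero, sub_zero, hF, map_sub, coeff_one_ne hc0, sub_zero] at h1
    exact (sub_eq_zero.1 h1).symm
  have hfa : coeff a f = coeff a z := hsmall a hla ha0 hae fun d hd =>
    hfz d (hd.le.trans hla) hd.ne (fun h1 => hle' (h1 ▸ hd.le))
      (fun h1 => absurd (h1 ▸ hd) (not_lt_of_ge hla))
  have hfb : coeff b f = coeff b z := hsmall b hlb hb0 hbe fun d hd =>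
    hfz d (hd.le.trans hlb) (fun h1 => hle (h1 ▸ hd.le)) hd.ne
      (fun h1 => absurd (h1 ▸ hd) (not_lt_of_ge hlb))
  have hea : e ∈ signClass (signOf θ') 0 := ⟨he0, signOf_eq_zero.2 he⟩
  have hZ : ∀ d < e, coeff d (restrict (signClass (signOf θ') 0) f) = 0 := by
    intro d hd
    by_cases h1 : d ∈ signClass (signOf θ') 0
    · rw [coeff_restrict_of_mem h1]
      refine hfz d hd.le ?_ ?_ hd.ne
      · rintro rfl; exact ha.ne' (signOf_eq_zero.1 h1.2)
      · rintro rfl; exact hb.ne (signOf_eq_zero.1 h1.2)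
    · exact coeff_restrict_of_notMem h1 f
  have hNZ : ∀ d ≤ e, coeff d (restrict (signClass (signOf θ') (-1)) f *
      restrict (signClass (signOf θ') 0) f) = 0 := by
    intro d hd
    rw [MvPowerSeries.coeff_mul]
    refine sum_eq_zero fun p hp => ?_
    rw [HasAntidiagonal.mem_antidiagonal] at hp
    by_cases h1 : p.1 = 0
    · rw [h1, coeff_zero_restrict_signClass, zero_mul]
    · rw [hZ p.2 ((lt_of_add_eq_right hp h1).trans_le hd), mul_zero]
  have hP : ∀ y ≤ e, y ≠ a → coeff y (restrict (signClass (signOf θ') 1) f) = 0 := by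
    intro y hy hya
    by_cases h1 : y ∈ signClass (signOf θ') 1
    · rw [coeff_restrict_of_mem h1]
      have h2 : 0 < θ' y := sign_eq_one_iff.1 h1.2
      refine hfz y hy hya ?_ ?_
      · rintro rfl; exact absurd h2 (not_lt_of_ge hb.le)
      · rintro rfl; rw [he] at h2; exact lt_irrefl _ h2
    · exact coeff_restrict_of_notMem h1 f
  have hNP : coeff e ((restrict (signClass (signOf θ') (-1)) f +
      restrict (signClass (signOf θ') 0) f + restrict (signClass (signOf θ') (-1)) f *
        restrict (signClass (signOf θ') 0) f) * restrict (signClass (signOf θ') 1) f) =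
      coeff b f * coeff a f := by
    rw [MvPowerSeries.coeff_mul, sum_eq_single (b, a)]
    · rw [map_add, map_add, hNZ b hlb, hZ b (lt_of_le_of_ne hlb hbe),
        coeff_restrict_of_mem (s := signClass (signOf θ') (-1)) ⟨hb0, sign_eq_neg_one_iff.2 hb⟩,
        coeff_restrict_of_mem (s := signClass (signOf θ') 1) ⟨ha0, sign_eq_one_iff.2 ha⟩, add_zero, add_zero]
    · intro p hp hne
      rw [HasAntidiagonal.mem_antidiagonal] at hp
      rw [hP p.2 (hp ▸ le_add_self), mul_zero]
      intro h2
      apply hne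
      have h3 : p.1 = b := by
        rw [h2, ← hab, add_comm a b] at hp
        exact add_right_cancel hp
      exact Prod.ext h3 h2
    · intro h1
      exact absurd (HasAntidiagonal.mem_antidiagonal.2 (by rw [add_comm]; exact hab)) h1
  have h1 := congrArg (coeff e) hF
  rw [facMap_eq, map_add, map_add, hNZ e le_rfl, hNP, zero_add, map_sub, coeff_one_ne he0,
    sub_zero] at h1
  rw [facPart, map_add, coeff_one_ne he0, zero_add, coeff_restrict_of_mem hea, ← hf, ← h1, hfa, hfb]
  abel

end ExpLog

/-! ### Homogeneous series over the quantum torus -/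

section Homogeneous

variable {σ : Type*}

open MvPowerSeries (coeff)

/-- The weight `∑ d_c w_c` of an exponent `d`. -/
def wt (w : σ → ZLat) : (σ →₀ ℕ) →+ ZLat := (Finsupp.linearCombination ℕ w).toAddMonoidHom

theorem wt_single (w : σ → ZLat) (c : σ) (r : ℕ) : wt w (Finsupp.single c r) = r • w c :=
  Finsupp.linearCombination_single ℕ r c

theorem toPlane_add (a b : ZLat) : toPlane (a + b) = toPlane a + toPlane b := by
  ext <;> simp [toPlane]

theorem toPlane_neg (a : ZLat) : toPlane (-a) = -toPlane a := by
  ext <;> simp [toPlane]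

theorem toPlane_zero : toPlane 0 = 0 := by
  ext <;> simp [toPlane]

theorem toPlane_injective : Function.Injective toPlane := by
  intro a b h
  have h1 := congrArg Prod.fst h
  have h2 := congrArg Prod.snd h
  simp only [toPlane] at h1 h2
  ext
  · exact_mod_cast h1
  · exact_mod_cast h2

theorem toPlane_eq_zero {a : ZLat} : toPlane a = 0 ↔ a = 0 :=
  ⟨fun h => toPlane_injective (h.trans toPlane_zero.symm), fun h => h ▸ toPlane_zero⟩

theorem toPlane_nsmul (r : ℕ) (a : ZLat) : toPlane (r • a) = (r : ℝ) • toPlane a := by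
  ext <;> simp [toPlane]

theorem skewR_add_left (a b c : Plane) : skewR (a + b) c = skewR a c + skewR b c := by
  simp only [skewR, Prod.fst_add, Prod.snd_add]; ring

theorem skewR_add_right (a b c : Plane) : skewR a (b + c) = skewR a b + skewR a c := by
  simp only [skewR, Prod.fst_add, Prod.snd_add]; ring

theorem skewR_sub_right (a b c : Plane) : skewR a (b - c) = skewR a b - skewR a c := by
  simp only [skewR, Prod.fst_sub, Prod.snd_sub]; ring

theorem skewR_neg_left (a b : Plane) : skewR (-a) b = -skewR a b := by
  simp only [skewR, Prod.fst_neg, Prod.snd_neg]; ring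

theorem skewR_neg_right (a b : Plane) : skewR a (-b) = -skewR a b := by
  simp only [skewR, Prod.fst_neg, Prod.snd_neg]; ring

theorem skewR_smul_left (r : ℝ) (a b : Plane) : skewR (r • a) b = r * skewR a b := by
  simp only [skewR, Prod.smul_fst, Prod.smul_snd, smul_eq_mul]; ring

theorem skewR_smul_right (r : ℝ) (a b : Plane) : skewR a (r • b) = r * skewR a b := by
  simp only [skewR, Prod.smul_fst, Prod.smul_snd, smul_eq_mul]; ring

theorem skewR_self (a : Plane) : skewR a a = 0 := by
  simp only [skewR]; ring

theorem skewR_zero_left (a : Plane) : skewR 0 a = 0 := by simp [skewR]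

theorem skewR_zero_right (a : Plane) : skewR a 0 = 0 := by simp [skewR]

theorem skewR_toPlane (a b : ZLat) : skewR (toPlane a) (toPlane b) = (skew a b : ℝ) := by
  simp only [skewR, toPlane, skew]; push_cast; ring

/-- Two vectors that are parallel to a non-zero vector are parallel. -/
theorem skewR_eq_zero_of_parallel {a b y : Plane} (hy : y ≠ 0) (ha : skewR a y = 0)
    (hb : skewR b y = 0) : skewR a b = 0 := by
  simp only [skewR] at *
  by_cases h1 : y.1 = 0
  · have h2 : y.2 ≠ 0 := fun h2 => hy (Prod.ext h1 h2)
    have ha' : a.1 = 0 := by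
      rw [h1, mul_zero, sub_zero] at ha
      exact (mul_eq_zero.1 ha).resolve_right h2
    have hb' : b.1 = 0 := by
      rw [h1, mul_zero, sub_zero] at hb
      exact (mul_eq_zero.1 hb).resolve_right h2
    rw [ha', hb']; ring
  · have h3 : y.1 * (a.1 * b.2 - a.2 * b.1) = 0 := by linear_combination b.1 * ha - a.1 * hb
    exact (mul_eq_zero.1 h3).resolve_left h1

/-- The additive function `d ↦ ⟨wt d, y⟩` on the exponents. -/
def slope (w : σ → ZLat) (y : Plane) : (σ →₀ ℕ) →+ ℝ where
  toFun d := skewR (toPlane (wt w d)) y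
  map_zero' := by rw [map_zero, toPlane_zero, skewR_zero_left]
  map_add' a b := by rw [map_add, toPlane_add, skewR_add_left]

theorem slope_apply (w : σ → ZLat) (y : Plane) (d : σ →₀ ℕ) :
    slope w y d = skewR (toPlane (wt w d)) y := rfl

theorem signOf_slope_smul (w : σ → ZLat) {c : ℝ} (hc : 0 < c) (y : Plane) :
    signOf (slope w (c • y)) = signOf (slope w y) := by
  ext d
  simp only [signOf, slope_apply, skewR_smul_right, sign_mul, sign_pos hc, one_mul]

/-- The homogeneous series, in which the coefficient at `d` is a multiple of `ẑ^{wt d}`. -/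
def homGrading (w : σ → ZLat) : Grading σ LaurentField QTorus where
  carrier d := Submodule.span LaurentField {QTorus.zhat (wt w d)}
  one_mem := by
    rw [map_zero]
    exact Submodule.mem_span_singleton_self _
  mul_mem a b x y hx hy := by
    obtain ⟨c, rfl⟩ := Submodule.mem_span_singleton.1 hx
    obtain ⟨c', rfl⟩ := Submodule.mem_span_singleton.1 hy
    rw [smul_mul_smul_comm, QTorus.zhat_mul_zhat, map_add, smul_smul]
    exact Submodule.smul_mem _ _ (Submodule.mem_span_singleton_self _)

theorem exists_coeff_eq_smul {w : σ → ZLat} {f : MvPowerSeries σ QTorus}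
    (hf : f ∈ (homGrading w).sub) (d : σ →₀ ℕ) :
    ∃ c : LaurentField, coeff d f = c • QTorus.zhat (wt w d) := by
  obtain ⟨c, hc⟩ := Submodule.mem_span_singleton.1 (hf d)
  exact ⟨c, hc.symm⟩

/-- Homogeneous series with parallel weights commute. -/
theorem commute_of_parallel {w : σ → ZLat} {f g : MvPowerSeries σ QTorus} {y : Plane} (hy : y ≠ 0)
    (hf : f ∈ (homGrading w).sub) (hg : g ∈ (homGrading w).sub)
    (hf' : ∀ d, slope w y d ≠ 0 → coeff d f = 0) (hg' : ∀ d, slope w y d ≠ 0 → coeff d g = 0) :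
    Commute f g := by
  classical
  change f * g = g * f
  ext d
  rw [MvPowerSeries.coeff_mul, MvPowerSeries.coeff_mul]
  refine sum_bij' (fun p _ => p.swap) (fun p _ => p.swap) ?_ ?_ (fun _ _ => rfl) (fun _ _ => rfl) ?_
  · intro p hp
    rw [HasAntidiagonal.mem_antidiagonal] at hp ⊢
    rw [← hp, add_comm, Prod.fst_swap, Prod.snd_swap, add_comm]
  · intro p hp
    rw [HasAntidiagonal.mem_antidiagonal] at hp ⊢
    rw [← hp, add_comm, Prod.fst_swap, Prod.snd_swap, add_comm]
  rintro ⟨p2, p1⟩ _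
  let p : (σ →₀ ℕ) × (σ →₀ ℕ) := (p1, p2)
  change coeff p.2 f * coeff p.1 g = coeff p.1 g * coeff p.2 f
  by_cases h1 : slope w y p.2 = 0
  · by_cases h2 : slope w y p.1 = 0
    · obtain ⟨c, hc⟩ := exists_coeff_eq_smul hf p.2
      obtain ⟨c', hc'⟩ := exists_coeff_eq_smul hg p.1
      have h3 : skew (wt w p.2) (wt w p.1) = 0 := by
        have := skewR_eq_zero_of_parallel hy h1 h2
        rw [skewR_toPlane] at this
        exact_mod_cast this
      rw [hc, hc', smul_mul_smul_comm, smul_mul_smul_comm, (QTorus.zhat_commute h3).eq, mul_comm c]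
    · rw [hg' _ h2, mul_zero, zero_mul]
  · rw [hf' _ h1, mul_zero, zero_mul]

/-- The logarithm of the middle factor of `g` with respect to the signs of `⟨wt d, y⟩`. -/
def wallLog (w : σ → ZLat) (g : MvPowerSeries σ QTorus) (y : Plane) : MvPowerSeries σ QTorus :=
  plog LaurentField (facPart (signOf (slope w y)) 0 g)

theorem coeff_zero_wallLog (w : σ → ZLat) (g : MvPowerSeries σ QTorus) (y : Plane) :
    coeff 0 (wallLog w g y) = 0 := coeff_zero_plog (coeff_zero_facPart _ _ _)

theorem pexp_wallLog (w : σ → ZLat) (g : MvPowerSeries σ QTorus) (y : Plane) :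
    pexp LaurentField (wallLog w g y) = facPart (signOf (slope w y)) 0 g :=
  pexp_plog (coeff_zero_facPart _ _ _)

theorem wallLog_mem {w : σ → ZLat} {g : MvPowerSeries σ QTorus} (hg : g ∈ (homGrading w).sub)
    (y : Plane) : wallLog w g y ∈ (homGrading w).sub := plog_mem (facPart_mem hg)

theorem coeff_wallLog_of_slope_ne {w : σ → ZLat} {g : MvPowerSeries σ QTorus} {y : Plane}
    {d : σ →₀ ℕ} (hd : slope w y d ≠ 0) : coeff d (wallLog w g y) = 0 :=
  Grading.mem_supported.1 (plog_mem (facPart_zero_mem LaurentField (slope w y) g)) d hd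

theorem wallLog_smul (w : σ → ZLat) (g : MvPowerSeries σ QTorus) {c : ℝ} (hc : 0 < c) (y : Plane) :
    wallLog w g (c • y) = wallLog w g y := by
  rw [wallLog, signOf_slope_smul w hc, wallLog]

theorem coeff_restrict_eq_zero {f : MvPowerSeries σ QTorus} {d : σ →₀ ℕ} (h : coeff d f = 0)
    (s : Set (σ →₀ ℕ)) : coeff d (restrict s f) = 0 := by
  by_cases hd : d ∈ s
  · rw [coeff_restrict_of_mem hd, h]
  · exact coeff_restrict_of_notMem hd f

theorem commute_restrict_wallLog {w : σ → ZLat} {g : MvPowerSeries σ QTorus}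
    (hg : g ∈ (homGrading w).sub) {y : Plane} (hy : y ≠ 0) (s t : Set (σ →₀ ℕ)) :
    Commute (restrict s (wallLog w g y)) (restrict t (wallLog w g y)) :=
  commute_of_parallel hy (Grading.restrict_mem (wallLog_mem hg y) s)
    (Grading.restrict_mem (wallLog_mem hg y) t)
    (fun _ hd => coeff_restrict_eq_zero (coeff_wallLog_of_slope_ne hd) s)
    fun _ hd => coeff_restrict_eq_zero (coeff_wallLog_of_slope_ne hd) t

/-- When the signs of `⟨wt d, y⟩` are refined, the middle factor splits according to the splitting
of its logarithm, as the exponents on which it is supported have parallel weights. -/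
theorem facPart_lexSign_slope {w : σ → ZLat} {g : MvPowerSeries σ QTorus}
    (hg : g ∈ (homGrading w).sub) (hg0 : coeff 0 g = 1) {y : Plane} (hy : y ≠ 0)
    (θ' : (σ →₀ ℕ) →+ ℝ) :
    facPart (lexSign (slope w y) θ') 0 g =
      pexp LaurentField (restrict (signClass (signOf θ') 0) (wallLog w g y)) ∧
    facPart (lexSign (slope w y) θ') 1 g =
      pexp LaurentField (restrict (signClass (signOf θ') 1) (wallLog w g y)) *
        facPart (signOf (slope w y)) 1 g := by
  have h1 := facPart_lexSign LaurentField (slope w y) θ' hg0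
  rw [← pexp_wallLog] at h1
  have h2 := facPart_pexp (k := LaurentField) θ' (coeff_zero_wallLog w g y)
    (commute_restrict_wallLog hg hy)
  rw [h2, h2] at h1
  exact h1

theorem coeff_facPart_lexSign_slope {w : σ → ZLat} {g : MvPowerSeries σ QTorus}
    (hg : g ∈ (homGrading w).sub) (hg0 : coeff 0 g = 1) {y : Plane} (hy : y ≠ 0)
    (θ' : (σ →₀ ℕ) →+ ℝ) {e : σ →₀ ℕ} (he0 : e ≠ 0) (he : θ' e = 0)
    (h : ∀ d < e, d ≠ 0 → slope w y d = 0 → θ' d ≠ 0) :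
    coeff e (facPart (lexSign (slope w y) θ') 0 g) = coeff e (wallLog w g y) := by
  rw [(facPart_lexSign_slope hg hg0 hy θ').1]
  set x := restrict (signClass (signOf θ') 0) (wallLog w g y)
  have hx0 : coeff 0 x = 0 := coeff_restrict_eq_zero (coeff_zero_wallLog w g y) _
  have h1 := pexp_sub_congr (k := LaurentField) (x := x) (y := 0) (d := e) hx0 (map_zero _) (by
    intro d hd
    rw [map_zero]
    by_cases hd0 : d = 0
    · rw [hd0, hx0]
    by_cases h2 : slope w y d = 0
    · exact coeff_restrict_of_notMem (fun h3 => h d hd hd0 h2 (signOf_eq_zero.1 h3.2)) _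
    · exact coeff_restrict_eq_zero (coeff_wallLog_of_slope_ne h2) _)
  rw [pexp_zero, coeff_one_ne he0, map_zero, sub_zero, sub_eq_zero] at h1
  rw [h1]
  exact coeff_restrict_of_mem (s := signClass (signOf θ') 0) ⟨he0, signOf_eq_zero.2 he⟩ _

/-! ### Prescribing the incoming part -/

theorem coeff_facPart_sub_congr {sg : (σ →₀ ℕ) → SignType} {s : SignType} {d : σ →₀ ℕ}
    (hd0 : d ≠ 0) (hd : sg d = s) {g g' : MvPowerSeries σ QTorus}
    (h : ∀ d' < d, coeff d' g = coeff d' g') :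
    coeff d (facPart sg s g) - coeff d g = coeff d (facPart sg s g') - coeff d g' := by
  have h1 := facInv_sub_congr (sg := sg) (g := g - 1) (g' := g' - 1) (d := d) fun d' hd' => by
    rw [map_sub, map_sub, h d' hd']
  have hm : d ∈ signClass sg s := ⟨hd0, hd⟩
  simp only [facPart, map_add, coeff_restrict_of_mem hm, coeff_one_ne hd0, zero_add, map_sub,
    sub_zero] at h1 ⊢
  exact h1

open Classical in
/-- The coefficients of the logarithms of the middle factors of `1 + f`, taken at each exponent `d`
at the point `-wt d`. -/
def incomingMap (w : σ → ZLat) (f : MvPowerSeries σ QTorus) : MvPowerSeries σ QTorus :=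
  fun d => if wt w d ≠ 0 then coeff d (wallLog w (1 + restrict {0}ᶜ f) (-toPlane (wt w d)))
    else coeff d f

theorem coeff_incomingMap_of_wt_eq_zero {w : σ → ZLat} {d : σ →₀ ℕ} (hd : wt w d = 0)
    (f : MvPowerSeries σ QTorus) : coeff d (incomingMap w f) = coeff d f :=
  if_neg (not_not.2 hd)

theorem incomingMap_triangular (w : σ → ZLat) : Triangular (incomingMap w) := by
  intro d f f' h
  by_cases hd : wt w d ≠ 0
  · have e : ∀ f : MvPowerSeries σ QTorus, coeff d (incomingMap w f) =
        coeff d (wallLog w (1 + restrict {0}ᶜ f) (-toPlane (wt w d))) := fun f => if_pos hd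
    have hd0 : d ≠ 0 := by rintro rfl; simp at hd
    have hs : signOf (slope w (-toPlane (wt w d))) d = 0 := by
      rw [signOf_eq_zero, slope_apply, skewR_neg_right, skewR_self, neg_zero]
    have h1 : ∀ d' < d, coeff d' (1 + restrict {0}ᶜ f) = coeff d' (1 + restrict {0}ᶜ f') := by
      intro d' hd'
      rw [map_add, map_add, coeff_restrict_congr Iff.rfl (h d' hd')]
    have h2 := coeff_facPart_sub_congr hd0 hs h1
    have h3 := plog_sub_congr (k := LaurentField) (d := d)
      (g := facPart (signOf (slope w (-toPlane (wt w d)))) 0 (1 + restrict {0}ᶜ f))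
      (g' := facPart (signOf (slope w (-toPlane (wt w d)))) 0 (1 + restrict {0}ᶜ f'))
      fun d' hd' => facPart_congr (fun e he => h1 e (he.trans_lt hd')) fun _ _ => rfl
    have h4 : ∀ f : MvPowerSeries σ QTorus, coeff d (1 + restrict {0}ᶜ f) = coeff d f := by
      intro f
      rw [map_add, coeff_one_ne hd0, zero_add, coeff_restrict_of_mem (s := {0}ᶜ) hd0]
    rw [h4, h4] at h2
    rw [e, e]
    unfold wallLog
    have h5 := congrArg₂ (· + ·) h3 h2
    simpa only [sub_add_sub_cancel] using h5
  · have e : ∀ f : MvPowerSeries σ QTorus, coeff d (incomingMap w f) = coeff d f :=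
      fun f => if_neg hd
    rw [e, e, sub_self, sub_self]

theorem incomingMap_mem {w : σ → ZLat} {f : MvPowerSeries σ QTorus}
    (hf : f ∈ (homGrading w).sub) : incomingMap w f ∈ (homGrading w).sub := by
  intro d
  by_cases hd : wt w d ≠ 0
  · have e : coeff d (incomingMap w f) =
        coeff d (wallLog w (1 + restrict {0}ᶜ f) (-toPlane (wt w d))) := if_pos hd
    rw [e]
    exact wallLog_mem (Subalgebra.add_mem _ (Subalgebra.one_mem _) (Grading.restrict_mem hf _)) _ d
  · have e : coeff d (incomingMap w f) = coeff d f := if_neg hd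
    rw [e]
    exact hf d

/-- There is a homogeneous series whose wall at `y` has, for every `y`, the prescribed logarithm
`η` in the directions opposite to `y`. -/
theorem exists_incoming (w : σ → ZLat) {η : MvPowerSeries σ QTorus} (hη : η ∈ (homGrading w).sub)
    (hη0 : coeff 0 η = 0) :
    ∃ g ∈ (homGrading w).sub, coeff 0 g = 1 ∧
      ∀ (y : Plane) (d : σ →₀ ℕ) (c : ℝ), wt w d ≠ 0 → 0 < c → toPlane (wt w d) = -(c • y) →
        coeff d (wallLog w g y) = coeff d η := by
  obtain ⟨f, hf⟩ := (incomingMap_triangular w).surjective η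
  have hfm : f ∈ (homGrading w).sub := (incomingMap_triangular w).mem_of_map_mem _
    (fun _ h => incomingMap_mem h) (by rwa [hf])
  have hf0 : coeff 0 f = 0 := by
    rw [← coeff_incomingMap_of_wt_eq_zero (map_zero (wt w)), hf, hη0]
  refine ⟨1 + f, Subalgebra.add_mem _ (Subalgebra.one_mem _) hfm, by
    rw [map_add, coeff_one_zero, hf0, add_zero], fun y d c hd hc hy => ?_⟩
  have e : coeff d (incomingMap w f) =
      coeff d (wallLog w (1 + restrict {0}ᶜ f) (-toPlane (wt w d))) := if_pos hd
  rw [restrict_compl_eq hf0, hf, hy, neg_neg, wallLog_smul w _ hc] at e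
  exact e.symm

end Homogeneous

/-! ### Binary trees -/

/-- Binary trees with leaves labelled by `ι`. They encode the rational tropical curves with a root
leg; the two branches at a node are ordered by the orientation of their directions. -/
inductive BTree (ι : Type) : Type
  | leaf : ι → BTree ι
  | node : BTree ι → BTree ι → BTree ι

section Trees

variable {ι : Type}

/-- The sum of the vectors `w_i`, `i ∈ J`. -/
def vec (w : ι → ZLat) (J : Finset ι) : ZLat := ∑ i ∈ J, w i

/-- The affine form `y ↦ ⟨w_J, y⟩ - μ_J`, where `μ_i` is the moment of the `i`-th leg. It vanishes on
the line that contains the root edge of every curve with the legs `J`. -/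
def lineForm (w : ι → ZLat) (μ : ι → ℝ) (J : Finset ι) (y : Plane) : ℝ :=
  skewR (toPlane (vec w J)) y - ∑ i ∈ J, μ i

/-- The point where the lines of `J` and `K` meet. -/
def meet (w : ι → ZLat) (μ : ι → ℝ) (J K : Finset ι) : Plane :=
  ((skew (vec w J) (vec w K) : ℤ) : ℝ)⁻¹ •
    ((∑ i ∈ J, μ i) • toPlane (vec w K) - (∑ i ∈ K, μ i) • toPlane (vec w J))

theorem lineForm_meet_left (w : ι → ZLat) (μ : ι → ℝ) {J K : Finset ι}
    (h : skew (vec w J) (vec w K) ≠ 0) : lineForm w μ J (meet w μ J K) = 0 := by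
  have h' : ((skew (vec w J) (vec w K) : ℤ) : ℝ) ≠ 0 := by exact_mod_cast h
  rw [lineForm, meet, skewR_smul_right, skewR_sub_right, skewR_smul_right, skewR_smul_right,
    skewR_self, skewR_toPlane]
  field_simp
  ring

theorem lineForm_meet_right (w : ι → ZLat) (μ : ι → ℝ) {J K : Finset ι}
    (h : skew (vec w J) (vec w K) ≠ 0) : lineForm w μ K (meet w μ J K) = 0 := by
  have h' : ((skew (vec w J) (vec w K) : ℤ) : ℝ) ≠ 0 := by exact_mod_cast h
  rw [lineForm, meet, skewR_smul_right, skewR_sub_right, skewR_smul_right, skewR_smul_right,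
    skewR_self, skewR_toPlane, QTorus.skew_neg_swap (vec w J) (vec w K)]
  push_cast
  field_simp
  ring

/-- A point is determined by its pairings with two independent vectors. -/
theorem eq_of_skewR_eq {a b y z : Plane} (h : skewR a b ≠ 0) (ha : skewR a y = skewR a z)
    (hb : skewR b y = skewR b z) : y = z := by
  simp only [skewR] at *
  have h1 : (a.1 * b.2 - a.2 * b.1) * (y.1 - z.1) = 0 := by linear_combination b.1 * ha - a.1 * hb
  have h2 : (a.1 * b.2 - a.2 * b.1) * (y.2 - z.2) = 0 := by linear_combination b.2 * ha - a.2 * hb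
  ext
  · exact sub_eq_zero.1 ((mul_eq_zero.1 h1).resolve_left h)
  · exact sub_eq_zero.1 ((mul_eq_zero.1 h2).resolve_left h)

theorem eq_meet {w : ι → ZLat} {μ : ι → ℝ} {J K : Finset ι} {y : Plane}
    (h : skew (vec w J) (vec w K) ≠ 0) (hJ : lineForm w μ J y = 0) (hK : lineForm w μ K y = 0) :
    y = meet w μ J K := by
  refine eq_of_skewR_eq (a := toPlane (vec w J)) (b := toPlane (vec w K)) ?_ ?_ ?_
  · rw [skewR_toPlane]; exact_mod_cast h
  · have := lineForm_meet_left w μ h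
    unfold lineForm at *
    linarith
  · have := lineForm_meet_right w μ h
    unfold lineForm at *
    linarith

theorem lineForm_add_smul (w : ι → ZLat) (μ : ι → ℝ) (J : Finset ι) (y v : Plane) (c : ℝ) :
    lineForm w μ J (y + c • v) = lineForm w μ J y + c * skewR (toPlane (vec w J)) v := by
  rw [lineForm, lineForm, skewR_add_right, skewR_smul_right]
  ring

/-- The indicator function of a set of legs. -/
def ind (J : Finset ι) : ι →₀ ℕ := ∑ i ∈ J, Finsupp.single i 1

theorem ind_empty : ind (∅ : Finset ι) = 0 := rfl

theorem wt_ind (w : ι → ZLat) (J : Finset ι) : wt w (ind J) = vec w J := by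
  rw [ind, map_sum, vec]
  exact sum_congr rfl fun i _ => by rw [wt_single, one_smul]

/-- The additive function on the exponents that takes the value `lineForm w μ J y` at `J`. -/
def affSlope (w : ι → ZLat) (μ : ι → ℝ) (y : Plane) : (ι →₀ ℕ) →+ ℝ :=
  slope w y - (Finsupp.linearCombination ℕ μ).toAddMonoidHom

theorem affSlope_ind (w : ι → ZLat) (μ : ι → ℝ) (y : Plane) (J : Finset ι) :
    affSlope w μ y (ind J) = lineForm w μ J y := by
  change slope w y (ind J) - Finsupp.linearCombination ℕ μ (ind J) = _
  rw [slope_apply, wt_ind, lineForm, ind, map_sum]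
  congr 1
  exact sum_congr rfl fun i _ => by rw [Finsupp.linearCombination_single, one_smul]

variable [DecidableEq ι]

theorem vec_union (w : ι → ZLat) {J K : Finset ι} (h : Disjoint J K) :
    vec w (J ∪ K) = vec w J + vec w K := sum_union h

theorem lineForm_union (w : ι → ZLat) (μ : ι → ℝ) {J K : Finset ι} (h : Disjoint J K) (y : Plane) :
    lineForm w μ (J ∪ K) y = lineForm w μ J y + lineForm w μ K y := by
  rw [lineForm, vec_union w h, sum_union h, toPlane_add, skewR_add_left, lineForm, lineForm]
  ring

theorem skew_vec_sdiff (w : ι → ZLat) {J I : Finset ι} (h : J ⊆ I) :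
    skew (vec w J) (vec w (I \ J)) = skew (vec w J) (vec w I) := by
  have h1 : vec w I = vec w J + vec w (I \ J) := by
    rw [← vec_union w disjoint_sdiff, union_sdiff_of_subset h]
  rw [h1]
  simp only [skew, Prod.fst_add, Prod.snd_add]
  ring

namespace BTree

/-- The set of the labels of the leaves. -/
def supp : BTree ι → Finset ι
  | leaf i => {i}
  | node l r => supp l ∪ supp r

/-- For a point `y` on the line of the root edge of `t`: the point `y` lies on the root edge, i.e.
beyond the root vertex. -/
def After (w : ι → ZLat) (μ : ι → ℝ) : BTree ι → Plane → Prop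
  | leaf _, _ => True
  | node l _, y => 0 < lineForm w μ (supp l) y

/-- The tree is realized by a rational tropical curve with legs on the lines given by `μ`. -/
def Valid (w : ι → ZLat) (μ : ι → ℝ) : BTree ι → Prop
  | leaf _ => True
  | node l r => Valid w μ l ∧ Valid w μ r ∧ Disjoint (supp l) (supp r) ∧
      0 < skew (vec w (supp l)) (vec w (supp r)) ∧
      After w μ l (meet w μ (supp l) (supp r)) ∧ After w μ r (meet w μ (supp l) (supp r))

/-- The product of the commutator factors `q^{m/2} - q^{-m/2}` over the nodes and of
`(q^{1/2} - q^{-1/2})⁻¹` over the leaves. -/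
def weight (w : ι → ZLat) : BTree ι → LaurentField
  | leaf _ => (qDiff 1)⁻¹
  | node l r => (qPow (skew (vec w (supp l)) (vec w (supp r))) -
      qPow (-skew (vec w (supp l)) (vec w (supp r)))) * (weight w l * weight w r)

/-- The refined multiplicity of a tree. -/
def mult (w : ι → ZLat) : BTree ι → ℕ[T;T⁻¹]
  | leaf _ => 1
  | node l r => quantumInt (skew (vec w (supp l)) (vec w (supp r))).natAbs * (mult w l * mult w r)

theorem atQ_mult {w : ι → ZLat} {μ : ι → ℝ} {t : BTree ι} (ht : t.Valid w μ) :
    atQ (t.mult w) / qDiff 1 = t.weight w := by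
  have h1 : qDiff 1 ≠ 0 := qDiff_ne_zero one_ne_zero
  induction t with
  | leaf i =>
    simp [mult, weight, atQ]
  | node l r hl hr =>
    obtain ⟨vl, vr, -, hs, -, -⟩ := ht
    rw [mult, weight, ← hl vl, ← hr vr]
    have h2 := atQ_quantumInt (skew (vec w (supp l)) (vec w (supp r))).natAbs
    rw [Int.natAbs_of_nonneg hs.le] at h2
    rw [← h2]
    have h3 : ∀ a b : ℕ[T;T⁻¹], atQ (a * b) = atQ a * atQ b := fun a b => map_mul _ a b
    rw [h3, h3]
    field_simp

theorem supp_nonempty (t : BTree ι) : t.supp.Nonempty := by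
  induction t with
  | leaf i => exact singleton_nonempty i
  | node l r hl _ => exact hl.mono subset_union_left

theorem finite_valid (w : ι → ZLat) (μ : ι → ℝ) (I : Finset ι) :
    {t : BTree ι | t.Valid w μ ∧ t.supp = I}.Finite := by
  induction I using Finset.strongInduction with
  | H I ih =>
    have h1 : {t : BTree ι | t.Valid w μ ∧ t.supp = I} ⊆ (leaf '' (I : Set ι)) ∪
        ⋃ J ∈ {J | J ∈ I.powerset ∧ J ≠ ∅ ∧ J ≠ I},
          Set.image2 node {t : BTree ι | t.Valid w μ ∧ t.supp = J}
            {t : BTree ι | t.Valid w μ ∧ t.supp = I \ J} := by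
      rintro (i | ⟨l, r⟩) ⟨hv, rfl⟩
      · left
        exact ⟨i, by simp [supp], rfl⟩
      · right
        obtain ⟨vl, vr, hd, -, -, -⟩ := hv
        rw [Set.mem_iUnion₂]
        refine ⟨supp l, ⟨mem_powerset.2 subset_union_left, l.supp_nonempty.ne_empty, ?_⟩,
          l, ⟨vl, rfl⟩, r, ⟨vr, ?_⟩, rfl⟩
        · intro h
          have h2 : supp r ⊆ supp l := by
            intro a ha
            rw [h]
            exact mem_union_right _ ha
          exact r.supp_nonempty.ne_empty (disjoint_self.1 (hd.mono_left h2))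
        · change supp r = (supp l ∪ supp r) \ supp l
          rw [union_sdiff_left, sdiff_eq_self_of_disjoint hd.symm]
    refine Set.Finite.subset (Set.Finite.union (I.finite_toSet.image _) ?_) h1
    refine Set.Finite.biUnion (I.powerset.finite_toSet.subset fun J hJ => hJ.1) fun J hJ => ?_
    have h2 : J ⊂ I := ssubset_of_subset_of_ne (mem_powerset.1 hJ.1) hJ.2.2
    refine Set.Finite.image2 _ (ih J h2) (ih (I \ J) ?_)
    exact sdiff_ssubset h2.1 (nonempty_iff_ne_empty.2 hJ.2.1)

end BTree

open BTree

/-- The trees with leaves `I` realized by tropical curves. -/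
def validTrees (w : ι → ZLat) (μ : ι → ℝ) (I : Finset ι) : Finset (BTree ι) :=
  (finite_valid w μ I).toFinset

theorem mem_validTrees {w : ι → ZLat} {μ : ι → ℝ} {I : Finset ι} {t : BTree ι} :
    t ∈ validTrees w μ I ↔ t.Valid w μ ∧ t.supp = I := by
  rw [validTrees, Set.Finite.mem_toFinset]
  rfl

open Classical in
/-- The weighted number of the trees with leaves `I` whose root edge contains `y`. -/
def treeSum (w : ι → ZLat) (μ : ι → ℝ) (I : Finset ι) (y : Plane) : LaurentField :=
  ∑ t ∈ (validTrees w μ I).filter fun t => t.After w μ y, t.weight w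

theorem treeSum_singleton (w : ι → ZLat) (μ : ι → ℝ) (i : ι) (y : Plane) :
    treeSum w μ {i} y = (qDiff 1)⁻¹ := by
  classical
  have h1 : (validTrees w μ {i}).filter (fun t => t.After w μ y) = {leaf i} := by
    ext t
    rw [mem_filter, mem_validTrees, mem_singleton]
    constructor
    · rintro ⟨⟨hv, hs⟩, -⟩
      rcases t with j | ⟨l, r⟩
      · rw [supp, singleton_inj] at hs
        rw [hs]
      · exfalso
        have hl : supp l = {i} := (subset_singleton_iff.1 (hs ▸ subset_union_left)).resolve_left
          l.supp_nonempty.ne_empty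
        have hr : supp r = {i} := (subset_singleton_iff.1 (hs ▸ subset_union_right)).resolve_left
          r.supp_nonempty.ne_empty
        have hd := hv.2.2.1
        rw [hl, hr] at hd
        simp at hd
    · rintro rfl
      exact ⟨⟨trivial, rfl⟩, trivial⟩
  rw [treeSum, h1, sum_singleton, weight]

/-- The recursion for the weighted number of trees: cut a tree at its root vertex. -/
theorem treeSum_eq (w : ι → ZLat) (μ : ι → ℝ) {I : Finset ι} (hI : ∀ i, I ≠ {i}) (y : Plane) :
    treeSum w μ I y = ∑ J ∈ I.powerset.filter fun J =>
      0 < skew (vec w J) (vec w (I \ J)) ∧ 0 < lineForm w μ J y,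
        (qPow (skew (vec w J) (vec w (I \ J))) - qPow (-skew (vec w J) (vec w (I \ J)))) *
          (treeSum w μ J (meet w μ J (I \ J)) * treeSum w μ (I \ J) (meet w μ J (I \ J))) := by
  classical
  have e : ∀ J, (qPow (skew (vec w J) (vec w (I \ J))) - qPow (-skew (vec w J) (vec w (I \ J)))) *
      (treeSum w μ J (meet w μ J (I \ J)) * treeSum w μ (I \ J) (meet w μ J (I \ J))) =
      ∑ p ∈ ((validTrees w μ J).filter fun t => t.After w μ (meet w μ J (I \ J))) ×ˢ
        ((validTrees w μ (I \ J)).filter fun t => t.After w μ (meet w μ J (I \ J))),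
        (qPow (skew (vec w J) (vec w (I \ J))) - qPow (-skew (vec w J) (vec w (I \ J)))) *
          (p.1.weight w * p.2.weight w) := by
    intro J
    rw [treeSum, treeSum, sum_mul_sum, ← sum_product', mul_sum]
  rw [treeSum, sum_congr rfl fun J _ => e J, sum_sigma']
  symm
  refine sum_bij (fun p _ => node p.2.1 p.2.2) ?_ ?_ ?_ ?_
  · rintro ⟨J, l, r⟩ hp
    simp only [mem_sigma, mem_filter, mem_powerset, mem_product, mem_validTrees] at hp
    obtain ⟨⟨hJ, hs, hy⟩, ⟨⟨vl, rfl⟩, al⟩, ⟨vr, er⟩, ar⟩ := hp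
    rw [mem_filter, mem_validTrees]
    refine ⟨⟨⟨vl, vr, ?_, ?_, ?_, ?_⟩, ?_⟩, hy⟩
    · rw [er]; exact disjoint_sdiff
    · rw [er]; exact hs
    · rw [er]; exact al
    · rw [er]; exact ar
    · rw [supp, er, union_sdiff_of_subset hJ]
  · rintro ⟨J, l, r⟩ hp ⟨J', l', r'⟩ hp' h
    simp only [mem_sigma, mem_filter, mem_powerset, mem_product, mem_validTrees] at hp hp'
    obtain ⟨-, ⟨⟨-, rfl⟩, -⟩, -⟩ := hp
    obtain ⟨-, ⟨⟨-, rfl⟩, -⟩, -⟩ := hp'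
    injection h with h1 h2
    subst h1 h2
    rfl
  · intro t ht
    rw [mem_filter, mem_validTrees] at ht
    obtain ⟨⟨hv, rfl⟩, ha⟩ := ht
    rcases t with i | ⟨l, r⟩
    · exact absurd rfl (hI i)
    · obtain ⟨vl, vr, hd, hs, al, ar⟩ := hv
      have e : supp (node l r) \ supp l = supp r := by
        rw [supp, union_sdiff_left, sdiff_eq_self_of_disjoint hd.symm]
      refine ⟨⟨supp l, l, r⟩, ?_, rfl⟩
      simp only [mem_sigma, mem_filter, mem_powerset, mem_product, mem_validTrees, e]
      exact ⟨⟨subset_union_left, hs, ha⟩, ⟨⟨vl, trivial⟩, al⟩, ⟨vr, trivial⟩, ar⟩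
  · rintro ⟨J, l, r⟩ hp
    simp only [mem_sigma, mem_filter, mem_powerset, mem_product, mem_validTrees] at hp
    obtain ⟨⟨hJ, hs, hy⟩, ⟨⟨vl, rfl⟩, al⟩, ⟨vr, er⟩, ar⟩ := hp
    rw [weight, er]

/-- The lines of the subsets of the legs are in general position. -/
structure GenericLines (w : ι → ZLat) (μ : ι → ℝ) : Prop where
  skew_ne : ∀ J K : Finset ι, J.Nonempty → K.Nonempty → Disjoint J K → ∀ y,
    lineForm w μ J y = 0 → lineForm w μ K y = 0 → skew (vec w J) (vec w K) ≠ 0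
  no_triple : ∀ J K : Finset ι, J.Nonempty → K.Nonempty → Disjoint J K → ∀ J' ⊆ J ∪ K, ∀ y,
    lineForm w μ J y = 0 → lineForm w μ K y = 0 → lineForm w μ J' y = 0 →
      J' = ∅ ∨ J' = J ∨ J' = K ∨ J' = J ∪ K

theorem ind_apply (J : Finset ι) (i : ι) : ind J i = if i ∈ J then 1 else 0 := by
  rw [ind, Finsupp.finsetSum_apply]
  simp [Finsupp.single_apply]

theorem ind_union {J K : Finset ι} (h : Disjoint J K) : ind (J ∪ K) = ind J + ind K := sum_union h

theorem ind_le_ind {J K : Finset ι} : ind J ≤ ind K ↔ J ⊆ K := by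
  constructor
  · intro h i hi
    by_contra hK
    have := h i
    rw [ind_apply, ind_apply, if_pos hi, if_neg hK] at this
    omega
  · intro h i
    rw [ind_apply, ind_apply]
    split_ifs with h1 h2
    · exact le_rfl
    · exact absurd (h h1) h2
    · exact zero_le_one
    · exact le_rfl

theorem ind_injective : Function.Injective (ind : Finset ι → ι →₀ ℕ) := fun _ _ h =>
  subset_antisymm (ind_le_ind.1 h.le) (ind_le_ind.1 h.ge)

theorem exists_eq_ind {d : ι →₀ ℕ} {I : Finset ι} (h : d ≤ ind I) : ∃ J ⊆ I, d = ind J := by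
  refine ⟨d.support, ?_, ?_⟩
  · intro i hi
    by_contra hI
    have h1 := h i
    rw [ind_apply, if_neg hI] at h1
    exact Finsupp.mem_support_iff.1 hi (by omega)
  · ext i
    have h1 := h i
    rw [ind_apply] at h1 ⊢
    by_cases h2 : i ∈ d.support
    · rw [if_pos h2]
      have := Finsupp.mem_support_iff.1 h2
      split_ifs at h1 <;> omega
    · rw [if_neg h2]
      exact Finsupp.notMem_support_iff.1 h2

theorem ind_eq_zero {J : Finset ι} : ind J = 0 ↔ J = ∅ :=
  ⟨fun h => ind_injective (h.trans ind_empty.symm), fun h => h ▸ ind_empty⟩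

end Trees

/-! ### Tropical trees as coefficients of the walls -/


section WallCrossing

variable {ι : Type} [DecidableEq ι]

open MvPowerSeries (coeff)
open Filter Topology

/-- The coefficient at `I` of the middle factor at the point `y` of the displaced arrangement. -/
def wallCoeff (w : ι → ZLat) (μ : ι → ℝ) (g : MvPowerSeries ι QTorus) (I : Finset ι) (y : Plane) :
    QTorus :=
  coeff (ind I) (facPart (signOf (affSlope w μ y)) 0 g)

theorem signOf_affSlope_ind (w : ι → ZLat) (μ : ι → ℝ) (y : Plane) (J : Finset ι) :
    signOf (affSlope w μ y) (ind J) = SignType.sign (lineForm w μ J y) := by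
  rw [signOf, affSlope_ind]

theorem wallCoeff_congr {w : ι → ZLat} {μ : ι → ℝ} {g : MvPowerSeries ι QTorus} {I : Finset ι}
    {y y' : Plane}
    (h : ∀ J ⊆ I, SignType.sign (lineForm w μ J y) = SignType.sign (lineForm w μ J y')) :
    wallCoeff w μ g I y = wallCoeff w μ g I y' := by
  refine facPart_congr (fun _ _ => rfl) fun d hd => ?_
  obtain ⟨J, hJ, rfl⟩ := exists_eq_ind hd
  rw [signOf_affSlope_ind, signOf_affSlope_ind, h J hJ]

theorem lineForm_sdiff {w : ι → ZLat} {μ : ι → ℝ} {I J : Finset ι} (hJ : J ⊆ I) {y : Plane}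
    (hI : lineForm w μ I y = 0) : lineForm w μ (I \ J) y = -lineForm w μ J y := by
  have h := lineForm_union w μ (J := J) (K := I \ J) disjoint_sdiff y
  rw [union_sdiff_of_subset hJ, hI] at h
  linarith

theorem lineForm_line (w : ι → ZLat) (μ : ι → ℝ) {I J : Finset ι} (hJ : J ⊆ I) (y : Plane)
    (τ : ℝ) : lineForm w μ J (y + τ • toPlane (vec w I)) =
      lineForm w μ J y + τ * (skew (vec w J) (vec w (I \ J)) : ℤ) := by
  rw [lineForm_add_smul, skewR_toPlane, skew_vec_sdiff w hJ]

theorem lineForm_line_self (w : ι → ZLat) (μ : ι → ℝ) (I : Finset ι) (y : Plane)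
    (τ : ℝ) : lineForm w μ I (y + τ • toPlane (vec w I)) = lineForm w μ I y := by
  rw [lineForm_add_smul, skewR_self, mul_zero, add_zero]

/-- For parallel subsets the value of the affine form, constant along the line, does not vanish. -/
theorem GenericLines.lineForm_ne {w : ι → ZLat} {μ : ι → ℝ} (hgen : GenericLines w μ)
    {I J : Finset ι} (hJ : J ⊆ I) (hJ0 : J ≠ ∅) (hJI : J ≠ I) {y : Plane}
    (hI : lineForm w μ I y = 0) (hs : skew (vec w J) (vec w (I \ J)) = 0) :
    lineForm w μ J y ≠ 0 := by
  intro h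
  refine hgen.skew_ne J (I \ J) (nonempty_iff_ne_empty.2 hJ0) ?_ disjoint_sdiff y h ?_ hs
  · rw [sdiff_nonempty]
    exact fun h' => hJI (subset_antisymm hJ h')
  · rw [lineForm_sdiff hJ hI, h, neg_zero]

/-- A bound beyond which the signs of all affine forms along the line of `I` are asymptotic. -/
def farBound (w : ι → ZLat) (μ : ι → ℝ) (I : Finset ι) (y : Plane) : ℝ :=
  ∑ J ∈ I.powerset, |lineForm w μ J y| + 1

theorem farBound_pos (w : ι → ZLat) (μ : ι → ℝ) (I : Finset ι) (y : Plane) :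
    0 < farBound w μ I y := by
  unfold farBound
  have : 0 ≤ ∑ J ∈ I.powerset, |lineForm w μ J y| := sum_nonneg fun _ _ => abs_nonneg _
  linarith

theorem abs_lineForm_lt_farBound (w : ι → ZLat) (μ : ι → ℝ) {I J : Finset ι} (hJ : J ⊆ I)
    (y : Plane) : |lineForm w μ J y| < farBound w μ I y := by
  unfold farBound
  have := single_le_sum (f := fun J => |lineForm w μ J y|) (fun _ _ => abs_nonneg _)
    (mem_powerset.2 hJ)
  linarith

theorem lineForm_far_pos {w : ι → ZLat} {μ : ι → ℝ} {I J : Finset ι} (hJ : J ⊆ I) {y : Plane}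
    {τ : ℝ} (hτ : farBound w μ I y ≤ τ) (hs : 0 < skew (vec w J) (vec w (I \ J))) :
    0 < lineForm w μ J (y + τ • toPlane (vec w I)) := by
  rw [lineForm_line w μ hJ]
  have h1 := abs_lineForm_lt_farBound w μ hJ y
  have h2 : (1 : ℝ) ≤ (skew (vec w J) (vec w (I \ J)) : ℤ) := by exact_mod_cast hs
  have h3 := neg_abs_le (lineForm w μ J y)
  have h4 := farBound_pos w μ I y
  nlinarith

theorem lineForm_far_neg {w : ι → ZLat} {μ : ι → ℝ} {I J : Finset ι} (hJ : J ⊆ I) {y : Plane}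
    {τ : ℝ} (hτ : farBound w μ I y ≤ τ) (hs : skew (vec w J) (vec w (I \ J)) < 0) :
    lineForm w μ J (y + τ • toPlane (vec w I)) < 0 := by
  rw [lineForm_line w μ hJ]
  have h1 := abs_lineForm_lt_farBound w μ hJ y
  have h2 : ((skew (vec w J) (vec w (I \ J)) : ℤ) : ℝ) ≤ -1 := by
    have : skew (vec w J) (vec w (I \ J)) ≤ -1 := by omega
    exact_mod_cast this
  have h3 := le_abs_self (lineForm w μ J y)
  have h4 := farBound_pos w μ I y
  nlinarith

theorem lineForm_far_pos' {w : ι → ZLat} {μ : ι → ℝ} {I J : Finset ι} (hJ : J ⊆ I) {y : Plane}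
    {τ : ℝ} (hτ : farBound w μ I y ≤ τ) (hs : skew (vec w J) (vec w (I \ J)) < 0) :
    0 < lineForm w μ J (y + (-τ) • toPlane (vec w I)) := by
  rw [lineForm_line w μ hJ]
  have h1 := abs_lineForm_lt_farBound w μ hJ y
  have h2 : ((skew (vec w J) (vec w (I \ J)) : ℤ) : ℝ) ≤ -1 := by
    have : skew (vec w J) (vec w (I \ J)) ≤ -1 := by omega
    exact_mod_cast this
  have h3 := neg_abs_le (lineForm w μ J y)
  have h4 := farBound_pos w μ I y
  nlinarith

theorem lineForm_far_neg' {w : ι → ZLat} {μ : ι → ℝ} {I J : Finset ι} (hJ : J ⊆ I) {y : Plane}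
    {τ : ℝ} (hτ : farBound w μ I y ≤ τ) (hs : 0 < skew (vec w J) (vec w (I \ J))) :
    lineForm w μ J (y + (-τ) • toPlane (vec w I)) < 0 := by
  rw [lineForm_line w μ hJ]
  have h1 := abs_lineForm_lt_farBound w μ hJ y
  have h2 : (1 : ℝ) ≤ (skew (vec w J) (vec w (I \ J)) : ℤ) := by exact_mod_cast hs
  have h3 := le_abs_self (lineForm w μ J y)
  have h4 := farBound_pos w μ I y
  nlinarith

theorem wallCoeff_eq_wallLog {w : ι → ZLat} {μ : ι → ℝ} {g : MvPowerSeries ι QTorus}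
    (hg : g ∈ (homGrading w).sub) (hg0 : coeff 0 g = 1) {I : Finset ι} (hI : I ≠ ∅)
    {y v : Plane} (hv : v ≠ 0) (hIy : lineForm w μ I y = 0)
    (hs : ∀ J ⊆ I, slope w v (ind J) ≠ 0 →
      SignType.sign (lineForm w μ J y) = SignType.sign (slope w v (ind J)))
    (hne : ∀ J ⊆ I, J ≠ ∅ → J ≠ I → slope w v (ind J) = 0 → lineForm w μ J y ≠ 0) :
    wallCoeff w μ g I y = coeff (ind I) (wallLog w g v) := by
  rw [← coeff_facPart_lexSign_slope hg hg0 hv (affSlope w μ y) (e := ind I)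
    (fun h => hI (ind_eq_zero.1 h)) (by rw [affSlope_ind, hIy])]
  · refine facPart_congr (fun _ _ => rfl) fun d hd => ?_
    obtain ⟨J, hJ, rfl⟩ := exists_eq_ind hd
    rw [signOf_affSlope_ind, lexSign]
    split_ifs with h
    · exact hs J hJ h
    · rw [affSlope_ind]
  · intro d hd hd0 hd1
    obtain ⟨J, hJ, rfl⟩ := exists_eq_ind hd.le
    rw [affSlope_ind]
    exact hne J hJ (fun h => hd0 (ind_eq_zero.2 h)) (fun h => hd.ne (by rw [h])) hd1

theorem slope_vec (w : ι → ZLat) {I J : Finset ι} (hJ : J ⊆ I) :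
    slope w (toPlane (vec w I)) (ind J) = (skew (vec w J) (vec w (I \ J)) : ℤ) := by
  rw [slope_apply, wt_ind, skewR_toPlane, skew_vec_sdiff w hJ]

theorem lineForm_line_ne_of_skew_eq_zero {w : ι → ZLat} {μ : ι → ℝ} (hgen : GenericLines w μ)
    {I J : Finset ι} (hJ : J ⊆ I) (hJ0 : J ≠ ∅) (hJI : J ≠ I) {y : Plane}
    (hIy : lineForm w μ I y = 0) (hs : skew (vec w J) (vec w (I \ J)) = 0) (τ : ℝ) :
    lineForm w μ J (y + τ • toPlane (vec w I)) ≠ 0 :=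
  hgen.lineForm_ne hJ hJ0 hJI (by rw [lineForm_line_self, hIy]) hs

/-- Far along the root edge, the coefficient is the one of the outgoing wall. -/
theorem wallCoeff_far {w : ι → ZLat} {μ : ι → ℝ} (hgen : GenericLines w μ)
    {g : MvPowerSeries ι QTorus}
    (hg : g ∈ (homGrading w).sub) (hg0 : coeff 0 g = 1) {I : Finset ι} (hI : I ≠ ∅)
    (hvI : vec w I ≠ 0) {y : Plane} (hIy : lineForm w μ I y = 0) {τ : ℝ}
    (hτ : farBound w μ I y ≤ τ) :
    wallCoeff w μ g I (y + τ • toPlane (vec w I)) =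
      coeff (ind I) (wallLog w g (toPlane (vec w I))) := by
  refine wallCoeff_eq_wallLog hg hg0 hI (fun h => hvI (toPlane_eq_zero.1 h))
    (by rw [lineForm_line_self, hIy]) (fun J hJ h => ?_) fun J hJ hJ0 hJI h => ?_
  · rw [slope_vec w hJ] at h ⊢
    rcases lt_or_gt_of_ne (show skew (vec w J) (vec w (I \ J)) ≠ 0 by exact_mod_cast h) with h1 | h1
    · rw [sign_neg (lineForm_far_neg hJ hτ h1), sign_neg (by exact_mod_cast h1)]
    · rw [sign_pos (lineForm_far_pos hJ hτ h1), sign_pos (by exact_mod_cast h1)]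
  · rw [slope_vec w hJ] at h
    exact lineForm_line_ne_of_skew_eq_zero hgen hJ hJ0 hJI hIy (by exact_mod_cast h) τ

/-- Far before the root vertex, the coefficient is the one of the incoming wall. -/
theorem wallCoeff_far_neg {w : ι → ZLat} {μ : ι → ℝ} (hgen : GenericLines w μ)
    {g : MvPowerSeries ι QTorus}
    (hg : g ∈ (homGrading w).sub) (hg0 : coeff 0 g = 1) {I : Finset ι} (hI : I ≠ ∅)
    (hvI : vec w I ≠ 0) {y : Plane} (hIy : lineForm w μ I y = 0) {τ : ℝ}
    (hτ : farBound w μ I y ≤ τ) :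
    wallCoeff w μ g I (y + (-τ) • toPlane (vec w I)) =
      coeff (ind I) (wallLog w g (-toPlane (vec w I))) := by
  have hsl : ∀ J ⊆ I, slope w (-toPlane (vec w I)) (ind J) =
      -((skew (vec w J) (vec w (I \ J)) : ℤ) : ℝ) := by
    intro J hJ
    rw [← slope_vec w hJ, slope_apply, skewR_neg_right, slope_apply]
  refine wallCoeff_eq_wallLog hg hg0 hI (fun h => hvI (toPlane_eq_zero.1 (neg_eq_zero.1 h)))
    (by rw [lineForm_line_self, hIy]) (fun J hJ h => ?_) fun J hJ hJ0 hJI h => ?_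
  · rw [hsl J hJ] at h ⊢
    rw [neg_ne_zero] at h
    rcases lt_or_gt_of_ne (show skew (vec w J) (vec w (I \ J)) ≠ 0 by exact_mod_cast h) with h1 | h1
    · rw [sign_pos (lineForm_far_pos' hJ hτ h1), sign_pos (neg_pos.2 (by exact_mod_cast h1))]
    · rw [sign_neg (lineForm_far_neg' hJ hτ h1), sign_neg (neg_neg_of_pos (by exact_mod_cast h1))]
  · rw [hsl J hJ, neg_eq_zero] at h
    exact lineForm_line_ne_of_skew_eq_zero hgen hJ hJ0 hJI hIy (by exact_mod_cast h) (-τ)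

/-- The sign of a continuous function is locally constant where the function does not vanish. -/
theorem eventually_sign_eq {X : Type*} [TopologicalSpace X] {f : X → ℝ} {x : X}
    (hf : ContinuousAt f x) (hx : f x ≠ 0) :
    ∀ᶠ x' in 𝓝 x, SignType.sign (f x') = SignType.sign (f x) := by
  rcases lt_or_gt_of_ne hx with h | h
  · filter_upwards [hf.eventually (eventually_lt_nhds h)] with x' hx'
    rw [sign_neg h, sign_neg hx']
  · filter_upwards [hf.eventually (eventually_gt_nhds h)] with x' hx'
    rw [sign_pos h, sign_pos hx']

/-- The weight with which the jump at the wall of `J` is counted: the full jump beyond the wall,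
and the part of it that is already present on the wall itself. -/
def jumpFactor (s : ℤ) (a : ℝ) : LaurentField :=
  if 0 < a then qPow s - qPow (-s) else if a = 0 then qPow s else 0

theorem jumpFactor_congr {s : ℤ} {a b : ℝ} (h : SignType.sign a = SignType.sign b) :
    jumpFactor s a = jumpFactor s b := by
  rcases lt_trichotomy a 0 with ha | ha | ha
  · rw [sign_neg ha, eq_comm, sign_eq_neg_one_iff] at h
    rw [jumpFactor, jumpFactor, if_neg ha.not_gt, if_neg ha.ne, if_neg h.not_gt, if_neg h.ne]
  · rw [ha, sign_zero, eq_comm, sign_eq_zero_iff] at h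
    rw [ha, h]
  · rw [sign_pos ha, eq_comm, sign_eq_one_iff] at h
    rw [jumpFactor, jumpFactor, if_pos ha, if_pos h]

/-- At a point where exactly the walls of `J` and `I \ J` meet, the coefficient at `I` jumps by a
commutator. -/
theorem wallCoeff_jump {w : ι → ZLat} {μ : ι → ℝ} (hgen : GenericLines w μ)
    {g : MvPowerSeries ι QTorus} (hg0 : coeff 0 g = 1) {I J K : Finset ι}
    (hJ : J.Nonempty) (hK : K.Nonempty) (hd : Disjoint J K) (hI : J ∪ K = I) {y y' : Plane}
    (hJy : lineForm w μ J y = 0) (hKy : lineForm w μ K y = 0)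
    (hIy' : lineForm w μ I y' = 0) (hJy' : 0 < lineForm w μ J y')
    (hsign : ∀ J' ⊆ I, lineForm w μ J' y ≠ 0 →
      SignType.sign (lineForm w μ J' y') = SignType.sign (lineForm w μ J' y)) :
    wallCoeff w μ g I y' = wallCoeff w μ g I y - wallCoeff w μ g K y * wallCoeff w μ g J y := by
  have hKy' : lineForm w μ K y' = -lineForm w μ J y' := by
    have h := lineForm_union w μ hd y'
    rw [hI, hIy'] at h
    linarith
  have hnot : ∀ A B : Finset ι, A.Nonempty → Disjoint A B → ¬ ind A ≤ ind B := by
    intro A B hA hAB h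
    exact hA.ne_empty (disjoint_self.1 (hAB.mono_right (ind_le_ind.1 h)))
  have h1 := coeff_facPart_lexSign LaurentField (affSlope w μ y) (affSlope w μ y') hg0
    (a := ind J) (b := ind K) (e := ind I) (by rw [← ind_union hd, hI]) (hnot J K hJ hd)
    (hnot K J hK hd.symm) (by
      intro d hd' h0
      obtain ⟨J', hJ', rfl⟩ := exists_eq_ind hd'
      rw [affSlope_ind] at h0
      rcases hgen.no_triple J K hJ hK hd J' (by rw [hI]; exact hJ') y hJy hKy h0 with h | h | h | h
      · left; rw [h]; rfl
      · right; left; rw [h]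
      · right; right; left; rw [h]
      · right; right; right; rw [h, hI]) (by rw [affSlope_ind]; exact hJy')
    (by rw [affSlope_ind, hKy']; linarith) (by rw [affSlope_ind, hIy'])
  rw [wallCoeff, wallCoeff, wallCoeff, wallCoeff, ← h1]
  refine facPart_congr (fun _ _ => rfl) fun d hd' => ?_
  obtain ⟨J', hJ', rfl⟩ := exists_eq_ind hd'
  rw [signOf_affSlope_ind, lexSign, affSlope_ind, affSlope_ind]
  split_ifs with h
  · exact hsign J' hJ' h
  · rfl

/-- The coefficient at `I` of the wall of a displaced arrangement counts the trees with leaves `I`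
whose root edge passes through the given point. Both sides vanish (or are the initial value) far
before the first vertex, and both have the same jumps along the line of `I`. -/
theorem wallCoeff_eq_treeSum {w : ι → ZLat} {μ : ι → ℝ} (hgen : GenericLines w μ)
    {g : MvPowerSeries ι QTorus} (hg : g ∈ (homGrading w).sub) (hg0 : coeff 0 g = 1)
    (hin : ∀ I : Finset ι, I ≠ ∅ → vec w I ≠ 0 →
      coeff (ind I) (wallLog w g (-toPlane (vec w I))) =
        (if I.card = 1 then (qDiff 1)⁻¹ else 0 : LaurentField) • QTorus.zhat (vec w I))
    (I : Finset ι) :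
    ∀ (_ : I ≠ ∅) (_ : vec w I ≠ 0) (y : Plane) (_ : lineForm w μ I y = 0)
      (_ : ∀ J ⊆ I, J ≠ ∅ → J ≠ I → lineForm w μ J y ≠ 0),
      wallCoeff w μ g I y = treeSum w μ I y • QTorus.zhat (vec w I) := by
  induction I using Finset.strongInduction with
  | H I ih =>
  intro hI hvI y hIy hne
  -- The point moves along the line of `I`. The coefficient of the wall jumps where the lines of some
  -- `J ⊆ I` and of `I \ J` cross; `F` is the coefficient without these jumps.
  let Y : ℝ → Plane := fun τ => y + τ • toPlane (vec w I)
  have hYI : ∀ τ, lineForm w μ I (Y τ) = 0 := fun τ => by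
    simp only [Y]; rw [lineForm_line_self, hIy]
  let s : Finset ι → ℤ := fun J => skew (vec w J) (vec w (I \ J))
  have hY : ∀ J ⊆ I, ∀ τ, lineForm w μ J (Y τ) = lineForm w μ J y + τ * (s J : ℝ) :=
    fun J hJ τ => lineForm_line w μ hJ y τ
  have hcont : ∀ J ⊆ I, Continuous fun τ => lineForm w μ J (Y τ) := by
    intro J hJ
    simp only [hY J hJ]
    fun_prop
  let κ : Finset ι → LaurentField := fun J =>
    treeSum w μ J (meet w μ J (I \ J)) * treeSum w μ (I \ J) (meet w μ J (I \ J))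
  let S := I.powerset.filter fun J => 0 < s J
  let F : ℝ → QTorus := fun τ => wallCoeff w μ g I (Y τ) -
    (∑ J ∈ S, jumpFactor (s J) (lineForm w μ J (Y τ)) * κ J) • QTorus.zhat (vec w I)
  have hloc : IsLocallyConstant F := by
    rw [IsLocallyConstant.iff_eventually_eq]
    intro τ₀
    have hev : ∀ᶠ τ in 𝓝 τ₀, ∀ J ∈ I.powerset, lineForm w μ J (Y τ₀) ≠ 0 →
        SignType.sign (lineForm w μ J (Y τ)) = SignType.sign (lineForm w μ J (Y τ₀)) := by
      rw [Filter.eventually_all_finset]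
      intro J hJ
      by_cases h : lineForm w μ J (Y τ₀) = 0
      · exact Eventually.of_forall fun τ h' => absurd h h'
      · filter_upwards [eventually_sign_eq (hcont J (mem_powerset.1 hJ)).continuousAt h] with τ hτ _
        exact hτ
    filter_upwards [hev] with τ hτ
    by_cases hex : ∃ J ⊆ I, J ≠ ∅ ∧ J ≠ I ∧ lineForm w μ J (Y τ₀) = 0
    · -- a vertex with branches `J` and `I \ J` at the time `τ₀`
      have hex' : ∃ J ⊆ I, J ≠ ∅ ∧ J ≠ I ∧ lineForm w μ J (Y τ₀) = 0 ∧ 0 < s J := by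
        obtain ⟨J, hJ, hJ0, hJI, hJy⟩ := hex
        have hs0 : s J ≠ 0 := fun h0 => hgen.lineForm_ne hJ hJ0 hJI (hYI τ₀) h0 hJy
        rcases lt_or_gt_of_ne hs0 with h | h
        · refine ⟨I \ J, sdiff_subset, ?_, ?_, ?_, ?_⟩
          · rw [Ne, sdiff_eq_empty_iff_subset]
            exact fun h' => hJI (subset_antisymm hJ h')
          · intro h'
            have : Disjoint I J := sdiff_eq_self_iff_disjoint.1 h'
            exact hJ0 (disjoint_self.1 (this.mono_left hJ))
          · rw [lineForm_sdiff hJ (hYI τ₀), hJy, neg_zero]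
          · simp only [s] at h ⊢
            rw [Finset.sdiff_sdiff_eq_self hJ, QTorus.skew_neg_swap]
            omega
        · exact ⟨J, hJ, hJ0, hJI, hJy, h⟩
      obtain ⟨J, hJ, hJ0, hJI, hJy, hsJ⟩ := hex'
      have hKy : lineForm w μ (I \ J) (Y τ₀) = 0 := by
        rw [lineForm_sdiff hJ (hYI τ₀), hJy, neg_zero]
      have hJne : J.Nonempty := nonempty_iff_ne_empty.2 hJ0
      have hKne : (I \ J).Nonempty := by
        rw [sdiff_nonempty]; exact fun h' => hJI (subset_antisymm hJ h')
      have hun : J ∪ I \ J = I := union_sdiff_of_subset hJ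
      have hun' : I \ J ∪ J = I := by rw [union_comm]; exact hun
      have hmeet : Y τ₀ = meet w μ J (I \ J) := eq_meet hsJ.ne' hJy hKy
      have hvJ : vec w J ≠ 0 := by
        intro h; simp only [s] at hsJ; rw [h] at hsJ; simp [skew] at hsJ
      have hvK : vec w (I \ J) ≠ 0 := by
        intro h; simp only [s] at hsJ; rw [h] at hsJ; simp [skew] at hsJ
      have hJss : J ⊂ I := ssubset_of_subset_of_ne hJ hJI
      have hKss : I \ J ⊂ I := sdiff_ssubset hJ hJne
      -- No other subset of `I` has a line through this point, so that the coefficients at `J` and `I \ J`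
      -- are known there by induction.
      have htriple := fun J' (hJ' : J' ⊆ I) => hgen.no_triple J (I \ J) hJne hKne disjoint_sdiff J'
        (by rw [hun]; exact hJ') (Y τ₀) hJy hKy
      have hdisj : ∀ A : Finset ι, A ⊆ J → A ⊆ I \ J → A = ∅ := fun A h1 h2 =>
        disjoint_self.1 ((disjoint_sdiff (s := J) (t := I)).mono h1 h2)
      have hZJ := ih J hJss hJ0 hvJ (Y τ₀) hJy (by
        intro J' hJ' h1 h2 h3
        rcases htriple J' (hJ'.trans hJ) h3 with h | h | h | h
        · exact h1 h
        · exact h2 h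
        · exact h1 (hdisj J' hJ' h.le)
        · rw [hun] at h
          exact hJI (subset_antisymm hJ (h ▸ hJ')))
      have hZK := ih (I \ J) hKss hKne.ne_empty hvK (Y τ₀) hKy (by
        intro J' hJ' h1 h2 h3
        rcases htriple J' (hJ'.trans sdiff_subset) h3 with h | h | h | h
        · exact h1 h
        · exact h1 (hdisj J' h.le hJ')
        · exact h2 h
        · rw [hun] at h
          exact hKss.ne (subset_antisymm sdiff_subset (h ▸ hJ')))
      rw [hmeet] at hZJ hZK
      have hother : ∀ J' ∈ S, J' ≠ J → lineForm w μ J' (Y τ₀) ≠ 0 := by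
        intro J' hJ' hne' h0
        obtain ⟨h1, h2⟩ := mem_filter.1 hJ'
        rcases htriple J' (mem_powerset.1 h1) h0 with h | h | h | h
        · rw [h] at h2; simp [s, vec, skew] at h2
        · exact hne' h
        · rw [h] at h2
          simp only [s] at h2 hsJ
          rw [Finset.sdiff_sdiff_eq_self hJ, QTorus.skew_neg_swap] at h2
          omega
        · rw [hun] at h
          rw [h] at h2; simp [s, vec, skew] at h2
      have hJS : J ∈ S := mem_filter.2 ⟨mem_powerset.2 hJ, hsJ⟩
      have hsum : ∀ σ : ℝ, (∀ J' ∈ I.powerset, lineForm w μ J' (Y τ₀) ≠ 0 →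
          SignType.sign (lineForm w μ J' (Y σ)) = SignType.sign (lineForm w μ J' (Y τ₀))) →
          ∑ J ∈ S, jumpFactor (s J) (lineForm w μ J (Y σ)) * κ J =
            jumpFactor (s J) (lineForm w μ J (Y σ)) * κ J +
            ∑ J ∈ S.erase J, jumpFactor (s J) (lineForm w μ J (Y τ₀)) * κ J := by
        intro σ hσ
        rw [← add_sum_erase S _ hJS]
        congr 1
        refine sum_congr rfl fun J' hJ' => ?_
        obtain ⟨h1, h2⟩ := mem_erase.1 hJ'
        rw [jumpFactor_congr (hσ J' (mem_filter.1 h2).1 (hother J' h2 h1))]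
      -- The two orders of multiplication differ by a commutator, which gives the factor
      -- `q^{m/2} - q^{-m/2}` of the new vertex.
      have hprod1 : wallCoeff w μ g J (Y τ₀) * wallCoeff w μ g (I \ J) (Y τ₀) =
          (qPow (s J) * κ J) • QTorus.zhat (vec w I) := by
        rw [hmeet, hZJ, hZK, smul_mul_smul_comm, QTorus.zhat_mul_zhat, smul_smul,
          ← vec_union w disjoint_sdiff, hun, mul_comm]
      have hprod2 : wallCoeff w μ g (I \ J) (Y τ₀) * wallCoeff w μ g J (Y τ₀) =
          (qPow (-s J) * κ J) • QTorus.zhat (vec w I) := by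
        rw [hmeet, hZJ, hZK, smul_mul_smul_comm, QTorus.zhat_mul_zhat, smul_smul,
          ← vec_union w sdiff_disjoint, hun', QTorus.skew_neg_swap (vec w J)]
        congr 1
        simp only [s, κ]
        ring
      simp only [F]
      rw [hsum τ (fun J' hJ' h => hτ J' hJ' h), hsum τ₀ fun _ _ _ => rfl, hJy]
      have hlin : lineForm w μ J (Y τ) = (τ - τ₀) * (s J : ℝ) := by
        have h1 := hY J hJ τ
        have h2 := hY J hJ τ₀
        rw [hJy] at h2
        rw [h1]; linarith
      have hsR : (0 : ℝ) < s J := by exact_mod_cast hsJ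
      rcases lt_trichotomy τ τ₀ with hlt | heq | hgt
      · have hneg : lineForm w μ J (Y τ) < 0 := by
          rw [hlin]; exact mul_neg_of_neg_of_pos (by linarith) hsR
        have hKpos : 0 < lineForm w μ (I \ J) (Y τ) := by
          rw [lineForm_sdiff hJ (hYI τ)]; linarith
        have hj := wallCoeff_jump hgen hg0 hKne hJne sdiff_disjoint hun' hKy hJy (hYI τ) hKpos
          fun J' hJ' h => hτ J' (mem_powerset.2 hJ') h
        rw [hj, hprod1, jumpFactor, if_neg hneg.not_gt, if_neg hneg.ne, jumpFactor,
          if_neg (lt_irrefl _), if_pos rfl, sub_sub, ← add_smul]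
        congr 2
        ring
      · rw [heq, hJy]
      · have hpos : 0 < lineForm w μ J (Y τ) := by
          rw [hlin]; exact mul_pos (by linarith) hsR
        have hj := wallCoeff_jump hgen hg0 hJne hKne disjoint_sdiff hun hJy hKy (hYI τ) hpos
          fun J' hJ' h => hτ J' (mem_powerset.2 hJ') h
        rw [hj, hprod2, jumpFactor, if_pos hpos, jumpFactor,
          if_neg (lt_irrefl _), if_pos rfl, sub_sub, ← add_smul]
        congr 2
        ring
    -- No line of a proper subset of `I` passes through the point: the coefficient is constant nearby.
    · push Not at hex
      have hall : ∀ J ⊆ I, SignType.sign (lineForm w μ J (Y τ)) =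
          SignType.sign (lineForm w μ J (Y τ₀)) := by
        intro J hJ
        by_cases h1 : J = ∅
        · rw [h1]; simp [lineForm, vec, toPlane_zero, skewR_zero_left]
        by_cases h2 : J = I
        · rw [h2, hYI, hYI]
        · exact hτ J (mem_powerset.2 hJ) (hex J hJ (nonempty_iff_ne_empty.2 h1) h2)
      simp only [F]
      rw [wallCoeff_congr hall]
      congr 2
      refine sum_congr rfl fun J hJ => ?_
      rw [jumpFactor_congr (hall J (mem_powerset.1 (mem_filter.1 hJ).1))]
  -- Far away on the incoming side the wall is the incoming wall of `g` in the direction of `I`, and no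
  -- tree of leaves `I` has a root there.
  have hF : F 0 = F (-farBound w μ I y) := hloc.apply_eq_of_preconnectedSpace _ _
  have hF1 : F (-farBound w μ I y) =
      (if I.card = 1 then (qDiff 1)⁻¹ else 0 : LaurentField) • QTorus.zhat (vec w I) := by
    simp only [F]
    have h0 : ∑ J ∈ S, jumpFactor (s J) (lineForm w μ J (Y (-farBound w μ I y))) * κ J =
        (0 : LaurentField) := by
      refine sum_eq_zero fun J hJ => ?_
      obtain ⟨h1, h2⟩ := mem_filter.1 hJ
      have h3 := lineForm_far_neg' (mem_powerset.1 h1) (le_refl (farBound w μ I y)) h2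
      simp only [Y]
      rw [jumpFactor, if_neg h3.not_gt, if_neg h3.ne, zero_mul]
    rw [h0]
    have h00 : (0 : LaurentField) • QTorus.zhat (vec w I) = 0 :=
      zero_smul LaurentField (QTorus.zhat (vec w I))
    refine (congrArg (wallCoeff w μ g I (Y (-farBound w μ I y)) - ·) h00).trans ?_
    rw [sub_zero]
    simp only [Y]
    rw [wallCoeff_far_neg hgen hg hg0 hI hvI hIy le_rfl, hin I hI hvI]
  have hY0 : Y 0 = y := by simp [Y]
  rw [hF1] at hF
  simp only [F] at hF
  rw [hY0, sub_eq_iff_eq_add, ← add_smul] at hF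
  rw [hF]
  congr 1
  by_cases hsing : I.card = 1
  · obtain ⟨i, rfl⟩ := card_eq_one.1 hsing
    rw [if_pos (card_singleton i), treeSum_singleton, sum_eq_zero, add_zero]
    intro J hJ
    obtain ⟨h1, h2⟩ := mem_filter.1 hJ
    exfalso
    rcases subset_singleton_iff.1 (mem_powerset.1 h1) with h | h
    · rw [h] at h2; simp [s, vec, skew] at h2
    · rw [h] at h2; simp [s, vec, skew] at h2
  · rw [if_neg hsing, zero_add, treeSum_eq w μ (fun i h => hsing (card_eq_one.2 ⟨i, h⟩))]
    have hfil : (I.powerset.filter fun J => 0 < skew (vec w J) (vec w (I \ J)) ∧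
        0 < lineForm w μ J y) = S.filter fun J => 0 < lineForm w μ J y := by
      simp only [S, s]
      rw [filter_filter]
    rw [hfil]
    refine Eq.trans ?_ (sum_filter _ _).symm
    refine sum_congr rfl fun J hJ => ?_
    obtain ⟨h1, h2⟩ := mem_filter.1 hJ
    have h3 : lineForm w μ J y ≠ 0 := by
      refine hne J (mem_powerset.1 h1) ?_ ?_
      · rintro rfl; simp [s, vec, skew] at h2
      · rintro rfl; simp [s, vec, skew] at h2
    by_cases h4 : 0 < lineForm w μ J y
    · rw [jumpFactor, if_pos h4, if_pos h4]
    · rw [jumpFactor, if_neg h4, if_neg h3, if_neg h4, zero_mul]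

open Classical in
/-- The outgoing wall in the direction `w_I` counts all the trees with leaves `I`. -/
theorem coeff_wallLog_eq_sum {w : ι → ZLat} {μ : ι → ℝ} (hgen : GenericLines w μ)
    {g : MvPowerSeries ι QTorus} (hg : g ∈ (homGrading w).sub) (hg0 : coeff 0 g = 1)
    (hin : ∀ I : Finset ι, I ≠ ∅ → vec w I ≠ 0 →
      coeff (ind I) (wallLog w g (-toPlane (vec w I))) =
        (if I.card = 1 then (qDiff 1)⁻¹ else 0 : LaurentField) • QTorus.zhat (vec w I))
    {I : Finset ι} (hI : I ≠ ∅) (hvI : vec w I ≠ 0) :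
    coeff (ind I) (wallLog w g (toPlane (vec w I))) =
      (∑ t ∈ validTrees w μ I, t.weight w) • QTorus.zhat (vec w I) := by
  obtain ⟨y, hy⟩ : ∃ y, lineForm w μ I y = 0 := by
    have hn : (vec w I).1 ^ 2 + (vec w I).2 ^ 2 ≠ 0 := by
      intro h
      apply hvI
      have h1 : (vec w I).1 = 0 := by nlinarith [sq_nonneg (vec w I).1, sq_nonneg (vec w I).2]
      have h2 : (vec w I).2 = 0 := by nlinarith [sq_nonneg (vec w I).1, sq_nonneg (vec w I).2]
      exact Prod.ext h1 h2
    have hn' : ((vec w I).1 : ℝ) ^ 2 + ((vec w I).2 : ℝ) ^ 2 ≠ 0 := by exact_mod_cast hn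
    refine ⟨((∑ i ∈ I, μ i) / (((vec w I).1 : ℝ) ^ 2 + ((vec w I).2 : ℝ) ^ 2)) •
      (-((vec w I).2 : ℝ), ((vec w I).1 : ℝ)), ?_⟩
    rw [lineForm, skewR_smul_right]
    simp only [skewR, toPlane]
    field_simp
    ring
  set τ := farBound w μ I y
  have h1 := wallCoeff_far hgen hg hg0 hI hvI hy (le_refl τ)
  have hfar : ∀ J ⊆ I, J ≠ ∅ → J ≠ I →
      lineForm w μ J (y + τ • toPlane (vec w I)) ≠ 0 := by
    intro J hJ hJ0 hJI
    rcases lt_trichotomy (skew (vec w J) (vec w (I \ J))) 0 with h | h | h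
    · exact (lineForm_far_neg hJ le_rfl h).ne
    · exact lineForm_line_ne_of_skew_eq_zero hgen hJ hJ0 hJI hy h τ
    · exact (lineForm_far_pos hJ le_rfl h).ne'
  have h2 := wallCoeff_eq_treeSum hgen hg hg0 hin I hI hvI (y + τ • toPlane (vec w I))
    (by rw [lineForm_line_self, hy]) hfar
  rw [← h1, h2, treeSum, filter_true_of_mem]
  intro t ht
  obtain ⟨hv, rfl⟩ := mem_validTrees.1 ht
  rcases t with i | ⟨l, r⟩
  · trivial
  · obtain ⟨-, -, hd, hs, -, -⟩ := hv
    change 0 < lineForm w μ l.supp _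
    refine lineForm_far_pos subset_union_left le_rfl ?_
    rw [union_sdiff_left, sdiff_eq_self_of_disjoint hd.symm]
    exact hs

end WallCrossing

/-! ### Rooted trees -/

section RootedTrees

variable {X : Type*} {G : SimpleGraph X}

/-- In the tree `G` with the root `ρ`, the node `v` is the parent of `u`. -/
def IsParent (G : SimpleGraph X) (ρ u v : X) : Prop := G.Adj v u ∧ G.dist ρ u = G.dist ρ v + 1

theorem exists_isParent (hG : G.IsTree) {ρ u : X} (hu : u ≠ ρ) : ∃ v, IsParent G ρ u v := by
  obtain ⟨p, hp, hl⟩ := hG.connected.exists_path_of_dist ρ u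
  have hn : ¬ p.Nil := fun h => hu h.eq.symm
  refine ⟨p.penultimate, p.adj_penultimate hn, ?_⟩
  rcases hG.dist_eq_dist_add_one_of_adj ρ (p.adj_penultimate hn) with h | h
  · exfalso
    have h1 := SimpleGraph.dist_le p.dropLast
    have h2 : p.dropLast.length = p.length - 1 := by simp
    omega
  · exact h

theorem IsParent.unique (hG : G.IsTree) {ρ u v v' : X} (h : IsParent G ρ u v)
    (h' : IsParent G ρ u v') : v = v' := by
  obtain ⟨p, hp⟩ := hG.connected.exists_walk_length_eq_dist ρ v
  obtain ⟨p', hp'⟩ := hG.connected.exists_walk_length_eq_dist ρ v'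
  have h1 : (p.concat h.1).IsPath :=
    SimpleGraph.Walk.isPath_of_length_eq_dist _ (by rw [SimpleGraph.Walk.length_concat, hp, h.2])
  have h2 : (p'.concat h'.1).IsPath :=
    SimpleGraph.Walk.isPath_of_length_eq_dist _ (by rw [SimpleGraph.Walk.length_concat, hp', h'.2])
  have h3 : p.concat h.1 = p'.concat h'.1 :=
    congrArg Subtype.val ((hG.isAcyclic.subsingleton_path ρ u).elim ⟨_, h1⟩ ⟨_, h2⟩)
  have h4 := congrArg SimpleGraph.Walk.penultimate h3
  rwa [SimpleGraph.Walk.penultimate_concat, SimpleGraph.Walk.penultimate_concat] at h4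

theorem isParent_or_of_adj (hG : G.IsTree) (ρ : X) {u v : X} (h : G.Adj u v) :
    IsParent G ρ u v ∨ IsParent G ρ v u := by
  rcases hG.dist_eq_dist_add_one_of_adj ρ h with h1 | h1
  · exact Or.inl ⟨h.symm, h1⟩
  · exact Or.inr ⟨h, h1⟩

theorem not_isParent_root (ρ v : X) : ¬ IsParent G ρ ρ v := by
  rintro ⟨-, h⟩
  rw [SimpleGraph.dist_self] at h
  omega

/-- Induction from the leaves to the root. -/
theorem induction_of_isParent [Finite X] (ρ : X) {P : X → Prop}
    (h : ∀ u, (∀ v, IsParent G ρ v u → P v) → P u) (u : X) : P u := by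
  obtain ⟨B, hB⟩ := (Set.finite_range fun u => G.dist ρ u).bddAbove
  have hB' : ∀ u, G.dist ρ u ≤ B := fun u => hB ⟨u, rfl⟩
  have key : ∀ (k : ℕ) (u : X), B - G.dist ρ u = k → P u := by
    intro k
    induction k using Nat.strong_induction_on with
    | _ k ih =>
      intro u hu
      refine h u fun v hv => ih (B - G.dist ρ v) ?_ v rfl
      have h1 := hv.2
      have h2 := hB' v
      omega
  exact key _ u rfl

/-- Induction from the root to the leaves. -/
theorem induction_of_root (hG : G.IsTree) (ρ : X) {P : X → Prop} (h0 : P ρ)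
    (h : ∀ u v, IsParent G ρ u v → P v → P u) (u : X) : P u := by
  have key : ∀ (k : ℕ) (u : X), G.dist ρ u = k → P u := by
    intro k
    induction k with
    | zero =>
      intro u hu
      rwa [← hG.connected.dist_eq_zero_iff.1 hu]
    | succ k ih =>
      intro u hu
      have hne : u ≠ ρ := by
        rintro rfl
        rw [SimpleGraph.dist_self] at hu
        omega
      obtain ⟨v, hv⟩ := exists_isParent hG hne
      exact h u v hv (ih v (by have := hv.2; omega))
  exact key _ u rfl

/-- The ancestor relation. -/
def IsAncestor (G : SimpleGraph X) (ρ : X) : X → X → Prop :=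
  Relation.ReflTransGen (IsParent G ρ)

theorem IsAncestor.dist_le {ρ u v : X} (h : IsAncestor G ρ u v) : G.dist ρ v ≤ G.dist ρ u := by
  induction h with
  | refl => exact le_rfl
  | tail _ h ih => have := h.2; omega

/-- A node has at most one ancestor at a given distance from the root. -/
theorem IsAncestor.unique (hG : G.IsTree) {ρ u a b : X} (ha : IsAncestor G ρ u a)
    (hb : IsAncestor G ρ u b) (h : G.dist ρ a = G.dist ρ b) : a = b := by
  induction ha using Relation.ReflTransGen.head_induction_on with
  | refl =>
    rcases Relation.ReflTransGen.cases_head hb with h1 | ⟨c, h1, h2⟩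
    · exact h1
    · have h3 := IsAncestor.dist_le h2
      have h4 := h1.2
      omega
  | head h1 h2 ih =>
    rcases Relation.ReflTransGen.cases_head hb with rfl | ⟨c, h3, h4⟩
    · have h3 := IsAncestor.dist_le h2
      have h4 := h1.2
      omega
    · exact ih (h1.unique hG h3 ▸ h4)

/-- A connected graph is a tree if every node has at most one neighbour of at least the same
height. -/
theorem isTree_of_height (hc : G.Connected) (f : X → ℕ)
    (h : ∀ u v v', G.Adj u v → G.Adj u v' → f u ≤ f v → f u ≤ f v' → v = v') : G.IsTree := by
  classical
  refine ⟨hc, ?_⟩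
  intro v c hcyc
  -- a node of least height on a cycle would have two such neighbours
  obtain ⟨u, hu, hmin⟩ := Finset.exists_min_image c.support.toFinset f
    ⟨v, List.mem_toFinset.2 c.start_mem_support⟩
  have hu' := List.mem_toFinset.1 hu
  have hcyc' : (c.rotate u hu').IsCycle := hcyc.rotate hu'
  have hmin' : ∀ a ∈ (c.rotate u hu').support, f u ≤ f a := by
    intro a ha
    exact hmin a (List.mem_toFinset.2 (by simpa using ha))
  have hn := hcyc'.not_nil
  exact hcyc'.snd_ne_penultimate (h u _ _ ((c.rotate u hu').adj_snd hn)
    ((c.rotate u hu').adj_penultimate hn).symm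
    (hmin' _ (SimpleGraph.Walk.getVert_mem_support _ _))
    (hmin' _ (SimpleGraph.Walk.getVert_mem_support _ _)))

end RootedTrees

/-! ### Subtrees -/

namespace BTree

variable {ι : Type} [DecidableEq ι]

open Classical in
/-- The set of all subtrees, including the leaves and the tree itself. -/
def subs : BTree ι → Finset (BTree ι)
  | leaf i => {leaf i}
  | node l r => insert (node l r) (subs l ∪ subs r)

theorem mem_subs_leaf {i : ι} {s : BTree ι} : s ∈ (leaf i).subs ↔ s = leaf i := by
  rw [subs, mem_singleton]

theorem mem_subs_node {l r s : BTree ι} :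
    s ∈ (node l r).subs ↔ s = node l r ∨ s ∈ l.subs ∨ s ∈ r.subs := by
  classical rw [subs, mem_insert, mem_union]

theorem self_mem_subs (t : BTree ι) : t ∈ t.subs := by
  cases t with
  | leaf i => exact mem_subs_leaf.2 rfl
  | node l r => exact mem_subs_node.2 (Or.inl rfl)

theorem mem_subs_of_node {t l r : BTree ι} (h : node l r ∈ t.subs) : l ∈ t.subs ∧ r ∈ t.subs := by
  induction t with
  | leaf i => cases mem_subs_leaf.1 h
  | node a b ha hb =>
    rw [mem_subs_node, mem_subs_node]
    rcases mem_subs_node.1 h with h | h | h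
    · injection h with h1 h2
      subst h1 h2
      exact ⟨Or.inr (Or.inl l.self_mem_subs), Or.inr (Or.inr r.self_mem_subs)⟩
    · exact ⟨Or.inr (Or.inl (ha h).1), Or.inr (Or.inl (ha h).2)⟩
    · exact ⟨Or.inr (Or.inr (hb h).1), Or.inr (Or.inr (hb h).2)⟩

/-- Induction from a tree to its subtrees. -/
theorem subs_induction {t : BTree ι} {P : BTree ι → Prop} (h0 : P t)
    (h : ∀ l r, node l r ∈ t.subs → P (node l r) → P l ∧ P r) {s : BTree ι} (hs : s ∈ t.subs) :
    P s := by
  induction t with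
  | leaf i => rwa [mem_subs_leaf.1 hs]
  | node a b ha hb =>
    have h1 := h a b (self_mem_subs _) h0
    rcases mem_subs_node.1 hs with rfl | hs | hs
    · exact h0
    · exact ha h1.1 (fun l r hlr => h l r (mem_subs_node.2 (Or.inr (Or.inl hlr)))) hs
    · exact hb h1.2 (fun l r hlr => h l r (mem_subs_node.2 (Or.inr (Or.inr hlr)))) hs

theorem Valid.of_mem_subs {w : ι → ZLat} {μ : ι → ℝ} {t s : BTree ι} (ht : t.Valid w μ)
    (hs : s ∈ t.subs) : s.Valid w μ :=
  subs_induction ht (fun _ _ _ h => ⟨h.1, h.2.1⟩) hs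

theorem supp_subset_of_mem_subs {t s : BTree ι} (hs : s ∈ t.subs) : s.supp ⊆ t.supp :=
  subs_induction (P := fun s => s.supp ⊆ t.supp) subset_rfl
    (fun _ _ _ h => ⟨subset_union_left.trans h, subset_union_right.trans h⟩) hs

theorem leaf_mem_subs {t : BTree ι} {i : ι} : leaf i ∈ t.subs ↔ i ∈ t.supp := by
  induction t with
  | leaf j => rw [mem_subs_leaf, supp, mem_singleton, leaf.injEq]
  | node l r hl hr => rw [mem_subs_node, supp, mem_union, hl, hr]; simp

/-- `s` is one of the two branches of the node `p`. -/
def IsBranch (s p : BTree ι) : Prop := ∃ l r, p = node l r ∧ (s = l ∨ s = r)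

theorem IsBranch.mem_subs {t s p : BTree ι} (h : s.IsBranch p) (hp : p ∈ t.subs) : s ∈ t.subs := by
  obtain ⟨l, r, rfl, rfl | rfl⟩ := h
  · exact (mem_subs_of_node hp).1
  · exact (mem_subs_of_node hp).2

/-- The number of leaves, a strictly monotone height. -/
def numLeaves : BTree ι → ℕ
  | leaf _ => 1
  | node l r => numLeaves l + numLeaves r

theorem numLeaves_pos (t : BTree ι) : 0 < t.numLeaves := by
  induction t with
  | leaf i => exact one_pos
  | node l r hl hr => rw [numLeaves]; omega

theorem IsBranch.numLeaves_lt {s p : BTree ι} (h : s.IsBranch p) : s.numLeaves < p.numLeaves := by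
  obtain ⟨l, r, rfl, rfl | rfl⟩ := h
  · have := r.numLeaves_pos; rw [numLeaves]; omega
  · have := l.numLeaves_pos; rw [numLeaves]; omega

theorem numLeaves_le_of_mem_subs {t s : BTree ι} (hs : s ∈ t.subs) :
    s.numLeaves ≤ t.numLeaves := by
  refine subs_induction (P := fun s => s.numLeaves ≤ t.numLeaves) le_rfl (fun l r _ h => ?_) hs
  rw [numLeaves] at h
  omega

theorem exists_isBranch {t s : BTree ι} (hs : s ∈ t.subs) (h : s ≠ t) :
    ∃ p ∈ t.subs, s.IsBranch p := by
  have := subs_induction (P := fun s => s = t ∨ ∃ p ∈ t.subs, s.IsBranch p) (Or.inl rfl)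
    (fun l r hlr _ => ⟨Or.inr ⟨_, hlr, l, r, rfl, Or.inl rfl⟩,
      Or.inr ⟨_, hlr, l, r, rfl, Or.inr rfl⟩⟩) hs
  exact this.resolve_left h

/-- The subtrees of the two branches of a valid tree are different. -/
theorem disjoint_subs {l r s : BTree ι} (hd : Disjoint l.supp r.supp)
    (hl : s ∈ l.subs) (hr : s ∈ r.subs) : False :=
  s.supp_nonempty.ne_empty (disjoint_self.1 (hd.mono (supp_subset_of_mem_subs hl)
    (supp_subset_of_mem_subs hr)))

theorem isBranch_unique {w : ι → ZLat} {μ : ι → ℝ} {t s p p' : BTree ι} (ht : t.Valid w μ)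
    (hp : p ∈ t.subs) (hp' : p' ∈ t.subs) (h : s.IsBranch p) (h' : s.IsBranch p') : p = p' := by
  induction t with
  | leaf i => rw [mem_subs_leaf.1 hp, mem_subs_leaf.1 hp']
  | node l r hl hr =>
    obtain ⟨vl, vr, hd, -⟩ := ht
    have key : ∀ q, q = node l r ∨ q ∈ l.subs ∨ q ∈ r.subs → s.IsBranch q →
        (s = l ∧ q = node l r) ∨ (s = r ∧ q = node l r) ∨
        (s ∈ l.subs ∧ s ≠ l ∧ q ∈ l.subs) ∨ (s ∈ r.subs ∧ s ≠ r ∧ q ∈ r.subs) := by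
      rintro q (rfl | hq | hq) hb
      · obtain ⟨a, b, e, hs⟩ := hb
        injection e with e1 e2
        subst e1 e2
        rcases hs with rfl | rfl <;> simp
      · refine Or.inr (Or.inr (Or.inl ⟨hb.mem_subs hq, ?_, hq⟩))
        rintro rfl
        exact absurd (numLeaves_le_of_mem_subs hq) hb.numLeaves_lt.not_ge
      · refine Or.inr (Or.inr (Or.inr ⟨hb.mem_subs hq, ?_, hq⟩))
        rintro rfl
        exact absurd (numLeaves_le_of_mem_subs hq) hb.numLeaves_lt.not_ge
    have hlr : l ≠ r := by
      rintro rfl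
      exact disjoint_subs hd l.self_mem_subs l.self_mem_subs
    rcases key p (mem_subs_node.1 hp) h with ⟨h1, h2⟩ | ⟨h1, h2⟩ | ⟨h1, h2, h3⟩ | ⟨h1, h2, h3⟩ <;>
    rcases key p' (mem_subs_node.1 hp') h' with
      ⟨k1, k2⟩ | ⟨k1, k2⟩ | ⟨k1, k2, k3⟩ | ⟨k1, k2, k3⟩
    all_goals first
      | exact h2.trans k2.symm
      | exact hl vl h3 k3
      | exact hr vr h3 k3
      | exact absurd h1 k2
      | exact absurd k1 h2
      | exact (disjoint_subs hd h1 k1).elim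
      | exact (disjoint_subs hd k1 h1).elim
      | exact (disjoint_subs hd (h1 ▸ l.self_mem_subs) k1).elim
      | exact (disjoint_subs hd k1 (h1 ▸ r.self_mem_subs)).elim
      | exact (disjoint_subs hd (k1 ▸ l.self_mem_subs) h1).elim
      | exact (disjoint_subs hd h1 (k1 ▸ r.self_mem_subs)).elim

/-- The factor of a node in the refined multiplicity. -/
def nodeMult (w : ι → ZLat) : BTree ι → ℕ[T;T⁻¹]
  | leaf _ => 1
  | node l r => quantumInt (skew (vec w (supp l)) (vec w (supp r))).natAbs

theorem prod_nodeMult {w : ι → ZLat} {μ : ι → ℝ} {t : BTree ι} (ht : t.Valid w μ) :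
    ∏ s ∈ t.subs, s.nodeMult w = t.mult w := by
  classical
  induction t with
  | leaf i => rw [subs, prod_singleton, nodeMult, mult]
  | node l r hl hr =>
    obtain ⟨vl, vr, hd, -⟩ := ht
    rw [subs, prod_insert, prod_union, hl vl, hr vr, nodeMult, mult]
    · rw [Finset.disjoint_left]
      exact fun s h1 h2 => disjoint_subs hd h1 h2
    · rw [mem_union]
      rintro (h | h)
      · have h1 := numLeaves_le_of_mem_subs h
        have h2 := r.numLeaves_pos
        rw [numLeaves] at h1
        omega
      · have h1 := numLeaves_le_of_mem_subs h
        have h2 := l.numLeaves_pos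
        rw [numLeaves] at h1
        omega

end BTree

/-! ### The curve of a tree -/

section Labellings

variable {ι : Type} [DecidableEq ι]

open BTree

/-- `a` is the node above `b` in the tree `t` with an additional root `none`. -/
def TreeLink (t : BTree ι) (a b : Option (BTree ι)) : Prop :=
  (a = none ∧ b = some t) ∨ ∃ p s, a = some p ∧ b = some s ∧ s.IsBranch p

theorem treeLink_some_some {t p s : BTree ι} : TreeLink t (some p) (some s) ↔ s.IsBranch p := by
  constructor
  · rintro (⟨h, -⟩ | ⟨p', s', h1, h2, h⟩)
    · cases h
    · cases h1; cases h2; exact h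
  · exact fun h => Or.inr ⟨p, s, rfl, rfl, h⟩

theorem treeLink_none {t : BTree ι} {b : Option (BTree ι)} : TreeLink t none b ↔ b = some t := by
  constructor
  · rintro (⟨-, h⟩ | ⟨p', s', h1, -⟩)
    · exact h
    · cases h1
  · exact fun h => Or.inl ⟨rfl, h⟩

theorem not_treeLink_none {t : BTree ι} {a : Option (BTree ι)} : ¬ TreeLink t a none := by
  rintro (⟨-, h⟩ | ⟨p', s', -, h1, -⟩)
  · cases h
  · cases h1

open Classical in
/-- The outward direction at the vertex `s` of the edge to the adjacent node `b`. -/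
def outDir (w : ι → ZLat) : BTree ι → Option (BTree ι) → ZLat
  | leaf _, _ => 0
  | node l r, b => if b = some l then -vec w l.supp else
      if b = some r then -vec w r.supp else vec w (l.supp ∪ r.supp)

/-- The position of a vertex: the point where the lines of its two branches meet. -/
def nodePos (w : ι → ZLat) (μ : ι → ℝ) : BTree ι → Plane
  | leaf _ => 0
  | node l r => meet w μ l.supp r.supp

/-- A labelling of the nodes of a graph by the subtrees of `t` that identifies the graph with `t`. -/
structure IsLabelling {N : ℕ} (G : SimpleGraph (Fin N ⊕ Option ι)) (t : BTree ι)
    (lab : Fin N ⊕ Option ι → Option (BTree ι)) : Prop where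
  inj : Function.Injective lab
  root : lab (Sum.inr none) = none
  leaf : ∀ i, lab (Sum.inr (some i)) = some (leaf i)
  mem : ∀ u s, lab u = some s → s ∈ t.subs
  surj : ∀ s ∈ t.subs, ∃ u, lab u = some s
  adj : ∀ u v, G.Adj u v ↔ TreeLink t (lab u) (lab v) ∨ TreeLink t (lab v) (lab u)

theorem BTree.Valid.ne {w : ι → ZLat} {μ : ι → ℝ} {l r : BTree ι}
    (h : (node l r).Valid w μ) : l ≠ r := by
  rintro rfl
  exact l.supp_nonempty.ne_empty (disjoint_self.1 h.2.2.1)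

namespace IsLabelling

variable {N : ℕ} {G : SimpleGraph (Fin N ⊕ Option ι)} {t : BTree ι}
  {lab : Fin N ⊕ Option ι → Option (BTree ι)}

theorem exists_node (h : IsLabelling G t lab) (V : Fin N) :
    ∃ l r, lab (Sum.inl V) = some (node l r) := by
  rcases hs : lab (Sum.inl V) with _ | (i | ⟨l, r⟩)
  · have := h.inj (hs.trans h.root.symm)
    cases this
  · have := h.inj (hs.trans (h.leaf i).symm)
    cases this
  · exact ⟨l, r, rfl⟩

/-- The three nodes adjacent to a vertex: the two branches and the node above. -/
theorem neighbours (h : IsLabelling G t lab) {w : ι → ZLat} {μ : ι → ℝ} (ht : t.Valid w μ)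
    {V : Fin N} {l r : BTree ι} (hV : lab (Sum.inl V) = some (node l r)) :
    ∃ a b c, lab a = some l ∧ lab b = some r ∧ TreeLink t (lab c) (some (node l r)) ∧
      a ≠ b ∧ a ≠ c ∧ b ≠ c ∧ ∀ u, G.Adj (Sum.inl V) u ↔ u = a ∨ u = b ∨ u = c := by
  have hmem := h.mem _ _ hV
  have hv := ht.of_mem_subs hmem
  obtain ⟨a, ha⟩ := h.surj l (mem_subs_of_node hmem).1
  obtain ⟨b, hb⟩ := h.surj r (mem_subs_of_node hmem).2
  have hc : ∃ c, TreeLink t (lab c) (some (node l r)) := by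
    by_cases he : node l r = t
    · exact ⟨Sum.inr none, Or.inl ⟨h.root, by rw [he]⟩⟩
    · obtain ⟨p, hp, hb⟩ := exists_isBranch hmem he
      obtain ⟨c, hc⟩ := h.surj p hp
      exact ⟨c, Or.inr ⟨p, _, hc, rfl, hb⟩⟩
  obtain ⟨c, hc⟩ := hc
  have hlt : ∀ s, s.IsBranch (node l r) → lab c ≠ some s := by
    intro s hs h1
    rw [h1, treeLink_some_some] at hc
    exact lt_asymm hc.numLeaves_lt hs.numLeaves_lt
  have hbl : l.IsBranch (node l r) := ⟨l, r, rfl, Or.inl rfl⟩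
  have hbr : r.IsBranch (node l r) := ⟨l, r, rfl, Or.inr rfl⟩
  refine ⟨a, b, c, ha, hb, hc, ?_, ?_, ?_, fun u => ?_⟩
  · rintro rfl
    rw [ha] at hb
    exact hv.ne (Option.some.inj hb)
  · rintro rfl
    exact hlt l hbl ha
  · rintro rfl
    exact hlt r hbr hb
  · rw [h.adj, hV]
    constructor
    · rintro (h1 | h1)
      · rcases h1 with ⟨h1, -⟩ | ⟨p, s, h1, h2, l', r', h3, h4⟩
        · cases h1
        · cases h1
          cases h3
          rcases h4 with rfl | rfl
          · exact Or.inl (h.inj (h2.trans ha.symm))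
          · exact Or.inr (Or.inl (h.inj (h2.trans hb.symm)))
      · right; right
        apply h.inj
        rcases hu : lab u with _ | p
        · rw [hu, treeLink_none] at h1
          cases h1
          rcases hc' : lab c with _ | p'
          · rfl
          · rw [hc', treeLink_some_some] at hc
            exact absurd (numLeaves_le_of_mem_subs (h.mem _ _ hc')) hc.numLeaves_lt.not_ge
        · rw [hu, treeLink_some_some] at h1
          rcases hc' : lab c with _ | p'
          · rw [hc', treeLink_none] at hc
            cases hc
            exact absurd (numLeaves_le_of_mem_subs (h.mem _ _ hu)) h1.numLeaves_lt.not_ge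
          · rw [hc', treeLink_some_some] at hc
            rw [isBranch_unique ht (h.mem _ _ hu) (h.mem _ _ hc') h1 hc]
    · rintro (rfl | rfl | rfl)
      · rw [ha, treeLink_some_some]; exact Or.inl hbl
      · rw [hb, treeLink_some_some]; exact Or.inl hbr
      · exact Or.inr hc

end IsLabelling

variable [Fintype ι]

/-- The curve `C` is the one encoded by the tree `t`. -/
structure IsModel (w : ι → ZLat) (μ : ι → ℝ) (C : TropCurve ι) (t : BTree ι)
    (lab : Fin C.numVertices ⊕ Option ι → Option (BTree ι)) : Prop
    extends IsLabelling C.graph t lab where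
  pos : ∀ V s, lab (Sum.inl V) = some s → C.pos V = nodePos w μ s
  dir : ∀ V s u, lab (Sum.inl V) = some s → C.graph.Adj (Sum.inl V) u →
    C.dir V u = outDir w s (lab u)

namespace IsModel

variable {w : ι → ZLat} {μ : ι → ℝ} {C C' : TropCurve ι} {t t' : BTree ι}
  {lab : Fin C.numVertices ⊕ Option ι → Option (BTree ι)}
  {lab' : Fin C'.numVertices ⊕ Option ι → Option (BTree ι)}

theorem exists_vertex (h : IsModel w μ C t lab) (h' : IsModel w μ C' t lab')
    (V : Fin C.numVertices) : ∃ V', lab' (Sum.inl V') = lab (Sum.inl V) := by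
  obtain ⟨l, r, hV⟩ := h.exists_node V
  obtain ⟨u, hu⟩ := h'.surj _ (h.mem _ _ hV)
  rcases u with V' | _ | i
  · exact ⟨V', hu.trans hV.symm⟩
  · rw [h'.root] at hu; cases hu
  · rw [h'.leaf] at hu; cases hu

/-- A curve is determined by its tree up to isomorphism. -/
theorem iso (h : IsModel w μ C t lab) (h' : IsModel w μ C' t lab') : C.Iso C' := by
  choose f hf using exists_vertex h h'
  choose g hg using exists_vertex h' h
  let σ : Fin C.numVertices ≃ Fin C'.numVertices :=
    ⟨f, g, fun V => Sum.inl_injective (h.inj ((hg _).trans (hf V))),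
      fun V => Sum.inl_injective (h'.inj ((hf _).trans (hg V)))⟩
  have key : ∀ u, lab' (σ.sumCongr (Equiv.refl _) u) = lab u := by
    rintro (V | _ | i)
    · exact hf V
    · exact h'.root.trans h.root.symm
    · exact (h'.leaf i).trans (h.leaf i).symm
  have hadj : ∀ a b, C'.graph.Adj (σ.sumCongr (Equiv.refl _) a) (σ.sumCongr (Equiv.refl _) b) ↔
      C.graph.Adj a b := by
    intro a b
    rw [h.adj, h'.adj, key, key]
  refine ⟨σ, hadj, fun V => ?_, fun V u hu => ?_⟩
  · obtain ⟨l, r, hV⟩ := h.exists_node V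
    rw [h.pos V _ hV, h'.pos (σ V) _ ((hf V).trans hV)]
  · obtain ⟨l, r, hV⟩ := h.exists_node V
    rw [h.dir V _ u hV hu, h'.dir (σ V) _ _ ((hf V).trans hV) ((hadj (Sum.inl V) u).2 hu), key]

/-- Isomorphic curves have the same tree. -/
theorem eq_of_iso (h : IsModel w μ C t lab) (h' : IsModel w μ C' t' lab') (ht : t.Valid w μ)
    (ht' : t'.Valid w μ) (hiso : C.Iso C') : t = t' := by
  obtain ⟨σ, hadj, -, -⟩ := hiso
  have key : ∀ (s : BTree ι) u, lab u = some s →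
      lab' (σ.sumCongr (Equiv.refl _) u) = some s := by
    intro s
    induction s with
    | leaf i =>
      intro u hu
      have := h.inj (hu.trans (h.leaf i).symm)
      subst this
      exact h'.leaf i
    | node l r hl hr =>
      intro u hu
      rcases u with V | _ | i
      · obtain ⟨a, b, c, ha, hb, -, hab, -, -, hn⟩ := h.neighbours ht hu
        obtain ⟨l', r', hV'⟩ := h'.exists_node (σ V)
        obtain ⟨a', b', c', ha', hb', hc', -, -, -, hn'⟩ := h'.neighbours ht' hV'
        have hva := ht.of_mem_subs (h.mem _ _ hu)
        have hvb := ht'.of_mem_subs (h'.mem _ _ hV')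
        obtain ⟨-, -, hd, hs, -, -⟩ := hva
        obtain ⟨-, -, hd', hs', -, -⟩ := hvb
        have h1 := (hn' _).1 ((hadj (Sum.inl V) a).2 ((hn a).2 (Or.inl rfl)))
        have h2 := (hn' _).1 ((hadj (Sum.inl V) b).2 ((hn b).2 (Or.inr (Or.inl rfl))))
        have la := hl a ha
        have lb := hr b hb
        have hne : σ.sumCongr (Equiv.refl _) a ≠ σ.sumCongr (Equiv.refl _) b :=
          fun e => hab ((σ.sumCongr (Equiv.refl _)).injective e)
        change lab' (Sum.inl (σ V)) = _
        rw [hV']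
        -- a branch of the vertex cannot be the node above it in the other tree
        have hup : ∀ p q : BTree ι, Disjoint p.supp q.supp → lab' c' = some p →
            (q = l' ∨ q = r') → False := by
          intro p q hpq hp hq
          rw [hp, treeLink_some_some] at hc'
          obtain ⟨l₁, r₁, rfl, he⟩ := hc'
          have hsub : q.supp ⊆ (node l' r').supp := by
            rcases hq with rfl | rfl
            · exact subset_union_left
            · exact subset_union_right
          have hsub' : (node l' r').supp ⊆ (node l₁ r₁).supp := by
            rcases he with e | e
            · rw [e]; exact subset_union_left
            · rw [e]; exact subset_union_right
          exact q.supp_nonempty.ne_empty (disjoint_self.1 (hpq.mono_left (hsub.trans hsub')))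
        have hcase : ∀ {v s}, lab' v = some s → (v = a' ∨ v = b' ∨ v = c') →
            (s = l' ∧ v = a') ∨ (s = r' ∧ v = b') ∨ (lab' c' = some s ∧ v = c') := by
          rintro v s hv (rfl | rfl | rfl)
          · exact Or.inl ⟨Option.some.inj (hv.symm.trans ha'), rfl⟩
          · exact Or.inr (Or.inl ⟨Option.some.inj (hv.symm.trans hb'), rfl⟩)
          · exact Or.inr (Or.inr ⟨hv, rfl⟩)
        rcases hcase la h1 with ⟨e1, e1'⟩ | ⟨e1, e1'⟩ | ⟨e1, e1'⟩ <;>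
        rcases hcase lb h2 with ⟨e2, e2'⟩ | ⟨e2, e2'⟩ | ⟨e2, e2'⟩
        · exact absurd (e1'.trans e2'.symm) hne
        · rw [e1, e2]
        · exact (hup r l hd.symm e2 (Or.inl e1)).elim
        · rw [e1, e2, QTorus.skew_neg_swap] at hs
          omega
        · exact absurd (e1'.trans e2'.symm) hne
        · exact (hup r l hd.symm e2 (Or.inr e1)).elim
        · exact (hup l r hd e1 (Or.inl e2)).elim
        · exact (hup l r hd e1 (Or.inr e2)).elim
        · exact absurd (e1'.trans e2'.symm) hne
      · rw [h.root] at hu; cases hu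
      · rw [h.leaf] at hu; cases hu
  obtain ⟨u, hu⟩ := h.surj t t.self_mem_subs
  have h1 : C.graph.Adj u (Sum.inr none) := by
    rw [h.adj, hu, h.root, treeLink_none]
    exact Or.inr rfl
  have h2 := (hadj _ _).2 h1
  have h3 : σ.sumCongr (Equiv.refl (Option ι)) (Sum.inr none) = Sum.inr none := rfl
  rw [h3, h'.adj, h'.root, treeLink_none, key t u hu] at h2
  exact Option.some.inj (h2.resolve_left not_treeLink_none)

theorem isTrivalent (h : IsModel w μ C t lab) (ht : t.Valid w μ) : C.IsTrivalent := by
  intro V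
  obtain ⟨l, r, hV⟩ := h.exists_node V
  obtain ⟨a, b, c, -, -, -, hab, hac, hbc, hn⟩ := h.neighbours ht hV
  have : C.graph.neighborSet (Sum.inl V) = {a, b, c} := by
    ext u
    rw [SimpleGraph.mem_neighborSet, hn]
    rfl
  rw [this, Set.ncard_eq_three]
  exact ⟨a, b, c, hab, hac, hbc, rfl⟩

theorem outDir_left (w : ι → ZLat) (l r : BTree ι) :
    outDir w (node l r) (some l) = -vec w l.supp := by
  rw [outDir, if_pos rfl]

theorem outDir_right (w : ι → ZLat) {l r : BTree ι} (h : l ≠ r) :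
    outDir w (node l r) (some r) = -vec w r.supp := by
  rw [outDir, if_neg (fun e => h (Option.some.inj e).symm), if_pos rfl]

theorem outDir_up (w : ι → ZLat) {l r : BTree ι} {b : Option (BTree ι)} (hl : b ≠ some l)
    (hr : b ≠ some r) : outDir w (node l r) b = vec w (l.supp ∪ r.supp) := by
  rw [outDir, if_neg hl, if_neg hr]

theorem vertexMult_eq (h : IsModel w μ C t lab) (ht : t.Valid w μ) {V : Fin C.numVertices}
    {l r : BTree ι} (hV : lab (Sum.inl V) = some (node l r)) :
    C.vertexMult V = (skew (vec w l.supp) (vec w r.supp)).natAbs := by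
  classical
  have hv := ht.of_mem_subs (h.mem _ _ hV)
  obtain ⟨a, b, c, ha, hb, -, hab, hac, hbc, hn⟩ := h.neighbours ht hV
  have dira : C.dir V a = -vec w l.supp := by
    rw [h.dir V _ a hV ((hn a).2 (Or.inl rfl)), ha, outDir_left]
  have dirb : C.dir V b = -vec w r.supp := by
    rw [h.dir V _ b hV ((hn b).2 (Or.inr (Or.inl rfl))), hb, outDir_right w hv.ne]
  have dirc : C.dir V c = vec w l.supp + vec w r.supp := by
    rw [h.dir V _ c hV ((hn c).2 (Or.inr (Or.inr rfl))), outDir_up, vec_union w hv.2.2.1]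
    · rw [← ha]; exact fun e => hac (h.inj e).symm
    · rw [← hb]; exact fun e => hbc (h.inj e).symm
  unfold TropCurve.vertexMult
  apply le_antisymm
  · refine Finset.sup_le fun e he => ?_
    obtain ⟨h1, h2⟩ := (mem_filter.1 he).2
    set m := skew (vec w l.supp) (vec w r.supp) with hm
    have key : ∀ x y, (x = -vec w l.supp ∨ x = -vec w r.supp ∨ x = vec w l.supp + vec w r.supp) →
        (y = -vec w l.supp ∨ y = -vec w r.supp ∨ y = vec w l.supp + vec w r.supp) →
        skew x y = 0 ∨ skew x y = m ∨ skew x y = -m := by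
      rintro x y (rfl | rfl | rfl) (rfl | rfl | rfl) <;>
      simp only [hm, skew, Prod.fst_add, Prod.snd_add, Prod.fst_neg, Prod.snd_neg]
      · left; ring
      · right; left; ring
      · right; right; ring
      · right; right; ring
      · left; ring
      · right; left; ring
      · right; left; ring
      · right; right; ring
      · left; ring
    have hdir : ∀ u, C.graph.Adj (Sum.inl V) u → C.dir V u = -vec w l.supp ∨
        C.dir V u = -vec w r.supp ∨ C.dir V u = vec w l.supp + vec w r.supp := by
      intro u hu
      rcases (hn u).1 hu with rfl | rfl | rfl
      · exact Or.inl dira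
      · exact Or.inr (Or.inl dirb)
      · exact Or.inr (Or.inr dirc)
    rcases key _ _ (hdir _ h1) (hdir _ h2) with h3 | h3 | h3 <;> rw [h3] <;> simp
  · have h0 : skew (vec w l.supp) (vec w r.supp) = skew (C.dir V a) (C.dir V b) := by
      rw [dira, dirb]
      simp only [skew, Prod.fst_neg, Prod.snd_neg]
      ring
    rw [h0]
    exact Finset.le_sup (f := fun e : (Fin C.numVertices ⊕ Option ι) × _ =>
      (skew (C.dir V e.1) (C.dir V e.2)).natAbs) (b := (a, b))
      (Finset.mem_filter.2 ⟨mem_univ _, (hn a).2 (Or.inl rfl), (hn b).2 (Or.inr (Or.inl rfl))⟩)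

theorem refinedMult_eq (h : IsModel w μ C t lab) (ht : t.Valid w μ) :
    C.refinedMult = t.mult w := by
  classical
  rw [← prod_nodeMult ht, TropCurve.refinedMult]
  choose f g hfg using h.exists_node
  have hinj : Function.Injective fun V => node (f V) (g V) := by
    intro V V' e
    have e' : node (f V) (g V) = node (f V') (g V') := e
    exact Sum.inl_injective (h.inj ((hfg V).trans ((congrArg some e').trans (hfg V').symm)))
  have himg : ∏ s ∈ univ.image (fun V => node (f V) (g V)), s.nodeMult w =
      ∏ s ∈ t.subs, s.nodeMult w := by
    refine prod_subset ?_ ?_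
    · intro s hs
      obtain ⟨V, -, rfl⟩ := Finset.mem_image.1 hs
      exact h.mem _ _ (hfg V)
    · intro s hs hns
      rcases s with i | ⟨l, r⟩
      · rfl
      · exfalso
        obtain ⟨u, hu⟩ := h.surj _ hs
        rcases u with V | _ | i
        · have e : node (f V) (g V) = node l r := Option.some.inj ((hfg V).symm.trans hu)
          exact hns (e ▸ mem_image_of_mem (fun V => node (f V) (g V)) (mem_univ V))
        · rw [h.root] at hu; cases hu
        · rw [h.leaf] at hu; cases hu
  rw [← himg, prod_image fun a _ b _ e => hinj e]
  exact prod_congr rfl fun V _ => by rw [h.vertexMult_eq ht (hfg V), nodeMult]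

end IsModel

end Labellings

/-! ### Existence of the curve of a valid tree -/

section Realization

variable {ι : Type} [DecidableEq ι]

open BTree

theorem treeLink_irrefl {t : BTree ι} (a : Option (BTree ι)) : ¬ TreeLink t a a := by
  rcases a with _ | s
  · exact not_treeLink_none
  · rw [treeLink_some_some]
    exact fun h => lt_irrefl _ h.numLeaves_lt

/-- The height of a label, larger at the root `none` than at all subtrees. -/
def labelHeight (t : BTree ι) : Option (BTree ι) → ℕ
  | none => t.numLeaves + 1
  | some s => s.numLeaves

theorem TreeLink.labelHeight_lt {t : BTree ι} {a b : Option (BTree ι)} (h : TreeLink t a b) :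
    labelHeight t b < labelHeight t a := by
  rcases h with ⟨rfl, rfl⟩ | ⟨p, s, rfl, rfl, h⟩
  · exact Nat.lt_succ_self _
  · exact h.numLeaves_lt

namespace IsLabelling

variable {N : ℕ} {G : SimpleGraph (Fin N ⊕ Option ι)} {t : BTree ι}
  {lab : Fin N ⊕ Option ι → Option (BTree ι)}

theorem exists_up (h : IsLabelling G t lab) {u : Fin N ⊕ Option ι} (hu : lab u ≠ none) :
    ∃ v, TreeLink t (lab v) (lab u) := by
  obtain ⟨s, hs⟩ := Option.ne_none_iff_exists'.1 hu
  rw [hs]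
  by_cases he : s = t
  · exact ⟨Sum.inr none, Or.inl ⟨h.root, by rw [he]⟩⟩
  · obtain ⟨p, hp, hb⟩ := exists_isBranch (h.mem _ _ hs) he
    obtain ⟨c, hc⟩ := h.surj p hp
    exact ⟨c, Or.inr ⟨p, _, hc, rfl, hb⟩⟩

theorem up_unique (h : IsLabelling G t lab) {w : ι → ZLat} {μ : ι → ℝ} (ht : t.Valid w μ)
    {u v v' : Fin N ⊕ Option ι} (hv : TreeLink t (lab v) (lab u))
    (hv' : TreeLink t (lab v') (lab u)) : v = v' := by
  apply h.inj
  rcases hu : lab u with _ | s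
  · rw [hu] at hv
    exact (not_treeLink_none hv).elim
  rw [hu] at hv hv'
  rcases hv with ⟨h1, h2⟩ | ⟨p, s₁, h1, h2, hb⟩ <;>
  rcases hv' with ⟨h1', h2'⟩ | ⟨p', s₁', h1', h2', hb'⟩
  · rw [h1, h1']
  · cases h2; cases h2'
    exact absurd (numLeaves_le_of_mem_subs (h.mem _ _ h1')) hb'.numLeaves_lt.not_ge
  · cases h2; cases h2'
    exact absurd (numLeaves_le_of_mem_subs (h.mem _ _ h1)) hb.numLeaves_lt.not_ge
  · cases h2; cases h2'
    rw [h1, h1', isBranch_unique ht (h.mem _ _ h1) (h.mem _ _ h1') hb hb']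

theorem isTree (h : IsLabelling G t lab) {w : ι → ZLat} {μ : ι → ℝ} (ht : t.Valid w μ) :
    G.IsTree := by
  have hreach : ∀ u, G.Reachable (Sum.inr none) u := by
    intro u
    rcases hu : lab u with _ | s
    · rw [h.inj (hu.trans h.root.symm)]
    · refine subs_induction (t := t) (P := fun s => ∀ u, lab u = some s →
        G.Reachable (Sum.inr none) u) ?_ ?_ (h.mem _ _ hu) u hu
      · intro u hu
        refine SimpleGraph.Adj.reachable ?_
        rw [h.adj, h.root, hu, treeLink_none]
        exact Or.inl rfl
      · intro l r hlr hP
        obtain ⟨v, hv⟩ := h.surj _ hlr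
        constructor
        · intro u hu
          refine (hP v hv).trans (SimpleGraph.Adj.reachable ?_)
          rw [h.adj, hv, hu, treeLink_some_some]
          exact Or.inl ⟨l, r, rfl, Or.inl rfl⟩
        · intro u hu
          refine (hP v hv).trans (SimpleGraph.Adj.reachable ?_)
          rw [h.adj, hv, hu, treeLink_some_some]
          exact Or.inl ⟨l, r, rfl, Or.inr rfl⟩
  have hc : G.Connected := by
    rw [SimpleGraph.connected_iff_exists_forall_reachable]
    exact ⟨_, hreach⟩
  refine isTree_of_height hc (fun u => labelHeight t (lab u)) fun u v v' hv hv' hle hle' => ?_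
  refine h.up_unique ht (u := u) ?_ ?_
  · exact ((h.adj u v).1 hv).resolve_left fun h1 => absurd h1.labelHeight_lt hle.not_gt
  · exact ((h.adj u v').1 hv').resolve_left fun h1 => absurd h1.labelHeight_lt hle'.not_gt

theorem leg_univalent (h : IsLabelling G t lab) {w : ι → ZLat} {μ : ι → ℝ} (ht : t.Valid w μ)
    (e : Option ι) : (G.neighborSet (Sum.inr e)).ncard = 1 := by
  rw [Set.ncard_eq_one]
  rcases e with _ | i
  · obtain ⟨u, hu⟩ := h.surj t t.self_mem_subs
    refine ⟨u, Set.ext fun v => ?_⟩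
    rw [SimpleGraph.mem_neighborSet, h.adj, h.root, treeLink_none, Set.mem_singleton_iff]
    constructor
    · rintro (h1 | h1)
      · exact h.inj (h1.trans hu.symm)
      · exact (not_treeLink_none h1).elim
    · rintro rfl
      exact Or.inl hu
  · obtain ⟨u, hu⟩ := h.exists_up (u := Sum.inr (some i)) (by rw [h.leaf]; exact fun h => by cases h)
    refine ⟨u, Set.ext fun v => ?_⟩
    rw [SimpleGraph.mem_neighborSet, h.adj, Set.mem_singleton_iff]
    constructor
    · rintro (h1 | h1)
      · rw [h.leaf] at h1
        rcases h1 with ⟨h1, -⟩ | ⟨p, s, h1, -, l, r, h2, -⟩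
        · cases h1
        · cases h1; cases h2
      · exact h.up_unique ht h1 hu
    · rintro rfl
      exact Or.inr hu

end IsLabelling

theorem exists_labelling [Fintype ι] {t : BTree ι} (ht : t.supp = univ) :
    ∃ (N : ℕ) (G : SimpleGraph (Fin N ⊕ Option ι)) (lab : Fin N ⊕ Option ι → Option (BTree ι)),
      IsLabelling G t lab := by
  classical
  let S := t.subs.filter fun s => ∃ l r, s = node l r
  let e : Fin S.card ≃ S := S.equivFin.symm
  let lab : Fin S.card ⊕ Option ι → Option (BTree ι) := fun u =>
    match u with
    | Sum.inl V => some (e V).1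
    | Sum.inr none => none
    | Sum.inr (some i) => some (leaf i)
  have hnode : ∀ V, ∃ l r, (e V).1 = node l r := fun V => (mem_filter.1 (e V).2).2
  refine ⟨S.card,
    { Adj := fun u v => TreeLink t (lab u) (lab v) ∨ TreeLink t (lab v) (lab u)
      symm := ⟨fun u v h => h.symm⟩
      loopless := ⟨fun u h => h.elim (treeLink_irrefl _) (treeLink_irrefl _)⟩ }, lab, ?_⟩
  refine ⟨?_, rfl, fun _ => rfl, ?_, ?_, fun _ _ => Iff.rfl⟩
  · rintro (V | _ | i) (V' | _ | i') h
    · have h' : (e V).1 = (e V').1 := Option.some.inj h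
      rw [e.injective (Subtype.ext h')]
    · cases h
    · obtain ⟨l, r, h1⟩ := hnode V
      have h' : (e V).1 = leaf i' := Option.some.inj h
      rw [h1] at h'; cases h'
    · cases h
    · rfl
    · cases h
    · obtain ⟨l, r, h1⟩ := hnode V'
      have h' : leaf i = (e V').1 := Option.some.inj h
      rw [h1] at h'; cases h'
    · cases h
    · have h' : leaf i = leaf i' := Option.some.inj h
      cases h'
      rfl
  · rintro (V | _ | i) s h
    · have h' : (e V).1 = s := Option.some.inj h
      rw [← h']
      exact (mem_filter.1 (e V).2).1
    · cases h
    · have h' : leaf i = s := Option.some.inj h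
      rw [← h', leaf_mem_subs, ht]
      exact mem_univ i
  · rintro (i | ⟨l, r⟩) hs
    · exact ⟨Sum.inr (some i), rfl⟩
    · refine ⟨Sum.inl (e.symm ⟨node l r, mem_filter.2 ⟨hs, l, r, rfl⟩⟩), ?_⟩
      change some (e (e.symm _)).1 = _
      rw [Equiv.apply_symm_apply]

theorem exists_smul_of_skewR_eq_zero {a : ZLat} (ha : a ≠ 0) {y : Plane}
    (h : skewR (toPlane a) y = 0) : ∃ c : ℝ, y = c • toPlane a := by
  simp only [skewR, toPlane] at h
  by_cases h1 : (a.1 : ℝ) = 0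
  · have h2 : (a.2 : ℝ) ≠ 0 := by
      intro h2
      exact ha (Prod.ext (by exact_mod_cast h1) (by exact_mod_cast h2))
    rw [h1, zero_mul, zero_sub, neg_eq_zero] at h
    refine ⟨y.2 / a.2, Prod.ext ?_ ?_⟩
    · simp [toPlane, h1, (mul_eq_zero.1 h).resolve_left h2]
    · simp [toPlane, h2]
  · refine ⟨y.1 / a.1, Prod.ext ?_ ?_⟩
    · simp [toPlane, h1]
    · simp only [toPlane, Prod.smul_snd, smul_eq_mul]
      field_simp
      linarith

theorem vec_ne_zero_of_skew_ne {a b : ZLat} (h : skew a b ≠ 0) : a ≠ 0 ∧ b ≠ 0 := by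
  constructor <;> rintro rfl <;> simp [skew] at h

theorem BTree.Valid.vec_ne {w : ι → ZLat} {μ : ι → ℝ} {l r : BTree ι}
    (h : (node l r).Valid w μ) :
    vec w l.supp ≠ 0 ∧ vec w r.supp ≠ 0 ∧ vec w (l.supp ∪ r.supp) ≠ 0 := by
  obtain ⟨-, -, hd, hs, -, -⟩ := h
  have h1 := vec_ne_zero_of_skew_ne hs.ne'
  refine ⟨h1.1, h1.2, ?_⟩
  have h2 : skew (vec w l.supp) (vec w (l.supp ∪ r.supp)) ≠ 0 := by
    rw [← skew_vec_sdiff w subset_union_left, union_sdiff_left, sdiff_eq_self_of_disjoint hd.symm]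
    exact hs.ne'
  exact (vec_ne_zero_of_skew_ne h2).2

theorem BTree.Valid.isBranch {w : ι → ZLat} {μ : ι → ℝ} {s p : BTree ι}
    (h : p.Valid w μ) (hs : s.IsBranch p) :
    s.Valid w μ ∧ vec w s.supp ≠ 0 ∧ lineForm w μ s.supp (nodePos w μ p) = 0 ∧
      s.After w μ (nodePos w μ p) := by
  have hn := h
  obtain ⟨l, r, rfl, rfl | rfl⟩ := hs
  · obtain ⟨vl, vr, hd, hs, al, ar⟩ := h
    exact ⟨vl, hn.vec_ne.1, lineForm_meet_left w μ hs.ne', al⟩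
  · obtain ⟨vl, vr, hd, hs, al, ar⟩ := h
    exact ⟨vr, hn.vec_ne.2.1, lineForm_meet_right w μ hs.ne', ar⟩

/-- A bounded edge of the curve of a valid tree has positive length. -/
theorem BTree.Valid.exists_length {w : ι → ZLat} {μ : ι → ℝ} {l r p : BTree ι}
    (h : p.Valid w μ) (hs : (node l r).IsBranch p) :
    ∃ len : ℝ, 0 < len ∧
      nodePos w μ p - nodePos w μ (node l r) = len • toPlane (vec w (l.supp ∪ r.supp)) := by
  obtain ⟨hv, hne, h1, h2⟩ := h.isBranch hs
  obtain ⟨-, -, hd, hs, -, -⟩ := hv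
  have h3 : lineForm w μ (l.supp ∪ r.supp) (nodePos w μ (node l r)) = 0 := by
    rw [lineForm_union w μ hd, nodePos, lineForm_meet_left w μ hs.ne',
      lineForm_meet_right w μ hs.ne', add_zero]
  have h4 : skewR (toPlane (vec w (l.supp ∪ r.supp)))
      (nodePos w μ p - nodePos w μ (node l r)) = 0 := by
    rw [skewR_sub_right]
    change lineForm w μ (l.supp ∪ r.supp) (nodePos w μ p) = 0 at h1
    unfold lineForm at h1 h3
    linarith
  obtain ⟨c, hc⟩ := exists_smul_of_skewR_eq_zero hne h4
  refine ⟨c, ?_, hc⟩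
  change 0 < lineForm w μ l.supp (nodePos w μ p) at h2
  rw [sub_eq_iff_eq_add'.1 hc, lineForm_add_smul, nodePos, lineForm_meet_left w μ hs.ne', zero_add,
    skewR_toPlane, BTree.supp, ← skew_vec_sdiff w subset_union_left, union_sdiff_left,
    sdiff_eq_self_of_disjoint hd.symm] at h2
  exact (pos_iff_pos_of_mul_pos h2).2 (by exact_mod_cast hs)

variable [Fintype ι]

/-- The moments of the lines `x_i + ℝ w_i`. -/
def moment (w : ι → ZLat) (x : ι → Plane) (i : ι) : ℝ := skewR (toPlane (w i)) (x i)

theorem exists_model {w : ι → ZLat} {x : ι → Plane} {t : BTree ι} (ht : t.Valid w (moment w x))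
    (hsupp : t.supp = univ) :
    ∃ C : TropCurve ι, C.IsOfType w x ∧ ∃ lab, IsModel w (moment w x) C t lab := by
  classical
  obtain ⟨N, G, lab, h⟩ := exists_labelling hsupp
  choose f g hfg using h.exists_node
  have hv : ∀ V, (node (f V) (g V)).Valid w (moment w x) :=
    fun V => ht.of_mem_subs (h.mem _ _ (hfg V))
  have hbranch : ∀ V u s, lab u = some s → G.Adj (Sum.inl V) u →
      (s.IsBranch (node (f V) (g V)) ∧ outDir w (node (f V) (g V)) (lab u) = -vec w s.supp) ∨
      (node (f V) (g V)).IsBranch s ∧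
        outDir w (node (f V) (g V)) (lab u) = vec w ((f V).supp ∪ (g V).supp) := by
    intro V u s hu hadj
    rw [h.adj, hfg, hu, treeLink_some_some, treeLink_some_some] at hadj
    rw [hu]
    rcases hadj with hb | hb
    · refine Or.inl ⟨hb, ?_⟩
      obtain ⟨l, r, e, rfl | rfl⟩ := hb
      · rw [e, IsModel.outDir_left]
      · rw [e, IsModel.outDir_right w (e ▸ hv V).ne]
    · refine Or.inr ⟨hb, IsModel.outDir_up w ?_ ?_⟩
      · intro e
        rw [Option.some.inj e] at hb
        exact lt_asymm hb.numLeaves_lt (IsBranch.numLeaves_lt ⟨_, _, rfl, Or.inl rfl⟩)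
      · intro e
        rw [Option.some.inj e] at hb
        exact lt_asymm hb.numLeaves_lt (IsBranch.numLeaves_lt ⟨_, _, rfl, Or.inr rfl⟩)
  have hroot : ∀ V u, lab u = none → outDir w (node (f V) (g V)) (lab u) =
      vec w ((f V).supp ∪ (g V).supp) := by
    intro V u hu
    rw [hu]
    exact IsModel.outDir_up w (fun e => by cases e) (fun e => by cases e)
  let C : TropCurve ι :=
    { numVertices := N
      graph := G
      isTree := h.isTree ht
      leg_univalent := h.leg_univalent ht
      valence := by
        intro V
        obtain ⟨a, b, c, -, -, -, hab, hac, hbc, hn⟩ := h.neighbours ht (hfg V)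
        have e : G.neighborSet (Sum.inl V) = {a, b, c} := by
          ext u
          rw [SimpleGraph.mem_neighborSet, hn]
          rfl
        rw [e, Set.ncard_eq_three.2 ⟨a, b, c, hab, hac, hbc, rfl⟩]
      pos := fun V => nodePos w (moment w x) (node (f V) (g V))
      dir := fun V u => outDir w (node (f V) (g V)) (lab u)
      dir_ne_zero := by
        intro V u hu
        rcases hs : lab u with _ | s
        · rw [← hs, hroot V u hs]
          exact (hv V).vec_ne.2.2
        · rw [← hs]
          rcases hbranch V u s hs hu with ⟨hb, e⟩ | ⟨hb, e⟩
          · rw [e, neg_ne_zero]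
            exact ((hv V).isBranch hb).2.1
          · rw [e]
            exact (hv V).vec_ne.2.2
      dir_symm := by
        intro V V' hadj
        rcases hbranch V _ _ (hfg V') hadj with ⟨hb, e⟩ | ⟨hb, e⟩ <;>
        rcases hbranch V' _ _ (hfg V) hadj.symm with ⟨hb', e'⟩ | ⟨hb', e'⟩
        · exact absurd hb.numLeaves_lt hb'.numLeaves_lt.not_gt
        · rw [e, e', neg_neg]; rfl
        · rw [e, e']; rfl
        · exact absurd hb.numLeaves_lt hb'.numLeaves_lt.not_gt
      edge := by
        intro V V' hadj
        rcases hbranch V _ _ (hfg V') hadj with ⟨hb, e⟩ | ⟨hb, e⟩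
        · obtain ⟨len, hlen, he⟩ := (hv V).exists_length hb
          refine ⟨len, hlen, ?_⟩
          rw [e, toPlane_neg, smul_neg, ← neg_sub, he]
          rfl
        · obtain ⟨len, hlen, he⟩ := (hv V').exists_length hb
          exact ⟨len, hlen, by rw [e, he]⟩
      balancing := by
        intro V
        obtain ⟨a, b, c, ha, hb, hc, hab, hac, hbc, hn⟩ := h.neighbours ht (hfg V)
        have e : (univ.filter fun u => G.Adj (Sum.inl V) u) = {a, b, c} := by
          ext u
          simp [hn]
        have dirc : outDir w (node (f V) (g V)) (lab c) = vec w ((f V).supp ∪ (g V).supp) := by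
          refine IsModel.outDir_up w ?_ ?_
          · rw [← ha]; exact fun e => hac (h.inj e).symm
          · rw [← hb]; exact fun e => hbc (h.inj e).symm
        refine (Finset.sum_congr (by convert e) fun _ _ => rfl).trans ?_
        rw [sum_insert (by simp [hab, hac]), sum_insert (by simp [hbc]), sum_singleton, dirc, ha, hb,
          IsModel.outDir_left, IsModel.outDir_right w (hv V).ne, vec_union w (hv V).2.2.1]
        abel }
  refine ⟨C, ⟨fun V hadj => ?_, fun V i hadj => ?_⟩, lab, h, fun V s hs => ?_, fun V s u hs hu => ?_⟩
  · change outDir w (node (f V) (g V)) (lab _) = _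
    have h1 : G.Adj (Sum.inl V) (Sum.inr none) := hadj
    rw [hroot V _ h.root]
    rw [h.adj, h.root, hfg, treeLink_none] at h1
    have h2 : node (f V) (g V) = t := Option.some.inj (h1.resolve_left not_treeLink_none)
    rw [← h2, BTree.supp] at hsupp
    rw [hsupp]
    rfl
  · have h1 : G.Adj (Sum.inl V) (Sum.inr (some i)) := hadj
    rcases hbranch V _ _ (h.leaf i) h1 with ⟨hb, e⟩ | ⟨hb, e⟩
    · have hvec : vec w (leaf i).supp = w i := sum_singleton _ _
      refine ⟨?_, ?_⟩
      · rw [← hvec]; exact e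
      · obtain ⟨-, hne, hl, -⟩ := (hv V).isBranch hb
        rw [hvec] at hne
        have h2 : skewR (toPlane (w i)) (nodePos w (moment w x) (node (f V) (g V)) - x i) = 0 := by
          rw [lineForm, hvec] at hl
          rw [skewR_sub_right]
          rw [BTree.supp, sum_singleton] at hl
          exact hl
        obtain ⟨c, hc⟩ := exists_smul_of_skewR_eq_zero hne h2
        exact ⟨c, sub_eq_iff_eq_add'.1 hc⟩
    · obtain ⟨l, r, h2, -⟩ := hb
      cases h2
  · cases (hfg V).symm.trans hs
    rfl
  · cases (hfg V).symm.trans hs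
    rfl

end Realization

/-! ### The tree of a tropical curve -/

section TreeOfCurve

variable {ι : Type} [DecidableEq ι] [Fintype ι]

open BTree

/-- The node `v` is the parent of `u` in the curve `C` with its root leg. -/
abbrev TropCurve.Parent (C : TropCurve ι) (u v : Fin C.numVertices ⊕ Option ι) : Prop :=
  IsParent C.graph (Sum.inr none) u v

/-- The part of the curve below the node `u` has the shape `t`. -/
def IsBelow (w : ι → ZLat) (μ : ι → ℝ) (C : TropCurve ι) :
    BTree ι → Fin C.numVertices ⊕ Option ι → Prop
  | leaf i, u => u = Sum.inr (some i)
  | node l r, u => ∃ V a b, u = Sum.inl V ∧ IsBelow w μ C l a ∧ IsBelow w μ C r b ∧ a ≠ b ∧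
      (∀ v, C.Parent v u ↔ v = a ∨ v = b) ∧
      (Disjoint l.supp r.supp ∧ 0 < skew (vec w l.supp) (vec w r.supp) ∧
      After w μ l (meet w μ l.supp r.supp) ∧ After w μ r (meet w μ l.supp r.supp)) ∧
      C.pos V = meet w μ l.supp r.supp ∧ C.dir V a = -vec w l.supp ∧ C.dir V b = -vec w r.supp ∧
      ∀ c, C.Parent u c → C.dir V c = vec w (l.supp ∪ r.supp)

variable {w : ι → ZLat} {μ : ι → ℝ} {C : TropCurve ι}

namespace IsBelow

theorem valid {t : BTree ι} {u : Fin C.numVertices ⊕ Option ι} (h : IsBelow w μ C t u) :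
    t.Valid w μ := by
  induction t generalizing u with
  | leaf i => trivial
  | node l r hl hr =>
    obtain ⟨V, a, b, -, ha, hb, -, -, ⟨h1, h2, h3, h4⟩, -⟩ := h
    exact ⟨hl ha, hr hb, h1, h2, h3, h4⟩

theorem ne_root {t : BTree ι} {u : Fin C.numVertices ⊕ Option ι} (h : IsBelow w μ C t u) :
    u ≠ Sum.inr none := by
  rintro rfl
  rcases t with i | ⟨l, r⟩
  · cases h
  · obtain ⟨V, a, b, h1, -⟩ := h
    cases h1

theorem unique_node {t : BTree ι} {u u' : Fin C.numVertices ⊕ Option ι} (h : IsBelow w μ C t u)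
    (h' : IsBelow w μ C t u') : u = u' := by
  induction t generalizing u u' with
  | leaf i => exact Eq.trans h (Eq.symm h')
  | node l r hl hr =>
    obtain ⟨V, a, b, -, ha, -, -, hn, -⟩ := h
    obtain ⟨V', a', b', -, ha', -, -, hn', -⟩ := h'
    have e := hl ha ha'
    subst e
    exact ((hn a).2 (Or.inl rfl)).unique C.isTree ((hn' a).2 (Or.inl rfl))

theorem unique_tree {t t' : BTree ι} {u : Fin C.numVertices ⊕ Option ι} (h : IsBelow w μ C t u)
    (h' : IsBelow w μ C t' u) : t = t' := by
  induction t generalizing t' u with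
  | leaf i =>
    have e : u = Sum.inr (some i) := h
    subst e
    rcases t' with i' | ⟨l', r'⟩
    · have e' : Sum.inr (some i) = (Sum.inr (some i') : Fin C.numVertices ⊕ Option ι) := h'
      cases e'
      rfl
    · obtain ⟨V, a, b, h1, -⟩ := h'
      cases h1
  | node l r hl hr =>
    obtain ⟨V, a, b, rfl, ha, hb, hab, hn, ⟨-, hs, -, -⟩, -⟩ := h
    rcases t' with i' | ⟨l', r'⟩
    · cases h'
    · obtain ⟨V', a', b', -, ha', hb', hab', hn', ⟨-, hs', -, -⟩, -⟩ := h'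
      have h1 := (hn' a).1 ((hn a).2 (Or.inl rfl))
      have h2 := (hn' b).1 ((hn b).2 (Or.inr rfl))
      rcases h1 with rfl | rfl <;> rcases h2 with rfl | rfl
      · exact absurd rfl hab
      · rw [hl ha ha', hr hb hb']
      · have e1 := hl ha hb'
        have e2 := hr hb ha'
        rw [e1, e2, QTorus.skew_neg_swap] at hs
        omega
      · exact absurd rfl hab

theorem isAncestor {t : BTree ι} {u : Fin C.numVertices ⊕ Option ι} (h : IsBelow w μ C t u)
    {i : ι} (hi : i ∈ t.supp) : IsAncestor C.graph (Sum.inr none) (Sum.inr (some i)) u := by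
  induction t generalizing u with
  | leaf j =>
    rw [supp, mem_singleton] at hi
    subst hi
    have e : u = Sum.inr (some i) := h
    rw [e]
    exact Relation.ReflTransGen.refl
  | node l r hl hr =>
    obtain ⟨V, a, b, -, ha, hb, -, hn, -⟩ := h
    rcases mem_union.1 hi with hi | hi
    · exact Relation.ReflTransGen.tail (hl ha hi) ((hn a).2 (Or.inl rfl))
    · exact Relation.ReflTransGen.tail (hr hb hi) ((hn b).2 (Or.inr rfl))

theorem disjoint {t t' : BTree ι} {u u' v : Fin C.numVertices ⊕ Option ι}
    (h : IsBelow w μ C t u) (h' : IsBelow w μ C t' u') (hv : C.Parent u v) (hv' : C.Parent u' v)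
    (hne : u ≠ u') : Disjoint t.supp t'.supp := by
  rw [Finset.disjoint_left]
  intro i hi hi'
  exact hne ((h.isAncestor hi).unique C.isTree (h'.isAncestor hi') (hv.2.trans hv'.2.symm))

/-- The edge from a node to its parent: its direction, its line, and the position of the parent
beyond the node. -/
theorem edge {x : ι → Plane} (hC : C.IsOfType w x) {t : BTree ι}
    {u : Fin C.numVertices ⊕ Option ι} (h : IsBelow w (moment w x) C t u) {V : Fin C.numVertices}
    (hV : C.Parent u (Sum.inl V)) :
    C.dir V u = -vec w t.supp ∧ lineForm w (moment w x) t.supp (C.pos V) = 0 ∧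
      t.After w (moment w x) (C.pos V) := by
  rcases t with i | ⟨l, r⟩
  · have e : u = Sum.inr (some i) := h
    subst e
    obtain ⟨h1, c, h2⟩ := hC.2 V i hV.1
    have hvec : vec w (leaf i).supp = w i := sum_singleton _ _
    refine ⟨by rw [hvec, h1], ?_, trivial⟩
    rw [lineForm, hvec, BTree.supp, sum_singleton, h2, skewR_add_right, skewR_smul_right, skewR_self,
      moment]
    ring
  · obtain ⟨V', a, b, rfl, ha, hb, hab, hn, ⟨hd, hs, -, -⟩, hpos, -, -, hup⟩ := h
    have h1 := hup _ hV
    obtain ⟨len, hlen, he⟩ := C.edge V' V hV.1.symm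
    have h2 : C.pos V = meet w (moment w x) l.supp r.supp +
        len • toPlane (vec w (l.supp ∪ r.supp)) := by
      rw [← h1, ← he, hpos]
      abel
    refine ⟨?_, ?_, ?_⟩
    · rw [C.dir_symm V' V hV.1.symm, h1]
      rfl
    · rw [h2, BTree.supp, lineForm_add_smul, skewR_self, lineForm_union w _ hd,
        lineForm_meet_left w _ hs.ne', lineForm_meet_right w _ hs.ne']
      ring
    · change 0 < lineForm w (moment w x) l.supp (C.pos V)
      rw [h2, lineForm_add_smul, lineForm_meet_left w _ hs.ne', zero_add, skewR_toPlane,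
        ← skew_vec_sdiff w subset_union_left, union_sdiff_left, sdiff_eq_self_of_disjoint hd.symm]
      exact mul_pos hlen (by exact_mod_cast hs)

end IsBelow

/-- A vertex of a curve in general position is the root of a tree: it has exactly two edges to
nodes below it. -/
theorem exists_isBelow {x : ι → Plane} (hgen : GenericLines w (moment w x)) (hC : C.IsOfType w x)
    (u : Fin C.numVertices ⊕ Option ι) :
    u ≠ Sum.inr none → ∃ t, IsBelow w (moment w x) C t u := by
  classical
  induction u using induction_of_isParent (G := C.graph) (Sum.inr none) with
  | h u ih =>
  intro hu
  rcases u with V | _ | i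
  swap
  · exact absurd rfl hu
  swap
  · exact ⟨leaf i, rfl⟩
  have hex : ∀ v, C.Parent v (Sum.inl V) → ∃ t, IsBelow w (moment w x) C t v :=
    fun v hv => ih v hv (fun e => not_isParent_root _ _ (e ▸ hv))
  obtain ⟨c, hc⟩ := exists_isParent C.isTree hu
  have hneigh : ∀ v, C.graph.Adj (Sum.inl V) v ↔ v = c ∨ C.Parent v (Sum.inl V) := by
    intro v
    constructor
    · intro h
      rcases isParent_or_of_adj C.isTree (Sum.inr none) h with h1 | h1
      · exact Or.inl (h1.unique C.isTree hc)
      · exact Or.inr h1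
    · rintro (rfl | h)
      · exact hc.1.symm
      · exact h.1
  have hcne : ∀ v, C.Parent v (Sum.inl V) → v ≠ c := by
    rintro v hv rfl
    have h1 := hv.2
    have h2 := hc.2
    omega
  -- two nodes below the vertex
  obtain ⟨a, b, ha, hb, hab⟩ : ∃ a b, C.Parent a (Sum.inl V) ∧ C.Parent b (Sum.inl V) ∧ a ≠ b := by
    have h3 := C.valence V
    have e : C.graph.neighborSet (Sum.inl V) = insert c {v | C.Parent v (Sum.inl V)} := by
      ext v
      exact hneigh v
    rw [e, Set.ncard_insert_of_notMem (show c ∉ {v | C.Parent v (Sum.inl V)} from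
      fun h => hcne c h rfl)] at h3
    obtain ⟨a, ha, b, hb, hab⟩ := (Set.one_lt_ncard (Set.toFinite _)).1
      (show 1 < {v | C.Parent v (Sum.inl V)}.ncard by omega)
    exact ⟨a, b, ha, hb, hab⟩
  obtain ⟨l, hl⟩ := hex a ha
  obtain ⟨r, hr⟩ := hex b hb
  have hd := hl.disjoint hr ha hb hab
  obtain ⟨dirl, linel, afterl⟩ := hl.edge hC ha
  obtain ⟨dirr, liner, afterr⟩ := hr.edge hC hb
  -- a third branch would give three concurrent lines
  have hthird : ∀ v, C.Parent v (Sum.inl V) → v = a ∨ v = b := by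
    intro v hv
    by_contra hvn
    push Not at hvn
    obtain ⟨s, hs⟩ := hex v hv
    have hd1 := hl.disjoint hs ha hv hvn.1.symm
    have hd2 := hr.disjoint hs hb hv hvn.2.symm
    obtain ⟨-, lines, -⟩ := hs.edge hC hv
    have hrs : Disjoint l.supp (r.supp ∪ s.supp) := disjoint_union_right.2 ⟨hd, hd1⟩
    have hl0 := l.supp_nonempty
    have hr0 := r.supp_nonempty
    have hs0 := s.supp_nonempty
    rcases hgen.no_triple l.supp (r.supp ∪ s.supp) hl0
      (hr0.mono subset_union_left) hrs r.supp
      (subset_union_left.trans subset_union_right) (C.pos V) linel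
      (by rw [lineForm_union w _ hd2, liner, lines, add_zero]) liner with h | h | h | h
    · exact hr0.ne_empty h
    · rw [h] at hd
      exact hl0.ne_empty (disjoint_self.1 hd)
    · have : s.supp ⊆ r.supp := by rw [h]; exact subset_union_right
      exact hs0.ne_empty (disjoint_self.1 (hd2.mono_left this))
    · have : l.supp ⊆ r.supp := by rw [h]; exact subset_union_left
      exact hl0.ne_empty (disjoint_self.1 (hd.mono_right this))
  -- The balancing condition gives the direction of the edge towards the root.
  have hdirc : C.dir V c = vec w l.supp + vec w r.supp := by
    have h1 := C.balancing V
    have e : (univ.filter fun v => C.graph.Adj (Sum.inl V) v) = {c, a, b} := by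
      ext v
      simp only [mem_filter, mem_univ, true_and, mem_insert, mem_singleton]
      rw [hneigh]
      constructor
      · rintro (h | h)
        · exact Or.inl h
        · exact Or.inr (hthird v h)
      · rintro (h | rfl | rfl)
        · exact Or.inl h
        · exact Or.inr ha
        · exact Or.inr hb
    have h2 : ∑ v ∈ ({c, a, b} : Finset _), C.dir V v = 0 := by
      rw [← h1]
      exact Finset.sum_congr (by rw [← e]) fun _ _ => rfl
    rw [sum_insert (by simp [(hcne a ha).symm, (hcne b hb).symm]), sum_insert (by simp [hab]),
      sum_singleton, dirl, dirr] at h2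
    have h3 : C.dir V c + (-vec w l.supp + -vec w r.supp) =
      C.dir V c - (vec w l.supp + vec w r.supp) := by abel
    rw [h3] at h2
    exact sub_eq_zero.1 h2
  have hskew := hgen.skew_ne l.supp r.supp l.supp_nonempty r.supp_nonempty hd _ linel liner
  have hiff : ∀ v, C.Parent v (Sum.inl V) ↔ v = a ∨ v = b := by
    intro v
    constructor
    · exact hthird v
    · rintro (rfl | rfl)
      · exact ha
      · exact hb
  -- The left branch of a valid tree is the one that makes the determinant positive.
  rcases lt_or_gt_of_ne hskew with hneg | hpos
  · have hskew' : 0 < skew (vec w r.supp) (vec w l.supp) := by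
      rw [QTorus.skew_neg_swap]
      omega
    have hm := eq_meet hskew'.ne' liner linel
    rw [hm] at afterl afterr
    exact ⟨node r l, V, b, a, rfl, hr, hl, hab.symm, fun v => by rw [hiff, or_comm],
      ⟨hd.symm, hskew', afterr, afterl⟩, hm, dirr, dirl, fun c' hc' => by
        rw [hc'.unique C.isTree hc, hdirc, vec_union w hd.symm, add_comm]⟩
  · have hm := eq_meet hpos.ne' linel liner
    rw [hm] at afterl afterr
    exact ⟨node l r, V, a, b, rfl, hl, hr, hab, hiff,
      ⟨hd, hpos, afterl, afterr⟩, hm, dirl, dirr, fun c' hc' => by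
        rw [hc'.unique C.isTree hc, hdirc, vec_union w hd]⟩

/-- Every curve in general position is the curve of a valid tree. -/
theorem exists_tree {x : ι → Plane} (hgen : GenericLines w (moment w x)) (hC : C.IsOfType w x) :
    ∃ t : BTree ι, t.Valid w (moment w x) ∧ t.supp = univ ∧
      ∃ lab, IsModel w (moment w x) C t lab := by
  classical
  choose tr htr using exists_isBelow hgen hC
  let lab : Fin C.numVertices ⊕ Option ι → Option (BTree ι) := fun u =>
    if h : u = Sum.inr none then none else some (tr u h)
  have hlab0 : lab (Sum.inr none) = none := dif_pos rfl
  have hlabB : ∀ u s, lab u = some s ↔ IsBelow w (moment w x) C s u := by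
    intro u s
    by_cases h : u = Sum.inr none
    · simp only [lab, dif_pos h]
      constructor
      · intro h'; cases h'
      · intro h'; exact absurd h h'.ne_root
    · simp only [lab, dif_neg h]
      constructor
      · intro h'
        cases h'
        exact htr u h
      · intro h'
        rw [(htr u h).unique_tree h']
  have hlabN : ∀ u, lab u = none → u = Sum.inr none := by
    intro u hu
    by_contra h
    simp only [lab, dif_neg h] at hu
    cases hu
  obtain ⟨u₀, hu₀⟩ := Set.ncard_eq_one.1 (C.leg_univalent none)
  have hadj₀ : ∀ v, C.graph.Adj (Sum.inr none) v ↔ v = u₀ := fun v => by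
    rw [← SimpleGraph.mem_neighborSet, hu₀, Set.mem_singleton_iff]
  have hne₀ : u₀ ≠ Sum.inr none := by
    rintro rfl
    exact SimpleGraph.irrefl _ ((hadj₀ _).2 rfl)
  set t := tr u₀ hne₀ with ht
  have hB₀ : IsBelow w (moment w x) C t u₀ := htr u₀ hne₀
  have hbranch : ∀ {u v s p}, C.Parent u v → IsBelow w (moment w x) C s u →
      IsBelow w (moment w x) C p v → s.IsBranch p := by
    intro u v s p huv hs hp
    rcases p with i | ⟨l, r⟩
    · -- a leg has no node below it
      exfalso
      have e : v = Sum.inr (some i) := hp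
      subst e
      obtain ⟨z, hz⟩ := Set.ncard_eq_one.1 (C.leg_univalent (some i))
      obtain ⟨c, hc⟩ := exists_isParent C.isTree
        (show (Sum.inr (some i) : Fin C.numVertices ⊕ Option ι) ≠ Sum.inr none from
          fun e => by cases e)
      have h1 : u = z := by
        rw [← Set.mem_singleton_iff, ← hz]; exact huv.1
      have h2 : c = z := by
        rw [← Set.mem_singleton_iff, ← hz]; exact hc.1.symm
      have h3 := huv.2
      have h4 := hc.2
      rw [h1] at h3
      rw [h2] at h4
      omega
    · obtain ⟨V, a, b, -, ha, hb, -, hn, -⟩ := hp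
      rcases (hn u).1 huv with rfl | rfl
      · exact ⟨l, r, rfl, Or.inl (hs.unique_tree ha)⟩
      · exact ⟨l, r, rfl, Or.inr (hs.unique_tree hb)⟩
  -- Along the path from the root the trees below the nodes are successive branches of `t`.
  have hmem : ∀ u s, lab u = some s → s ∈ t.subs := by
    intro u
    induction u using induction_of_root C.isTree (Sum.inr none) with
    | h0 =>
      intro s hs
      rw [hlab0] at hs
      cases hs
    | h u v huv ih =>
      intro s hs
      rw [hlabB] at hs
      by_cases hv : v = Sum.inr none
      · subst hv
        have e := (hadj₀ u).1 huv.1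
        subst e
        rw [hs.unique_tree hB₀]
        exact t.self_mem_subs
      · exact (hbranch huv hs (htr v hv)).mem_subs (ih _ ((hlabB _ _).2 (htr v hv)))
  have hleaf : ∀ i, lab (Sum.inr (some i)) = some (leaf i) := fun i => (hlabB _ _).2 rfl
  refine ⟨t, hB₀.valid, ?_, lab, ⟨?_, hlab0, hleaf, hmem, ?_, ?_⟩, ?_, ?_⟩
  · exact eq_univ_iff_forall.2 fun i => leaf_mem_subs.1 (hmem _ _ (hleaf i))
  · intro u u' h
    rcases hs : lab u with _ | s
    · rw [hlabN u hs, hlabN u' (h.symm.trans hs)]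
    · exact ((hlabB _ _).1 hs).unique_node ((hlabB _ _).1 (h.symm.trans hs))
  · intro s hs
    refine subs_induction (t := t) (P := fun s => ∃ u, lab u = some s) ?_ ?_ hs
    · exact ⟨u₀, (hlabB _ _).2 hB₀⟩
    · rintro l r - ⟨u, hu⟩
      obtain ⟨V, a, b, -, ha, hb, -⟩ := (hlabB _ _).1 hu
      exact ⟨⟨a, (hlabB _ _).2 ha⟩, ⟨b, (hlabB _ _).2 hb⟩⟩
  · have hdown : ∀ u v, C.Parent u v → TreeLink t (lab v) (lab u) := by
      intro u v huv
      have hu : u ≠ Sum.inr none := fun e => not_isParent_root _ _ (e ▸ huv)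
      by_cases hv : v = Sum.inr none
      · subst hv
        have e := (hadj₀ u).1 huv.1
        subst e
        exact Or.inl ⟨hlab0, (hlabB _ _).2 hB₀⟩
      · exact Or.inr ⟨_, _, (hlabB _ _).2 (htr v hv), (hlabB _ _).2 (htr u hu),
          hbranch huv (htr u hu) (htr v hv)⟩
    have hup : ∀ u v, TreeLink t (lab u) (lab v) → C.graph.Adj u v := by
      rintro u v (⟨h1, h2⟩ | ⟨p, s, h1, h2, l, r, rfl, hs⟩)
      · rw [hlabN u h1, hadj₀]
        exact ((hlabB _ _).1 h2).unique_node hB₀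
      · obtain ⟨V, a, b, -, ha, hb, -, hn, -⟩ := (hlabB _ _).1 h1
        rcases hs with rfl | rfl
        · exact ((hn v).2 (Or.inl (((hlabB _ _).1 h2).unique_node ha))).1
        · exact ((hn v).2 (Or.inr (((hlabB _ _).1 h2).unique_node hb))).1
    intro u v
    constructor
    · intro h
      rcases isParent_or_of_adj C.isTree (Sum.inr none) h with h1 | h1
      · exact Or.inr (hdown u v h1)
      · exact Or.inl (hdown v u h1)
    · rintro (h | h)
      · exact hup u v h
      · exact (hup v u h).symm
  · intro V s hs
    rw [hlabB] at hs
    rcases s with i | ⟨l, r⟩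
    · cases hs
    · obtain ⟨V', a, b, e, -, -, -, -, -, hpos, -⟩ := hs
      cases e
      exact hpos
  · intro V s u hs hu
    rw [hlabB] at hs
    have hv := hs.valid
    rcases s with i | ⟨l, r⟩
    · cases hs
    · obtain ⟨V', a, b, e, ha, hb, hab, hn, -, -, dira, dirb, hup⟩ := hs
      cases e
      rcases isParent_or_of_adj C.isTree (Sum.inr none) hu with h1 | h1
      · rw [hup u h1, IsModel.outDir_up]
        · intro e
          rw [ha.unique_node ((hlabB _ _).1 e)] at hn
          have h2 := ((hn u).2 (Or.inl rfl)).2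
          have h3 := h1.2
          omega
        · intro e
          rw [hb.unique_node ((hlabB _ _).1 e)] at hn
          have h2 := ((hn u).2 (Or.inr rfl)).2
          have h3 := h1.2
          omega
      · rcases (hn u).1 h1 with rfl | rfl
        · rw [dira, (hlabB _ _).2 ha, IsModel.outDir_left]
        · rw [dirb, (hlabB _ _).2 hb, IsModel.outDir_right w hv.ne]

/-- For lines in general position the curves are finitely many and trivalent, and their refined
count is the sum over the trees. -/
theorem count_of_generic {x : ι → Plane} (hgen : GenericLines w (moment w x)) :
    Finite (TropClasses w x) ∧ (∀ C : TropCurve ι, C.IsOfType w x → C.IsTrivalent) ∧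
      ∑ᶠ c : TropClasses w x, c.refinedMult = ∑ t ∈ validTrees w (moment w x) univ, t.mult w := by
  classical
  have hval : ∀ t : validTrees w (moment w x) univ, t.1.Valid w (moment w x) ∧ t.1.supp = univ :=
    fun t => mem_validTrees.1 t.2
  choose D hD lab hlab using fun t : validTrees w (moment w x) univ =>
    exists_model (hval t).1 (hval t).2
  let F : validTrees w (moment w x) univ → TropClasses w x :=
    fun t => Quotient.mk (TropCurve.isoSetoid w x) ⟨D t, hD t⟩
  have hF : Function.Bijective F := by
    constructor
    · intro t t' h
      have h1 : (D t).Iso (D t') := Quotient.exact h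
      exact Subtype.ext ((hlab t).eq_of_iso (hlab t') (hval t).1 (hval t').1 h1)
    · intro c
      induction c using Quotient.inductionOn with
      | h C =>
      obtain ⟨t, ht, hs, lab', hm⟩ := exists_tree hgen C.2
      refine ⟨⟨t, mem_validTrees.2 ⟨ht, hs⟩⟩, ?_⟩
      exact Quotient.sound ((hlab ⟨t, mem_validTrees.2 ⟨ht, hs⟩⟩).iso hm)
  refine ⟨Finite.of_surjective F hF.2, fun C hC => ?_, ?_⟩
  · obtain ⟨t, ht, -, lab', hm⟩ := exists_tree hgen hC
    exact hm.isTrivalent ht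
  · rw [← finsum_comp_equiv (Equiv.ofBijective F hF), finsum_eq_sum_of_fintype,
      ← sum_coe_sort (validTrees w (moment w x) univ) fun t => t.mult w]
    exact sum_congr rfl fun t _ => (hlab t).refinedMult_eq (hval t).1

end TreeOfCurve

/-! ### General position -/

section GeneralPosition

variable {ι : Type} [DecidableEq ι]

/-- If the lines of `J` and `K` are parallel, their moments satisfy a non-trivial linear relation as
soon as they have a common point. -/
theorem exists_relation_of_skew_eq_zero (w : ι → ZLat) {J K : Finset ι} (hJ : J.Nonempty)
    (hK : K.Nonempty) (hd : Disjoint J K) (h : skew (vec w J) (vec w K) = 0) :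
    ∃ c : ι → ℝ, c ≠ 0 ∧ ∀ (μ : ι → ℝ) (y : Plane), lineForm w μ J y = 0 → lineForm w μ K y = 0 →
      ∀ s : Finset ι, J ∪ K ⊆ s → ∑ i ∈ s, c i * μ i = 0 := by
  obtain ⟨α, β, hne, h1, h2⟩ : ∃ α β : ℝ, (α ≠ 0 ∨ β ≠ 0) ∧
      α * (vec w J).1 + β * (vec w K).1 = 0 ∧ α * (vec w J).2 + β * (vec w K).2 = 0 := by
    have h' : ((vec w J).1 : ℝ) * (vec w K).2 - (vec w J).2 * (vec w K).1 = 0 := by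
      unfold skew at h
      exact_mod_cast h
    by_cases ha : (vec w J).1 = 0 ∧ (vec w K).1 = 0
    · by_cases hb : (vec w J).2 = 0 ∧ (vec w K).2 = 0
      · exact ⟨1, 0, Or.inl one_ne_zero, by simp [ha.1], by simp [hb.1]⟩
      · refine ⟨(vec w K).2, -(vec w J).2, ?_, by simp [ha.1, ha.2], by ring⟩
        by_contra hc
        push Not at hc
        exact hb ⟨by exact_mod_cast neg_eq_zero.1 hc.2, by exact_mod_cast hc.1⟩
    · refine ⟨(vec w K).1, -(vec w J).1, ?_, by ring, by linarith⟩
      by_contra hc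
      push Not at hc
      exact ha ⟨by exact_mod_cast neg_eq_zero.1 hc.2, by exact_mod_cast hc.1⟩
  refine ⟨fun i => (if i ∈ J then α else 0) + (if i ∈ K then β else 0), ?_, ?_⟩
  · intro h0
    rcases hne with hα | hβ
    · obtain ⟨i, hi⟩ := hJ
      have := congrFun h0 i
      simp [hi, Finset.disjoint_left.1 hd hi] at this
      exact hα this
    · obtain ⟨i, hi⟩ := hK
      have := congrFun h0 i
      simp [hi, Finset.disjoint_right.1 hd hi] at this
      exact hβ this
  · intro μ y hJy hKy s hs
    have e1 : ∀ (L : Finset ι) (a : ℝ), L ⊆ s →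
        ∑ i ∈ s, (if i ∈ L then a else 0) * μ i = a * ∑ i ∈ L, μ i := by
      intro L a hL
      simp only [ite_mul, zero_mul]
      rw [← sum_filter, filter_mem_eq_inter, inter_eq_right.2 hL, mul_sum]
    simp only [add_mul, sum_add_distrib]
    rw [e1 J α (subset_union_left.trans hs), e1 K β (subset_union_right.trans hs)]
    unfold lineForm skewR toPlane at hJy hKy
    simp only at hJy hKy
    linear_combination (-α) * hJy + (-β) * hKy + y.2 * h1 - y.1 * h2

/-- If the lines of `J` and `K` are not parallel, their moments and the one of another set `J'`
satisfy a non-trivial linear relation as soon as the three lines have a common point. -/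
theorem exists_relation_of_concurrent (w : ι → ZLat) {J K J' : Finset ι}
    (hd : Disjoint J K) (h : skew (vec w J) (vec w K) ≠ 0) (hJ' : J' ⊆ J ∪ K)
    (hne : ¬ (J' = ∅ ∨ J' = J ∨ J' = K ∨ J' = J ∪ K)) :
    ∃ c : ι → ℝ, c ≠ 0 ∧ ∀ (μ : ι → ℝ) (y : Plane), lineForm w μ J y = 0 → lineForm w μ K y = 0 →
      lineForm w μ J' y = 0 → ∀ s : Finset ι, J ∪ K ⊆ s → ∑ i ∈ s, c i * μ i = 0 := by
  have hR : ((skew (vec w J) (vec w K) : ℤ) : ℝ) ≠ 0 := by exact_mod_cast h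
  set α : ℝ := ((skew (vec w J) (vec w K) : ℤ) : ℝ) with hα
  set β : ℝ := ((skew (vec w K) (vec w J') : ℤ) : ℝ) with hβ
  set δ : ℝ := ((skew (vec w J') (vec w J) : ℤ) : ℝ) with hδ
  refine ⟨fun i => (if i ∈ J' then α else 0) + (if i ∈ J then β else 0) + (if i ∈ K then δ else 0),
    ?_, ?_⟩
  · intro h0
    -- the coefficients at a point of `J ∩ J'` and at a point of `J \ J'` differ by `α`
    have key : ∀ (L : Finset ι) (b : ℝ), (∀ i ∈ L, (if i ∈ J then β else 0) +
        (if i ∈ K then δ else 0) = b) → L ⊆ J' ∨ Disjoint L J' := by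
      intro L b hL
      by_contra hc
      push Not at hc
      obtain ⟨⟨i, hi, hi'⟩, ⟨i', hi2, hi2'⟩⟩ : (∃ i ∈ L, i ∉ J') ∧ ∃ i ∈ L, i ∈ J' :=
        ⟨not_subset.1 hc.1, not_disjoint_iff.1 hc.2⟩
      have k1 := congrFun h0 i
      have k2 := congrFun h0 i'
      simp only [Pi.zero_apply, add_assoc, hL i hi, hL i' hi2, if_neg hi', if_pos hi2'] at k1 k2
      exact hR (by linarith)
    have kJ := key J β fun i hi => by rw [if_pos hi, if_neg (Finset.disjoint_left.1 hd hi), add_zero]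
    have kK := key K δ fun i hi => by rw [if_pos hi, if_neg (Finset.disjoint_right.1 hd hi), zero_add]
    apply hne
    rcases kJ with kJ | kJ <;> rcases kK with kK | kK
    · exact Or.inr (Or.inr (Or.inr (subset_antisymm hJ' (union_subset kJ kK))))
    · refine Or.inr (Or.inl (subset_antisymm (fun i hi => ?_) kJ))
      exact (mem_union.1 (hJ' hi)).resolve_right fun hK => Finset.disjoint_left.1 kK hK hi
    · refine Or.inr (Or.inr (Or.inl (subset_antisymm (fun i hi => ?_) kK)))
      exact (mem_union.1 (hJ' hi)).resolve_left fun hJ => Finset.disjoint_left.1 kJ hJ hi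
    · refine Or.inl (eq_empty_iff_forall_notMem.2 fun i hi => ?_)
      rcases mem_union.1 (hJ' hi) with hJ | hK
      · exact Finset.disjoint_left.1 kJ hJ hi
      · exact Finset.disjoint_left.1 kK hK hi
  · intro μ y hJy hKy hJy' s hs
    have e1 : ∀ (L : Finset ι) (a : ℝ), L ⊆ s →
        ∑ i ∈ s, (if i ∈ L then a else 0) * μ i = a * ∑ i ∈ L, μ i := by
      intro L a hL
      simp only [ite_mul, zero_mul]
      rw [← sum_filter, filter_mem_eq_inter, inter_eq_right.2 hL, mul_sum]
    simp only [add_mul, sum_add_distrib]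
    rw [e1 J β (subset_union_left.trans hs), e1 K δ (subset_union_right.trans hs),
      e1 J' α (hJ'.trans hs)]
    have hα' : α = (vec w J).1 * (vec w K).2 - (vec w J).2 * (vec w K).1 := by
      rw [hα, skew]; push_cast; ring
    have hβ' : β = (vec w K).1 * (vec w J').2 - (vec w K).2 * (vec w J').1 := by
      rw [hβ, skew]; push_cast; ring
    have hδ' : δ = (vec w J').1 * (vec w J).2 - (vec w J').2 * (vec w J).1 := by
      rw [hδ, skew]; push_cast; ring
    unfold lineForm skewR toPlane at hJy hKy hJy'
    simp only at hJy hKy hJy'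
    rw [hα', hβ', hδ'] at *
    linear_combination (-((vec w K).1 * (vec w J').2 - (vec w K).2 * (vec w J').1) : ℝ) * hJy -
      ((vec w J').1 * (vec w J).2 - (vec w J').2 * (vec w J).1 : ℝ) * hKy -
      ((vec w J).1 * (vec w K).2 - (vec w J).2 * (vec w K).1 : ℝ) * hJy'

variable [Fintype ι]

/-- Moments are in general position if they satisfy none of finitely many linear relations. -/
theorem exists_relations [Nonempty ι] (w : ι → ZLat) :
    ∃ c : Finset ι × Finset ι × Finset ι → ι → ℝ, (∀ T, c T ≠ 0) ∧
      ∀ μ : ι → ℝ, (∀ T, ∑ i, c T i * μ i ≠ 0) → GenericLines w μ := by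
  classical
  have key : ∀ T : Finset ι × Finset ι × Finset ι, ∃ c : ι → ℝ, c ≠ 0 ∧ ∀ μ : ι → ℝ,
      (T.1.Nonempty ∧ T.2.1.Nonempty ∧ Disjoint T.1 T.2.1 ∧ T.2.2 ⊆ T.1 ∪ T.2.1 ∧
        (skew (vec w T.1) (vec w T.2.1) = 0 ∨
        ¬ (T.2.2 = ∅ ∨ T.2.2 = T.1 ∨ T.2.2 = T.2.1 ∨ T.2.2 = T.1 ∪ T.2.1)) ∧
        ∃ y, lineForm w μ T.1 y = 0 ∧ lineForm w μ T.2.1 y = 0 ∧ lineForm w μ T.2.2 y = 0) →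
      ∑ i, c i * μ i = 0 := by
    rintro ⟨J, K, J'⟩
    by_cases hc : J.Nonempty ∧ K.Nonempty ∧ Disjoint J K ∧ J' ⊆ J ∪ K ∧
        (skew (vec w J) (vec w K) = 0 ∨ ¬ (J' = ∅ ∨ J' = J ∨ J' = K ∨ J' = J ∪ K))
    · obtain ⟨h1, h2, h3, h4, h5⟩ := hc
      by_cases h6 : skew (vec w J) (vec w K) = 0
      · obtain ⟨c, hc, h⟩ := exists_relation_of_skew_eq_zero w h1 h2 h3 h6
        exact ⟨c, hc, fun μ ⟨_, _, _, _, _, y, k1, k2, _⟩ => h μ y k1 k2 univ (subset_univ _)⟩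
      · obtain ⟨c, hc, h⟩ := exists_relation_of_concurrent w h3 h6 h4 (h5.resolve_left h6)
        exact ⟨c, hc, fun μ ⟨_, _, _, _, _, y, k1, k2, k3⟩ => h μ y k1 k2 k3 univ (subset_univ _)⟩
    · exact ⟨fun _ => 1, fun h => one_ne_zero (congrFun h (Classical.arbitrary ι)),
        fun μ ⟨k1, k2, k3, k4, k5, _⟩ => absurd ⟨k1, k2, k3, k4, k5⟩ hc⟩
  choose c hc h using key
  refine ⟨c, hc, fun μ hμ => ⟨?_, ?_⟩⟩
  · intro J K hJ hK hd y hJy hKy hs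
    refine hμ (J, K, ∅) (h _ μ ⟨hJ, hK, hd, empty_subset _, Or.inl hs, y, hJy, hKy, ?_⟩)
    simp [lineForm, vec, toPlane_zero, skewR_zero_left]
  · intro J K hJ hK hd J' hJ' y hJy hKy hJy'
    by_contra hne
    exact hμ (J, K, J') (h _ μ ⟨hJ, hK, hd, hJ', Or.inr hne, y, hJy, hKy, hJy'⟩)

/-- The complement of the kernel of a non-zero continuous linear form is dense. -/
theorem dense_ne_zero {E : Type*} [AddCommGroup E] [Module ℝ E] [TopologicalSpace E]
    [ContinuousAdd E] [ContinuousSMul ℝ E] (L : E →ₗ[ℝ] ℝ) {z : E} (hz : L z ≠ 0) :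
    Dense {x | L x ≠ 0} := by
  intro x
  by_cases hx : L x = 0
  · have hlim : Filter.Tendsto (fun k : ℕ => x + (1 / ((k : ℝ) + 1)) • z) Filter.atTop
        (nhds (x + (0 : ℝ) • z)) :=
      tendsto_const_nhds.add (tendsto_one_div_add_atTop_nhds_zero_nat.smul_const z)
    rw [zero_smul, add_zero] at hlim
    refine mem_closure_of_tendsto hlim (Filter.Eventually.of_forall fun k => ?_)
    change L (x + _) ≠ 0
    rw [map_add, hx, zero_add, map_smul, smul_eq_mul]
    exact mul_ne_zero (by positivity) hz
  · exact subset_closure hx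

/-- General position of the lines holds on an open dense set. -/
theorem exists_open_dense_generic [Nonempty ι] {w : ι → ZLat} (hw : ∀ i, w i ≠ 0) :
    ∃ U : Set (ι → Plane), IsOpen U ∧ Dense U ∧ ∀ x ∈ U, GenericLines w (moment w x) := by
  obtain ⟨c, hc, h⟩ := exists_relations w
  let L : Finset ι × Finset ι × Finset ι → (ι → Plane) →ₗ[ℝ] ℝ := fun T =>
    { toFun := fun x => ∑ i, c T i * moment w x i
      map_add' := fun x y => by
        rw [← sum_add_distrib]
        exact sum_congr rfl fun i _ => by rw [moment, Pi.add_apply, skewR_add_right, mul_add]; rfl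
      map_smul' := fun a x => by
        rw [RingHom.id_apply, smul_eq_mul, mul_sum]
        exact sum_congr rfl fun i _ => by
          rw [moment, Pi.smul_apply, skewR_smul_right, moment]; ring }
  have hcont : ∀ T, Continuous (L T) := by
    intro T
    change Continuous fun x : ι → Plane => ∑ i, c T i * moment w x i
    unfold moment skewR
    fun_prop
  have hopen : ∀ T, IsOpen {x | L T x ≠ 0} := fun T =>
    isOpen_ne_fun (hcont T) continuous_const
  have hdense : ∀ T, Dense {x | L T x ≠ 0} := by
    intro T
    obtain ⟨i, hi⟩ := Function.ne_iff.1 (hc T)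
    have hwi : ((w i).1 : ℝ) ^ 2 + ((w i).2 : ℝ) ^ 2 ≠ 0 := by
      intro h0
      apply hw i
      have h1 : ((w i).1 : ℝ) = 0 := by nlinarith [sq_nonneg ((w i).1 : ℝ), sq_nonneg ((w i).2 : ℝ)]
      have h2 : ((w i).2 : ℝ) = 0 := by nlinarith [sq_nonneg ((w i).1 : ℝ), sq_nonneg ((w i).2 : ℝ)]
      exact Prod.ext (by exact_mod_cast h1) (by exact_mod_cast h2)
    refine dense_ne_zero (L T)
      (z := Pi.single i ((-((w i).2 : ℝ), ((w i).1 : ℝ)) : Plane)) ?_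
    change ∑ j, c T j * moment w _ j ≠ 0
    rw [sum_eq_single i]
    · rw [moment, Pi.single_eq_same]
      refine mul_ne_zero hi ?_
      simp only [skewR, toPlane]
      intro h0
      apply hwi
      linarith
    · intro j _ hj
      rw [moment, Pi.single_eq_of_ne hj, skewR_zero_right, mul_zero]
    · intro hi'
      exact absurd (mem_univ i) hi'
  refine ⟨⋂ T, {x | L T x ≠ 0}, isOpen_iInter_of_finite hopen, dense_iInter_of_isOpen hopen hdense,
    fun x hx => h _ fun T => ?_⟩
  exact Set.mem_iInter.1 hx T

/-- The refined count exists, and it is the coefficient of the outgoing wall of the arrangement whose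
incoming walls are the legs. -/
theorem exists_refinedCount [Nonempty ι] {w : ι → ZLat} (hw : ∀ i, w i ≠ 0)
    {g : MvPowerSeries ι QTorus} (hg : g ∈ (homGrading w).sub)
    (hg0 : MvPowerSeries.coeff 0 g = 1)
    (hin : ∀ I : Finset ι, I ≠ ∅ → vec w I ≠ 0 →
      MvPowerSeries.coeff (ind I) (wallLog w g (-toPlane (vec w I))) =
        (if I.card = 1 then (qDiff 1)⁻¹ else 0 : LaurentField) • QTorus.zhat (vec w I))
    (hsum : vec w univ ≠ 0) :
    ∃ N, IsRefinedCount w N ∧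
      MvPowerSeries.coeff (ind univ) (wallLog w g (toPlane (vec w univ))) =
        (atQ N / qDiff 1) • QTorus.zhat (vec w univ) := by
  classical
  obtain ⟨U, hU, hd, hgen⟩ := exists_open_dense_generic hw
  have hcoeff : ∀ x ∈ U,
      MvPowerSeries.coeff (ind univ) (wallLog w g (toPlane (vec w univ))) =
        (atQ (∑ t ∈ validTrees w (moment w x) univ, t.mult w) / qDiff 1) •
          QTorus.zhat (vec w univ) := by
    intro x hx
    rw [coeff_wallLog_eq_sum (hgen x hx) hg hg0 hin univ_nonempty.ne_empty hsum]
    congr 1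
    have h1 : atQ (∑ t ∈ validTrees w (moment w x) univ, t.mult w) =
        ∑ t ∈ validTrees w (moment w x) univ, atQ (t.mult w) :=
      map_sum (LaurentPolynomial.eval₂ (Nat.castRingHom LaurentField) qHalf) _ _
    rw [h1, sum_div]
    exact sum_congr rfl fun t ht => (BTree.atQ_mult (mem_validTrees.1 ht).1).symm
  obtain ⟨x₀, hx₀⟩ := hd.nonempty
  refine ⟨_, ⟨U, hU, hd, fun x hx => ?_⟩, hcoeff x₀ hx₀⟩
  obtain ⟨h1, h2, h3⟩ := count_of_generic (hgen x hx)
  refine ⟨h1, h2, h3.trans (atQ_injective ?_)⟩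
  have h4 := (hcoeff x hx).symm.trans (hcoeff x₀ hx₀)
  have h5 := congrArg (QTorus.coeff (vec w univ)) h4
  rw [QTorus.coeff_smul, QTorus.coeff_smul, QTorus.coeff_zhat_self, mul_one, mul_one] at h5
  exact (div_left_inj' (qDiff_ne_zero one_ne_zero)).1 h5

end GeneralPosition

/-! ### Substitution of the variables -/

section Substitution

open MvPowerSeries (coeff)

/-- A substitution of power series with scalar coefficients for variables, given by its values on
the monomials. -/
structure Substitution (D τ K : Type*) [Field K] where
  mono : (D →₀ ℕ) → MvPowerSeries τ K
  mono_zero : mono 0 = 1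
  mono_add : ∀ a b, mono (a + b) = mono a * mono b
  coeff_zero : ∀ a, a ≠ 0 → coeff 0 (mono a) = 0
  finite : ∀ e, {a | coeff e (mono a) ≠ 0}.Finite

variable {D τ K A : Type*} [Field K] [Ring A] [Algebra K A]

namespace Substitution

variable (Φ : Substitution D τ K)

/-- The result of the substitution. -/
def app (f : MvPowerSeries D A) : MvPowerSeries τ A := fun e =>
  ∑ a ∈ (Φ.finite e).toFinset, coeff e (Φ.mono a) • coeff a f

theorem coeff_app {e : τ →₀ ℕ} {T : Finset (D →₀ ℕ)}
    (hT : ∀ a, coeff e (Φ.mono a) ≠ 0 → a ∈ T) (f : MvPowerSeries D A) :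
    coeff e (Φ.app f) = ∑ a ∈ T, coeff e (Φ.mono a) • coeff a f := by
  refine sum_subset (fun a ha => hT a ((Φ.finite e).mem_toFinset.1 ha)) fun a _ ha => ?_
  rw [Set.Finite.mem_toFinset, Set.mem_ofPred_eq, not_not] at ha
  rw [ha, zero_smul]

theorem app_add (f g : MvPowerSeries D A) : Φ.app (f + g) = Φ.app f + Φ.app g := by
  ext e
  have hT := fun a (h : coeff e (Φ.mono a) ≠ 0) => (Φ.finite e).mem_toFinset.2 h
  rw [map_add, Φ.coeff_app hT, Φ.coeff_app hT, Φ.coeff_app hT, ← sum_add_distrib]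
  exact sum_congr rfl fun a _ => by rw [map_add, smul_add]

theorem app_smul (c : K) (f : MvPowerSeries D A) : Φ.app (c • f) = c • Φ.app f := by
  ext e
  have hT := fun a (h : coeff e (Φ.mono a) ≠ 0) => (Φ.finite e).mem_toFinset.2 h
  have h1 : ∀ (c : K) (f : MvPowerSeries D A) a, coeff a (c • f) = c • coeff a f :=
    fun _ _ _ => rfl
  have h2 : ∀ (c : K) (f : MvPowerSeries τ A) a, coeff a (c • f) = c • coeff a f :=
    fun _ _ _ => rfl
  rw [h2, Φ.coeff_app hT, Φ.coeff_app hT, smul_sum]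
  exact sum_congr rfl fun a _ => by rw [h1, smul_comm]

theorem app_one : Φ.app (1 : MvPowerSeries D A) = 1 := by
  classical
  ext e
  have hT := fun a (h : coeff e (Φ.mono a) ≠ 0) => mem_insert_of_mem (b := (0 : D →₀ ℕ))
    ((Φ.finite e).mem_toFinset.2 h)
  rw [Φ.coeff_app hT, sum_eq_single 0]
  · rw [Φ.mono_zero, coeff_one_zero, MvPowerSeries.coeff_one, MvPowerSeries.coeff_one]
    split_ifs <;> simp
  · intro a _ ha
    rw [coeff_one_ne ha, smul_zero]
  · intro h
    exact absurd (mem_insert_self _ _) h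

theorem app_mul (f g : MvPowerSeries D A) : Φ.app (f * g) = Φ.app f * Φ.app g := by
  classical
  ext e
  obtain ⟨T, hT1, hT2⟩ : ∃ T : Finset (D →₀ ℕ),
      (∀ p ∈ HasAntidiagonal.antidiagonal e, ∀ a, coeff p.1 (Φ.mono a) ≠ 0 → a ∈ T) ∧
      ∀ p ∈ HasAntidiagonal.antidiagonal e, ∀ a, coeff p.2 (Φ.mono a) ≠ 0 → a ∈ T :=
    ⟨(HasAntidiagonal.antidiagonal e).biUnion fun p =>
      (Φ.finite p.1).toFinset ∪ (Φ.finite p.2).toFinset,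
      fun p hp a h => mem_biUnion.2 ⟨p, hp, mem_union_left _ ((Φ.finite p.1).mem_toFinset.2 h)⟩,
      fun p hp a h => mem_biUnion.2 ⟨p, hp, mem_union_right _ ((Φ.finite p.2).mem_toFinset.2 h)⟩⟩
  have hT : ∀ a, coeff e (Φ.mono a) ≠ 0 → a ∈ T := fun a h =>
    hT1 (e, 0) (HasAntidiagonal.mem_antidiagonal.2 (add_zero e)) a h
  let F : (D →₀ ℕ) × (D →₀ ℕ) → A := fun p =>
    coeff e (Φ.mono (p.1 + p.2)) • (coeff p.1 f * coeff p.2 g)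
  have hL : coeff e (Φ.app (f * g)) =
      ∑ p ∈ T.biUnion fun a => HasAntidiagonal.antidiagonal a, F p := by
    rw [Φ.coeff_app hT, sum_biUnion]
    · refine sum_congr rfl fun a _ => ?_
      rw [MvPowerSeries.coeff_mul, smul_sum]
      refine sum_congr rfl fun p hp => ?_
      simp only [F]
      rw [HasAntidiagonal.mem_antidiagonal.1 hp]
    · intro a _ b _ hab
      rw [Function.onFun, Finset.disjoint_left]
      intro p hp hp'
      exact hab ((HasAntidiagonal.mem_antidiagonal.1 hp).symm.trans
        (HasAntidiagonal.mem_antidiagonal.1 hp'))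
  have hR : coeff e (Φ.app f * Φ.app g) = ∑ p ∈ T ×ˢ T, F p := by
    rw [MvPowerSeries.coeff_mul]
    have h1 : ∀ p ∈ HasAntidiagonal.antidiagonal e, coeff p.1 (Φ.app f) * coeff p.2 (Φ.app g) =
        ∑ q ∈ T ×ˢ T, (coeff p.1 (Φ.mono q.1) * coeff p.2 (Φ.mono q.2)) •
          (coeff q.1 f * coeff q.2 g) := by
      intro p hp
      rw [Φ.coeff_app (hT1 p hp), Φ.coeff_app (hT2 p hp), sum_mul_sum, ← sum_product']
      exact sum_congr rfl fun q _ => smul_mul_smul_comm _ _ _ _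
    rw [sum_congr rfl h1, sum_comm]
    refine sum_congr rfl fun q _ => ?_
    simp only [F]
    rw [Φ.mono_add, MvPowerSeries.coeff_mul, sum_smul]
  rw [hL, hR]
  -- both sums run over all pairs for which the term does not vanish
  have h1 : ∑ p ∈ (T.biUnion fun a => HasAntidiagonal.antidiagonal a) ∪ T ×ˢ T, F p =
      ∑ p ∈ T.biUnion fun a => HasAntidiagonal.antidiagonal a, F p := by
    refine (sum_subset subset_union_left fun p _ hp => ?_).symm
    have h0 : coeff e (Φ.mono (p.1 + p.2)) = 0 := by
      by_contra h
      exact hp (mem_biUnion.2 ⟨_, hT _ h, HasAntidiagonal.mem_antidiagonal.2 rfl⟩)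
    simp only [F]
    rw [h0, zero_smul]
  have h2 : ∑ p ∈ (T.biUnion fun a => HasAntidiagonal.antidiagonal a) ∪ T ×ˢ T, F p =
      ∑ p ∈ T ×ˢ T, F p := by
    refine (sum_subset subset_union_right fun p _ hp => ?_).symm
    have h0 : coeff e (Φ.mono (p.1 + p.2)) = 0 := by
      rw [Φ.mono_add, MvPowerSeries.coeff_mul]
      refine sum_eq_zero fun q hq => ?_
      by_contra h
      exact hp (mem_product.2 ⟨hT1 q hq _ (left_ne_zero_of_mul h),
        hT2 q hq _ (right_ne_zero_of_mul h)⟩)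
    simp only [F]
    rw [h0, zero_smul]
  rw [← h1, h2]

variable (A) in
/-- The substitution as an algebra homomorphism. -/
def hom : MvPowerSeries D A →ₐ[K] MvPowerSeries τ A :=
  AlgHom.ofLinearMap ⟨⟨Φ.app, Φ.app_add⟩, Φ.app_smul⟩ Φ.app_one Φ.app_mul

theorem coeff_hom {e : τ →₀ ℕ} {T : Finset (D →₀ ℕ)}
    (hT : ∀ a, coeff e (Φ.mono a) ≠ 0 → a ∈ T) (f : MvPowerSeries D A) :
    coeff e (Φ.hom A f) = ∑ a ∈ T, coeff e (Φ.mono a) • coeff a f := Φ.coeff_app hT f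

theorem coeff_hom' (e : τ →₀ ℕ) (f : MvPowerSeries D A) :
    coeff e (Φ.hom A f) = ∑ a ∈ (Φ.finite e).toFinset, coeff e (Φ.mono a) • coeff a f := rfl

theorem coeff_hom_eq_zero {e : τ →₀ ℕ} {f : MvPowerSeries D A}
    (h : ∀ a, coeff e (Φ.mono a) ≠ 0 → coeff a f = 0) : coeff e (Φ.hom A f) = 0 := by
  rw [coeff_hom']
  refine sum_eq_zero fun a ha => ?_
  rw [h a ((Φ.finite e).mem_toFinset.1 ha), smul_zero]

theorem coeff_zero_hom (f : MvPowerSeries D A) : coeff 0 (Φ.hom A f) = coeff 0 f := by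
  have hT : ∀ a, coeff 0 (Φ.mono a) ≠ 0 → a ∈ ({0} : Finset (D →₀ ℕ)) := by
    intro a ha
    rw [mem_singleton]
    by_contra h
    exact ha (Φ.coeff_zero a h)
  rw [Φ.coeff_hom hT, sum_singleton, Φ.mono_zero, coeff_one_zero, one_smul]

theorem hom_pexp {f : MvPowerSeries D A} (hf : coeff 0 f = 0) :
    Φ.hom A (pexp K f) = pexp K (Φ.hom A f) := by
  ext e
  obtain ⟨N, hN⟩ : ∃ N, e.degree ≤ N ∧ ∀ a ∈ (Φ.finite e).toFinset, a.degree ≤ N :=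
    ⟨e.degree + ∑ a ∈ (Φ.finite e).toFinset, a.degree, by omega, fun a ha => by
      have := single_le_sum (f := fun a : D →₀ ℕ => a.degree) (fun _ _ => Nat.zero_le _) ha
      omega⟩
  rw [coeff_pexp_of_le (by rw [coeff_zero_hom, hf]) hN.1, coeff_hom',
    sum_congr rfl fun a ha => by rw [coeff_pexp_of_le hf (hN.2 a ha), smul_sum], sum_comm]
  refine sum_congr rfl fun r _ => ?_
  rw [← map_pow, coeff_hom', smul_sum]
  exact sum_congr rfl fun a _ => smul_comm _ _ _

end Substitution

/-- The substitution preserves the weights of the exponents. -/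
def Substitution.Homogeneous (Φ : Substitution D τ LaurentField) (w : D → ZLat) (w' : τ → ZLat) :
    Prop := ∀ a e, coeff e (Φ.mono a) ≠ 0 → wt w' e = wt w a

namespace Substitution.Homogeneous

variable {Φ : Substitution D τ LaurentField} {w : D → ZLat} {w' : τ → ZLat}

theorem hom_mem (h : Φ.Homogeneous w w') {f : MvPowerSeries D QTorus}
    (hf : f ∈ (homGrading w).sub) : Φ.hom QTorus f ∈ (homGrading w').sub := by
  intro e
  rw [Φ.coeff_hom']
  refine Submodule.sum_mem _ fun a ha => Submodule.smul_mem _ _ ?_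
  have h1 := h a e ((Φ.finite e).mem_toFinset.1 ha)
  change _ ∈ Submodule.span LaurentField {QTorus.zhat (wt w' e)}
  rw [h1]
  exact hf a

theorem hom_facPart (h : Φ.Homogeneous w w') {g : MvPowerSeries D QTorus} (hg : coeff 0 g = 1)
    (y : Plane) (s : SignType) :
    Φ.hom QTorus (facPart (signOf (slope w y)) s g) =
      facPart (signOf (slope w' y)) s (Φ.hom QTorus g) := by
  have h1 := facPart_eq_of_mul (sg := signOf (slope w' y))
    (x := fun s => Φ.hom QTorus (facPart (signOf (slope w y)) s g)) (fun s => ?_) s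
  · rw [← h1, ← map_mul, ← map_mul, facPart_mul _ hg]
  · have h2 := facPart_oneSupported (signOf (slope w y)) s g
    refine ⟨by rw [Φ.coeff_zero_hom, h2.1], fun e he hs => Φ.coeff_hom_eq_zero fun a ha => ?_⟩
    refine h2.2 a ?_ ?_
    · rintro rfl
      rw [Φ.mono_zero, coeff_one_ne he] at ha
      exact ha rfl
    · intro h3
      apply hs
      rw [Set.mem_ofPred_eq] at h3 ⊢
      rw [← h3, signOf, signOf, slope_apply, slope_apply, h a e ha]

theorem hom_wallLog (h : Φ.Homogeneous w w') {g : MvPowerSeries D QTorus} (hg : coeff 0 g = 1)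
    (y : Plane) : Φ.hom QTorus (wallLog w g y) = wallLog w' (Φ.hom QTorus g) y := by
  have h1 : pexp LaurentField (Φ.hom QTorus (wallLog w g y)) =
      facPart (signOf (slope w' y)) 0 (Φ.hom QTorus g) := by
    rw [← Φ.hom_pexp (coeff_zero_wallLog w g y), pexp_wallLog, h.hom_facPart hg]
  rw [wallLog.eq_1 w', ← h1, plog_pexp]
  rw [Φ.coeff_zero_hom, coeff_zero_wallLog]

end Substitution.Homogeneous

end Substitution

/-! ### The universal arrangement -/

section Universal

open MvPowerSeries (coeff)

/-- The image of the monomial `s^a` under the substitution of `κ_d t^{δ d}` for each variable `s_d`. -/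
def monomialMap {D τ : Type*} (κ : D → LaurentField) (δ : D → τ →₀ ℕ) (a : D →₀ ℕ) :
    MvPowerSeries τ LaurentField :=
  MvPowerSeries.monomial (Finsupp.linearCombination ℕ δ a) (a.prod fun d r => κ d ^ r)

theorem coeff_monomialMap_ne {D τ : Type*} {κ : D → LaurentField} {δ : D → τ →₀ ℕ} {a : D →₀ ℕ}
    {e : τ →₀ ℕ} (h : coeff e (monomialMap κ δ a) ≠ 0) : Finsupp.linearCombination ℕ δ a = e := by
  classical
  rw [monomialMap, MvPowerSeries.coeff_monomial] at h
  by_contra hne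
  exact h (if_neg fun h' => hne h'.symm)

theorem coeff_monomialMap_self {D τ : Type*} {κ : D → LaurentField} {δ : D → τ →₀ ℕ} {a : D →₀ ℕ}
    {e : τ →₀ ℕ} (h : Finsupp.linearCombination ℕ δ a = e) :
    coeff e (monomialMap κ δ a) = a.prod fun d r => κ d ^ r := by
  classical
  rw [monomialMap, MvPowerSeries.coeff_monomial, if_pos h.symm]

variable {n : ℕ}

/-- The exponent of `t` attached to the part `l + 1` of the `j`-th partition. -/
def partExp (d : ℕ × Fin n) : Fin n →₀ ℕ := Finsupp.single d.2 (d.1 + 1)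

/-- The vector `(l + 1) m_j` attached to the part `l + 1` of the `j`-th partition. -/
def partWt (m : Fin n → ZLat) (d : ℕ × Fin n) : ZLat := (d.1 + 1) • m d.2

theorem wt_linearCombination (m : Fin n → ZLat) (a : ℕ × Fin n →₀ ℕ) :
    wt m (Finsupp.linearCombination ℕ partExp a) = wt (partWt m) a := by
  induction a using Finsupp.induction_linear with
  | zero => rw [map_zero, map_zero, map_zero]
  | add a b ha hb => rw [map_add, map_add, map_add, ha, hb]
  | single d r =>
    rw [Finsupp.linearCombination_single, map_nsmul, partExp, wt_single, wt_single, partWt]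

theorem le_linearCombination_partExp (a : ℕ × Fin n →₀ ℕ) (d : ℕ × Fin n) :
    a d * (d.1 + 1) ≤ Finsupp.linearCombination ℕ partExp a d.2 := by
  have h1 : Finsupp.linearCombination ℕ partExp a =
      Finsupp.linearCombination ℕ partExp (Finsupp.single d (a d)) +
        Finsupp.linearCombination ℕ partExp (a.erase d) := by
    rw [← map_add, Finsupp.single_add_erase]
  rw [h1, Finsupp.linearCombination_single, Finsupp.add_apply, Finsupp.smul_apply, partExp,
    Finsupp.single_eq_same, smul_eq_mul]
  omega

theorem finite_linearCombination_eq (e : Fin n →₀ ℕ) :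
    {a : ℕ × Fin n →₀ ℕ | Finsupp.linearCombination ℕ partExp a = e}.Finite := by
  classical
  let B : ℕ × Fin n →₀ ℕ := ∑ d ∈ range e.degree ×ˢ univ, Finsupp.single d e.degree
  refine (Set.finite_Icc 0 B).subset fun a ha => ⟨zero_le, fun d => ?_⟩
  by_cases h0 : a d = 0
  · rw [h0]; exact Nat.zero_le _
  have h1 := le_linearCombination_partExp a d
  have ha' : Finsupp.linearCombination ℕ partExp a = e := ha
  rw [ha'] at h1
  have h2 : e d.2 ≤ e.degree := Finsupp.le_degree d.2 e
  have h3 : 0 < a d := Nat.pos_of_ne_zero h0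
  have h4 : d.1 + 1 ≤ e.degree := by nlinarith
  have h5 : a d ≤ e.degree := by nlinarith
  have h6 : B d = e.degree := by
    simp only [B]
    rw [Finsupp.finsetSum_apply, sum_eq_single d]
    · exact Finsupp.single_eq_same
    · intro d' _ hd'
      exact Finsupp.single_eq_of_ne hd'.symm
    · intro h
      exact absurd (mem_product.2 ⟨mem_range.2 (by omega), mem_univ _⟩) h
  rw [h6]
  exact h5

/-- The substitution of `κ_{l j} t_j^{l+1}` for the variable attached to `(l, j)`. -/
def dilogSubst (κ : ℕ × Fin n → LaurentField) : Substitution (ℕ × Fin n) (Fin n) LaurentField where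
  mono := monomialMap κ partExp
  mono_zero := by
    rw [monomialMap, map_zero, Finsupp.prod_zero_index]
    rfl
  mono_add a b := by
    classical
    rw [monomialMap, monomialMap, monomialMap, MvPowerSeries.monomial_mul_monomial, map_add,
      Finsupp.prod_add_index' (fun _ => pow_zero _) fun _ _ _ => pow_add _ _ _]
  coeff_zero a ha := by
    by_contra h
    apply ha
    ext d
    have h1 := le_linearCombination_partExp a d
    rw [coeff_monomialMap_ne h, Finsupp.zero_apply] at h1
    rw [Finsupp.zero_apply]
    nlinarith
  finite e := (finite_linearCombination_eq e).subset fun _ ha => coeff_monomialMap_ne ha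

theorem dilogSubst_homogeneous (κ : ℕ × Fin n → LaurentField) (m : Fin n → ZLat) :
    (dilogSubst κ).Homogeneous (partWt m) m := by
  intro a e h
  rw [← coeff_monomialMap_ne h, wt_linearCombination]

end Universal

section Colouring

open MvPowerSeries (coeff)

variable {ι D : Type} [Fintype ι] [DecidableEq ι] [DecidableEq D]

/-- The type of an exponent for a colouring of the variables. -/
def colourType (c : ι → D) : (ι →₀ ℕ) →+ (D →₀ ℕ) :=
  (Finsupp.linearCombination ℕ fun i => Finsupp.single (c i) 1).toAddMonoidHom

theorem colourType_single (c : ι → D) (i : ι) (r : ℕ) :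
    colourType c (Finsupp.single i r) = Finsupp.single (c i) r := by
  refine (Finsupp.linearCombination_single ℕ r i).trans ?_
  rw [Finsupp.smul_single, smul_eq_mul, mul_one]

theorem colourType_ind_apply (c : ι → D) (J : Finset ι) (d : D) :
    colourType c (ind J) d = (J.filter fun i => c i = d).card := by
  rw [ind, map_sum, Finsupp.finsetSum_apply, card_filter]
  refine sum_congr rfl fun i _ => ?_
  rw [colourType_single, Finsupp.single_apply]

theorem wt_colourType (c : ι → D) (w : D → ZLat) (e : ι →₀ ℕ) :
    wt w (colourType c e) = wt (fun i => w (c i)) e := by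
  induction e using Finsupp.induction_linear with
  | zero => rw [map_zero, map_zero, map_zero]
  | add a b ha hb => rw [map_add, map_add, map_add, ha, hb]
  | single d r => rw [colourType_single, wt_single, wt_single]

/-- The sum of the variables of a given colour. -/
def colourSum (c : ι → D) (d : D) : MvPowerSeries ι LaurentField :=
  ∑ i with c i = d, MvPowerSeries.monomial (Finsupp.single i 1) (1 : LaurentField)

/-- The monomials in the sums of the variables of each colour. -/
def colourMono (c : ι → D) (a : D →₀ ℕ) : MvPowerSeries ι LaurentField :=
  a.prod fun d r => colourSum c d ^ r

theorem colourMono_add (c : ι → D) (a b : D →₀ ℕ) :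
    colourMono c (a + b) = colourMono c a * colourMono c b :=
  Finsupp.prod_add_index' (fun _ => pow_zero _) fun _ _ _ => pow_add _ _ _

theorem colourMono_single (c : ι → D) (d : D) : colourMono c (Finsupp.single d 1) = colourSum c d :=
  (Finsupp.prod_single_index (h := fun d r => colourSum c d ^ r) (pow_zero _)).trans (pow_one _)

theorem colourType_eq_of_coeff_ne {c : ι → D} {a : D →₀ ℕ} {e : ι →₀ ℕ}
    (h : coeff e (colourMono c a) ≠ 0) : colourType c e = a := by
  induction a using Finsupp.induction_linear generalizing e with
  | zero =>
    rw [colourMono, Finsupp.prod_zero_index] at h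
    by_cases he : e = 0
    · rw [he, map_zero]
    · rw [coeff_one_ne he] at h
      exact absurd rfl h
  | add a b ha hb =>
    rw [colourMono_add, MvPowerSeries.coeff_mul] at h
    obtain ⟨p, hp, hne⟩ := exists_ne_zero_of_sum_ne_zero h
    rw [← HasAntidiagonal.mem_antidiagonal.1 hp, map_add, ha (left_ne_zero_of_mul hne),
      hb (right_ne_zero_of_mul hne)]
  | single d r =>
    induction r generalizing e with
    | zero =>
      rw [Finsupp.single_zero, colourMono, Finsupp.prod_zero_index] at h
      by_cases he : e = 0
      · rw [he, map_zero, Finsupp.single_zero]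
      · rw [coeff_one_ne he] at h
        exact absurd rfl h
    | succ r ih =>
      rw [Finsupp.single_add, colourMono_add, MvPowerSeries.coeff_mul, colourMono_single] at h
      obtain ⟨p, hp, hne⟩ := exists_ne_zero_of_sum_ne_zero h
      have h2 := right_ne_zero_of_mul hne
      rw [colourSum, map_sum] at h2
      obtain ⟨i, hi, hne'⟩ := exists_ne_zero_of_sum_ne_zero h2
      rw [MvPowerSeries.coeff_monomial] at hne'
      have h3 : p.2 = Finsupp.single i 1 := by
        by_contra hh
        exact hne' (if_neg hh)
      rw [← HasAntidiagonal.mem_antidiagonal.1 hp, map_add, ih (left_ne_zero_of_mul hne), h3,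
        colourType_single, (mem_filter.1 hi).2, Finsupp.single_add]

/-- The substitution of the sum of the variables of the colour `d` for the variable `s_d`. -/
def colourSubst (c : ι → D) : Substitution D ι LaurentField where
  mono := colourMono c
  mono_zero := Finsupp.prod_zero_index
  mono_add := colourMono_add c
  coeff_zero a ha := by
    by_contra h
    exact ha (by rw [← colourType_eq_of_coeff_ne h, map_zero])
  finite e := (Set.finite_singleton (colourType c e)).subset fun _ ha =>
    (colourType_eq_of_coeff_ne ha).symm

theorem colourSubst_homogeneous (c : ι → D) (w : D → ZLat) :
    (colourSubst c).Homogeneous w fun i => w (c i) := by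
  intro a e h
  rw [← colourType_eq_of_coeff_ne h, wt_colourType]

theorem coeff_colourSubst (c : ι → D) (e : ι →₀ ℕ) (f : MvPowerSeries D QTorus) :
    coeff e ((colourSubst c).hom QTorus f) =
      coeff e (colourMono c (colourType c e)) • coeff (colourType c e) f := by
  have hT : ∀ a, coeff e ((colourSubst c).mono a) ≠ 0 → a ∈ ({colourType c e} : Finset (D →₀ ℕ)) :=
    fun a h => mem_singleton.2 (colourType_eq_of_coeff_ne h).symm
  rw [(colourSubst c).coeff_hom hT, sum_singleton]
  rfl

/-- The coefficient of the squarefree monomial counts the bijections that respect the colours. -/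
theorem coeff_colourMono_ind (c : ι → D) (J : Finset ι) :
    coeff (ind J) (colourMono c (colourType c (ind J))) =
      (colourType c (ind J)).prod fun _ r => (r.factorial : LaurentField) := by
  induction hN : J.card generalizing J with
  | zero =>
    rw [card_eq_zero] at hN
    rw [hN, ind_empty, map_zero, Finsupp.prod_zero_index, colourMono, Finsupp.prod_zero_index,
      coeff_one_zero]
  | succ N ih =>
    obtain ⟨i, hi⟩ : J.Nonempty := card_pos.1 (by omega)
    have hind : ∀ i' ∈ J, ind (J.erase i') + Finsupp.single i' 1 = ind J := by
      intro i' hi'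
      rw [ind, ind, add_comm, add_sum_erase J (fun i => Finsupp.single i 1) hi']
    set a := colourType c (ind (J.erase i)) with ha
    have hk : ∀ i' ∈ J, c i' = c i → colourType c (ind (J.erase i')) = a := by
      intro i' hi' hc
      have h1 := congrArg (colourType c) (hind i' hi')
      have h2 := congrArg (colourType c) (hind i hi)
      rw [map_add, colourType_single, hc] at h1
      rw [map_add, colourType_single] at h2
      exact add_right_cancel (h1.trans h2.symm)
    have hsplit : colourType c (ind J) = a + Finsupp.single (c i) 1 := by
      rw [← hind i hi, map_add, colourType_single]
    have hterm : ∀ i', coeff (ind J) (colourMono c a *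
        MvPowerSeries.monomial (Finsupp.single i' 1) (1 : LaurentField)) =
        if i' ∈ J then coeff (ind (J.erase i')) (colourMono c a) else 0 := by
      intro i'
      rw [MvPowerSeries.coeff_mul_monomial]
      by_cases hi' : i' ∈ J
      · have hle : Finsupp.single i' 1 ≤ ind J := by
          rw [← hind i' hi']; exact le_add_self
        rw [if_pos hle, if_pos hi', mul_one]
        congr 1
        rw [← hind i' hi', add_tsub_cancel_right]
      · rw [if_neg hi', if_neg]
        intro hle
        have := hle i'
        rw [Finsupp.single_eq_same, ind_apply, if_neg hi'] at this
        omega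
    have hcount : ((J.filter fun i' => c i' = c i).card : LaurentField) =
        ((a (c i) + 1 : ℕ) : LaurentField) := by
      rw [← colourType_ind_apply, hsplit, Finsupp.add_apply, Finsupp.single_eq_same]
    rw [hsplit, colourMono_add, colourMono_single, colourSum, mul_sum, map_sum,
      sum_congr rfl fun i' _ => hterm i', ← sum_filter, filter_filter]
    have hfil : (univ.filter fun i' => c i' = c i ∧ i' ∈ J) = J.filter fun i' => c i' = c i := by
      ext i'
      simp only [mem_filter, mem_univ, true_and]
      exact and_comm
    rw [hfil, sum_congr rfl fun i' hi' => by
      obtain ⟨h1, h2⟩ := mem_filter.1 hi'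
      rw [← hk i' h1 h2, ih (J.erase i') (by rw [card_erase_of_mem h1]; omega), hk i' h1 h2],
      sum_const, nsmul_eq_mul, hcount]
    have hext : ∀ b : D →₀ ℕ, b.support ⊆ insert (c i) a.support →
        b.prod (fun _ r => (r.factorial : LaurentField)) =
        ((b (c i)).factorial : LaurentField) *
          ∏ d ∈ (insert (c i) a.support).erase (c i), ((b d).factorial : LaurentField) := by
      intro b hb
      rw [mul_prod_erase _ (fun d => ((b d).factorial : LaurentField)) (mem_insert_self _ _)]
      exact Finsupp.prod_of_support_subset _ hb _ fun _ _ => by simp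
    rw [hext a (subset_insert _ _), hext (a + Finsupp.single (c i) 1), ← mul_assoc]
    · congr 1
      · rw [Finsupp.add_apply, Finsupp.single_eq_same, Nat.factorial_succ]
        push_cast
        ring
      · refine prod_congr rfl fun d hd => ?_
        rw [Finsupp.add_apply, Finsupp.single_eq_of_ne (ne_of_mem_erase hd), add_zero]
    · intro d hd
      rcases mem_union.1 (Finsupp.support_add hd) with h | h
      · exact mem_insert_of_mem h
      · rw [mem_singleton.1 (Finsupp.support_single_subset h)]
        exact mem_insert_self _ _

end Colouring

section Universal

open MvPowerSeries (coeff)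

/-- The series whose coefficient at the variable `s_d` is `ẑ^{W d} / (q^{1/2} - q^{-1/2})`. -/
def linearSeries {D : Type*} (W : D → ZLat) : MvPowerSeries D QTorus := fun a =>
  if a.degree = 1 then (qDiff 1)⁻¹ • QTorus.zhat (wt W a) else 0

theorem coeff_linearSeries {D : Type*} (W : D → ZLat) (a : D →₀ ℕ) :
    coeff a (linearSeries W) =
      (if a.degree = 1 then (qDiff 1)⁻¹ else 0 : LaurentField) • QTorus.zhat (wt W a) := by
  change (if a.degree = 1 then (qDiff 1)⁻¹ • QTorus.zhat (wt W a) else 0) = _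
  split_ifs
  · rfl
  · exact (zero_smul LaurentField (_ : QTorus)).symm

/-- `g` is a homogeneous series, that is, an arrangement of walls through the origin, and the
logarithms of its incoming walls are given by `η`: the coefficient of the wall at `y` is prescribed at
the exponents whose weight is a positive multiple of `-y`. -/
structure HasIncoming {D : Type*} (W : D → ZLat) (η g : MvPowerSeries D QTorus) : Prop where
  mem : g ∈ (homGrading W).sub
  coeff_zero : coeff 0 g = 1
  incoming : ∀ (y : Plane) (d : D →₀ ℕ) (c : ℝ), wt W d ≠ 0 → 0 < c →
    toPlane (wt W d) = -(c • y) → coeff d (wallLog W g y) = coeff d η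

theorem exists_hasIncoming_linearSeries {D : Type*} (W : D → ZLat) :
    ∃ g, HasIncoming W (linearSeries W) g := by
  obtain ⟨g, h1, h2, h3⟩ := exists_incoming W (η := linearSeries W)
    (fun d => Submodule.mem_span_singleton.2 ⟨_, (coeff_linearSeries W d).symm⟩)
    ((coeff_linearSeries W 0).trans (by
      rw [map_zero, if_neg zero_ne_one]
      exact zero_smul LaurentField (_ : QTorus)))
  exact ⟨g, h1, h2, h3⟩

theorem degree_colourType {ι D : Type} [Fintype ι] [DecidableEq ι] [DecidableEq D] (c : ι → D)
    (J : Finset ι) : (colourType c (ind J)).degree = J.card := by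
  rw [ind, map_sum, map_sum, card_eq_sum_ones]
  refine sum_congr rfl fun i _ => ?_
  rw [colourType_single, Finsupp.degree_single]

/-- The squarefree coefficients of the arrangement obtained by splitting each variable into a sum
of variables of the same colour are the refined counts. -/
theorem HasIncoming.coeff_colourType {ι D : Type} [Fintype ι] [DecidableEq D] {W : D → ZLat}
    {g : MvPowerSeries D QTorus} (hg : HasIncoming W (linearSeries W) g) (c : ι → D)
    (hw : ∀ i, W (c i) ≠ 0) {a : D →₀ ℕ} (ha : ∀ d, a d = (univ.filter fun i => c i = d).card)
    (ha0 : wt W a ≠ 0) :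
    IsRefinedCount (fun i => W (c i)) (refinedCount fun i => W (c i)) ∧
      coeff a (wallLog W g (toPlane (wt W a))) =
        (atQ (refinedCount fun i => W (c i)) / qDiff 1 /
          a.prod fun _ r => (r.factorial : LaurentField)) • QTorus.zhat (wt W a) := by
  classical
  have hac : colourType c (ind univ) = a := by
    ext d
    rw [colourType_ind_apply, ha]
  have hvec : vec (fun i => W (c i)) univ = wt W a := by
    rw [← wt_ind, ← wt_colourType, hac]
  have hsum : vec (fun i => W (c i)) univ ≠ 0 := by rwa [hvec]
  have : Nonempty ι := by
    by_contra h
    rw [not_nonempty_iff] at h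
    exact hsum (by rw [vec, univ_eq_empty, sum_empty])
  have hΦ := colourSubst_homogeneous c W
  have hΦl := hΦ.hom_wallLog hg.coeff_zero
  obtain ⟨N, hN, hcoeff⟩ := exists_refinedCount hw (hΦ.hom_mem hg.mem)
    (by rw [Substitution.coeff_zero_hom, hg.coeff_zero]) (fun I hI hv => by
      have hwt : wt W (colourType c (ind I)) = vec (fun i => W (c i)) I := by
        rw [wt_colourType, wt_ind]
      rw [← hΦl, coeff_colourSubst, hg.incoming (-toPlane (vec (fun i => W (c i)) I)) _ 1
        (by rwa [hwt]) one_pos (by rw [hwt, one_smul, neg_neg]), coeff_linearSeries,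
        degree_colourType, hwt]
      by_cases h1 : I.card = 1
      · rw [coeff_colourMono_ind]
        obtain ⟨i, rfl⟩ := card_eq_one.1 h1
        have h2 : colourType c (ind {i}) = Finsupp.single (c i) 1 := by
          rw [ind, sum_singleton, colourType_single]
        rw [h2, Finsupp.prod_single_index (by simp), Nat.factorial_one, Nat.cast_one]
        exact one_smul LaurentField _
      · rw [if_neg h1]
        refine (smul_smul _ _ _).trans ?_
        rw [mul_zero]) hsum
  have hN' : refinedCount (fun i => W (c i)) = N := by
    have h : ∃ N, IsRefinedCount (fun i => W (c i)) N := ⟨N, hN⟩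
    rw [refinedCount, dif_pos h]
    exact h.choose_spec.unique hN
  refine ⟨by rwa [hN'], ?_⟩
  rw [hN']
  rw [← hΦl, coeff_colourSubst, hac, hvec, ← hac, coeff_colourMono_ind, hac] at hcoeff
  have h0 : (a.prod fun _ r => (r.factorial : LaurentField)) ≠ 0 :=
    prod_ne_zero_iff.2 fun d _ => Nat.cast_ne_zero.2 (Nat.factorial_ne_zero _)
  have h1 := congrArg (fun x => (a.prod fun _ r => (r.factorial : LaurentField))⁻¹ • x) hcoeff
  simp only [smul_smul] at h1
  rw [inv_mul_cancel₀ h0] at h1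
  refine ((one_smul LaurentField _).symm.trans h1).trans ?_
  rw [div_eq_inv_mul _ (a.prod _)]

end Universal

/-! ### The arrangement of the initial diagram -/

section Dilogarithm

open MvPowerSeries (coeff)

variable {n : ℕ}

theorem wt_apply (m : Fin n → ZLat) (p : Fin n →₀ ℕ) : wt m p = ∑ j, p j • m j :=
  (Finsupp.linearCombination_apply ℕ p).trans (Finsupp.sum_fintype _ _ fun _ => zero_smul ℕ _)

/-- The coefficient of `t_j^{l+1}` in the substitution for the variable attached to `(l, j)`. -/
def dilogScale (d : ℕ × Fin n) : LaurentField := dilogCoeff (d.1 + 1) * qDiff 1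

theorem coeff_dilogSubst_linearSeries (m : Fin n → ZLat) (p : Fin n →₀ ℕ) :
    coeff p ((dilogSubst dilogScale).hom QTorus (linearSeries (partWt m))) =
      ∑ j, coeff p (initialHam m j) := by
  classical
  have hL : ∀ d : ℕ × Fin n, Finsupp.linearCombination ℕ partExp (Finsupp.single d 1) = partExp d :=
    fun d => by rw [Finsupp.linearCombination_single, one_smul]
  -- A finite set of exponents that contains the variables relevant for `t^p`.
  obtain ⟨T, hT, hTs⟩ : ∃ T : Finset (ℕ × Fin n →₀ ℕ),
      (∀ a, coeff p ((dilogSubst dilogScale).mono a) ≠ 0 → a ∈ T) ∧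
      ∀ d ∈ range p.degree ×ˢ (univ : Finset (Fin n)), Finsupp.single d 1 ∈ T :=
    ⟨((dilogSubst dilogScale).finite p).toFinset ∪
      (range p.degree ×ˢ univ).image fun d => Finsupp.single d 1,
      fun a h => mem_union_left _ (((dilogSubst dilogScale).finite p).mem_toFinset.2 h),
      fun d hd => mem_union_right _ (mem_image.2 ⟨d, hd, rfl⟩)⟩
  rw [Substitution.coeff_hom _ hT]
  have hinj : Set.InjOn (fun d : ℕ × Fin n => Finsupp.single d 1)
      (range p.degree ×ˢ (univ : Finset (Fin n)) : Finset (ℕ × Fin n)) :=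
    fun d _ d' _ h => (Finsupp.single_left_injective one_ne_zero) h
  have h1 : ∑ a ∈ T, coeff p ((dilogSubst dilogScale).mono a) • coeff a (linearSeries (partWt m)) =
      ∑ d ∈ range p.degree ×ˢ univ, coeff p ((dilogSubst dilogScale).mono (Finsupp.single d 1)) •
        coeff (Finsupp.single d 1) (linearSeries (partWt m)) := by
    refine Eq.trans ?_ (sum_image (f := fun a =>
      coeff p ((dilogSubst dilogScale).mono a) • coeff a (linearSeries (partWt m))) hinj)
    refine (sum_subset (image_subset_iff.2 hTs) fun a _ ha => ?_).symm
    by_cases h2 : a.degree = 1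
    · by_cases h3 : coeff p ((dilogSubst dilogScale).mono a) = 0
      · rw [h3]; exact zero_smul LaurentField (_ : QTorus)
      exfalso
      obtain ⟨d, rfl⟩ := (Finsupp.sum_eq_one_iff a).1 h2
      have h4 := coeff_monomialMap_ne h3
      rw [hL] at h4
      refine ha (mem_image.2 ⟨d, mem_product.2 ⟨mem_range.2 ?_, mem_univ _⟩, rfl⟩)
      rw [← h4, partExp, Finsupp.degree_single]
      omega
    · rw [coeff_linearSeries, if_neg h2]
      refine (smul_smul _ _ _).trans ?_
      rw [mul_zero]
      exact zero_smul LaurentField (_ : QTorus)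
  rw [h1, sum_product_right]
  refine sum_congr rfl fun j _ => ?_
  have h2 : ∀ l, coeff p ((dilogSubst dilogScale).mono (Finsupp.single (l, j) 1)) •
        coeff (Finsupp.single (l, j) 1) (linearSeries (partWt m)) =
      if p = Finsupp.single j (l + 1) then dilogCoeff (l + 1) • QTorus.zhat ((l + 1) • m j) else 0 := by
    intro l
    split_ifs with h
    · have h3 : coeff p ((dilogSubst dilogScale).mono (Finsupp.single (l, j) 1)) =
          dilogScale (l, j) := by
        refine (coeff_monomialMap_self ((hL (l, j)).trans h.symm)).trans ?_
        exact (Finsupp.prod_single_index (h := fun d r => dilogScale d ^ r) (pow_zero _)).trans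
          (pow_one _)
      rw [h3, coeff_linearSeries, if_pos (Finsupp.degree_single _ _), smul_smul, wt_single,
        one_smul, dilogScale, mul_assoc, mul_inv_cancel₀ (qDiff_ne_zero one_ne_zero), mul_one]
      rfl
    · have h3 : coeff p ((dilogSubst dilogScale).mono (Finsupp.single (l, j) 1)) = 0 := by
        by_contra h3
        have h4 := coeff_monomialMap_ne h3
        rw [hL] at h4
        exact h h4.symm
      rw [h3]
      exact zero_smul LaurentField (_ : QTorus)
  rw [sum_congr rfl fun l _ => h2 l]
  change _ = if p j ≠ 0 ∧ p = Finsupp.single j (p j) then _ else _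
  split_ifs with h
  · obtain ⟨h3, h4⟩ := h
    rw [sum_eq_single (p j - 1)]
    · rw [Nat.sub_add_cancel (Nat.pos_of_ne_zero h3), if_pos h4]
    · intro l _ hl
      refine if_neg fun h5 => hl ?_
      rw [h5, Finsupp.single_eq_same]
      rfl
    · intro h5
      refine absurd (mem_range.2 ?_) h5
      have := Finsupp.le_degree j p
      omega
  · refine sum_eq_zero fun l _ => if_neg fun h5 => h ?_
    rw [h5, Finsupp.single_eq_same]
    exact ⟨Nat.succ_ne_zero l, rfl⟩

theorem count_sum_ite (l : ℕ) (s : Multiset ℕ) (hs : ∀ x ∈ s, 0 < x) :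
    (s.map fun x => if x - 1 = l then 1 else 0).sum = s.count (l + 1) := by
  induction s using Multiset.induction with
  | empty => rfl
  | cons x s ih =>
    rw [Multiset.map_cons, Multiset.sum_cons, ih fun y hy => hs y (Multiset.mem_cons_of_mem hy),
      Multiset.count_cons]
    have := hs x (Multiset.mem_cons_self x s)
    split_ifs <;> omega

/-- The type of a part of a tuple of partitions: its size, diminished by one, and its position. -/
def partColour {p : Fin n →₀ ℕ} (k : ∀ j, Nat.Partition (p j)) (r : PartIndex k) : ℕ × Fin n :=
  ((r.2 : ℕ) - 1, r.1)

theorem partWt_partColour (m : Fin n → ZLat) {p : Fin n →₀ ℕ} (k : ∀ j, Nat.Partition (p j)) :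
    (fun r => partWt m (partColour k r)) = partVec m k := by
  funext r
  have h : 0 < (r.2 : ℕ) := (k r.1).parts_pos (Multiset.coe_mem)
  rw [partWt, partColour, partVec]
  simp only
  rw [Nat.sub_add_cancel h]

theorem card_partColour {p : Fin n →₀ ℕ} (k : ∀ j, Nat.Partition (p j)) (d : ℕ × Fin n) :
    (univ.filter fun r => partColour k r = d).card = (k d.2).parts.count (d.1 + 1) := by
  classical
  rw [card_filter, Fintype.sum_sigma, sum_eq_single d.2]
  · rw [← count_sum_ite d.1 (k d.2).parts fun x hx => (k d.2).parts_pos hx]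
    conv_rhs => rw [← Multiset.map_univ_coe (k d.2).parts, Multiset.map_map]
    refine sum_congr rfl fun x _ => ?_
    simp only [partColour, Function.comp, Prod.ext_iff, and_true]
  · intro j _ hj
    refine sum_eq_zero fun x _ => if_neg fun h => hj ?_
    rw [← h]
    rfl
  · intro h
    exact absurd (mem_univ _) h

open Classical in
/-- The exponents attached to the tuples of partitions of the `p_j`. -/
def partType {p : Fin n →₀ ℕ} (k : ∀ j, Nat.Partition (p j)) : ℕ × Fin n →₀ ℕ :=
  colourType (partColour k) (ind univ)

theorem partType_apply {p : Fin n →₀ ℕ} (k : ∀ j, Nat.Partition (p j)) (d : ℕ × Fin n) :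
    partType k d = (k d.2).parts.count (d.1 + 1) := by
  classical
  rw [partType, colourType_ind_apply, card_partColour]

theorem partType_injective {p : Fin n →₀ ℕ} :
    Function.Injective (partType : (∀ j, Nat.Partition (p j)) → ℕ × Fin n →₀ ℕ) := by
  intro k k' h
  funext j
  refine Nat.Partition.ext (Multiset.ext.2 fun l => ?_)
  rcases l with _ | l
  · rw [Multiset.count_eq_zero_of_notMem fun h => (Nat.lt_irrefl 0) ((k j).parts_pos h),
      Multiset.count_eq_zero_of_notMem fun h => (Nat.lt_irrefl 0) ((k' j).parts_pos h)]
  · rw [← partType_apply k (l, j), h, partType_apply]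

/-- The parts in the position `j` of the tuple of partitions attached to an exponent. -/
def partsOf (a : ℕ × Fin n →₀ ℕ) (j : Fin n) : Multiset ℕ :=
  ((Finsupp.toMultiset a).filter fun d => d.2 = j).map fun d => d.1 + 1

theorem partsOf_add (a b : ℕ × Fin n →₀ ℕ) (j : Fin n) :
    partsOf (a + b) j = partsOf a j + partsOf b j := by
  rw [partsOf, map_add, Multiset.filter_add, Multiset.map_add]
  rfl

theorem partsOf_single (d : ℕ × Fin n) (r : ℕ) (j : Fin n) :
    partsOf (Finsupp.single d r) j = if d.2 = j then Multiset.replicate r (d.1 + 1) else 0 := by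
  rw [partsOf, Finsupp.toMultiset_single, Multiset.nsmul_singleton]
  split_ifs with h
  · rw [Multiset.filter_eq_self.2 fun x hx => by rw [Multiset.eq_of_mem_replicate hx, h],
      Multiset.map_replicate]
  · rw [Multiset.filter_eq_nil.2 fun x hx => by rwa [Multiset.eq_of_mem_replicate hx],
      Multiset.map_zero]

theorem sum_partsOf (a : ℕ × Fin n →₀ ℕ) (j : Fin n) :
    (partsOf a j).sum = Finsupp.linearCombination ℕ partExp a j := by
  induction a using Finsupp.induction_linear with
  | zero => rw [map_zero]; rfl
  | add a b ha hb => rw [partsOf_add, Multiset.sum_add, ha, hb, map_add, Finsupp.add_apply]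
  | single d r =>
    rw [partsOf_single, Finsupp.linearCombination_single, Finsupp.smul_apply, partExp,
      Finsupp.single_apply]
    split_ifs
    · rw [Multiset.sum_replicate]
    · rfl

theorem count_partsOf (a : ℕ × Fin n →₀ ℕ) (d : ℕ × Fin n) :
    (partsOf a d.2).count (d.1 + 1) = a d := by
  induction a using Finsupp.induction_linear with
  | zero => rw [partsOf, map_zero]; rfl
  | add a b ha hb => rw [partsOf_add, Multiset.count_add, ha, hb, Finsupp.add_apply]
  | single d' r =>
    rw [partsOf_single, Finsupp.single_apply]
    by_cases h : d'.2 = d.2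
    · rw [if_pos h, Multiset.count_replicate]
      simp only [Prod.ext_iff, h, and_true, Nat.add_right_cancel_iff]
    · rw [if_neg h, if_neg fun h' => h (by rw [h'])]
      rfl

theorem linearCombination_partType {p : Fin n →₀ ℕ} (k : ∀ j, Nat.Partition (p j)) :
    Finsupp.linearCombination ℕ partExp (partType k) = p := by
  ext j
  rw [← sum_partsOf]
  refine Eq.trans (congrArg Multiset.sum (Multiset.ext.2 fun l => ?_)) (k j).parts_sum
  rcases l with _ | l
  · rw [Multiset.count_eq_zero_of_notMem fun h => (Nat.lt_irrefl 0) ((k j).parts_pos h),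
      Multiset.count_eq_zero_of_notMem fun h => ?_]
    obtain ⟨d, _, hd⟩ := Multiset.mem_map.1 h
    exact Nat.succ_ne_zero _ hd
  · rw [count_partsOf (partType k) (l, j), partType_apply]

theorem exists_partType_eq {p : Fin n →₀ ℕ} {a : ℕ × Fin n →₀ ℕ}
    (h : Finsupp.linearCombination ℕ partExp a = p) :
    ∃ k : ∀ j, Nat.Partition (p j), partType k = a := by
  refine ⟨fun j => ⟨partsOf a j, fun {i} hi => ?_, by rw [sum_partsOf, h]⟩, ?_⟩
  · obtain ⟨d, _, hd⟩ := Multiset.mem_map.1 hi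
    omega
  · ext d
    rw [partType_apply]
    exact count_partsOf a d

theorem partFactor_eq {p : Fin n →₀ ℕ} (k : ∀ j, Nat.Partition (p j)) :
    partFactor k = ((partType k).prod fun d r => dilogScale d ^ r) /
      (partType k).prod fun _ r => (r.factorial : LaurentField) := by
  classical
  have hlt : ∀ l j, p j ≤ l → (k j).parts.count (l + 1) = 0 := by
    intro l j hl
    refine Multiset.count_eq_zero_of_notMem fun h => ?_
    have := Multiset.single_le_sum (fun _ _ => Nat.zero_le _) _ h
    rw [(k j).parts_sum] at this
    omega
  have hsub : (partType k).support ⊆ range p.degree ×ˢ univ := by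
    intro d hd
    rw [Finsupp.mem_support_iff, partType_apply] at hd
    refine mem_product.2 ⟨mem_range.2 ?_, mem_univ _⟩
    by_contra h
    refine hd (hlt _ _ ?_)
    have := Finsupp.le_degree d.2 p
    omega
  rw [Finsupp.prod_of_support_subset _ hsub _ fun _ _ => pow_zero _,
    Finsupp.prod_of_support_subset _ hsub _ fun _ _ => by simp, ← prod_div_distrib,
    prod_product_right, partFactor]
  refine prod_congr rfl fun j _ => ?_
  have h1 : Finset.Icc 1 (p j) = (range (p j)).image (· + 1) := by
    ext l
    rw [mem_Icc, Finset.mem_image]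
    constructor
    · rintro ⟨h1, h2⟩
      exact ⟨l - 1, mem_range.2 (by omega), by omega⟩
    · rintro ⟨l', h, rfl⟩
      rw [mem_range] at h
      omega
  rw [h1, prod_image fun _ _ _ _ h => Nat.add_right_cancel h]
  refine Eq.trans (prod_congr rfl fun l _ => ?_)
    (prod_subset (range_mono (Finsupp.le_degree j p)) fun l _ hl => ?_)
  · rw [partType_apply, div_eq_inv_mul (dilogScale _ ^ _)]
    congr 2
    rw [dilogScale, dilogCoeff, Nat.add_sub_cancel]
    simp only [div_eq_mul_inv]
    ring
  · rw [mem_range, not_lt] at hl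
    rw [partType_apply, hlt l j hl]
    simp

theorem partWt_ne_zero {m : Fin n → ZLat} (hm : ∀ j, m j ≠ 0) (d : ℕ × Fin n) : partWt m d ≠ 0 :=
  smul_ne_zero (Nat.succ_ne_zero _) (hm _)

theorem isRefinedCount_partVec {m : Fin n → ZLat} (hm : ∀ j, m j ≠ 0) {p : Fin n →₀ ℕ}
    (hp : wt m p ≠ 0) (k : ∀ j, Nat.Partition (p j)) :
    IsRefinedCount (partVec m k) (refinedCount (partVec m k)) := by
  obtain ⟨g, hg⟩ := exists_hasIncoming_linearSeries (partWt m)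
  have h := (hg.coeff_colourType (partColour k) (fun r => partWt_ne_zero hm _) (a := partType k)
    (fun d => by rw [partType_apply, card_partColour])
    (by rwa [← wt_linearCombination, linearCombination_partType])).1
  rwa [partWt_partColour] at h

/-- The outgoing coefficient at `t^p` predicted by the tropical counts. -/
def tropicalCoeff (m : Fin n → ZLat) (p : Fin n →₀ ℕ) : LaurentField :=
  ∑ k : ∀ j, Nat.Partition (p j), atQ (refinedCount (partVec m k)) * partFactor k / qDiff 1

/-- The arrangement whose incoming walls are those of the initial diagram has the tropical counts
as coefficients of its outgoing walls. -/
theorem exists_hasIncoming_initialHam {m : Fin n → ZLat} (hm : ∀ j, m j ≠ 0) :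
    ∃ g, HasIncoming m (∑ j, initialHam m j) g ∧ ∀ p, wt m p ≠ 0 →
      coeff p (wallLog m g (toPlane (wt m p))) = tropicalCoeff m p • QTorus.zhat (wt m p) := by
  classical
  obtain ⟨g, hg⟩ := exists_hasIncoming_linearSeries (partWt m)
  have hΦ := dilogSubst_homogeneous dilogScale m
  have hΦl := hΦ.hom_wallLog hg.coeff_zero
  refine ⟨(dilogSubst dilogScale).hom QTorus g, ⟨hΦ.hom_mem hg.mem, ?_, ?_⟩, fun p hp => ?_⟩
  · rw [Substitution.coeff_zero_hom, hg.coeff_zero]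
  · intro y p c hp hc hy
    rw [map_sum, ← coeff_dilogSubst_linearSeries, ← hΦl, Substitution.coeff_hom',
      Substitution.coeff_hom']
    refine sum_congr rfl fun a ha => ?_
    have h1 := hΦ a p (((dilogSubst dilogScale).finite p).mem_toFinset.1 ha)
    rw [hg.incoming y a c (by rwa [← h1]) hc (by rwa [← h1])]
  · rw [← hΦl, Substitution.coeff_hom (T := univ.image partType) _ fun a ha => by
      obtain ⟨k, hk⟩ := exists_partType_eq (coeff_monomialMap_ne ha)
      exact mem_image.2 ⟨k, mem_univ _, hk⟩]
    rw [sum_image fun _ _ _ _ h => partType_injective h, tropicalCoeff, sum_smul]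
    refine sum_congr rfl fun k _ => ?_
    have hwt : wt (partWt m) (partType k) = wt m p := by
      rw [← wt_linearCombination, linearCombination_partType]
    have h := (hg.coeff_colourType (partColour k) (fun r => partWt_ne_zero hm _) (a := partType k)
      (fun d => by rw [partType_apply, card_partColour]) (by rwa [hwt])).2
    rw [partWt_partColour, hwt] at h
    have h2 : coeff p ((dilogSubst dilogScale).mono (partType k)) =
        (partType k).prod fun d r => dilogScale d ^ r :=
      coeff_monomialMap_self (linearCombination_partType k)
    rw [h, h2, smul_smul, partFactor_eq]
    congr 1
    ring

end Dilogarithm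

/-! ### Path-ordered products -/

section PathProduct

open MvPowerSeries (coeff)

variable {n : ℕ} {l : ℕ}

theorem EqMod.refl (f : QFun n) : EqMod l f f := fun _ _ => rfl

theorem EqMod.symm {f g : QFun n} (h : EqMod l f g) : EqMod l g f := fun d hd => (h d hd).symm

theorem EqMod.trans {f g h : QFun n} (h1 : EqMod l f g) (h2 : EqMod l g h) : EqMod l f h :=
  fun d hd => (h1 d hd).trans (h2 d hd)

theorem degree_le_degree {d d' : Fin n →₀ ℕ} (h : d' ≤ d) : d'.degree ≤ d.degree := by
  obtain ⟨e, rfl⟩ := exists_add_of_le h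
  rw [map_add]
  exact Nat.le_add_right _ _

theorem EqMod.mul {f f' g g' : QFun n} (h : EqMod l f f') (h' : EqMod l g g') :
    EqMod l (f * g) (f' * g') := fun _ hd =>
  coeff_mul_congr (fun d' hd' => h d' ((degree_le_degree hd').trans_lt hd))
    fun d' hd' => h' d' ((degree_le_degree hd').trans_lt hd)

theorem EqMod.neg {f f' : QFun n} (h : EqMod l f f') : EqMod l (-f) (-f') := fun d hd => by
  have := h d hd
  change -(coeff d f) = -(coeff d f')
  exact congrArg Neg.neg this

theorem EqMod.pexp {f f' : QFun n} (hf : coeff 0 f = 0) (hf' : coeff 0 f' = 0)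
    (h : EqMod l f f') : EqMod l (pexp LaurentField f) (pexp LaurentField f') := fun d hd => by
  have h1 := pexp_sub_congr (k := LaurentField) hf hf' fun d' hd' =>
    h d' ((degree_le_degree hd'.le).trans_lt hd)
  have h2 : coeff d f = coeff d f' := h d hd
  rw [h2] at h1
  exact sub_left_injective h1

theorem EqMod.mul_right_cancel {f f' g : QFun n} (hg : coeff 0 g = 1)
    (h : EqMod l (f * g) (f' * g)) : EqMod l f f' := by
  have h1 : g * TropVertex.pexp LaurentField (-plog LaurentField g) = 1 := by
    nth_rewrite 1 [← pexp_plog (k := LaurentField) hg]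
    exact pexp_mul_pexp_neg (coeff_zero_plog hg)
  have h2 := h.mul (EqMod.refl (TropVertex.pexp LaurentField (-plog LaurentField g)))
  rwa [mul_assoc, h1, mul_one, mul_assoc, h1, mul_one] at h2

variable (D : QDiagram n) (γ : ℝ → Plane)

/-- The logarithm of the contribution of a crossing. -/
def crossingLog (c : ℝ × D.Index) : QFun n := D.crossingSign γ c • (D.ray c.2).ham

theorem coeff_crossingLog (c : ℝ × D.Index) (d : Fin n →₀ ℕ) :
    coeff d (crossingLog D γ c) = D.crossingSign γ c • coeff d (D.ray c.2).ham :=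
  map_zsmul (coeff d) _ _

theorem coeff_zero_crossingLog (c : ℝ × D.Index) : coeff 0 (crossingLog D γ c) = 0 := by
  have h : coeff 0 (D.ray c.2).ham = 0 := (D.ray c.2).ham_const
  rw [coeff_crossingLog, h, smul_zero]

/-- The path-ordered product of the exponentials of the Hamiltonians. -/
def pathElem : List (ℝ × D.Index) → QFun n
  | [] => 1
  | c :: L => pathElem L * pexp LaurentField (crossingLog D γ c)

/-- The inverse of the path-ordered product. -/
def pathElemInv : List (ℝ × D.Index) → QFun n
  | [] => 1
  | c :: L => pexp LaurentField (-crossingLog D γ c) * pathElemInv L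

theorem pathProduct_eq (L : List (ℝ × D.Index)) (a : QFun n) :
    D.pathProduct γ L a = pathElem D γ L * a * pathElemInv D γ L := by
  induction L generalizing a with
  | nil => exact ((mul_one _).trans (one_mul a)).symm
  | cons c L ih =>
    have h : D.pathProduct γ (c :: L) a = D.pathProduct γ L
      (pexp LaurentField (crossingLog D γ c) * a * pexp LaurentField (-crossingLog D γ c)) := rfl
    rw [h, ih, pathElem, pathElemInv]
    simp only [mul_assoc]

theorem pathElem_mul_pathElemInv (L : List (ℝ × D.Index)) :
    pathElem D γ L * pathElemInv D γ L = 1 := by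
  induction L with
  | nil => exact mul_one 1
  | cons c L ih =>
    rw [pathElem, pathElemInv, mul_assoc, ← mul_assoc (pexp _ _),
      pexp_mul_pexp_neg (coeff_zero_crossingLog D γ c), one_mul, ih]

theorem pathElemInv_mul_pathElem (L : List (ℝ × D.Index)) :
    pathElemInv D γ L * pathElem D γ L = 1 := by
  induction L with
  | nil => exact mul_one 1
  | cons c L ih =>
    rw [pathElem, pathElemInv, mul_assoc, ← mul_assoc (pathElemInv D γ L), ih, one_mul,
      pexp_neg_mul_pexp (coeff_zero_crossingLog D γ c)]

theorem pathElemInv_append (L L' : List (ℝ × D.Index)) :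
    pathElemInv D γ (L ++ L') = pathElemInv D γ L * pathElemInv D γ L' := by
  induction L with
  | nil => exact (one_mul _).symm
  | cons c L ih => rw [List.cons_append, pathElemInv, pathElemInv, ih, mul_assoc]

theorem coeff_zero_list_sum {α : Type*} (L : List α) (f : α → QFun n) (h : ∀ c, coeff 0 (f c) = 0) :
    coeff 0 (L.map f).sum = 0 := by
  induction L with
  | nil => rfl
  | cons c L ih => rw [List.map_cons, List.sum_cons, map_add, h, ih, add_zero]

/-- Simultaneous crossings with commuting Hamiltonians. -/
theorem pathElemInv_eq_pexp (L : List (ℝ × D.Index))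
    (h : ∀ c ∈ L, ∀ c' ∈ L, Commute (crossingLog D γ c) (crossingLog D γ c')) :
    pathElemInv D γ L = pexp LaurentField (-(L.map (crossingLog D γ)).sum) := by
  induction L with
  | nil => exact (by rw [List.map_nil, List.sum_nil, neg_zero, pexp_zero]; rfl)
  | cons c L ih =>
    rw [pathElemInv, ih fun a ha b hb => h a (List.mem_cons_of_mem c ha) b
      (List.mem_cons_of_mem c hb), List.map_cons, List.sum_cons, neg_add, pexp_add]
    · rw [map_neg, coeff_zero_crossingLog, neg_zero]
    · rw [map_neg, coeff_zero_list_sum _ _ (coeff_zero_crossingLog D γ), neg_zero]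
    · refine Commute.neg_left (Commute.neg_right (Commute.list_sum_right _ _ fun b hb => ?_))
      obtain ⟨c', hc', rfl⟩ := List.mem_map.1 hb
      exact h c List.mem_cons_self c' (List.mem_cons_of_mem c hc')

end PathProduct

/-! ### The potential of an arrangement -/

section Potential

open MvPowerSeries (coeff)
open Filter Topology

variable {n : ℕ} {l : ℕ}

/-- The factor of `g` with positive signs at `y`. It is the path-ordered product from a fixed chamber
to the one that contains `y`. -/
def potential (m : Fin n → ZLat) (g : QFun n) (y : Plane) : QFun n := facPart (signOf (slope m y)) 1 g

theorem coeff_zero_potential (m : Fin n → ZLat) (g : QFun n) (y : Plane) :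
    coeff 0 (potential m g y) = 1 := coeff_zero_facPart _ _ _

/-- The part of the wall through `y` with weights `a` such that `⟨a, v⟩ > 0`. -/
def halfWall (m : Fin n → ZLat) (g : QFun n) (y v : Plane) : QFun n :=
  restrict (signClass (signOf (slope m v)) 1) (wallLog m g y)

theorem coeff_zero_halfWall (m : Fin n → ZLat) (g : QFun n) (y v : Plane) :
    coeff 0 (halfWall m g y v) = 0 := coeff_restrict_eq_zero (coeff_zero_wallLog m g y) _

theorem coeff_halfWall (m : Fin n → ZLat) (g : QFun n) (y v : Plane) (d : Fin n →₀ ℕ) :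
    coeff d (halfWall m g y v) =
      if SignType.sign (slope m v d) = 1 then coeff d (wallLog m g y) else 0 := by
  split_ifs with h
  · by_cases h0 : d = 0
    · rw [h0, coeff_zero_halfWall, coeff_zero_wallLog]
    · exact coeff_restrict_of_mem (s := signClass (signOf (slope m v)) 1) ⟨h0, h⟩ _
  · exact coeff_restrict_of_notMem (fun h' => h h'.2) _

theorem potential_eqMod {m : Fin n → ZLat} {g : QFun n} (hg : g ∈ (homGrading m).sub)
    (hg0 : coeff 0 g = 1) {y y' : Plane} (hy : y ≠ 0)
    (h : ∀ d : Fin n →₀ ℕ, d.degree < l → slope m y d ≠ 0 →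
      SignType.sign (slope m y' d) = SignType.sign (slope m y d)) :
    EqMod l (potential m g y') (pexp LaurentField (halfWall m g y y') * potential m g y) := by
  intro d hd
  rw [potential, potential, halfWall, ← (facPart_lexSign_slope hg hg0 hy (slope m y')).2]
  refine facPart_congr (fun _ _ => rfl) fun d' hd' => ?_
  rw [lexSign, signOf]
  split_ifs with h1
  · exact h d' ((degree_le_degree hd').trans_lt hd) h1
  · rfl

theorem halfWall_commute {m : Fin n → ZLat} {g : QFun n} (hg : g ∈ (homGrading m).sub)
    {y : Plane} (hy : y ≠ 0) (v v' : Plane) : Commute (halfWall m g y v) (halfWall m g y v') :=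
  commute_restrict_wallLog hg hy _ _

theorem continuous_slope (m : Fin n → ZLat) (d : Fin n →₀ ℕ) :
    Continuous fun y => slope m y d := by
  simp only [slope_apply, skewR]
  fun_prop

theorem eventually_sign_eq_of_deriv {h : ℝ → ℝ} {t₀ : ℝ} (h0 : h t₀ = 0) (h1 : deriv h t₀ ≠ 0) :
    ∀ᶠ t in 𝓝 t₀, SignType.sign (h t) = SignType.sign ((t - t₀) * deriv h t₀) := by
  rcases lt_or_gt_of_ne h1 with h2 | h2
  · filter_upwards [eventually_nhdsWithin_sign_eq_of_deriv_neg h2 h0] with t ht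
    rw [ht, sign_mul, sign_neg h2, mul_neg, mul_one, ← Left.sign_neg, neg_sub]
  · filter_upwards [eventually_nhdsWithin_sign_eq_of_deriv_pos h2 h0] with t ht
    rw [ht, sign_mul, sign_pos h2, mul_one]

/-- The rays of the diagram start at the origin, and the Hamiltonians of the rays through a point `y`
add up to the wall of the arrangement `g` at `y`. An ingoing and an outgoing ray may share a support,
so that only the sums of the Hamiltonians are fixed. -/
structure IsWallDiagram (m : Fin n → ZLat) (g : QFun n) (D : QDiagram n) : Prop where
  base : ∀ i, (D.ray i).base = 0
  mem : ∀ i, (D.ray i).ham ∈ (homGrading m).sub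
  dir : ∀ i d, coeff d (D.ray i).ham ≠ 0 → ∃ r : ℕ, 1 ≤ r ∧ wt m d = r • (D.ray i).hamDir
  walls : ∀ (y : Plane) (d : Fin n →₀ ℕ) (l : ℕ) (T : Finset D.Index), y ≠ 0 → wt m d ≠ 0 →
    d.degree < l → (∀ i, i ∈ T ↔ y ∈ (D.ray i).support ∧ ¬ EqMod l (D.ray i).ham 0) →
    ∑ i ∈ T, coeff d (D.ray i).ham = coeff d (wallLog m g y)

end Potential

section Consistency

open MvPowerSeries (coeff)
open Filter Topology

variable {n : ℕ} {l : ℕ} {m : Fin n → ZLat} {g : QFun n} {D : QDiagram n} {γ : ℝ → Plane}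
  {L : List (ℝ × D.Index)}

theorem skewR_hamDir_ne {r : QRay n} {v : Plane} (h : skewR (toPlane r.dir) v ≠ 0) :
    skewR (toPlane r.hamDir) v ≠ 0 := by
  rw [QRay.hamDir]
  split_ifs
  · exact h
  · rwa [toPlane_neg, skewR_neg_left, neg_ne_zero]

theorem skewR_hamDir_eq_zero {r : QRay n} {y : Plane} (hb : r.base = 0) (h : y ∈ r.support) :
    skewR (toPlane r.hamDir) y = 0 := by
  obtain ⟨t, _, rfl⟩ := h
  rw [hb, zero_add, skewR_smul_right, QRay.hamDir]
  split_ifs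
  · rw [skewR_self, mul_zero]
  · rw [toPlane_neg, skewR_neg_left, skewR_self, neg_zero, mul_zero]

theorem ham_ne_zero_of_not_eqMod {i : D.Index} (h : ¬ EqMod l (D.ray i).ham 0) :
    (D.ray i).ham ≠ 0 := fun h0 => h (by rw [h0]; exact EqMod.refl 0)

open Classical in
/-- The rays crossed at the time `t`. -/
def crossedAt (L : List (ℝ × D.Index)) (t : ℝ) : Finset D.Index :=
  ((L.filter fun c => c.1 = t).map Prod.snd).toFinset

theorem mem_crossedAt {t : ℝ} {i : D.Index} : i ∈ crossedAt L t ↔ (t, i) ∈ L := by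
  classical
  rw [crossedAt, List.mem_toFinset, List.mem_map]
  constructor
  · rintro ⟨c, hc, rfl⟩
    rw [List.mem_filter, decide_eq_true_iff] at hc
    rw [← hc.2]
    exact hc.1
  · intro h
    exact ⟨(t, i), List.mem_filter.2 ⟨h, decide_eq_true rfl⟩, rfl⟩

theorem sum_crossedAt (hL : L.Nodup) (t : ℝ) (f : D.Index → QFun n) :
    ((L.filter fun c => c.1 = t).map fun c => f c.2).sum = ∑ i ∈ crossedAt L t, f i := by
  classical
  have h : ((L.filter fun c => c.1 = t).map Prod.snd).Nodup := by
    refine List.Nodup.map_on (fun c hc c' hc' h => ?_) (hL.filter _)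
    rw [List.mem_filter, decide_eq_true_iff] at hc hc'
    exact Prod.ext (hc.2.trans hc'.2.symm) h
  rw [crossedAt, List.sum_toFinset _ h, List.map_map]
  rfl

/-- A wall met by the path at the time `t` belongs to a ray that is crossed transversally. -/
theorem IsWallDiagram.transverse (hD : IsWallDiagram m g D) (hγ : D.IsAdmissible γ)
    (hL : D.IsCrossingList γ l L) {t : ℝ} (ht : t ∈ Set.Icc (0 : ℝ) 1) (hy : γ t ≠ 0)
    {d : Fin n →₀ ℕ} (hd : d.degree < l) (hw : wt m d ≠ 0) (hc : coeff d (wallLog m g (γ t)) ≠ 0) :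
    (∃ i, (t, i) ∈ L) ∧ t ∈ Set.Ioo (0 : ℝ) 1 ∧ slope m (deriv γ t) d ≠ 0 := by
  have h1 := hD.walls (γ t) d l (crossedAt L t) hy hw hd fun i => by
    rw [mem_crossedAt, hL.mem_iff]
    exact and_iff_right ht
  rw [← h1] at hc
  obtain ⟨i, hi, hi'⟩ := exists_ne_zero_of_sum_ne_zero hc
  rw [mem_crossedAt] at hi
  obtain ⟨-, h2, h3⟩ := (hL.mem_iff t i).1 hi
  have h4 := ham_ne_zero_of_not_eqMod h3
  refine ⟨⟨i, hi⟩, ⟨lt_of_le_of_ne ht.1 ?_, lt_of_le_of_ne ht.2 ?_⟩, ?_⟩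
  · rintro rfl
    exact (hγ.endpoints i h4).1 h2
  · rintro rfl
    exact (hγ.endpoints i h4).2 h2
  · obtain ⟨r, hr, hwt⟩ := hD.dir i d hi'
    rw [slope_apply, hwt, toPlane_nsmul, skewR_smul_left]
    exact mul_ne_zero (Nat.cast_ne_zero.2 (by omega)) (skewR_hamDir_ne (hγ.transverse i h4 t ht h2))

theorem hasDerivAt_slope (hγ : D.IsAdmissible γ) {t : ℝ} (ht : t ∈ Set.Ioo (0 : ℝ) 1)
    (d : Fin n →₀ ℕ) : HasDerivAt (fun t => slope m (γ t) d) (slope m (deriv γ t) d) t := by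
  have h1 : DifferentiableAt ℝ γ t :=
    ((hγ.smooth t (Set.Ioo_subset_Icc_self ht)).differentiableWithinAt (by simp)).differentiableAt
      (Icc_mem_nhds ht.1 ht.2)
  have h2 := h1.hasDerivAt
  have h3 : HasDerivAt (fun t => (γ t).1) (deriv γ t).1 t :=
    (hasFDerivAt_fst (p := γ t)).comp_hasDerivAt t h2
  have h4 : HasDerivAt (fun t => (γ t).2) (deriv γ t).2 t :=
    (hasFDerivAt_snd (p := γ t)).comp_hasDerivAt t h2
  exact (h4.const_mul _).sub (h3.const_mul _)

/-- The contributions of the rays crossed at the time `t` add up to the difference of the two halves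
of the wall. -/
theorem IsWallDiagram.sum_crossingLog (hD : IsWallDiagram m g D) (hL : D.IsCrossingList γ l L)
    {t : ℝ} (ht : t ∈ Set.Icc (0 : ℝ) 1) (hy : γ t ≠ 0) :
    EqMod l ((L.filter fun c => c.1 = t).map (crossingLog D γ)).sum
      (halfWall m g (γ t) (deriv γ t) - halfWall m g (γ t) (-deriv γ t)) := by
  intro d hd
  have h0 : ((L.filter fun c => c.1 = t).map (crossingLog D γ)).sum =
      ∑ i ∈ crossedAt L t, crossingLog D γ (t, i) := by
    rw [← sum_crossedAt hL.nodup]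
    congr 1
    refine List.map_congr_left fun c hc => ?_
    rw [List.mem_filter, decide_eq_true_iff] at hc
    rw [← hc.2]
  have hslope : slope m (-deriv γ t) d = -slope m (deriv γ t) d := by
    rw [slope_apply, slope_apply, skewR_neg_right]
  have h1 : ∀ i, coeff d (crossingLog D γ (t, i)) =
      (SignType.sign (slope m (deriv γ t) d) : ℤ) • coeff d (D.ray i).ham := by
    intro i
    rw [coeff_crossingLog]
    by_cases hi : coeff d (D.ray i).ham = 0
    · rw [hi, smul_zero, smul_zero]
    · obtain ⟨r, hr, hwt⟩ := hD.dir i d hi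
      have h2 : D.crossingSign γ (t, i) = (SignType.sign (slope m (deriv γ t) d) : ℤ) := by
        rw [slope_apply, hwt, toPlane_nsmul, skewR_smul_left, sign_mul,
          sign_pos (Nat.cast_pos.2 hr), one_mul]
        rfl
      rw [h2]
  change coeff d _ = coeff d _
  rw [h0, map_sum, sum_congr rfl fun i _ => h1 i, ← smul_sum, map_sub, coeff_halfWall,
    coeff_halfWall, hslope]
  by_cases hw : wt m d = 0
  · have h2 : slope m (deriv γ t) d = 0 := by rw [slope_apply, hw, toPlane_zero, skewR_zero_left]
    rw [h2, neg_zero, sign_zero, sub_self]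
    exact zero_smul ℤ _
  rw [hD.walls (γ t) d l (crossedAt L t) hy hw hd fun i => by
    rw [mem_crossedAt, hL.mem_iff]
    exact and_iff_right ht]
  rcases lt_trichotomy (slope m (deriv γ t) d) 0 with h2 | h2 | h2
  · rw [sign_neg h2, if_neg (by decide), if_pos (sign_pos (neg_pos.2 h2)), zero_sub]
    exact neg_one_zsmul _
  · rw [h2, neg_zero, sign_zero, sub_self]
    exact zero_smul ℤ _
  · rw [sign_pos h2, if_pos rfl, if_neg (by rw [sign_neg (neg_neg_of_pos h2)]; decide), sub_zero]
    exact one_zsmul _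

/-- The inverse of the path-ordered product up to the time `t`, applied to the potential just before
`t`: when `γ t` lies on a wall, the potential there is multiplied by the half of the wall that belongs
to the side the path comes from. It does not depend on `t` if the walls are the jumps of the
potential. -/
def comparison (m : Fin n → ZLat) (g : QFun n) (D : QDiagram n) (γ : ℝ → Plane)
    (L : List (ℝ × D.Index)) (t : ℝ) : QFun n :=
  pathElemInv D γ (L.filter fun c => c.1 < t) *
    (pexp LaurentField (halfWall m g (γ t) (-deriv γ t)) * potential m g (γ t))

theorem IsWallDiagram.halfWall_eqMod_zero (hD : IsWallDiagram m g D) (hγ : D.IsAdmissible γ)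
    (hL : D.IsCrossingList γ l L) {t : ℝ} (ht : t ∈ Set.Icc (0 : ℝ) 1) (hy : γ t ≠ 0)
    (h : ∀ i, (t, i) ∉ L) (v : Plane) : EqMod l (halfWall m g (γ t) v) 0 := by
  intro d hd
  change coeff d _ = coeff d 0
  rw [coeff_halfWall, map_zero]
  split_ifs with h1
  · by_contra hc
    have hw : wt m d ≠ 0 := by
      intro hw
      rw [slope_apply, hw, toPlane_zero, skewR_zero_left, sign_zero] at h1
      exact absurd h1 (by decide)
    obtain ⟨i, hi⟩ := (hD.transverse hγ hL ht hy hd hw hc).1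
    exact h i hi
  · rfl

theorem IsWallDiagram.comparison_of_not_crossed (hD : IsWallDiagram m g D) (hγ : D.IsAdmissible γ)
    (hL : D.IsCrossingList γ l L) {t : ℝ} (ht : t ∈ Set.Icc (0 : ℝ) 1) (hy : γ t ≠ 0)
    (h : ∀ i, (t, i) ∉ L) : EqMod l (comparison m g D γ L t)
      (pathElemInv D γ (L.filter fun c => c.1 < t) * potential m g (γ t)) := by
  refine (EqMod.refl _).mul ?_
  have h1 := (EqMod.pexp (coeff_zero_halfWall m g (γ t) (-deriv γ t)) (map_zero _)
    (hD.halfWall_eqMod_zero hγ hL ht hy h _)).mul (EqMod.refl (potential m g (γ t)))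
  rwa [pexp_zero, one_mul] at h1

theorem filter_le_eq (hL : L.Pairwise fun c c' => c.1 ≤ c'.1) (t : ℝ) :
    (L.filter fun c => c.1 ≤ t) = (L.filter fun c => c.1 < t) ++ L.filter fun c => c.1 = t := by
  induction L with
  | nil => rfl
  | cons c L ih =>
    obtain ⟨h1, h2⟩ := List.pairwise_cons.1 hL
    rcases lt_trichotomy c.1 t with h | h | h
    · rw [List.filter_cons_of_pos (by simpa using h.le), List.filter_cons_of_pos (by simpa using h),
        List.filter_cons_of_neg (by simpa using h.ne), ih h2, List.cons_append]
    · have h3 : (L.filter fun c => c.1 < t) = [] := by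
        refine List.filter_eq_nil_iff.2 fun c' hc' => ?_
        have := h1 c' hc'
        simp only [decide_eq_true_eq, not_lt]
        linarith
      rw [List.filter_cons_of_pos (by simpa using h.le), List.filter_cons_of_neg (by simpa using h.ge),
        List.filter_cons_of_pos (by simpa using h), ih h2, h3]
      rfl
    · rw [List.filter_cons_of_neg (by simpa using h), List.filter_cons_of_neg (by simpa using h.le),
        List.filter_cons_of_neg (by simpa using h.ne'), ih h2]

theorem IsWallDiagram.eventually_comparison (hD : IsWallDiagram m g D)
    (hg : g ∈ (homGrading m).sub) (hg0 : coeff 0 g = 1) (hγ : D.IsAdmissible γ)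
    (hL : D.IsCrossingList γ l L) (hy : ∀ t ∈ Set.Icc (0 : ℝ) 1, γ t ≠ 0) {t₀ : ℝ}
    (ht₀ : t₀ ∈ Set.Icc (0 : ℝ) 1) :
    ∀ᶠ t in 𝓝[Set.Icc 0 1] t₀, EqMod l (comparison m g D γ L t) (comparison m g D γ L t₀) := by
  -- Modulo `𝔪^l` only finitely many exponents matter. Near `t₀` the slopes that do not vanish at `t₀`
  -- keep their signs, those of the wall at `γ t₀` have the signs of their derivatives, and no crossing
  -- occurs at a time other than `t₀`.
  have hA : ∀ᶠ t in 𝓝[Set.Icc 0 1] t₀, ∀ d ∈ {d : Fin n →₀ ℕ | d.degree < l},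
      slope m (γ t₀) d ≠ 0 →
        SignType.sign (slope m (γ t) d) = SignType.sign (slope m (γ t₀) d) := by
    refine (eventually_all_finite (Finsupp.finite_of_degree_lt l)).2 fun d _ => ?_
    by_cases h0 : slope m (γ t₀) d = 0
    · exact Eventually.of_forall fun _ h => absurd h0 h
    · have h1 : ContinuousWithinAt (fun t => slope m (γ t) d) (Set.Icc 0 1) t₀ :=
        (continuous_slope m d).continuousAt.comp_continuousWithinAt
          (hγ.smooth.continuousOn t₀ ht₀)
      filter_upwards [h1.eventually (eventually_sign_eq continuousAt_id h0)] with t ht _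
      exact ht
  have hB : ∀ᶠ t in 𝓝[Set.Icc 0 1] t₀, ∀ d ∈ {d : Fin n →₀ ℕ | d.degree < l},
      coeff d (wallLog m g (γ t₀)) ≠ 0 → wt m d ≠ 0 →
        SignType.sign (slope m (γ t) d) =
          SignType.sign ((t - t₀) * slope m (deriv γ t₀) d) := by
    refine (eventually_all_finite (Finsupp.finite_of_degree_lt l)).2 fun d hd => ?_
    by_cases h0 : coeff d (wallLog m g (γ t₀)) ≠ 0 ∧ wt m d ≠ 0
    · obtain ⟨-, h1, h2⟩ := hD.transverse hγ hL ht₀ (hy t₀ ht₀) hd h0.2 h0.1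
      have h3 := (hasDerivAt_slope (m := m) hγ h1 d).deriv
      have h4 : slope m (γ t₀) d = 0 := by
        by_contra h
        exact h0.1 (coeff_wallLog_of_slope_ne h)
      filter_upwards [mem_nhdsWithin_of_mem_nhds (eventually_sign_eq_of_deriv
        (h := fun t => slope m (γ t) d) h4 (by rwa [h3]))] with t ht _ _
      rw [← h3]
      exact ht
    · exact Eventually.of_forall fun _ h h' => absurd ⟨h, h'⟩ h0
  have hC : ∀ᶠ t in 𝓝[Set.Icc 0 1] t₀, ∀ c ∈ {c | c ∈ L},
      c.1 ≠ t₀ → ((c.1 < t ↔ c.1 < t₀) ∧ c.1 ≠ t) := by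
    refine (eventually_all_finite (List.finite_toSet L)).2 fun c _ => ?_
    by_cases h0 : c.1 = t₀
    · exact Eventually.of_forall fun _ h => absurd h0 h
    · rcases lt_or_gt_of_ne h0 with h2 | h2
      · filter_upwards [mem_nhdsWithin_of_mem_nhds (lt_mem_nhds h2)] with t ht _
        exact ⟨iff_of_true ht h2, ne_of_lt ht⟩
      · filter_upwards [mem_nhdsWithin_of_mem_nhds (gt_mem_nhds h2)] with t ht _
        exact ⟨iff_of_false (not_lt.2 (le_of_lt ht)) (not_lt.2 (le_of_lt h2)), ne_of_gt ht⟩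
  filter_upwards [hA, hB, hC, self_mem_nhdsWithin] with t hA hB hC ht
  have hy₀ := hy t₀ ht₀
  by_cases htt : t = t₀
  · rw [htt]; exact EqMod.refl _
  have hnc : ∀ i, (t, i) ∉ L := by
    intro i hi
    exact (hC (t, i) hi htt).2 rfl
  refine (hD.comparison_of_not_crossed hγ hL ht (hy t ht) hnc).trans ?_
  -- the half of the wall at `t₀` that separates `t₀` from `t` is the one seen by the velocity
  have hhalf : ∀ v : Plane, (∀ d, slope m v d = (t - t₀) / |t - t₀| * slope m (deriv γ t₀) d) →
      EqMod l (halfWall m g (γ t₀) (γ t)) (halfWall m g (γ t₀) v) := by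
    intro v hv d hd
    change coeff d _ = coeff d _
    rw [coeff_halfWall, coeff_halfWall]
    by_cases hc : coeff d (wallLog m g (γ t₀)) = 0
    · rw [hc, ite_self, ite_self]
    have hs : SignType.sign (slope m (γ t) d) = SignType.sign (slope m v d) := by
      by_cases hw : wt m d = 0
      · rw [slope_apply, slope_apply, hw, toPlane_zero, skewR_zero_left, skewR_zero_left]
      · rw [hB d hd hc hw, hv, sign_mul, sign_mul, div_eq_mul_inv, sign_mul,
          sign_pos (inv_pos.2 (abs_pos.2 (sub_ne_zero.2 htt))), mul_one]
    rw [hs]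
  have hpot : ∀ v : Plane, (∀ d, slope m v d = (t - t₀) / |t - t₀| * slope m (deriv γ t₀) d) →
      EqMod l (potential m g (γ t))
        (pexp LaurentField (halfWall m g (γ t₀) v) * potential m g (γ t₀)) := fun v hv =>
    (potential_eqMod hg hg0 hy₀ hA).trans ((EqMod.pexp (coeff_zero_halfWall _ _ _ _)
      (coeff_zero_halfWall _ _ _ _) (hhalf v hv)).mul (EqMod.refl _))
  -- Before `t₀` the crossings at `t₀` are in neither product; after `t₀` they are all passed, and their
  -- total is the jump of the potential.
  rcases lt_or_gt_of_ne htt with hlt | hgt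
  · have hfil : (L.filter fun c => c.1 < t) = L.filter fun c => c.1 < t₀ := by
      refine List.filter_congr fun c hc => ?_
      rw [decide_eq_decide]
      by_cases h : c.1 = t₀
      · rw [h]; exact iff_of_false (not_lt.2 hlt.le) (lt_irrefl _)
      · exact (hC c hc h).1
    rw [hfil, comparison]
    refine (EqMod.refl _).mul (hpot _ fun d => ?_)
    rw [abs_of_neg (sub_neg.2 hlt), div_neg, div_self (sub_ne_zero.2 htt), neg_one_mul,
      slope_apply, slope_apply, skewR_neg_right]
  · have hfil : (L.filter fun c => c.1 < t) =
        (L.filter fun c => c.1 < t₀) ++ L.filter fun c => c.1 = t₀ := by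
      rw [← filter_le_eq hL.sorted]
      refine List.filter_congr fun c hc => ?_
      rw [decide_eq_decide]
      by_cases h : c.1 = t₀
      · rw [h]; exact iff_of_true hgt le_rfl
      · exact ((hC c hc h).1).trans ⟨le_of_lt, fun h' => lt_of_le_of_ne h' h⟩
    rw [hfil, comparison, pathElemInv_append, mul_assoc]
    refine (EqMod.refl _).mul ?_
    have h1 := hpot (deriv γ t₀) fun d => by
      rw [abs_of_pos (sub_pos.2 hgt), div_self (sub_ne_zero.2 htt), one_mul]
    have hcomm : ∀ c ∈ L.filter (fun c => c.1 = t₀), ∀ c' ∈ L.filter (fun c => c.1 = t₀),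
        Commute (crossingLog D γ c) (crossingLog D γ c') := by
      have hz : ∀ c ∈ L.filter (fun c => c.1 = t₀), ∀ d, slope m (γ t₀) d ≠ 0 →
          coeff d (crossingLog D γ c) = 0 := by
        intro c hc d hd
        rw [List.mem_filter, decide_eq_true_iff] at hc
        rw [coeff_crossingLog]
        by_contra h
        have h2 : coeff d (D.ray c.2).ham ≠ 0 := fun h' => h (by rw [h', smul_zero])
        obtain ⟨r, -, hr⟩ := hD.dir c.2 d h2
        apply hd
        rw [slope_apply, hr, toPlane_nsmul, skewR_smul_left, ← hc.2, skewR_hamDir_eq_zero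
          (hD.base c.2) ((hL.mem_iff c.1 c.2).1 hc.1).2.1, mul_zero]
      intro c hc c' hc'
      exact commute_of_parallel hy₀ (zsmul_mem (hD.mem c.2) _) (zsmul_mem (hD.mem c'.2) _)
        (hz c hc) (hz c' hc')
    rw [pathElemInv_eq_pexp D γ _ hcomm]
    have h2 := hD.sum_crossingLog hL ht₀ hy₀
    have h3 := EqMod.pexp (by
      rw [map_neg, coeff_zero_list_sum _ _ (coeff_zero_crossingLog D γ), neg_zero]) (by
      rw [map_neg, map_sub, coeff_zero_halfWall, coeff_zero_halfWall, sub_zero, neg_zero]) h2.neg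
    refine (h3.mul h1).trans ?_
    rw [← mul_assoc, ← pexp_add _ (coeff_zero_halfWall _ _ _ _)]
    · rw [neg_sub, sub_add_cancel]
      exact EqMod.refl _
    · exact Commute.neg_left (Commute.sub_left (halfWall_commute hg hy₀ _ _)
        (halfWall_commute hg hy₀ _ _))
    · rw [map_neg, map_sub, coeff_zero_halfWall, coeff_zero_halfWall, sub_zero, neg_zero]

/-- The potential trivializes the path-ordered products. -/
theorem IsWallDiagram.isConsistent (hD : IsWallDiagram m g D) (hg : g ∈ (homGrading m).sub)
    (hg0 : coeff 0 g = 1) : D.IsConsistent := by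
  intro γ hγ hclosed l L hL a
  by_cases hne : ∃ i, (D.ray i).ham ≠ 0
  swap
  · have h1 : L = [] := List.eq_nil_iff_forall_not_mem.2 fun c hc =>
      hne ⟨c.2, ham_ne_zero_of_not_eqMod ((hL.mem_iff c.1 c.2).1 hc).2.2⟩
    rw [h1]
    exact EqMod.refl a
  obtain ⟨i₀, hi₀⟩ := hne
  have hy : ∀ t ∈ Set.Icc (0 : ℝ) 1, γ t ≠ 0 := fun t ht h0 =>
    hγ.avoids t ht (Or.inl ⟨i₀, hi₀, by rw [h0, hD.base]⟩)
  have h0 : (0 : ℝ) ∈ Set.Icc (0 : ℝ) 1 := ⟨le_rfl, zero_le_one⟩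
  have h1 : (1 : ℝ) ∈ Set.Icc (0 : ℝ) 1 := ⟨zero_le_one, le_rfl⟩
  have hconst : EqMod l (comparison m g D γ L 1) (comparison m g D γ L 0) := by
    let F : Set.Icc (0 : ℝ) 1 → {d : Fin n →₀ ℕ // d.degree < l} → QTorus := fun t d =>
      coeff d.1 (comparison m g D γ L t)
    have hF : IsLocallyConstant F := by
      refine (IsLocallyConstant.iff_eventually_eq F).2 fun t => ?_
      have h2 := hD.eventually_comparison hg hg0 hγ hL hy t.2
      rw [nhdsWithin_eq_map_subtype_coe t.2, eventually_map] at h2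
      filter_upwards [h2] with t' ht'
      funext d
      exact ht' d.1 d.2
    intro d hd
    exact congrFun (hF.apply_eq_of_preconnectedSpace ⟨1, h1⟩ ⟨0, h0⟩) ⟨d, hd⟩
  have hn0 : ∀ i, ((0 : ℝ), i) ∉ L := fun i hi => by
    obtain ⟨-, h2, h3⟩ := (hL.mem_iff 0 i).1 hi
    exact (hγ.endpoints i (ham_ne_zero_of_not_eqMod h3)).1 h2
  have hn1 : ∀ i, ((1 : ℝ), i) ∉ L := fun i hi => by
    obtain ⟨-, h2, h3⟩ := (hL.mem_iff 1 i).1 hi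
    exact (hγ.endpoints i (ham_ne_zero_of_not_eqMod h3)).2 h2
  have hf0 : (L.filter fun c => c.1 < 0) = [] := List.filter_eq_nil_iff.2 fun c hc => by
    have := ((hL.mem_iff c.1 c.2).1 hc).1.1
    simpa using this
  have hf1 : (L.filter fun c => c.1 < 1) = L := List.filter_eq_self.2 fun c hc => by
    have h2 := ((hL.mem_iff c.1 c.2).1 hc).1.2
    have h3 : c.1 ≠ 1 := fun h => hn1 c.2 (by rw [← h]; exact hc)
    simpa using lt_of_le_of_ne h2 h3
  have h2 := (hD.comparison_of_not_crossed hγ hL h1 (hy 1 h1) hn1).symm.trans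
    (hconst.trans (hD.comparison_of_not_crossed hγ hL h0 (hy 0 h0) hn0))
  rw [hf0, hf1, hclosed] at h2
  have h3 : EqMod l (pathElemInv D γ L) 1 := h2.mul_right_cancel (coeff_zero_potential m g (γ 1))
  have h4 : EqMod l (pathElem D γ L) 1 := by
    have h5 := (EqMod.refl (l := l) (pathElem D γ L)).mul h3
    rw [pathElem_mul_pathElemInv, mul_one] at h5
    exact h5.symm
  rw [pathProduct_eq]
  have h6 := (h4.mul (EqMod.refl a)).mul h3
  rwa [one_mul, mul_one] at h6

end Consistency

/-! ### Existence of the consistent completion -/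

section Existence

open MvPowerSeries (coeff)

variable {n : ℕ} {l : ℕ} {m : Fin n → ZLat} {g : QFun n}

theorem IsPrimitive.ne_zero {v : ZLat} (h : IsPrimitive v) : v ≠ 0 := by
  rintro rfl
  exact not_isCoprime_zero_zero h

theorem exists_primitive {w : ZLat} (hw : w ≠ 0) : ∃ (v : PrimVec) (r : ℕ), 1 ≤ r ∧ w = r • v.1 := by
  have h0 : 0 < Int.gcd w.1 w.2 := by
    refine Int.gcd_pos_iff.2 ?_
    by_contra h
    push Not at h
    exact hw (Prod.ext h.1 h.2)
  obtain ⟨a, b, h1, h2, h3⟩ := Int.exists_gcd_one h0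
  refine ⟨⟨(a, b), Int.isCoprime_iff_gcd_eq_one.2 h1⟩, Int.gcd w.1 w.2, h0, Prod.ext ?_ ?_⟩
  · rw [Prod.smul_fst, nsmul_eq_mul, mul_comm]
    exact h2
  · rw [Prod.smul_snd, nsmul_eq_mul, mul_comm]
    exact h3

theorem PrimVec.gcd_nsmul (v : PrimVec) (r : ℕ) : Int.gcd (r • v.1).1 (r • v.1).2 = r := by
  rw [Prod.smul_fst, Prod.smul_snd, nsmul_eq_mul, nsmul_eq_mul, Int.gcd_mul_left,
    Int.isCoprime_iff_gcd_eq_one.1 v.2, mul_one, Int.natAbs_natCast]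

theorem PrimVec.eq_of_nsmul_eq {v v' : PrimVec} {r r' : ℕ} (hr : 1 ≤ r) (h : r • v.1 = r' • v'.1) :
    v = v' := by
  have h1 : r = r' := by rw [← v.gcd_nsmul r, h, v'.gcd_nsmul]
  subst h1
  exact Subtype.ext (smul_right_injective ZLat (by omega : r ≠ 0) h)

theorem toPlane_smul_injective {v : ZLat} (hv : v ≠ 0) {a b : ℝ}
    (h : a • toPlane v = b • toPlane v) : a = b :=
  smul_left_injective ℝ (fun h' => hv (toPlane_eq_zero.1 h')) h

/-- The outgoing walls of an arrangement. -/
def outgoingFamily (m : Fin n → ZLat) (g : QFun n) (hg : g ∈ (homGrading m).sub) :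
    OutgoingFamily n where
  ham v := restrict {d | ∃ r : ℕ, 1 ≤ r ∧ wt m d = r • v.1} (wallLog m g (toPlane v.1))
  ham_const v := coeff_restrict_eq_zero (coeff_zero_wallLog m g _) _
  ham_supp v d a h := by
    by_cases hd : d ∈ {d | ∃ r : ℕ, 1 ≤ r ∧ wt m d = r • v.1}
    · have h1 : tcoeff d (restrict {d | ∃ r : ℕ, 1 ≤ r ∧ wt m d = r • v.1}
          (wallLog m g (toPlane v.1))) = coeff d (wallLog m g (toPlane v.1)) :=
        coeff_restrict_of_mem hd _
      obtain ⟨c, hc⟩ := exists_coeff_eq_smul (wallLog_mem hg (toPlane v.1)) d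
      rw [h1, hc] at h
      obtain ⟨r, hr, hw⟩ := hd
      exact ⟨r, hr, (QTorus.eq_of_coeff_smul_zhat_ne h).trans hw⟩
    · exact absurd (congrArg (QTorus.coeff a) (coeff_restrict_of_notMem hd _)) h
  finite_mod l := by
    refine ((Finsupp.finite_of_degree_lt l).biUnion
      (t := fun d => {v : PrimVec | ∃ r : ℕ, 1 ≤ r ∧ wt m d = r • v.1}) fun d _ =>
        Set.Subsingleton.finite ?_).subset fun v hv => ?_
    · rintro v ⟨r, hr, hw⟩ v' ⟨r', _, hw'⟩
      exact PrimVec.eq_of_nsmul_eq hr (hw.symm.trans hw')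
    · by_contra h
      refine hv fun d hd => coeff_restrict_of_notMem (fun h' => h ?_) _
      exact Set.mem_biUnion (show d ∈ {d : Fin n →₀ ℕ | d.degree < l} from hd) h'

variable {hg : g ∈ (homGrading m).sub}

theorem coeff_outgoingFamily_of_eq {v : PrimVec} {d : Fin n →₀ ℕ} {r : ℕ} (hr : 1 ≤ r)
    (hw : wt m d = r • v.1) : coeff d ((outgoingFamily m g hg).ham v) =
      coeff d (wallLog m g (toPlane v.1)) :=
  coeff_restrict_of_mem (s := {d | ∃ r : ℕ, 1 ≤ r ∧ wt m d = r • v.1}) ⟨r, hr, hw⟩ _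

theorem coeff_outgoingFamily_of_ne {v : PrimVec} {d : Fin n →₀ ℕ}
    (h : ¬ ∃ r : ℕ, 1 ≤ r ∧ wt m d = r • v.1) : coeff d ((outgoingFamily m g hg).ham v) = 0 :=
  coeff_restrict_of_notMem (s := {d | ∃ r : ℕ, 1 ≤ r ∧ wt m d = r • v.1}) h _

theorem exists_wt_of_coeff_initialHam_ne {j : Fin n} {d : Fin n →₀ ℕ}
    (h : coeff d (initialHam m j) ≠ 0) : ∃ r : ℕ, 1 ≤ r ∧ wt m d = r • m j ∧
      coeff d (initialHam m j) = dilogCoeff r • QTorus.zhat (r • m j) := by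
  change initialHam m j d ≠ 0 at h
  change ∃ r : ℕ, 1 ≤ r ∧ wt m d = r • m j ∧
      initialHam m j d = dilogCoeff r • QTorus.zhat (r • m j)
  unfold initialHam at h ⊢
  split_ifs at h ⊢ with h1
  · refine ⟨d j, Nat.pos_of_ne_zero h1.1, ?_, rfl⟩
    conv_lhs => rw [h1.2]
    rw [wt_single]
  · exact absurd rfl h

theorem addOutgoing_base (hm : ∀ j, IsPrimitive (m j)) (S : OutgoingFamily n) (i) :
    (((initialDiagram m hm).addOutgoing S).ray i).base = 0 := by
  rcases i with j | v <;> rfl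

theorem hamDir_initialRay (hm : ∀ j, IsPrimitive (m j)) (j : Fin n) :
    (initialRay m hm j).hamDir = m j := by
  rw [QRay.hamDir, if_neg (by exact Bool.false_ne_true)]
  exact neg_neg _

/-- The walls of an arrangement with the prescribed incoming walls are the rays of the initial
diagram and the outgoing rays. -/
theorem isWallDiagram_outgoingFamily (hm : ∀ j, IsPrimitive (m j))
    (hin : HasIncoming m (∑ j, initialHam m j) g) :
    IsWallDiagram m g ((initialDiagram m hm).addOutgoing (outgoingFamily m g hin.mem)) where
  base := addOutgoing_base hm _
  mem := by
    rintro (j | v)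
    · intro d
      change coeff d (initialHam m j) ∈ _
      by_cases h : coeff d (initialHam m j) = 0
      · rw [h]; exact Submodule.zero_mem _
      · obtain ⟨r, _, hw, hc⟩ := exists_wt_of_coeff_initialHam_ne h
        exact Submodule.mem_span_singleton.2 ⟨dilogCoeff r, by rw [hw, hc]⟩
    · exact Grading.restrict_mem (wallLog_mem hin.mem _) _
  dir := by
    rintro (j | v) d hd
    · obtain ⟨r, hr, hw, _⟩ := exists_wt_of_coeff_initialHam_ne (show coeff d (initialHam m j) ≠ 0
        from hd)
      exact ⟨r, hr, hw.trans (congrArg _ (hamDir_initialRay hm j).symm)⟩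
    · by_contra h
      exact hd (coeff_outgoingFamily_of_ne (hg := hin.mem) h)
  walls := by
    intro y d l (T : Finset (Fin n ⊕ PrimVec)) hy hw hd hT
    obtain ⟨R, hR⟩ : ∃ R : Fin n ⊕ PrimVec → QRay n,
        R = ((initialDiagram m hm).addOutgoing (outgoingFamily m g hin.mem)).ray := ⟨_, rfl⟩
    have hT : ∀ i, i ∈ T ↔ y ∈ (R i).support ∧ ¬ EqMod l (R i).ham 0 := by
      rw [hR]
      exact hT
    suffices h : ∑ i ∈ T, coeff d (R i).ham = coeff d (wallLog m g y) by
      rw [hR] at h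
      exact h
    have hinl : ∀ j : Fin n, coeff d (R (Sum.inl j)).ham ≠ 0 → ∃ r : ℕ, 1 ≤ r ∧ wt m d = r • m j :=
      fun j h => by
        rw [hR] at h
        obtain ⟨r, hr, hw, _⟩ := exists_wt_of_coeff_initialHam_ne
          (show coeff d (initialHam m j) ≠ 0 from h)
        exact ⟨r, hr, hw⟩
    have hinr : ∀ v, coeff d (R (Sum.inr v)).ham ≠ 0 → ∃ r : ℕ, 1 ≤ r ∧ wt m d = r • v.1 :=
      fun v h => by
        rw [hR] at h
        by_contra h'
        exact h (coeff_outgoingFamily_of_ne (hg := hin.mem) h')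
    have hsl : ∀ j : Fin n, y ∈ (R (Sum.inl j)).support ↔
        ∃ t : ℝ, 0 ≤ t ∧ y = (-t) • toPlane (m j) := by
      intro j
      rw [hR]
      refine exists_congr fun t => and_congr_right fun _ => ?_
      change y = (0 : Plane) + t • toPlane (-(m j)) ↔ _
      rw [zero_add, toPlane_neg, smul_neg, neg_smul]
    have hsr : ∀ v : PrimVec, y ∈ (R (Sum.inr v)).support ↔
        ∃ t : ℝ, 0 ≤ t ∧ y = t • toPlane v.1 := by
      intro v
      rw [hR]
      refine exists_congr fun t => and_congr_right fun _ => ?_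
      change y = (0 : Plane) + t • toPlane v.1 ↔ _
      rw [zero_add]
    have hmod : ∀ i, coeff d (R i).ham ≠ 0 → ¬ EqMod l (R i).ham 0 := fun i h h' =>
      h (h' d hd)
    have hpos : ∀ r : ℕ, 1 ≤ r → (0 : ℝ) < r := fun r hr => Nat.cast_pos.2 hr
    by_cases hpar : slope m y d = 0
    swap
    · rw [coeff_wallLog_of_slope_ne hpar]
      refine sum_eq_zero fun i hi => ?_
      by_contra h
      apply hpar
      obtain ⟨h1, _⟩ := (hT i).1 hi
      rcases i with j | v
      · obtain ⟨r, _, hr⟩ := hinl j h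
        obtain ⟨t, _, rfl⟩ := (hsl j).1 h1
        rw [slope_apply, hr, toPlane_nsmul, skewR_smul_left, skewR_smul_right, skewR_self, mul_zero,
          mul_zero]
      · obtain ⟨r, _, hr⟩ := hinr v h
        obtain ⟨t, _, rfl⟩ := (hsr v).1 h1
        rw [slope_apply, hr, toPlane_nsmul, skewR_smul_left, skewR_smul_right, skewR_self, mul_zero,
          mul_zero]
    obtain ⟨c, hc⟩ := exists_smul_of_skewR_eq_zero hw hpar
    have hc0 : c ≠ 0 := by
      rintro rfl
      exact hy (by rw [hc, zero_smul])
    rcases lt_or_gt_of_ne hc0 with hneg | hpos'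
    · -- the incoming part of the wall
      have h1 : ∑ i ∈ T, coeff d (R i).ham =
          ∑ i ∈ univ.map (Function.Embedding.inl : Fin n ↪ Fin n ⊕ PrimVec),
            coeff d (R i).ham := by
        refine sum_congr_of_eq_on_inter (fun i hi hi' => ?_) (fun i hi hi' => ?_)
          fun _ _ _ => rfl
        · rcases i with j | v
          · exact absurd (mem_map_of_mem _ (mem_univ j)) hi'
          · by_contra h
            obtain ⟨r, hr, hwr⟩ := hinr v h
            obtain ⟨t, ht, hyt⟩ := (hsr v).1 ((hT _).1 hi).1
            rw [hc, hwr, toPlane_nsmul, smul_smul] at hyt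
            have h2 := toPlane_smul_injective v.2.ne_zero hyt
            nlinarith [hpos r hr]
        · obtain ⟨j, _, rfl⟩ := Finset.mem_map.1 hi
          by_contra h
          obtain ⟨r, hr, hwr⟩ := hinl j h
          refine hi' ((hT _).2 ⟨(hsl j).2 ⟨-(c * r), by nlinarith [hpos r hr], ?_⟩, hmod _ h⟩)
          rw [hc, hwr, toPlane_nsmul, smul_smul, neg_neg]
      rw [h1, sum_map, hin.incoming y d (-c⁻¹) hw (neg_pos.2 (inv_lt_zero.2 hneg)) (by
        rw [neg_smul, neg_neg, hc, smul_smul, inv_mul_cancel₀ hc0, one_smul]), map_sum, hR]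
      rfl
    · -- the outgoing part of the wall
      obtain ⟨v, r, hr, hwr⟩ := exists_primitive hw
      have h1 : ∑ i ∈ T, coeff d (R i).ham =
          ∑ i ∈ ({Sum.inr v} : Finset (Fin n ⊕ PrimVec)), coeff d (R i).ham := by
        refine sum_congr_of_eq_on_inter (fun i hi hi' => ?_) (fun i hi hi' => ?_)
          fun _ _ _ => rfl
        · by_contra h
          rcases i with j | v'
          · obtain ⟨r', hr', hwr'⟩ := hinl j h
            obtain ⟨t, ht, hyt⟩ := (hsl j).1 ((hT _).1 hi).1
            rw [hc, hwr', toPlane_nsmul, smul_smul] at hyt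
            have h2 := toPlane_smul_injective (hm j).ne_zero hyt
            nlinarith [hpos r' hr', mul_pos hpos' (hpos r' hr')]
          · obtain ⟨r', hr', hwr'⟩ := hinr v' h
            exact hi' (mem_singleton.2 (congrArg Sum.inr
              (PrimVec.eq_of_nsmul_eq hr' (hwr'.symm.trans hwr))))
        · rw [mem_singleton.1 hi] at hi' ⊢
          by_contra h
          refine hi' ((hT _).2 ⟨(hsr v).2 ⟨c * r, (mul_pos hpos' (hpos r hr)).le, ?_⟩, hmod _ h⟩)
          rw [hc, hwr, toPlane_nsmul, smul_smul]
      rw [h1, sum_singleton, hR]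
      refine (coeff_outgoingFamily_of_eq (hg := hin.mem) hr hwr).trans ?_
      rw [hc, hwr, toPlane_nsmul, smul_smul, wallLog_smul m g (mul_pos hpos' (hpos r hr))]

theorem isConsistentCompletion_outgoingFamily (hm : ∀ j, IsPrimitive (m j))
    (hin : HasIncoming m (∑ j, initialHam m j) g) :
    IsConsistentCompletion m hm (outgoingFamily m g hin.mem) :=
  (isWallDiagram_outgoingFamily hm hin).isConsistent hin.mem hin.coeff_zero

end Existence

/-! ### A circle around the origin -/

section Circle

open Real

/-- The circle around the origin that starts at the point `(1, √2)`, which lies on no line with a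
rational slope. -/
def circle (t : ℝ) : Plane :=
  (cos (2 * π * t) - √2 * sin (2 * π * t), sin (2 * π * t) + √2 * cos (2 * π * t))

theorem circle_contDiff : ContDiff ℝ ∞ circle := by
  unfold circle
  fun_prop

theorem circle_zero : circle 0 = (1, √2) := by simp [circle]

theorem circle_one : circle 1 = (1, √2) := by simp [circle]

theorem circle_sq (t : ℝ) : (circle t).1 ^ 2 + (circle t).2 ^ 2 = 3 := by
  have h1 := sin_sq_add_cos_sq (2 * π * t)
  have h2 : √2 ^ 2 = 2 := sq_sqrt (by norm_num)
  simp only [circle]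
  linear_combination (1 + √2 ^ 2) * h1 + h2

theorem circle_ne_zero (t : ℝ) : circle t ≠ 0 := by
  intro h
  have := circle_sq t
  rw [h] at this
  norm_num at this

theorem deriv_circle (t : ℝ) :
    deriv circle t = (-(2 * π * (circle t).2), 2 * π * (circle t).1) := by
  have h0 : HasDerivAt (fun t : ℝ => 2 * π * t) (2 * π) t := by
    simpa using (hasDerivAt_id t).const_mul (2 * π)
  have hs := h0.sin
  have hc := h0.cos
  have h := (hc.sub (hs.const_mul (√2))).prodMk (hs.add (hc.const_mul (√2)))
  refine h.deriv.trans (Prod.ext ?_ ?_)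
  · simp only [circle]; ring
  · simp only [circle]; ring

theorem skewR_circle_deriv (t : ℝ) : skewR (circle t) (deriv circle t) = 6 * π := by
  rw [deriv_circle]
  simp only [skewR]
  linear_combination (2 * π) * circle_sq t

theorem start_ne_smul {v : ZLat} (c : ℝ) : ((1, √2) : Plane) ≠ c • toPlane v := by
  intro h
  have h1 : 1 = c * (v.1 : ℝ) := congrArg Prod.fst h
  have h2 : √2 = c * (v.2 : ℝ) := congrArg Prod.snd h
  have hv : (v.1 : ℝ) ≠ 0 := by
    intro hv
    rw [hv, mul_zero] at h1
    exact one_ne_zero h1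
  have h3 : √2 = (v.2 : ℝ) / (v.1 : ℝ) := by
    rw [h2, eq_div_iff hv]
    linear_combination (-(v.2 : ℝ)) * h1
  exact (irrational_iff_ne_rational _).1 irrational_sqrt_two v.2 v.1 (by exact_mod_cast hv) h3

/-- The circle meets every half-line. -/
theorem exists_circle_eq {v : Plane} (hv : v ≠ 0) :
    ∃ t ∈ Set.Icc (0 : ℝ) 1, ∃ c : ℝ, 0 ≤ c ∧ circle t = c • v := by
  -- a circle parametrized by the argument of `v / (1 + √2 i)`
  let z : ℂ := ⟨v.1 + √2 * v.2, v.2 - √2 * v.1⟩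
  have h2 : √2 ^ 2 = 2 := sq_sqrt (by norm_num)
  have hz : z ≠ 0 := by
    intro h
    have e1 : v.1 + √2 * v.2 = 0 := congrArg Complex.re h
    have e2 : v.2 - √2 * v.1 = 0 := congrArg Complex.im h
    refine hv (Prod.ext ?_ ?_)
    · change v.1 = 0
      linear_combination e1 / 3 - √2 * e2 / 3 - v.1 * h2 / 3
    · change v.2 = 0
      linear_combination √2 * e1 / 3 + e2 / 3 - v.2 * h2 / 3
  have hn : ‖z‖ ≠ 0 := norm_ne_zero_iff.2 hz
  have key : ∀ t, cos (2 * π * t) = z.re / ‖z‖ → sin (2 * π * t) = z.im / ‖z‖ →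
      circle t = (3 / ‖z‖) • v := by
    intro t hc hs
    rw [circle, hc, hs]
    refine Prod.ext ?_ ?_
    · change (v.1 + √2 * v.2) / ‖z‖ - √2 * ((v.2 - √2 * v.1) / ‖z‖) = 3 / ‖z‖ * v.1
      field_simp
      linear_combination v.1 * h2
    · change (v.2 - √2 * v.1) / ‖z‖ + √2 * ((v.1 + √2 * v.2) / ‖z‖) = 3 / ‖z‖ * v.2
      field_simp
      linear_combination v.2 * h2
  have hpi := pi_pos
  have hmem := Complex.arg_mem_Ioc z
  rcases le_or_gt 0 (Complex.arg z) with h | h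
  · refine ⟨Complex.arg z / (2 * π), ⟨by positivity, ?_⟩, 3 / ‖z‖, by positivity, key _ ?_ ?_⟩
    · rw [div_le_one (by positivity)]
      linarith [hmem.2]
    · rw [mul_div_cancel₀ _ (by positivity), Complex.cos_arg hz]
    · rw [mul_div_cancel₀ _ (by positivity), Complex.sin_arg]
  · have e : 2 * π * (Complex.arg z / (2 * π) + 1) = Complex.arg z + 2 * π := by
      field_simp
    refine ⟨Complex.arg z / (2 * π) + 1, ⟨?_, ?_⟩, 3 / ‖z‖, by positivity, key _ ?_ ?_⟩
    · rw [div_add_one (by positivity)]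
      refine div_nonneg ?_ (by positivity)
      linarith [hmem.1]
    · have := div_neg_of_neg_of_pos h (by positivity : 0 < 2 * π)
      linarith
    · rw [e, cos_add_two_pi, Complex.cos_arg hz]
    · rw [e, sin_add_two_pi, Complex.sin_arg]

theorem exists_int_of_circle_eq {t t' : ℝ} (h : circle t = circle t') : ∃ k : ℤ, t = t' + k := by
  have h1 : cos (2 * π * t) - √2 * sin (2 * π * t) = cos (2 * π * t') - √2 * sin (2 * π * t') :=
    congrArg Prod.fst h
  have h2 : sin (2 * π * t) + √2 * cos (2 * π * t) = sin (2 * π * t') + √2 * cos (2 * π * t') :=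
    congrArg Prod.snd h
  have h3 : √2 ^ 2 = 2 := sq_sqrt (by norm_num)
  have hc : cos (2 * π * t) = cos (2 * π * t') := by
    linear_combination (h1 + √2 * h2) / 3 - (cos (2 * π * t) - cos (2 * π * t')) * h3 / 3
  have hs : sin (2 * π * t) = sin (2 * π * t') := by
    linear_combination (h2 - √2 * h1) / 3 - (sin (2 * π * t) - sin (2 * π * t')) * h3 / 3
  have h4 : cos (2 * π * t - 2 * π * t') = 1 := by
    rw [cos_sub, hc, hs]
    linear_combination sin_sq_add_cos_sq (2 * π * t')
  obtain ⟨k, hk⟩ := (cos_eq_one_iff _).1 h4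
  refine ⟨k, ?_⟩
  have h5 : 2 * π * (t - t' - k) = 0 := by linear_combination -hk
  have h6 := (mul_eq_zero.1 h5).resolve_left (by positivity)
  linarith

theorem finite_circle_eq (v : Plane) :
    {t | t ∈ Set.Icc (0 : ℝ) 1 ∧ ∃ c : ℝ, 0 ≤ c ∧ circle t = c • v}.Finite := by
  rcases Set.eq_empty_or_nonempty {t | t ∈ Set.Icc (0 : ℝ) 1 ∧ ∃ c : ℝ, 0 ≤ c ∧ circle t = c • v}
    with h | ⟨t', ht', c', hc', he'⟩
  · rw [h]; exact Set.finite_empty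
  refine ((Set.finite_singleton (t' + 1)).insert t' |>.insert (t' - 1)).subset ?_
  rintro t ⟨ht, c, hc, he⟩
  have h1 := circle_sq t
  have h2 := circle_sq t'
  rw [he] at h1
  rw [he'] at h2
  simp only [Prod.smul_fst, Prod.smul_snd, smul_eq_mul] at h1 h2
  have h3 : (c - c') * ((c + c') * (v.1 ^ 2 + v.2 ^ 2)) = 0 := by linear_combination h1 - h2
  have h4 : c = c' := by
    rcases mul_eq_zero.1 h3 with h | h
    · linarith
    · rcases mul_eq_zero.1 h with h | h
      · linarith
      · have h5 : c ^ 2 * (v.1 ^ 2 + v.2 ^ 2) = 3 := by linear_combination h1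
        rw [h, mul_zero] at h5
        norm_num at h5
  obtain ⟨k, hk⟩ := exists_int_of_circle_eq (he.trans ((congrArg (· • v) h4).trans he'.symm))
  have h5 : (k : ℝ) ≤ 1 := by linarith [ht.2, ht'.1]
  have h6 : (-1 : ℝ) ≤ k := by linarith [ht.1, ht'.2]
  have h7 : k ≤ 1 := by exact_mod_cast h5
  have h8 : -1 ≤ k := by exact_mod_cast h6
  simp only [Set.mem_insert_iff, Set.mem_singleton_iff]
  have h9 : k = -1 ∨ k = 0 ∨ k = 1 := by omega
  rcases h9 with rfl | rfl | rfl
  · left; rw [hk]; push_cast; ring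
  · right; left; rw [hk]; push_cast; ring
  · right; right; rw [hk]; push_cast; ring

end Circle

/-! ### Uniqueness of the consistent completion -/

section Uniqueness

open MvPowerSeries (coeff)

variable {n : ℕ} {l : ℕ}

theorem coeff_zero_pathElem (D : QDiagram n) (γ : ℝ → Plane) (L : List (ℝ × D.Index)) :
    coeff 0 (pathElem D γ L) = 1 := by
  induction L with
  | nil => exact coeff_one_zero
  | cons c L ih => rw [pathElem, coeff_zero_mul', ih, coeff_zero_pexp, one_mul]

theorem coeff_mul_sub_congr {x x' y y' : QFun n} {d : Fin n →₀ ℕ} (hx : coeff 0 x = 1)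
    (hx' : coeff 0 x' = 1) (hy : coeff 0 y = 1) (hy' : coeff 0 y' = 1)
    (h : ∀ e < d, coeff e x = coeff e x') (h' : ∀ e < d, coeff e y = coeff e y') :
    coeff d (x * y) - coeff d (x' * y') =
      (coeff d x - coeff d x') + (coeff d y - coeff d y') := by
  have e : ∀ x y : QFun n, x * y = (x - 1) * (y - 1) + x + y - 1 := fun x y => by noncomm_ring
  have h0 : ∀ x : QFun n, coeff 0 x = 1 → coeff 0 (x - 1) = 0 := fun x hx => by
    rw [map_sub, hx, coeff_one_zero, sub_self]
  have h1 : coeff d ((x - 1) * (y - 1)) = coeff d ((x' - 1) * (y' - 1)) :=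
    coeff_mul_congr_of_lt (h0 x hx) (h0 x' hx') (h0 y hy) (h0 y' hy')
      (fun e he => by rw [map_sub, map_sub, h e he]) fun e he => by rw [map_sub, map_sub, h' e he]
  rw [e x y, e x' y', map_sub, map_sub, map_add, map_add, map_add, map_add, h1]
  abel

/-- To first order, a change of the Hamiltonians changes the path-ordered product by the sum of the
changes of the logarithms of the factors. -/
theorem coeff_pathElem_sub {I : Type} {R R' : I → QRay n}
    (hf : ∀ l : ℕ, {i | ¬ EqMod l (R i).ham 0}.Finite)
    (hf' : ∀ l : ℕ, {i | ¬ EqMod l (R' i).ham 0}.Finite) (γ : ℝ → Plane) {d : Fin n →₀ ℕ}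
    (L : List (ℝ × I))
    (h : ∀ e < d, ∀ c, coeff e (crossingLog ⟨I, R, hf⟩ γ c) = coeff e (crossingLog ⟨I, R', hf'⟩ γ c)) :
    coeff d (pathElem ⟨I, R, hf⟩ γ L) - coeff d (pathElem ⟨I, R', hf'⟩ γ L) =
      (L.map fun c => coeff d (crossingLog ⟨I, R, hf⟩ γ c) -
        coeff d (crossingLog ⟨I, R', hf'⟩ γ c)).sum := by
  have hlt : ∀ e < d, ∀ L, coeff e (pathElem ⟨I, R, hf⟩ γ L) =
      coeff e (pathElem ⟨I, R', hf'⟩ γ L) := by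
    intro e he L
    induction L generalizing e with
    | nil => rfl
    | cons c L ih =>
      rw [pathElem, pathElem]
      refine coeff_mul_congr (fun e' he' => ih e' (he'.trans_lt he)) fun e' he' => ?_
      have h1 := pexp_sub_congr (k := LaurentField) (coeff_zero_crossingLog ⟨I, R, hf⟩ γ c)
        (coeff_zero_crossingLog ⟨I, R', hf'⟩ γ c) (d := e')
        fun e'' he'' => h e'' (he''.trans (he'.trans_lt he)) c
      rw [h e' (he'.trans_lt he) c] at h1
      exact sub_left_injective h1
  induction L with
  | nil => exact sub_self _
  | cons c L ih =>
    rw [List.map_cons, List.sum_cons, ← ih, pathElem, pathElem, add_comm]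
    have h1 : ∀ e ≤ d, coeff e (pexp LaurentField (crossingLog ⟨I, R, hf⟩ γ c)) -
        coeff e (crossingLog ⟨I, R, hf⟩ γ c) =
        coeff e (pexp LaurentField (crossingLog ⟨I, R', hf'⟩ γ c)) -
        coeff e (crossingLog ⟨I, R', hf'⟩ γ c) := fun e he =>
      pexp_sub_congr (coeff_zero_crossingLog ⟨I, R, hf⟩ γ c) (coeff_zero_crossingLog ⟨I, R', hf'⟩ γ c)
        fun e' he' => h e' (he'.trans_le he) c
    have h2 := coeff_mul_sub_congr (coeff_zero_pathElem ⟨I, R, hf⟩ γ L)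
      (coeff_zero_pathElem ⟨I, R', hf'⟩ γ L)
      (coeff_zero_pexp (crossingLog ⟨I, R, hf⟩ γ c))
      (coeff_zero_pexp (crossingLog ⟨I, R', hf'⟩ γ c)) (d := d) (fun e he => hlt e he L)
      fun e he => by
        have h3 := h1 e he.le
        rw [h e he c] at h3
        exact sub_left_injective h3
    refine h2.trans (congrArg _ ?_)
    have h3 := h1 d le_rfl
    rw [sub_eq_sub_iff_add_eq_add] at h3 ⊢
    exact h3.trans (add_comm _ _)

/-- The rays whose Hamiltonian vanishes modulo `𝔪^l` do not contribute. -/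
theorem pathElem_filter (D : QDiagram n) (γ : ℝ → Plane) (L : List (ℝ × D.Index))
    (P : ℝ × D.Index → Bool) (h : ∀ c, P c = false → EqMod l (D.ray c.2).ham 0) :
    EqMod l (pathElem D γ (L.filter P)) (pathElem D γ L) := by
  induction L with
  | nil => exact EqMod.refl _
  | cons c L ih =>
    by_cases hc : P c = true
    · rw [List.filter_cons_of_pos hc]
      exact ih.mul (EqMod.refl _)
    · rw [List.filter_cons_of_neg hc, pathElem]
      have h0 : EqMod l (crossingLog D γ c) 0 := fun d hd => by
        have h1 : coeff d (D.ray c.2).ham = coeff d 0 := h c (by simpa using hc) d hd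
        change coeff d _ = coeff d 0
        rw [coeff_crossingLog, h1, map_zero, smul_zero]
      have h1 := (EqMod.pexp (coeff_zero_crossingLog D γ c) (map_zero _) h0).symm
      rw [pexp_zero] at h1
      have h2 := ih.mul h1
      rwa [mul_one] at h2

/-- The coefficients of the path-ordered product of a loop are central. -/
theorem coeff_pathElem_of_loop {D : QDiagram n} {γ : ℝ → Plane} {L : List (ℝ × D.Index)}
    (h : ∀ a : QFun n, EqMod l (D.pathProduct γ L a) a) {d : Fin n →₀ ℕ} (hd : d.degree < l)
    {b : ZLat} (hb : b ≠ 0) : QTorus.coeff b (coeff d (pathElem D γ L)) = 0 := by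
  refine QTorus.coeff_eq_zero_of_central (fun a => ?_) hb
  have h1 := (h (MvPowerSeries.C (QTorus.zhat a))).mul (EqMod.refl (pathElem D γ L))
  rw [pathProduct_eq, mul_assoc, pathElemInv_mul_pathElem, mul_one] at h1
  have h2 := h1 d hd
  change coeff d _ = coeff d _ at h2
  rwa [MvPowerSeries.coeff_mul_C, MvPowerSeries.coeff_C_mul] at h2

variable {m : Fin n → ZLat} (hm : ∀ j, IsPrimitive (m j))

theorem mem_support_iff {r : QRay n} (hr : r.base = 0) {y : Plane} :
    y ∈ r.support ↔ ∃ c : ℝ, 0 ≤ c ∧ y = c • toPlane r.dir := by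
  refine exists_congr fun t => and_congr_right fun _ => ?_
  rw [hr, zero_add]

theorem skewR_dir_deriv_circle_pos {v : ZLat} {t c : ℝ} (hc : 0 ≤ c)
    (h : circle t = c • toPlane v) : 0 < skewR (toPlane v) (deriv circle t) := by
  have h1 := skewR_circle_deriv t
  nth_rewrite 1 [h] at h1
  rw [skewR_smul_left] at h1
  have h2 := Real.pi_pos
  by_contra h3
  rw [not_lt] at h3
  nlinarith [mul_nonneg hc (neg_nonneg.2 h3)]

theorem circle_isAdmissible {D : QDiagram n} (hD : ∀ i, (D.ray i).base = 0) :
    D.IsAdmissible circle where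
  smooth := circle_contDiff.contDiffOn
  avoids := by
    rintro t - (⟨i, -, h⟩ | ⟨i, j, -, -, hij, hi, hj⟩)
    · exact circle_ne_zero t (h.trans (hD i))
    · obtain ⟨c, -, hc⟩ := (mem_support_iff (hD i)).1 hi
      obtain ⟨c', -, hc'⟩ := (mem_support_iff (hD j)).1 hj
      have h1 : skewR (toPlane (D.ray i).dir) (circle t) = 0 := by
        rw [hc, skewR_smul_right, skewR_self, mul_zero]
      rw [hc', skewR_smul_right, skewR_toPlane] at h1
      rcases mul_eq_zero.1 h1 with h2 | h2
      · exact circle_ne_zero t (by rw [hc', h2, zero_smul])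
      · exact hij (by exact_mod_cast h2)
  endpoints := fun i _ => by
    rw [mem_support_iff (hD i), mem_support_iff (hD i), circle_zero, circle_one]
    exact ⟨fun ⟨c, _, h⟩ => start_ne_smul c h, fun ⟨c, _, h⟩ => start_ne_smul c h⟩
  transverse := fun i _ t _ h => by
    obtain ⟨c, hc, hc'⟩ := (mem_support_iff (hD i)).1 h
    exact (skewR_dir_deriv_circle_pos hc hc').ne'

/-- A list of crossings of the circle with finitely many rays. -/
theorem exists_crossings {I : Type} {s : Set I} (hs : s.Finite) (v : I → Plane) :
    ∃ L : List (ℝ × I), L.Nodup ∧ (L.Pairwise fun c c' => c.1 ≤ c'.1) ∧ ∀ t i, (t, i) ∈ L ↔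
      t ∈ Set.Icc (0 : ℝ) 1 ∧ (∃ c : ℝ, 0 ≤ c ∧ circle t = c • v i) ∧ i ∈ s := by
  have hfin : {p : ℝ × I | p.1 ∈ Set.Icc (0 : ℝ) 1 ∧
      (∃ c : ℝ, 0 ≤ c ∧ circle p.1 = c • v p.2) ∧ p.2 ∈ s}.Finite := by
    refine (hs.biUnion fun i _ => (finite_circle_eq (v i)).image fun t => (t, i)).subset ?_
    rintro ⟨t, i⟩ ⟨h1, h2, h3⟩
    exact Set.mem_biUnion h3 ⟨t, ⟨h1, h2⟩, rfl⟩
  let r : ℝ × I → ℝ × I → Prop := fun c c' => c.1 ≤ c'.1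
  have : Std.Total r := ⟨fun a b => le_total a.1 b.1⟩
  have : IsTrans (ℝ × I) r := ⟨fun a b c h h' => le_trans h h'⟩
  classical
  refine ⟨hfin.toFinset.toList.insertionSort r, ?_, List.pairwise_insertionSort r _, fun t i => ?_⟩
  · exact (List.perm_insertionSort r _).nodup_iff.2 (Finset.nodup_toList _)
  · rw [List.mem_insertionSort, Finset.mem_toList, Set.Finite.mem_toFinset]
    rfl

/-- The coefficients of the path-ordered product along the circle are central, for any list that
contains the crossings. -/
theorem coeff_pathElem_circle {D : QDiagram n} (hD : ∀ i, (D.ray i).base = 0)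
    (hc : D.IsConsistent) {L : List (ℝ × D.Index)} (hL : L.Nodup)
    (hL' : L.Pairwise fun c c' => c.1 ≤ c'.1)
    (hmem : ∀ t i, ¬ EqMod l (D.ray i).ham 0 → ((t, i) ∈ L ↔
      t ∈ Set.Icc (0 : ℝ) 1 ∧ ∃ c : ℝ, 0 ≤ c ∧ circle t = c • toPlane (D.ray i).dir))
    {d : Fin n →₀ ℕ} (hd : d.degree < l) {b : ZLat} (hb : b ≠ 0) :
    QTorus.coeff b (coeff d (pathElem D circle L)) = 0 := by
  classical
  have hloop : D.IsCrossingList circle l (L.filter fun c => ¬ EqMod l (D.ray c.2).ham 0) := by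
    refine ⟨hL.filter _, fun t i => ?_, hL'.filter _⟩
    rw [List.mem_filter, mem_support_iff (hD i), decide_eq_true_iff, ← and_assoc]
    exact and_congr_left fun h => hmem t i h
  have h1 : coeff d (pathElem D circle (L.filter fun c => ¬ EqMod l (D.ray c.2).ham 0)) =
      coeff d (pathElem D circle L) :=
    pathElem_filter D circle L _ (fun c hc => by simpa using hc) d hd
  rw [← h1]
  exact coeff_pathElem_of_loop
    (hc circle (circle_isAdmissible hD) (circle_zero.trans circle_one.symm) l _ hloop) hd hb

theorem sum_map_ite_eq {α M : Type*} [AddCommMonoid M] (P : α → Prop) [DecidablePred P] (x : M)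
    (L : List α) : (L.map fun c => if P c then x else 0).sum = (L.countP fun c => P c) • x := by
  induction L with
  | nil => exact (zero_smul ℕ x).symm
  | cons c L ih =>
    rw [List.map_cons, List.sum_cons, ih, List.countP_cons]
    by_cases h : P c
    · simp [h, add_smul, add_comm]
    · simp [h]

variable {hm} in
/-- The rays of a consistent completion, indexed by the initial rays and the primitive vectors. -/
theorem IsConsistentCompletion.exists_rays {S : OutgoingFamily n}
    (hS : IsConsistentCompletion m hm S) :
    ∃ (R : Fin n ⊕ PrimVec → QRay n) (hf : ∀ l : ℕ, {i | ¬ EqMod l (R i).ham 0}.Finite),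
      (⟨_, R, hf⟩ : QDiagram n).IsConsistent ∧ (∀ i, (R i).base = 0) ∧
      (∀ j, R (Sum.inl j) = initialRay m hm j) ∧
      ∀ v, (R (Sum.inr v)).ham = S.ham v ∧ (R (Sum.inr v)).dir = v.1 ∧
        (R (Sum.inr v)).hamDir = v.1 :=
  ⟨((initialDiagram m hm).addOutgoing S).ray, ((initialDiagram m hm).addOutgoing S).finite_mod, hS,
    addOutgoing_base hm S, fun _ => rfl, fun _ => ⟨rfl, rfl, rfl⟩⟩

variable {hm} in
/-- The outgoing rays of a consistent completion are determined by the loop around the origin. -/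
theorem IsConsistentCompletion.ham_eq {S S' : OutgoingFamily n}
    (hS : IsConsistentCompletion m hm S) (hS' : IsConsistentCompletion m hm S') (v : PrimVec) :
    S.ham v = S'.ham v := by
  classical
  suffices h : ∀ (k : ℕ) (d : Fin n →₀ ℕ), d.degree = k → ∀ v,
      coeff d (S.ham v) = coeff d (S'.ham v) by
    ext d : 1
    exact h _ d rfl v
  intro k
  induction k using Nat.strong_induction_on with
  | _ k ih =>
  intro d hdk v
  obtain ⟨R, hf, hc, hb, hl, hr⟩ := hS.exists_rays
  obtain ⟨R', hf', hc', hb', hl', hr'⟩ := hS'.exists_rays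
  have hdir : ∀ i, (R' i).dir = (R i).dir := by
    rintro (j | v)
    · rw [hl, hl']
    · rw [(hr v).2.1, (hr' v).2.1]
  -- One list of crossings serves both diagrams; the rays that vanish modulo `𝔪^(k+1)` in one of them
  -- contribute trivial factors.
  obtain ⟨L, hL1, hL2, hL3⟩ := exists_crossings
    (s := {i | ¬ EqMod (k + 1) (R i).ham 0} ∪ {i | ¬ EqMod (k + 1) (R' i).ham 0})
    ((hf (k + 1)).union (hf' (k + 1))) fun i => toPlane (R i).dir
  have hdl : d.degree < k + 1 := by omega
  by_contra hne
  obtain ⟨b, hbne⟩ : ∃ b, QTorus.coeff b (coeff d (S.ham v)) ≠ QTorus.coeff b (coeff d (S'.ham v)) := by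
    by_contra h
    push Not at h
    exact hne (QTorus.ext_coeff h)
  obtain ⟨r, hr1, hbr⟩ : ∃ r : ℕ, 1 ≤ r ∧ b = r • v.1 := by
    by_cases h : QTorus.coeff b (coeff d (S.ham v)) = 0
    · exact S'.ham_supp v d b fun h' => hbne (h.trans h'.symm)
    · exact S.ham_supp v d b h
  have hb0 : b ≠ 0 := by
    rw [hbr]
    exact smul_ne_zero (by omega) v.2.ne_zero
  have hE : QTorus.coeff b (coeff d (pathElem ⟨_, R, hf⟩ circle L)) = 0 :=
    coeff_pathElem_circle hb hc hL1 hL2 (fun t i hi =>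
      (hL3 t i).trans ⟨fun h => ⟨h.1, h.2.1⟩, fun h => ⟨h.1, h.2, Or.inl hi⟩⟩) hdl hb0
  have hE' : QTorus.coeff b (coeff d (pathElem ⟨_, R', hf'⟩ circle L)) = 0 :=
    coeff_pathElem_circle hb' hc' hL1 hL2 (fun t i hi => by
      change (t, i) ∈ L ↔ t ∈ Set.Icc (0 : ℝ) 1 ∧ ∃ c : ℝ, 0 ≤ c ∧ circle t = c • toPlane (R' i).dir
      rw [hdir]
      exact (hL3 t i).trans ⟨fun h => ⟨h.1, h.2.1⟩, fun h => ⟨h.1, h.2, Or.inr hi⟩⟩) hdl hb0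
  have hlog : ∀ (R : Fin n ⊕ PrimVec → QRay n) (hf : ∀ l : ℕ, {i | ¬ EqMod l (R i).ham 0}.Finite)
      (e : Fin n →₀ ℕ) (t : ℝ) (i), coeff e (crossingLog ⟨_, R, hf⟩ circle (t, i)) =
        (SignType.sign (skewR (toPlane (R i).hamDir) (deriv circle t)) : ℤ) •
          coeff e (R i).ham := fun R hf e t i => coeff_crossingLog ⟨_, R, hf⟩ circle (t, i) e
  -- Below `d` the Hamiltonians agree, so that the two path-ordered products differ at `d` by the sum
  -- of the differences of the Hamiltonians; the monomial `ẑ^b` isolates the rays in the direction `v`.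
  have hlow : ∀ e < d, ∀ c, coeff e (crossingLog ⟨_, R, hf⟩ circle c) =
      coeff e (crossingLog ⟨_, R', hf'⟩ circle c) := by
    rintro e he ⟨t, j | v'⟩
    · rw [hlog, hlog, hl, hl']
    · rw [hlog, hlog, (hr v').1, (hr' v').1, (hr v').2.2, (hr' v').2.2,
        ih e.degree (by rw [← hdk]; exact degree_lt_degree he) e rfl v']
  have hsub := congrArg (QTorus.coeff b) (coeff_pathElem_sub hf hf' circle (d := d) L hlow)
  have hterm : ∀ c ∈ L, QTorus.coeff b (coeff d (crossingLog ⟨_, R, hf⟩ circle c) -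
      coeff d (crossingLog ⟨_, R', hf'⟩ circle c)) = if c.2 = Sum.inr v then
        QTorus.coeff b (coeff d (S.ham v)) - QTorus.coeff b (coeff d (S'.ham v)) else 0 := by
    rintro ⟨t, j | v'⟩ hmem
    · rw [if_neg Sum.inl_ne_inr, hlog, hlog, hl, hl', sub_self]
      rfl
    · obtain ⟨c, hc0, hc'⟩ := ((hL3 t _).1 hmem).2.1
      rw [(hr v').2.1] at hc'
      have hsign := sign_pos (skewR_dir_deriv_circle_pos hc0 hc')
      rw [hlog, hlog, (hr v').1, (hr' v').1, (hr v').2.2, (hr' v').2.2, hsign]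
      change QTorus.coeff b ((1 : ℤ) • _ - (1 : ℤ) • _) = _
      rw [one_smul, one_smul, QTorus.coeff_sub]
      split_ifs with h
      · rw [Sum.inr_injective h]
      · have hz : ∀ S : OutgoingFamily n, QTorus.coeff b (coeff d (S.ham v')) = 0 := by
          intro S
          by_contra h1
          obtain ⟨r', hr', hbr'⟩ := S.ham_supp v' d b h1
          exact h (congrArg Sum.inr (PrimVec.eq_of_nsmul_eq hr' (hbr'.symm.trans hbr)))
        rw [hz, hz, sub_self]
  have hsum : ∀ (L : List (ℝ × (Fin n ⊕ PrimVec))) (f : ℝ × (Fin n ⊕ PrimVec) → QTorus),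
      QTorus.coeff b (L.map f).sum = (L.map fun c => QTorus.coeff b (f c)).sum := by
    intro L f
    induction L with
    | nil => rfl
    | cons c L ih => rw [List.map_cons, List.map_cons, List.sum_cons, List.sum_cons,
        QTorus.coeff_add, ih]
  rw [QTorus.coeff_sub, hE] at hsub
  have hsub' := (congrArg (fun x => (0 : LaurentField) - x) hE').symm.trans hsub
  rw [hsum, sub_zero, List.map_congr_left hterm, sum_map_ite_eq] at hsub'
  -- The circle meets the ray of `v`, always in the same sense, so that the contributions do not cancel.
  have hcount : L.countP (fun c => c.2 = Sum.inr v) ≠ 0 := by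
    obtain ⟨t, ht, c, hc, he⟩ := exists_circle_eq
      (v := toPlane v.1) fun h => v.2.ne_zero (toPlane_eq_zero.1 h)
    have hmem : (t, Sum.inr v) ∈ L := by
      refine (hL3 t (Sum.inr v)).2 ⟨ht, ⟨c, hc, by rw [(hr v).2.1]; exact he⟩, ?_⟩
      by_contra h
      rw [Set.mem_union, not_or] at h
      have h1 : EqMod (k + 1) (R (Sum.inr v)).ham 0 := not_not.1 h.1
      have h2 : EqMod (k + 1) (R' (Sum.inr v)).ham 0 := not_not.1 h.2
      rw [(hr v).1] at h1
      rw [(hr' v).1] at h2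
      exact hne ((h1 d hdl).trans (h2 d hdl).symm)
    exact (List.countP_pos_iff.2 ⟨_, hmem, decide_eq_true rfl⟩).ne'
  have := smul_eq_zero.1 hsub'.symm
  exact hbne (sub_eq_zero.1 (this.resolve_left hcount))

end Uniqueness

end TropVertex

end

theorem proposition6p2 (n : ℕ) (m : Fin n → TropVertex.ZLat)
    (hm : ∀ j, TropVertex.IsPrimitive (m j)) :
    -- the refined counts `N_{w(k)}` are well defined
    (∀ p : Fin n →₀ ℕ, ∑ j, p j • m j ≠ 0 → ∀ k : ∀ j, Nat.Partition (p j),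
      TropVertex.IsRefinedCount (TropVertex.partVec m k)
        (TropVertex.refinedCount (TropVertex.partVec m k))) ∧
    -- the consistent completion exists
    (∃ S : TropVertex.OutgoingFamily n, TropVertex.IsConsistentCompletion m hm S) ∧
    -- the coefficients of its outgoing Hamiltonians
    ∀ S : TropVertex.OutgoingFamily n, TropVertex.IsConsistentCompletion m hm S →
      ∀ (v : TropVertex.PrimVec) (p : Fin n →₀ ℕ),
        (∀ l : ℕ, 1 ≤ l → ∑ j, p j • m j = l • v.1 →
          TropVertex.tcoeff p (S.ham v) =
            (∑ k : ∀ j, Nat.Partition (p j),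
              TropVertex.atQ (TropVertex.refinedCount (TropVertex.partVec m k)) *
                TropVertex.partFactor k / TropVertex.qDiff 1) •
              TropVertex.QTorus.zhat (l • v.1)) ∧
        ((¬ ∃ l : ℕ, 1 ≤ l ∧ ∑ j, p j • m j = l • v.1) → TropVertex.tcoeff p (S.ham v) = 0) := by
  have hm0 : ∀ j, m j ≠ 0 := fun j => (hm j).ne_zero
  obtain ⟨g, hg, hcoeff⟩ := TropVertex.exists_hasIncoming_initialHam hm0
  have hS₀ := TropVertex.isConsistentCompletion_outgoingFamily hm hg
  refine ⟨fun p hp k => TropVertex.isRefinedCount_partVec hm0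
    (by rwa [TropVertex.wt_apply]) k, ⟨_, hS₀⟩, fun S hS v p => ?_⟩
  rw [hS.ham_eq hS₀ v, ← TropVertex.wt_apply]
  refine ⟨fun l hl hw => ?_, fun h => TropVertex.coeff_outgoingFamily_of_ne h⟩
  have h0 : TropVertex.wt m p ≠ 0 := by
    rw [hw]
    exact smul_ne_zero (by omega) v.2.ne_zero
  refine (TropVertex.coeff_outgoingFamily_of_eq hl hw).trans ?_
  have h1 := hcoeff p h0
  rw [hw, TropVertex.toPlane_nsmul, TropVertex.wallLog_smul m g (Nat.cast_pos.2 hl)] at h1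
  exact h1
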